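/- **Setting.** A *spectral curve* is a Riemann surface $\Sigma$ with two (possibly multi-valued) functions $x,y$ such that $dx,dy$ are meromorphic one-forms, and a symmetric bidifferential $\omega_{0,2}$ on $\Sigma\times\Sigma$ whose only singularity is a double pole on the diagonal with biresidue $1$; the set $\mathfrak a$ of zeros of $dx$ is finite and all these zeros are simple. It is *regular* if at every $a\in\mathfrak a$ the function $y$ is holomorphic and $dy(a)\neq 0$. Choose local coordinates $\zeta_a$ at $a\in\mathfrak a$ with $x=x(a)+\zeta_a^2$, and let $\sigma_a$ be the involution $\zeta_a\mapsto-\zeta_a$. The correlators $\omega_{g,n}$, $g\ge 0$, $n\ge1$, $2g-2+n>0$, are defined by topological recursion: $$\omega_{g,n}(z_1,\dots,z_n)=\sum_{a\in\mathfrak a}\operatorname*{Res}_{z=a}K_a(z_1,z)\Big(\omega_{g-1,n+1}(z,\sigma_a(z),z_2,\dots,z_n)+\sum_{\substack{g_1+g_2=g\\ J_1\sqcup J_2=\{2,\dots,n\}}}^{\text{no }(0,1)}\omega_{g_1,1+|J_1|}(z,z_{J_1})\,\omega_{g_2,1+|J_2|}(\sigma_a(z),z_{J_2})\Big),$$ $$K_a(z_1,z)=\frac{\frac12\int_{\sigma_a(z)}^z\omega_{0,2}(z_1,\cdot)}{(y(z)-y(\sigma_a(z)))\,dx(z)}.$$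 Let $H^0(\Sigma,K_\Sigma(*\mathfrak a))$ be the space of meromorphic one-forms with poles only in $\mathfrak a$; it contains, for $a\in\mathfrak a$, $i\ge0$, the forms $$\xi^{(a,i)}(z)=\operatorname*{Res}_{w=a}\Big(\int_a^w\omega_{0,2}(z,\cdot)\Big)\frac{(2i+1)!!}{\zeta_a(w)^{2i+2}}\,d\zeta_a(w).$$ A linear form $I$ on this space is *bounded*, with constants $N_I,v_I>0$, if $|I[\xi^{(a,i)}]|\le N_I\,(2i+1)!!/v_I^{\,i}$ for all $a\in\mathfrak a$, $i\ge 0$. Define $\theta_{(a,m)}$ and $\phi_{(a,i),(b,j)}$ by the expansions $$\frac{-2}{(y-y\circ\sigma_a)\,dx}=\Big(\sum_{m\ge0}\theta_{(a,m)}\zeta_a^{2m-2}\Big)\frac1{d\zeta_a},\qquad \phi_{(a,i),(b,j)}=[\zeta_a(z_1)^{2i}\zeta_b(z_2)^{2j}]\Big(\frac{\omega_{0,2}(z_1,z_2)}{d\zeta_a(z_1)d\zeta_b(z_2)}-\frac{\delta_{a,b}}{(\zeta_a(z_1)-\zeta_b(z_2))^2}\Big).$$ The curve is *bounded* with constants $M_\theta>0$,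 $M_\phi\ge0$, $\rho>0$ if $|\theta_{(a,i)}|\le M_\theta\rho^{-i-1}$ and $|\phi_{(a,i),(b,j)}|\le M_\phi\rho^{-i-j}$ for all $a,b\in\mathfrak a$ and $i,j\ge0$. Put $$u=3^{-4/3}\rho,\quad Q=2M_\theta\max\{(1+\rho M_\phi)^2,\,1+4\rho M_\phi\},\quad P(w)=\begin{cases}\frac{2}{5w^2}&w<\frac25\\ \frac{5}{10w-2}&w\ge\frac25.\end{cases}$$ **Theorem.** There is a universal function $S:(0,\infty)\to(0,\infty)$ such that the following holds. Every regular spectral curve is bounded for some constants $M_\theta,M_\phi,\rho$, and its correlators with $n\ge1$, $2g-2+n>0$ lie in $H^0(\Sigma,K_\Sigma(*\mathfrak a))^{\otimes n}$. For every regular spectral curve, every such choice of constants, every $n\ge1$, all bounded linear forms $I_1,\dots,I_n$ with constants $N_{I_i},v_{I_i}$, and every $g\ge0$ with $2g-2+n>0$, one has, with $v_I=\min_i v_{I_i}$, $$\big|(I_1\otimes\cdots\otimes I_n)[\omega_{g,n}]\big|\le\Big(\prod_{i=1}^n|\mathfrak a|\,N_{I_i}\Big)\frac{S(u/v_I)}{v_I}\Big(\frac{2u}{27}\Big)^gQ^{2g-2+n}\Big(\frac{|\mathfrak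 a|\,P(u/v_I)}{v_I^2}\Big)^{3g-3+n}\frac{(3g-3+2n)!}{g!\,n!}.$$ For fixed $n\ge1$ there are $\mathsf S_{n,I},\mathsf A_I>0$, depending only on $n$, $|\mathfrak a|$ and the constants $M_\theta,M_\phi,\rho,N_{I_i},v_{I_i}$, such that for all $g$ with $2g-2+n>0$ $$\big|(I_1\otimes\cdots\otimes I_n)[\omega_{g,n}]\big|\le\mathsf S_{n,I}\,\frac{\Gamma(2g-2+n)}{\mathsf A_I^{2g-2+n}};$$ if $\mathfrak a\ne\emptyset$ one can take $\mathsf A_I^{-1}=\dfrac{Q}{v_I^3}\sqrt{\dfrac u2}\,\big(|\mathfrak a|\,P(u/v_I)\big)^{3/2}$. Consequently, for bounded linear forms, the series $$\sum_{g\ge0}\hbar^{2g-2+n}(I_1\otimes\cdots\otimes I_n)[\omega_{g,n}]\quad(n\ge1\text{ fixed})\qquad\text{and}\qquad\sum_{g\ge0,\,n\ge1}\frac{\hbar^{2g-2+n}}{n!}I^{\otimes n}[\omega_{g,n}],$$ summed over $2g-2+n>0$, are Gevrey-1, i.e. the coefficient of $\hbar^k$ is bounded by $c\,b^k\,k!$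 for some $c,b>0$. -/

import Mathlib

open Filter Topology
open scoped Manifold ContDiff Nat

universe u

noncomputable section

namespace TopRec

/-! ### Residues, Laurent coefficients, line integrals in the complex plane -/

/-- Residue at `0` of a one-form `f(t) dt` with an isolated singularity at `0`: the common value of
`(2πi)⁻¹ ∮_{|t| = r} f(t) dt` for all small `r > 0`. -/
def residue (f : ℂ → ℂ) : ℂ :=
  limUnder (𝓝[>] (0 : ℝ)) fun r : ℝ =>
    (2 * (Real.pi : ℂ) * Complex.I)⁻¹ * ∮ t in C(0, r), f t

/-- The coefficient of `t ^ k` in the Laurent expansion of `f` at `0`. -/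
def laurentCoeff (f : ℂ → ℂ) (k : ℤ) : ℂ :=
  residue fun t => f t * t ^ (-k - 1)

/-- The integral of `f(w) dw` along the straight segment from `s` to `t`. -/
def segIntegral (f : ℂ → ℂ) (s t : ℂ) : ℂ :=
  (t - s) * ∫ r in (0 : ℝ)..1, f (s + (r : ℂ) * (t - s))

section Surface

variable {X : Type u} [TopologicalSpace X] [ChartedSpace ℂ X]

/-! ### Differentials on a Riemann surface

Mathlib's tangent space of `X` at `p` is `ℂ`, the vector `1` being the coordinate vector of the
preferred chart `chartAt ℂ p`. A one-form is therefore given by a function `η : X → ℂ`, where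
`η p` is the value of the form on that vector; a section of the `n`-fold exterior product
`K ⊠ ⋯ ⊠ K` over `X ^ n` is given in the same way by a function `(Fin n → X) → ℂ`. -/

/-- The value at `t` of the coordinate vector `∂/∂t` of the chart `e`, expressed in the preferred
chart at the point `e.symm t`. -/
def jac (e : OpenPartialHomeomorph X ℂ) (t : ℂ) : ℂ :=
  deriv (fun s => chartAt ℂ (e.symm t) (e.symm s)) t

/-- The local expression of the one-form `η` in the chart `e`: `η = pull e η t dt`. -/
def pull (e : OpenPartialHomeomorph X ℂ) (η : X → ℂ) (t : ℂ) : ℂ :=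
  η (e.symm t) * jac e t

/-- The local expression of a bidifferential: `B = pull₂ e e' B s t ds dt`. -/
def pull₂ (e e' : OpenPartialHomeomorph X ℂ) (B : X → X → ℂ) (s t : ℂ) : ℂ :=
  B (e.symm s) (e'.symm t) * jac e s * jac e' t

/-- The one-form `η` is holomorphic at `p`. -/
def HolomorphicFormAt (η : X → ℂ) (p : X) : Prop :=
  AnalyticAt ℂ (pull (chartAt ℂ p) η) (chartAt ℂ p p)

/-- The one-form `η` is meromorphic at `p`. -/
def MeromorphicFormAt (η : X → ℂ) (p : X) : Prop :=
  MeromorphicAt (pull (chartAt ℂ p) η) (chartAt ℂ p p)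

/-- The order of vanishing at `p` of the meromorphic one-form `η`. -/
def formOrder (η : X → ℂ) (p : X) : WithTop ℤ :=
  meromorphicOrderAt (pull (chartAt ℂ p) η) (chartAt ℂ p p)

theorem pull_add (e : OpenPartialHomeomorph X ℂ) (η η' : X → ℂ) :
    pull e (η + η') = pull e η + pull e η' := by
  funext t; simp [pull, add_mul]

theorem pull_zero (e : OpenPartialHomeomorph X ℂ) : pull e (0 : X → ℂ) = fun _ => 0 := by
  funext t; simp [pull]

theorem pull_smul (e : OpenPartialHomeomorph X ℂ) (c : ℂ) (η : X → ℂ) :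
    pull e (c • η) = (fun _ => c) * pull e η := by
  funext t; simp [pull, mul_assoc]

/-! ### Spectral curves -/

variable (X) in
/-- A spectral curve on the Riemann surface `X`. The functions `x` and `y` may be multi-valued and
have logarithmic singularities; they are the (local) primitives of the meromorphic one-forms `dx`
and `dy`, which are the data, since additive constants in `x` and `y` never enter. -/
structure SpectralCurve where
  /-- the differential of `x` -/
  dx : X → ℂ
  /-- the differential of `y` -/
  dy : X → ℂ
  /-- the fundamental bidifferential `ω_{0,2}` -/
  B : X → X → ℂ
  dx_meromorphic : ∀ p, MeromorphicFormAt dx p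
  dy_meromorphic : ∀ p, MeromorphicFormAt dy p
  /-- `dx` has finitely many zeros, ... -/
  ramification_finite : {p | 0 < formOrder dx p}.Finite
  /-- ... all of them simple -/
  ramification_simple : ∀ p, 0 < formOrder dx p → formOrder dx p = 1
  B_symm : ∀ p q, B p q = B q p
  /-- `ω_{0,2}` is holomorphic away from the diagonal ... -/
  B_holomorphic : ∀ p q, p ≠ q →
    AnalyticAt ℂ (fun w : ℂ × ℂ => pull₂ (chartAt ℂ p) (chartAt ℂ q) B w.1 w.2)
      (chartAt ℂ p p, chartAt ℂ q q)
  /-- ... and has a double pole with biresidue `1` on the diagonal -/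
  B_diagonal : ∀ p, ∃ h : ℂ × ℂ → ℂ, AnalyticAt ℂ h (chartAt ℂ p p, chartAt ℂ p p) ∧
    ∀ᶠ w in 𝓝 (chartAt ℂ p p, chartAt ℂ p p), w.1 ≠ w.2 →
      pull₂ (chartAt ℂ p) (chartAt ℂ p) B w.1 w.2 = 1 / (w.1 - w.2) ^ 2 + h w

namespace SpectralCurve

variable (C : SpectralCurve X)

/-- The set of zeros of `dx`. -/
def ram : Finset X := C.ramification_finite.toFinset

/-- A spectral curve is regular if at every zero `a` of `dx` the function `y` is holomorphic and
`dy(a) ≠ 0`, that is, if `dy` has order `0` at `a`. -/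
def IsRegular : Prop := ∀ a ∈ C.ram, formOrder C.dy a = 0

/-- A choice, for every zero `a` of `dx`, of a local coordinate `ζ_a` centred at `a` with
`x = x(a) + ζ_a ^ 2` near `a`, i.e. `dx = 2 ζ_a dζ_a`. -/
structure LocalCoordinates where
  ζ : X → OpenPartialHomeomorph X ℂ
  holomorphic : ∀ a ∈ C.ram, ζ a ∈ IsManifold.maximalAtlas 𝓘(ℂ) ω X
  mem_source : ∀ a ∈ C.ram, a ∈ (ζ a).source
  center : ∀ a ∈ C.ram, ζ a a = 0
  dx_eq : ∀ a ∈ C.ram, ∀ᶠ t in 𝓝[≠] (0 : ℂ), pull (ζ a) C.dx t = 2 * t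

/-- The space `H⁰(X, K(*𝔞))` of meromorphic one-forms whose poles are zeros of `dx`. A form in it is
a function on `X ∖ 𝔞`, and its value at the points of `𝔞` is `0` by convention. -/
def forms : Submodule ℂ (X → ℂ) where
  carrier := {η | (∀ p, p ∉ C.ram → HolomorphicFormAt η p) ∧
    ∀ a ∈ C.ram, MeromorphicFormAt η a ∧ η a = 0}
  add_mem' := by
    rintro η η' ⟨h1, h2⟩ ⟨h1', h2'⟩
    refine ⟨fun p hp => ?_, fun a ha => ⟨?_, ?_⟩⟩
    · rw [HolomorphicFormAt, pull_add]
      exact (h1 p hp).add (h1' p hp)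
    · rw [MeromorphicFormAt, pull_add]
      exact (h2 a ha).1.add (h2' a ha).1
    · simp [(h2 a ha).2, (h2' a ha).2]
  zero_mem' := by
    refine ⟨fun p _ => ?_, fun a _ => ⟨?_, rfl⟩⟩
    · rw [HolomorphicFormAt, pull_zero]
      exact analyticAt_const
    · rw [MeromorphicFormAt, pull_zero]
      exact MeromorphicAt.const 0 _
  smul_mem' := by
    rintro c η ⟨h1, h2⟩
    refine ⟨fun p hp => ?_, fun a ha => ⟨?_, ?_⟩⟩
    · rw [HolomorphicFormAt, pull_smul]
      exact analyticAt_const.mul (h1 p hp)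
    · rw [MeromorphicFormAt, pull_smul]
      exact (MeromorphicAt.const c _).mul (h2 a ha).1
    · simp [(h2 a ha).2]

/-! ### Topological recursion -/

variable {C} (Z : C.LocalCoordinates)

/-- `y(z) - y(σ_a(z))` in the coordinate `t = ζ_a(z)`, in which the involution `σ_a` with
`x ∘ σ_a = x` is `t ↦ -t`. -/
def deltaY (a : X) (t : ℂ) : ℂ :=
  segIntegral (pull (Z.ζ a) C.dy) (-t) t

/-- The recursion kernel
`K_a(p, z) = ½ ∫_{σ_a(z)}^z ω_{0,2}(p, ·) / ((y(z) - y(σ_a(z))) dx(z))` in the coordinate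
`t = ζ_a(z)`. -/
def kernel (a p : X) (t : ℂ) : ℂ :=
  (1 / 2 * segIntegral (pull (Z.ζ a) (C.B p)) (-t) t) /
    (deltaY Z a t * pull (Z.ζ a) C.dx t)

open Classical in
/-- The correlators: `correlatorAux Z g m p q` is `ω_{g,1+m}(p, q₁, …, q_m)`.
The recursion never uses `ω_{0,1}`, whose place is taken by `0`. The pull-back of a one-form `η`
along `σ_a` is `-(pull (ζ a) η (-t)) dt`. Following the convention for `forms`, a stable correlator
is set to `0` when one of its arguments is a zero of `dx`. The sum over the splittings
`J₁ ⊔ J₂` is a sum over `J = J₁`. -/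
def correlatorAux (g m : ℕ) (p : X) (q : Fin m → X) : ℂ :=
  if 2 * g + m = 0 then 0
  else if h : g = 0 ∧ m = 1 then C.B p (q ⟨0, by omega⟩)
  else if p ∈ C.ram ∨ ∃ i, q i ∈ C.ram then 0
  else ∑ a ∈ C.ram, residue fun t => kernel Z a p t *
    ((if h : 0 < g then
        -pull₂ (Z.ζ a) (Z.ζ a)
          (fun z z' => correlatorAux (g - 1) (m + 1) z (Fin.cons z' q)) t (-t)
      else 0) +
    ∑ g₁ : Fin (g + 1), ∑ J : Finset (Fin m),
      if h : (0 < (g₁ : ℕ) + J.card) ∧ (0 < (g - (g₁ : ℕ)) + Jᶜ.card) then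
        pull (Z.ζ a)
          (fun z => correlatorAux g₁ J.card z (fun i => q (J.orderEmbOfFin rfl i))) t *
        -pull (Z.ζ a)
          (fun z => correlatorAux (g - g₁) Jᶜ.card z (fun i => q (Jᶜ.orderEmbOfFin rfl i))) (-t)
      else 0)
termination_by 2 * g + m
decreasing_by
  · omega
  · have _h1 := g₁.2
    have h2 := Finset.card_add_card_compl J
    rw [Fintype.card_fin] at h2
    omega
  · have _h1 := g₁.2
    have h2 := Finset.card_add_card_compl J
    rw [Fintype.card_fin] at h2
    omega

/-- The correlator `ω_{g,n}` for `n ≥ 1`, `2g - 2 + n > 0`. -/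
def correlator (g : ℕ) : (n : ℕ) → (Fin n → X) → ℂ
  | 0, _ => 0
  | m + 1, z => correlatorAux Z g m (z 0) (Fin.tail z)

/-! ### Generalised periods -/

variable (C) in
/-- The algebraic tensor power `H⁰(X, K(*𝔞)) ^ {⊗ n}`, realised as the space of functions on `X ^ n`
spanned by the products `v₁(z₁) ⋯ v_n(z_n)`. -/
def tensorPower (n : ℕ) : Submodule ℂ ((Fin n → X) → ℂ) :=
  Submodule.span ℂ {W | ∃ v : Fin n → C.forms, W = fun z => ∏ i, (v i : X → ℂ) (z i)}

variable (C) in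
open Classical in
/-- A linear form, applied to a one-form that lies in its domain (and `0` elsewhere). -/
def applyForm (I : Module.Dual ℂ C.forms) (η : X → ℂ) : ℂ :=
  if h : η ∈ C.forms then I ⟨η, h⟩ else 0

variable (C) in
/-- `(I₁ ⊗ ⋯ ⊗ I_n)[W]`: apply `I₁` in the first variable, `I₂` in the second one, and so on. -/
def period : (n : ℕ) → (Fin n → Module.Dual ℂ C.forms) → ((Fin n → X) → ℂ) → ℂ
  | 0, _, W => W Fin.elim0
  | n + 1, I, W =>
    period n (Fin.tail I) fun z => C.applyForm (I 0) fun p => W (Fin.cons p z)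

/-- On the tensor power `period` is the tensor product of the linear forms. -/
theorem period_sum_prod {ι : Type*} (s : Finset ι) (n : ℕ) (I : Fin n → Module.Dual ℂ C.forms)
    (c : ι → ℂ) (v : ι → Fin n → C.forms) :
    C.period n I (fun z => ∑ j ∈ s, c j * ∏ i, (v j i : X → ℂ) (z i)) =
      ∑ j ∈ s, c j * ∏ i, I i (v j i) := by
  induction n generalizing c with
  | zero => simp [period]
  | succ n ih =>
    have key : ∀ z : Fin n → X, C.applyForm (I 0) (fun p => ∑ j ∈ s, c j *
        ∏ i, (v j i : X → ℂ) ((Fin.cons p z : Fin (n + 1) → X) i)) =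
        ∑ j ∈ s, (c j * I 0 (v j 0)) * ∏ i : Fin n, (v j i.succ : X → ℂ) (z i) := by
      intro z
      have e : (fun p => ∑ j ∈ s, c j *
          ∏ i, (v j i : X → ℂ) ((Fin.cons p z : Fin (n + 1) → X) i)) =
          ((∑ j ∈ s, (c j * ∏ i : Fin n, (v j i.succ : X → ℂ) (z i)) • v j 0 : C.forms) :
            X → ℂ) := by
        funext p
        simp only [Fin.prod_univ_succ, Fin.cons_zero, Fin.cons_succ, Submodule.coe_sum,
          Submodule.coe_smul, Finset.sum_apply, Pi.smul_apply, smul_eq_mul]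
        exact Finset.sum_congr rfl fun j _ => by ring
      rw [e, applyForm, dif_pos (Subtype.prop _)]
      simp only [Subtype.coe_eta, map_sum, map_smul, smul_eq_mul]
      exact Finset.sum_congr rfl fun j _ => by ring
    simp only [period, key]
    rw [ih (Fin.tail I) (fun j => c j * I 0 (v j 0)) (fun j i => v j i.succ)]
    simp only [Fin.prod_univ_succ, Fin.tail]
    exact Finset.sum_congr rfl fun j _ => by ring

open Classical in
/-- The one-forms
`ξ^{(a,i)}(z) = Res_{w = a} (∫_a^w ω_{0,2}(z, ·)) (2i+1)!! / ζ_a(w) ^ (2i+2) dζ_a(w)`. -/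
def xi (a : X) (i : ℕ) (z : X) : ℂ :=
  if z ∈ C.ram then 0
  else residue fun t =>
    segIntegral (pull (Z.ζ a) (C.B z)) 0 t * ((2 * i + 1)‼ : ℂ) / t ^ (2 * i + 2)

/-- The linear form `I` is bounded, with constants `N` and `v`. -/
def IsBoundedWith (I : Module.Dual ℂ C.forms) (N v : ℝ) : Prop :=
  0 < N ∧ 0 < v ∧ ∀ a ∈ C.ram, ∀ i : ℕ, ∀ η : C.forms, (η : X → ℂ) = xi Z a i →
    ‖I η‖ ≤ N * ((2 * i + 1)‼ : ℝ) / v ^ i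

/-! ### Expansion coefficients of the spectral curve -/

/-- The coefficients `θ_{(a,m)}` of the expansion
`-2 / ((y(z) - y(σ_a(z))) dx(z)) = (∑ m, θ_{(a,m)} ζ_a ^ (2m - 2)) / dζ_a`. -/
def theta (a : X) (m : ℕ) : ℂ :=
  laurentCoeff (fun t => -2 / (deltaY Z a t * pull (Z.ζ a) C.dx t)) (2 * m - 2)

open Classical in
/-- The coefficients `φ_{(a,i),(b,j)}` of `ζ_a(z₁) ^ (2i) ζ_b(z₂) ^ (2j)` in the expansion of
`ω_{0,2}(z₁, z₂) / (dζ_a(z₁) dζ_b(z₂)) - δ_{a,b} / (ζ_a(z₁) - ζ_b(z₂)) ^ 2`. -/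
def phi (a : X) (i : ℕ) (b : X) (j : ℕ) : ℂ :=
  laurentCoeff (fun s => laurentCoeff (fun t =>
    pull₂ (Z.ζ a) (Z.ζ b) C.B s t - if a = b then 1 / (s - t) ^ 2 else 0) (2 * j)) (2 * i)

/-- The spectral curve is bounded, with constants `Mθ > 0`, `Mφ ≥ 0` and `ρ > 0`. -/
def IsBoundedCurveWith (Mθ Mφ ρ : ℝ) : Prop :=
  0 < Mθ ∧ 0 ≤ Mφ ∧ 0 < ρ ∧
  (∀ a ∈ C.ram, ∀ i : ℕ, ‖theta Z a i‖ ≤ Mθ / ρ ^ (i + 1)) ∧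
  ∀ a ∈ C.ram, ∀ b ∈ C.ram, ∀ i j : ℕ, ‖phi Z a i b j‖ ≤ Mφ / ρ ^ (i + j)

/-! ### Generating series -/

open Classical in
/-- The series `∑_g ħ^{2g-2+n} (I₁ ⊗ ⋯ ⊗ I_n)[ω_{g,n}]` over `g` with `2g - 2 + n > 0`. -/
def periodSeries (n : ℕ) (I : Fin n → Module.Dual ℂ C.forms) : PowerSeries ℂ :=
  PowerSeries.mk fun χ => ∑ g ∈ Finset.range (χ + 3),
    if 0 < χ ∧ 2 * g + n = χ + 2 then C.period n I (correlator Z g n) else 0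

open Classical in
/-- The series `∑_{g, n} ħ^{2g-2+n} / n! I^{⊗ n}[ω_{g,n}]` over `g ≥ 0`, `n ≥ 1` with
`2g - 2 + n > 0`. -/
def totalPeriodSeries (I : Module.Dual ℂ C.forms) : PowerSeries ℂ :=
  PowerSeries.mk fun χ => ∑ g ∈ Finset.range (χ + 3), ∑ n ∈ Finset.Icc 1 (χ + 2),
    if 0 < χ ∧ 2 * g + n = χ + 2 then
      C.period n (fun _ => I) (correlator Z g n) / (n ! : ℂ) else 0

end SpectralCurve

end Surface

/-- A formal power series is Gevrey-1 if its coefficients grow at most like `k!`, up to a geometric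
factor. -/
def IsGevreyOne (f : PowerSeries ℂ) : Prop :=
  ∃ c b : ℝ, 0 < c ∧ 0 < b ∧ ∀ k : ℕ, ‖PowerSeries.coeff k f‖ ≤ c * b ^ k * (k ! : ℝ)

/-! ### Constants -/

/-- `Q = 2 Mθ max((1 + ρ Mφ)², 1 + 4 ρ Mφ)` -/
def constQ (Mθ Mφ ρ : ℝ) : ℝ := 2 * Mθ * max ((1 + ρ * Mφ) ^ 2) (1 + 4 * ρ * Mφ)

/-- `u = 3^{-4/3} ρ` -/
def constU (ρ : ℝ) : ℝ := (3 : ℝ) ^ (-(4 / 3) : ℝ) * ρ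

/-- `P(w) = 2 / (5 w²)` for `w < 2/5` and `P(w) = 5 / (10 w - 2)` for `w ≥ 2/5`. -/
def constP (w : ℝ) : ℝ := if w < 2 / 5 then 2 / (5 * w ^ 2) else 5 / (10 * w - 2)

end TopRec

end

set_option linter.unusedSectionVars false

noncomputable section

namespace TopRec

/-! ### Taylor series and residues -/

/-! Write `ξ̂^{(a,i)} = ξ^{(a,i)} / (2i+1)!!`, `n = 1 + m` and `D = 3g - 3 + n = 3g + m - 2`.

Algebra. At `a` the form `ξ̂^{(a,i)}` is `ζ^{-2i-2}` plus a holomorphic part whose even coefficients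
are the numbers `φ / (2i+1)`; at another zero of `dx` only the holomorphic part is present. The
kernel `K_a(z₁, ·)` is `-½ (∑ ξ̂^{(a,i)}(z₁) ζ^{2i+1}) (∑ θ_m ζ^{2m-2})`, an odd series, so the
residue sees only the even Laurent coefficients of the bracket up to `ζ^0`. All factors in the
bracket have even polar parts, so a product of two odd parts starts at `ζ^2` and is invisible.
Topological recursion thus becomes a recursion, in terms of `θ` and `φ` alone, for the finitely many
coefficients `coef` of `ω_{g,n}` in products of the `ξ̂` (`EvenExp.mul_neg`, `residue_kernel_mul`,
`hasExpansion`). Counting powers of `X` shows that only total degree at most `D` occurs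
(`coef_support`).

Analysis. The claim to be propagated is `|coef| ≤ A(g,m) v^(total degree)`. Weighted ℓ¹ norms with
weight `ρ` (`wt`) turn the recursion into geometric series in `ν = v/ρ`, and leave a scalar
inequality with three kinds of terms: `ω_{0,2}` times `ω_{g,n-1}`, the term with `ω_{g-1,n+1}`, and
the stable splittings (`Bounds.norm_coef_le`). The majorant is `A = w_g · 6/(D+6) · D! ·
(exponential)`, where `w_g` is `1/g!` up to a power of `g`. The factor `6/(D+6)` removes a logarithm
from the convolution over the splittings (`sum_splitWeight_le`, `sum_splittings_le`). After division
by `A` the scalar inequality reads `x + f y + f² z ≤ q` with `f = ρ Mφ`; the bounds `x ≤ 1`, `z ≤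
1`, `y + 2z ≤ 4` (`main_le`, `cross_le`) give `q = max((1+f)², 1+4f)`, the maximum in `Q`. So `A` is
a supersolution (`recursion_majorant_le`), and induction from `ω_{0,3}` and `ω_{1,1}` gives
`Bounds.coefBound`.

Conclusion. In a period the powers of `v` cancel, and at most `|𝔞|^n C(D+n, n)` index tuples remain;
since `D! C(D+n, n) = (3g-3+2n)!/n!`, the factorials of the theorem appear
(`norm_period_correlator_le`). Bounded forms stay bounded for smaller `v`, so `v` may be chosen
freely below `V = min v_I`; the best choice for `v (2u - 2v/5)` is `v = min(V, 5u/2)`, and the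
reciprocal of the optimal value is `P(u/V)/V²` (`constP_div_sq`). The growth rate in the genus stays
strictly below the claimed one by a factor `0.995`. That margin turns `w_g` into `c · 0.998^g / g!`,
and the remaining `0.998^g` absorbs the powers of `g` that arise for fixed `n` when `(3g-3+2n)!/(g!
n!)` is compared with `(27/4)^g Γ(2g-2+n)`; this is why `A_I` can be reached exactly. The Gevrey
statements follow from these bounds. -/

/-- The Taylor series at `0`. -/
def taylor (f : ℂ → ℂ) : PowerSeries ℂ :=
  PowerSeries.mk fun n => iteratedDeriv n f 0 / (n ! : ℂ)

theorem coeff_taylor (f : ℂ → ℂ) (n : ℕ) :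
    PowerSeries.coeff n (taylor f) = iteratedDeriv n f 0 / (n ! : ℂ) := by
  simp [taylor]

theorem coeff_zero_taylor (f : ℂ → ℂ) : PowerSeries.coeff 0 (taylor f) = f 0 := by
  simp [coeff_taylor]

theorem taylor_congr {f g : ℂ → ℂ} (h : f =ᶠ[𝓝 0] g) : taylor f = taylor g := by
  ext n
  rw [coeff_taylor, coeff_taylor, h.iteratedDeriv_eq n]

theorem taylor_add {f g : ℂ → ℂ} (hf : AnalyticAt ℂ f 0) (hg : AnalyticAt ℂ g 0) :
    taylor (f + g) = taylor f + taylor g := by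
  ext n
  simp only [coeff_taylor, map_add]
  rw [iteratedDeriv_add hf.contDiffAt hg.contDiffAt, add_div]

theorem taylor_const_mul (c : ℂ) (f : ℂ → ℂ) :
    taylor (fun t => c * f t) = PowerSeries.C c * taylor f := by
  ext n
  rw [PowerSeries.coeff_C_mul, coeff_taylor, coeff_taylor, iteratedDeriv_const_mul_field,
    mul_div_assoc]

theorem taylor_sum {ι : Type*} (s : Finset ι) {f : ι → ℂ → ℂ}
    (hf : ∀ i ∈ s, AnalyticAt ℂ (f i) 0) :
    taylor (fun t => ∑ i ∈ s, f i t) = ∑ i ∈ s, taylor (f i) := by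
  ext n
  simp only [coeff_taylor, map_sum]
  rw [iteratedDeriv_fun_sum fun i hi => (hf i hi).contDiffAt, Finset.sum_div]

theorem taylor_mul {f g : ℂ → ℂ} (hf : AnalyticAt ℂ f 0) (hg : AnalyticAt ℂ g 0) :
    taylor (f * g) = taylor f * taylor g := by
  ext n
  rw [PowerSeries.coeff_mul, Finset.Nat.sum_antidiagonal_eq_sum_range_succ_mk, coeff_taylor,
    iteratedDeriv_mul hf.contDiffAt hg.contDiffAt, Finset.sum_div]
  refine Finset.sum_congr rfl fun k hk => ?_
  have hk' : k ≤ n := Nat.lt_succ_iff.1 (Finset.mem_range.1 hk)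
  rw [coeff_taylor, coeff_taylor]
  have h := Nat.choose_mul_factorial_mul_factorial hk'
  have h1 : (n ! : ℂ) ≠ 0 := by exact_mod_cast n.factorial_ne_zero
  have h2 : (k ! : ℂ) ≠ 0 := by exact_mod_cast k.factorial_ne_zero
  have h3 : ((n - k)! : ℂ) ≠ 0 := by exact_mod_cast (n - k).factorial_ne_zero
  have h' : (n.choose k : ℂ) * (k ! : ℂ) * ((n - k)! : ℂ) = (n ! : ℂ) := by exact_mod_cast h
  field_simp
  rw [← h']
  ring

theorem coeff_taylor_comp_neg (f : ℂ → ℂ) (n : ℕ) :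
    PowerSeries.coeff n (taylor fun t => f (-t)) = (-1) ^ n * PowerSeries.coeff n (taylor f) := by
  rw [coeff_taylor, coeff_taylor, iteratedDeriv_comp_neg, neg_zero, smul_eq_mul, mul_div_assoc]

theorem taylor_pow (k : ℕ) : taylor (fun t => t ^ k) = PowerSeries.X ^ k := by
  ext n
  rw [coeff_taylor, iteratedDeriv_fun_pow_zero, PowerSeries.coeff_X_pow]
  split_ifs with h
  · subst h
    exact div_self (by exact_mod_cast n.factorial_ne_zero)
  · simp

theorem residue_congr {f g : ℂ → ℂ} (h : f =ᶠ[𝓝[≠] 0] g) : residue f = residue g := by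
  have h' : ∃ ε > 0, ∀ t : ℂ, t ≠ 0 → ‖t‖ < ε → f t = g t := by
    obtain ⟨ε, hε, h⟩ := Metric.eventually_nhds_iff.1 (eventually_nhdsWithin_iff.1 h)
    exact ⟨ε, hε, fun t ht hn => h (by simpa using hn) ht⟩
  obtain ⟨ε, hε, h'⟩ := h'
  unfold residue limUnder
  congr 1
  refine Filter.map_congr ?_
  filter_upwards [Ioo_mem_nhdsGT hε] with r hr
  congr 1
  refine circleIntegral.integral_congr hr.1.le fun t ht => ?_
  have : ‖t‖ = r := by simpa using ht
  exact h' t (by rintro rfl; simp at this; linarith [hr.1]) (by rw [this]; exact hr.2)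

/-- The residue of `g(t) / t ^ (N+1)`, where `g` is analytic, is a Taylor coefficient of `g`. -/
theorem residue_eq_coeff {f g : ℂ → ℂ} {N : ℕ} (hg : AnalyticAt ℂ g 0)
    (h : f =ᶠ[𝓝[≠] 0] fun t => g t / t ^ (N + 1)) :
    residue f = PowerSeries.coeff N (taylor g) := by
  rw [residue_congr h]
  obtain ⟨ε, hε, hd⟩ := Metric.eventually_nhds_iff_ball.1 hg.eventually_analyticAt
  refine Tendsto.limUnder_eq ?_
  refine tendsto_const_nhds.congr' ?_
  filter_upwards [Ioo_mem_nhdsGT hε] with r hr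
  have hdiff : DiffContOnCl ℂ g (Metric.ball 0 r) := by
    apply DifferentiableOn.diffContOnCl
    intro z hz
    refine ((hd z ?_).differentiableAt).differentiableWithinAt
    exact Metric.closedBall_subset_ball hr.2 (Metric.closure_ball_subset_closedBall hz)
  have key := DiffContOnCl.circleIntegral_one_div_sub_center_pow_smul hr.1 N hdiff
  have e : (∮ t in C(0, r), g t / t ^ (N + 1)) =
      ∮ z in C(0, r), (1 / (z - 0) ^ (N + 1)) • g z := by
    refine circleIntegral.integral_congr hr.1.le fun t _ => ?_
    simp [div_eq_inv_mul]
  rw [e, key, coeff_taylor, smul_eq_mul]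
  have : (2 * (Real.pi : ℂ) * Complex.I) ≠ 0 := by simp [Real.pi_ne_zero]
  field_simp

theorem laurentCoeff_eq_coeff {f g : ℂ → ℂ} (hg : AnalyticAt ℂ g 0) (h : f =ᶠ[𝓝[≠] 0] g) (k : ℕ) :
    laurentCoeff f k = PowerSeries.coeff k (taylor g) := by
  refine residue_eq_coeff hg ?_
  filter_upwards [h] with t ht
  rw [ht, div_eq_mul_inv, ← zpow_natCast, ← zpow_neg]
  congr 2
  push_cast
  ring

/-! ### Even parts of Laurent expansions -/

/-- `f` has a pole of order at most `2M` with even polar part, and the coefficients of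
`t ^ (2k - 2M)`, `k ≤ T`, are those of `E`. -/
def EvenExp (f : ℂ → ℂ) (M T : ℕ) (E : PowerSeries ℂ) : Prop :=
  ∃ g : ℂ → ℂ, AnalyticAt ℂ g 0 ∧ (f =ᶠ[𝓝[≠] 0] fun t => g t / t ^ (2 * M)) ∧
    (∀ k ≤ T, PowerSeries.coeff (2 * k) (taylor g) = PowerSeries.coeff k E) ∧
    ∀ k < M, PowerSeries.coeff (2 * k + 1) (taylor g) = 0

/-- `F` has a pole of order at most `2M`, and the coefficients of `t ^ (2k - 2M)`, `k ≤ M`, are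
those of `E`. -/
def HasEven (F : ℂ → ℂ) (M : ℕ) (E : PowerSeries ℂ) : Prop :=
  ∃ g : ℂ → ℂ, AnalyticAt ℂ g 0 ∧ (F =ᶠ[𝓝[≠] 0] fun t => g t / t ^ (2 * M)) ∧
    ∀ k ≤ M, PowerSeries.coeff (2 * k) (taylor g) = PowerSeries.coeff k E

theorem EvenExp.congr {f f' : ℂ → ℂ} {M T : ℕ} {E : PowerSeries ℂ} (h : EvenExp f M T E)
    (hf : f' =ᶠ[𝓝[≠] 0] f) : EvenExp f' M T E := by
  obtain ⟨g, h1, h2, h3⟩ := h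
  exact ⟨g, h1, hf.trans h2, h3⟩

theorem HasEven.congr {f f' : ℂ → ℂ} {M : ℕ} {E : PowerSeries ℂ} (h : HasEven f M E)
    (hf : f' =ᶠ[𝓝[≠] 0] f) : HasEven f' M E := by
  obtain ⟨g, h1, h2, h3⟩ := h
  exact ⟨g, h1, hf.trans h2, h3⟩

theorem EvenExp.const_mul {f : ℂ → ℂ} {M T : ℕ} {E : PowerSeries ℂ} (h : EvenExp f M T E) (c : ℂ) :
    EvenExp (fun t => c * f t) M T (PowerSeries.C c * E) := by
  obtain ⟨g, h1, h2, h3, h4⟩ := h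
  refine ⟨fun t => c * g t, analyticAt_const.mul h1, ?_, fun k hk => ?_, fun k hk => ?_⟩
  · filter_upwards [h2] with t ht
    rw [ht, mul_div_assoc]
  · rw [taylor_const_mul, PowerSeries.coeff_C_mul, PowerSeries.coeff_C_mul, h3 k hk]
  · rw [taylor_const_mul, PowerSeries.coeff_C_mul, h4 k hk, mul_zero]

theorem EvenExp.sum {ι : Type*} (s : Finset ι) {f : ι → ℂ → ℂ} {M T : ℕ} {E : ι → PowerSeries ℂ}
    (h : ∀ i ∈ s, EvenExp (f i) M T (E i)) :
    EvenExp (fun t => ∑ i ∈ s, f i t) M T (∑ i ∈ s, E i) := by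
  choose! g h1 h2 h3 h4 using h
  refine ⟨fun t => ∑ i ∈ s, g i t, ?_, ?_, fun k hk => ?_, fun k hk => ?_⟩
  · have := s.analyticAt_sum fun i hi => h1 i hi
    simpa [Finset.sum_fn] using this
  · have : ∀ᶠ t in 𝓝[≠] (0 : ℂ), ∀ i ∈ s, f i t = g i t / t ^ (2 * M) :=
      (Filter.eventually_all_finset s).2 h2
    filter_upwards [this] with t ht
    rw [Finset.sum_div]
    exact Finset.sum_congr rfl ht
  · rw [taylor_sum s h1, map_sum, map_sum]
    exact Finset.sum_congr rfl fun i hi => h3 i hi k hk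
  · rw [taylor_sum s h1, map_sum]
    exact Finset.sum_eq_zero fun i hi => h4 i hi k hk

theorem HasEven.sum {ι : Type*} (s : Finset ι) {f : ι → ℂ → ℂ} {M : ℕ} {E : ι → PowerSeries ℂ}
    (h : ∀ i ∈ s, HasEven (f i) M (E i)) :
    HasEven (fun t => ∑ i ∈ s, f i t) M (∑ i ∈ s, E i) := by
  choose! g h1 h2 h3 using h
  refine ⟨fun t => ∑ i ∈ s, g i t, ?_, ?_, fun k hk => ?_⟩
  · have := s.analyticAt_sum fun i hi => h1 i hi
    simpa [Finset.sum_fn] using this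
  · have : ∀ᶠ t in 𝓝[≠] (0 : ℂ), ∀ i ∈ s, f i t = g i t / t ^ (2 * M) :=
      (Filter.eventually_all_finset s).2 h2
    filter_upwards [this] with t ht
    rw [Finset.sum_div]
    exact Finset.sum_congr rfl ht
  · rw [taylor_sum s h1, map_sum, map_sum]
    exact Finset.sum_congr rfl fun i hi => h3 i hi k hk

theorem HasEven.add {f f' : ℂ → ℂ} {M : ℕ} {E E' : PowerSeries ℂ}
    (h : HasEven f M E) (h' : HasEven f' M E') : HasEven (fun t => f t + f' t) M (E + E') := by
  obtain ⟨g, h1, h2, h3⟩ := h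
  obtain ⟨g', h1', h2', h3'⟩ := h'
  refine ⟨g + g', h1.add h1', ?_, fun k hk => ?_⟩
  · filter_upwards [h2, h2'] with t ht ht'
    rw [ht, ht', Pi.add_apply, add_div]
  · rw [taylor_add h1 h1', map_add, map_add, h3 k hk, h3' k hk]

theorem HasEven.const_mul {f : ℂ → ℂ} {M : ℕ} {E : PowerSeries ℂ} (h : HasEven f M E) (c : ℂ) :
    HasEven (fun t => c * f t) M (PowerSeries.C c * E) := by
  obtain ⟨g, h1, h2, h3⟩ := h
  refine ⟨fun t => c * g t, analyticAt_const.mul h1, ?_, fun k hk => ?_⟩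
  · filter_upwards [h2] with t ht
    rw [ht, mul_div_assoc]
  · rw [taylor_const_mul, PowerSeries.coeff_C_mul, PowerSeries.coeff_C_mul, h3 k hk]

theorem HasEven.zero (M : ℕ) : HasEven (fun _ => 0) M 0 := by
  simpa using HasEven.sum (∅ : Finset ℕ) (f := fun _ _ => 0) (E := fun _ => 0) (M := M) (by simp)

/-- Multiplying numerator and denominator by `t ^ (2K)`. -/
theorem EvenExp.shift {f : ℂ → ℂ} {M T : ℕ} {E : PowerSeries ℂ} (h : EvenExp f M T E) (K : ℕ) :
    EvenExp f (M + K) (T + K) (PowerSeries.X ^ K * E) := by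
  obtain ⟨g, h1, h2, h3, h4⟩ := h
  have hX : AnalyticAt ℂ (fun t : ℂ => t ^ (2 * K)) 0 := analyticAt_id.pow _
  refine ⟨(fun t : ℂ => t ^ (2 * K)) * g, hX.mul h1, ?_, fun k hk => ?_, fun k hk => ?_⟩
  · filter_upwards [h2, self_mem_nhdsWithin] with t ht h0
    have h0 : t ≠ 0 := h0
    rw [ht, Pi.mul_apply, mul_add, pow_add]
    field_simp
  · rw [taylor_mul hX h1, taylor_pow, PowerSeries.coeff_X_pow_mul', PowerSeries.coeff_X_pow_mul']
    by_cases hK : K ≤ k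
    · rw [if_pos (by omega), if_pos hK, ← h3 (k - K) (by omega)]
      congr 2
      omega
    · rw [if_neg (by omega), if_neg hK]
  · rw [taylor_mul hX h1, taylor_pow, PowerSeries.coeff_X_pow_mul']
    split_ifs with hK
    · rw [← h4 (k - K) (by omega)]
      congr 2
      omega
    · rfl

theorem EvenExp.of_coeff_eq {f : ℂ → ℂ} {M T : ℕ} {E E' : PowerSeries ℂ} (h : EvenExp f M T E)
    (hE : ∀ k ≤ T, PowerSeries.coeff k E = PowerSeries.coeff k E') : EvenExp f M T E' := by
  obtain ⟨g, h1, h2, h3, h4⟩ := h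
  exact ⟨g, h1, h2, fun k hk => (h3 k hk).trans (hE k hk), h4⟩

theorem EvenExp.mono {f : ℂ → ℂ} {M T T' : ℕ} {E : PowerSeries ℂ} (h : EvenExp f M T E)
    (hT : T' ≤ T) : EvenExp f M T' E := by
  obtain ⟨g, h1, h2, h3, h4⟩ := h
  exact ⟨g, h1, h2, fun k hk => h3 k (hk.trans hT), h4⟩

/-- Splitting an antidiagonal of an even number into its even and its odd pairs. -/
theorem sum_antidiagonal_two_mul {M : Type*} [AddCommMonoid M] (k : ℕ) (F : ℕ × ℕ → M) :
    ∑ p ∈ Finset.HasAntidiagonal.antidiagonal (2 * k), F p =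
      ∑ p ∈ Finset.HasAntidiagonal.antidiagonal k, F (2 * p.1, 2 * p.2) +
      ∑ p ∈ (Finset.HasAntidiagonal.antidiagonal (2 * k)).filter (fun p => ¬ Even p.1), F p := by
  rw [← Finset.sum_filter_add_sum_filter_not (Finset.HasAntidiagonal.antidiagonal (2 * k)) (fun p => Even p.1)]
  congr 1
  symm
  refine Finset.sum_bij (fun p _ => (2 * p.1, 2 * p.2)) ?_ ?_ ?_ ?_
  · intro p hp
    rw [Finset.HasAntidiagonal.mem_antidiagonal] at hp
    simp only [Finset.mem_filter, Finset.HasAntidiagonal.mem_antidiagonal, even_two, Even.mul_right, and_true]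
    omega
  · rintro ⟨a, b⟩ _ ⟨c, d⟩ _ h
    simp only [Prod.mk.injEq] at h ⊢
    omega
  · rintro ⟨a, b⟩ h
    simp only [Finset.mem_filter, Finset.HasAntidiagonal.mem_antidiagonal] at h
    obtain ⟨c, hc⟩ := h.2
    refine ⟨(c, b / 2), ?_, ?_⟩
    · rw [Finset.HasAntidiagonal.mem_antidiagonal]; omega
    · simp only [Prod.mk.injEq]; omega
  · intros; rfl

/-- The odd part of each factor starts at a positive power of `t`, so the product of the two odd
parts starts at `t ^ 2`. Up to `t ^ 0`, all that the kernel can see, the even part of the product is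
the product of the even parts, and these do not notice the sign in `f' (-t)`. -/
theorem EvenExp.mul_neg {f f' : ℂ → ℂ} {M M' T : ℕ} {E E' : PowerSeries ℂ} (h : EvenExp f M T E)
    (h' : EvenExp f' M' T E') (hT : M + M' ≤ T) :
    HasEven (fun t => f t * f' (-t)) (M + M') (E * E') := by
  obtain ⟨g, h1, h2, h3, h4⟩ := h
  obtain ⟨g', h1', h2', h3', h4'⟩ := h'
  have hneg : AnalyticAt ℂ (fun t => g' (-t)) 0 := by
    have h0 : AnalyticAt ℂ g' (-0) := by simpa using h1'
    exact h0.fun_comp analyticAt_id.neg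
  refine ⟨g * fun t => g' (-t), h1.mul hneg, ?_, fun k hk => ?_⟩
  · have ht : Tendsto (fun t : ℂ => -t) (𝓝[≠] 0) (𝓝[≠] 0) := by
      refine tendsto_nhdsWithin_iff.2 ⟨?_, ?_⟩
      · have : Tendsto (fun t : ℂ => -t) (𝓝 0) (𝓝 (-0)) := continuous_neg.tendsto 0
        rw [neg_zero] at this
        exact this.mono_left nhdsWithin_le_nhds
      · filter_upwards [self_mem_nhdsWithin] with t ht
        simpa using ht
    filter_upwards [h2, ht.eventually h2'] with t e1 e2
    rw [e1, e2, Pi.mul_apply, mul_add, pow_add, Even.neg_pow (even_two_mul M')]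
    rw [div_mul_div_comm]
  · rw [taylor_mul h1 hneg, PowerSeries.coeff_mul, sum_antidiagonal_two_mul, PowerSeries.coeff_mul,
      Finset.sum_eq_zero (s := Finset.filter _ _), add_zero]
    · refine Finset.sum_congr rfl fun p hp => ?_
      rw [Finset.HasAntidiagonal.mem_antidiagonal] at hp
      rw [coeff_taylor_comp_neg, h3 _ (by omega), h3' _ (by omega),
        Even.neg_one_pow (even_two_mul _), one_mul]
    · rintro ⟨a, b⟩ hp
      simp only [Finset.mem_filter, Finset.HasAntidiagonal.mem_antidiagonal, Nat.not_even_iff_odd] at hp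
      obtain ⟨hab, c, hc⟩ := hp
      obtain ⟨d, hd⟩ : ∃ d, b = 2 * d + 1 := ⟨b / 2, by omega⟩
      dsimp only
      rw [coeff_taylor_comp_neg, hc, hd]
      -- The indices add up to at most `2(M + M')`, so one of the two odd indices lies in a polar
      -- part, where odd coefficients vanish.
      by_cases hcM : c < M
      · rw [h4 c hcM, zero_mul]
      · rw [h4' d (by omega), mul_zero, mul_zero]

/-! ### Analytic functions of two variables -/

/-- The power series in two variables of the difference quotient of the power series `p`. -/
def diffQuotSeries (p : FormalMultilinearSeries ℂ ℂ ℂ) : FormalMultilinearSeries ℂ (ℂ × ℂ) ℂ :=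
  fun n => p.coeff (n + 1) • ∑ a ∈ Finset.range (n + 1),
    (ContinuousMultilinearMap.mkPiAlgebra ℂ (Fin n) ℂ).compContinuousLinearMap
      (fun i => if (i : ℕ) < a then ContinuousLinearMap.fst ℂ ℂ ℂ
        else ContinuousLinearMap.snd ℂ ℂ ℂ)

theorem diffQuotSeries_apply (p : FormalMultilinearSeries ℂ ℂ ℂ) (n : ℕ) (w : ℂ × ℂ) :
    diffQuotSeries p n (fun _ => w) =
      p.coeff (n + 1) * ∑ a ∈ Finset.range (n + 1), w.1 ^ a * w.2 ^ (n - a) := by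
  simp only [diffQuotSeries, smul_apply, smul_eq_mul,
    sum_apply, ContinuousMultilinearMap.compContinuousLinearMap_apply,
    ContinuousMultilinearMap.mkPiAlgebra_apply]
  congr 1
  refine Finset.sum_congr rfl fun a ha => ?_
  have ha' : a ≤ n := Nat.lt_succ_iff.1 (Finset.mem_range.1 ha)
  have : ∀ i : Fin n, (if (i : ℕ) < a then ContinuousLinearMap.fst ℂ ℂ ℂ
      else ContinuousLinearMap.snd ℂ ℂ ℂ) w = if (i : ℕ) < a then w.1 else w.2 := by
    intro i; split_ifs <;> rfl
  simp only [this]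
  rw [Fin.prod_univ_eq_prod_range (fun i => if i < a then w.1 else w.2) n, Finset.prod_ite,
    Finset.prod_const, Finset.prod_const]
  have h1 : (Finset.range n).filter (fun i => i < a) = Finset.range a := by
    ext i; simp only [Finset.mem_filter, Finset.mem_range]; omega
  have h2 : (Finset.range n).filter (fun i => ¬ i < a) = Finset.Ico a n := by
    ext i; simp only [Finset.mem_filter, Finset.mem_range, Finset.mem_Ico]; omega
  rw [h1, h2, Finset.card_range, Nat.card_Ico]

theorem norm_diffQuotSeries_le (p : FormalMultilinearSeries ℂ ℂ ℂ) (n : ℕ) :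
    ‖diffQuotSeries p n‖ ≤ ‖p (n + 1)‖ * (n + 1) := by
  rw [diffQuotSeries, norm_smul]
  have h1 : ‖p.coeff (n + 1)‖ = ‖p (n + 1)‖ := by
    rw [FormalMultilinearSeries.norm_apply_eq_norm_coef]
  rw [h1]
  refine mul_le_mul_of_nonneg_left ?_ (norm_nonneg _)
  refine (norm_sum_le _ _).trans ?_
  have : ∀ a ∈ Finset.range (n + 1),
    ‖(ContinuousMultilinearMap.mkPiAlgebra ℂ (Fin n) ℂ).compContinuousLinearMap
      (fun i : Fin n => if (i : ℕ) < a then ContinuousLinearMap.fst ℂ ℂ ℂ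
        else ContinuousLinearMap.snd ℂ ℂ ℂ)‖ ≤ 1 := by
    intro a _
    refine (ContinuousMultilinearMap.norm_compContinuousLinearMap_le _ _).trans ?_
    rw [ContinuousMultilinearMap.norm_mkPiAlgebra, one_mul]
    refine Finset.prod_le_one (fun _ _ => norm_nonneg _) fun i _ => ?_
    split_ifs
    · exact ContinuousLinearMap.norm_fst_le ℂ ℂ ℂ
    · exact ContinuousLinearMap.norm_snd_le ℂ ℂ ℂ
  refine (Finset.sum_le_sum this).trans ?_
  simp

/-- The difference quotient of an analytic function is an analytic function of two variables. -/
theorem exists_analytic_diffQuot {ψ : ℂ → ℂ} (hψ : AnalyticAt ℂ ψ 0) :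
    ∃ k : ℂ × ℂ → ℂ, AnalyticAt ℂ k (0, 0) ∧
      ∀ᶠ w in 𝓝 ((0, 0) : ℂ × ℂ), ψ w.1 - ψ w.2 = (w.1 - w.2) * k w := by
  obtain ⟨p, R, hp⟩ := hψ
  obtain ⟨r, hr0, hrR⟩ : ∃ r : NNReal, 0 < r ∧ (r : ENNReal) < R :=
    ⟨_, ENNReal.lt_iff_exists_nnreal_btwn.1 hp.r_pos |>.choose_spec.1 |> fun h => by
      exact_mod_cast h, (ENNReal.lt_iff_exists_nnreal_btwn.1 hp.r_pos).choose_spec.2⟩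
  obtain ⟨C, hC0, hC⟩ := p.norm_mul_pow_le_of_lt_radius (hrR.trans_le hp.r_le)
  have hr0' : (0 : ℝ) < r := hr0
  have hrad : ((r / 2 : NNReal) : ENNReal) ≤ (diffQuotSeries p).radius := by
    refine FormalMultilinearSeries.le_radius_of_bound _ (C / r) fun n => ?_
    -- The `n + 1` monomials of degree `n` cost a factor that is absorbed by halving the radius.
    have h2 : ((n : ℝ) + 1) ≤ 2 ^ n := by exact_mod_cast Nat.lt_two_pow_self (n := n)
    have h3 := hC (n + 1)
    push_cast
    calc ‖diffQuotSeries p n‖ * ((r : ℝ) / 2) ^ n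
        ≤ (‖p (n + 1)‖ * (n + 1)) * ((r : ℝ) / 2) ^ n :=
          mul_le_mul_of_nonneg_right (norm_diffQuotSeries_le p n) (by positivity)
      _ ≤ (‖p (n + 1)‖ * 2 ^ n) * ((r : ℝ) / 2) ^ n := by gcongr
      _ = ‖p (n + 1)‖ * (r : ℝ) ^ (n + 1) / r := by
          rw [div_pow, pow_succ]; field_simp
      _ ≤ C / r := by gcongr
  have hpos : 0 < (diffQuotSeries p).radius :=
    lt_of_lt_of_le (by exact_mod_cast half_pos hr0) hrad
  have hq := (diffQuotSeries p).hasFPowerSeriesOnBall hpos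
  refine ⟨(diffQuotSeries p).sum, hq.analyticAt, ?_⟩
  have hball1 : ∀ᶠ w in 𝓝 ((0, 0) : ℂ × ℂ), w ∈ Metric.eball (0 : ℂ × ℂ) (diffQuotSeries p).radius :=
    Metric.eball_mem_nhds _ hpos
  have hball2 : ∀ᶠ w in 𝓝 ((0, 0) : ℂ × ℂ), w.1 ∈ Metric.eball (0 : ℂ) R :=
    continuous_fst.continuousAt.eventually_mem (Metric.eball_mem_nhds _ hp.r_pos)
  have hball3 : ∀ᶠ w in 𝓝 ((0, 0) : ℂ × ℂ), w.2 ∈ Metric.eball (0 : ℂ) R :=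
    continuous_snd.continuousAt.eventually_mem (Metric.eball_mem_nhds _ hp.r_pos)
  filter_upwards [hball1, hball2, hball3] with w h1 h2 h3
  have e1 := (hq.hasSum h1).mul_left (w.1 - w.2)
  have e2 := hp.hasSum h2
  have e3 := hp.hasSum h3
  have e4 := e2.sub e3
  have e5 := (hasSum_nat_add_iff' 1).2 e4
  rw [zero_add, zero_add] at e5
  rw [zero_add] at e1
  have : ∀ n, (w.1 - w.2) * (diffQuotSeries p n fun _ => w) =
      (p (n + 1) fun _ => w.1) - (p (n + 1) fun _ => w.2) := by
    intro n
    rw [diffQuotSeries_apply, FormalMultilinearSeries.apply_eq_pow_smul_coeff,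
      FormalMultilinearSeries.apply_eq_pow_smul_coeff, smul_eq_mul, smul_eq_mul, ← sub_mul,
      ← (Commute.all w.1 w.2).geom_sum₂_mul (n + 1)]
    simp only [Nat.add_sub_cancel]
    ring
  simp only [this] at e1
  have e6 := e5.unique e1
  rw [← e6]
  simp

/-- The partial derivative in the second variable. -/
def dsnd (h : ℂ × ℂ → ℂ) (w : ℂ × ℂ) : ℂ := fderiv ℂ h w (0, 1)

/-- The partial derivative in the first variable. -/
def dfst (h : ℂ × ℂ → ℂ) (w : ℂ × ℂ) : ℂ := fderiv ℂ h w (1, 0)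

theorem analyticAt_dsnd {h : ℂ × ℂ → ℂ} {w : ℂ × ℂ} (hh : AnalyticAt ℂ h w) :
    AnalyticAt ℂ (dsnd h) w :=
  ((ContinuousLinearMap.apply ℂ ℂ ((0, 1) : ℂ × ℂ)).analyticAt _).comp hh.fderiv

theorem analyticAt_dfst {h : ℂ × ℂ → ℂ} {w : ℂ × ℂ} (hh : AnalyticAt ℂ h w) :
    AnalyticAt ℂ (dfst h) w :=
  ((ContinuousLinearMap.apply ℂ ℂ ((1, 0) : ℂ × ℂ)).analyticAt _).comp hh.fderiv

theorem hasDerivAt_snd {h : ℂ × ℂ → ℂ} {s t : ℂ} (hh : AnalyticAt ℂ h (s, t)) :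
    HasDerivAt (fun t => h (s, t)) (dsnd h (s, t)) t := by
  have := hh.differentiableAt.hasFDerivAt.comp_hasDerivAt t
    ((hasDerivAt_const t s).prodMk (hasDerivAt_id t))
  exact this

theorem hasDerivAt_fst {h : ℂ × ℂ → ℂ} {s t : ℂ} (hh : AnalyticAt ℂ h (s, t)) :
    HasDerivAt (fun s => h (s, t)) (dfst h (s, t)) s := by
  have := hh.differentiableAt.hasFDerivAt.comp_hasDerivAt s
    ((hasDerivAt_id s).prodMk (hasDerivAt_const s t))
  exact this

theorem eventually_slice {P : ℂ × ℂ → Prop} {s t : ℂ} (h : ∀ᶠ w in 𝓝 (s, t), P w) :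
    ∀ᶠ t' in 𝓝 t, P (s, t') :=
  (Continuous.tendsto (by fun_prop : Continuous fun t' : ℂ => (s, t')) t).eventually h

/-- Taylor coefficients in the second variable depend analytically on the first one. -/
theorem analyticAt_coeff_slice (k : ℕ) {s₀ t₀ : ℂ} : ∀ {h : ℂ × ℂ → ℂ},
    AnalyticAt ℂ h (s₀, t₀) → AnalyticAt ℂ (fun s => iteratedDeriv k (fun t => h (s, t)) t₀) s₀ := by
  induction k with
  | zero =>
    intro h hh
    simp only [iteratedDeriv_zero]
    exact hh.fun_comp (f := fun s : ℂ => (s, t₀)) (analyticAt_id.prod analyticAt_const)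
  | succ k ih =>
    intro h hh
    refine (ih (analyticAt_dsnd hh)).congr ?_
    have h1 : ∀ᶠ s in 𝓝 s₀, AnalyticAt ℂ h (s, t₀) :=
      (Continuous.tendsto (by fun_prop : Continuous fun s : ℂ => (s, t₀)) s₀).eventually
        hh.eventually_analyticAt
    filter_upwards [h1] with s hs
    rw [iteratedDeriv_succ']
    refine Filter.EventuallyEq.iteratedDeriv_eq k ?_
    filter_upwards [eventually_slice hs.eventually_analyticAt] with t ht
    exact (hasDerivAt_snd ht).deriv.symm

theorem analyticAt_coeff_taylor {s₀ : ℂ} {h : ℂ × ℂ → ℂ} (hh : AnalyticAt ℂ h (s₀, 0)) (k : ℕ) :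
    AnalyticAt ℂ (fun s => PowerSeries.coeff k (taylor fun t => h (s, t))) s₀ := by
  simp only [coeff_taylor]
  exact (analyticAt_coeff_slice k hh).div_const

/-- A change of coordinates changes the singular part `1 / (s - t) ^ 2` of a bidifferential by an
analytic function. -/
theorem exists_analytic_schwarzian {ψ : ℂ → ℂ} (hψ : AnalyticAt ℂ ψ 0) (h0 : deriv ψ 0 ≠ 0) :
    ∃ h : ℂ × ℂ → ℂ, AnalyticAt ℂ h (0, 0) ∧ ∀ᶠ w in 𝓝 ((0, 0) : ℂ × ℂ), w.1 ≠ w.2 →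
      ψ w.1 ≠ ψ w.2 ∧
      deriv ψ w.1 * deriv ψ w.2 / (ψ w.1 - ψ w.2) ^ 2 = 1 / (w.1 - w.2) ^ 2 + h w := by
  obtain ⟨k, hk, hkψ⟩ := exists_analytic_diffQuot hψ
  -- On the diagonal the difference quotient is the derivative, so `k (0, 0) = ψ'(0)`.
  have hk0 : k (0, 0) ≠ 0 := by
    have e : ∀ᶠ s in 𝓝[≠] (0 : ℂ), slope ψ 0 s = k (s, 0) := by
      have : ∀ᶠ s in 𝓝 (0 : ℂ), ψ s - ψ 0 = (s - 0) * k (s, 0) :=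
        (Continuous.tendsto (by fun_prop : Continuous fun s : ℂ => (s, (0 : ℂ))) 0).eventually hkψ
      filter_upwards [this.filter_mono nhdsWithin_le_nhds, self_mem_nhdsWithin] with s hs hs0
      have hs0 : s ≠ 0 := hs0
      rw [slope_def_field, hs, sub_zero, mul_div_cancel_left₀ _ hs0]
    have t1 : Tendsto (slope ψ 0) (𝓝[≠] 0) (𝓝 (deriv ψ 0)) :=
      hasDerivAt_iff_tendsto_slope.1 hψ.differentiableAt.hasDerivAt
    have t2 : Tendsto (fun s => k (s, 0)) (𝓝[≠] (0 : ℂ)) (𝓝 (k (0, 0))) := by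
      have : ContinuousAt (fun s : ℂ => k (s, 0)) 0 :=
        hk.continuousAt.comp (f := fun s : ℂ => (s, (0 : ℂ))) (by fun_prop)
      exact this.tendsto.mono_left nhdsWithin_le_nhds
    rw [tendsto_nhds_unique (t2.congr' (e.mono fun _ h => h.symm)) t1]
    exact h0
  have hk1 : AnalyticAt ℂ (fun w => dsnd k w / k w) (0, 0) := (analyticAt_dsnd hk).div hk hk0
  -- Apply `∂_s ∂_t log` to `ψ(s) - ψ(t) = (s - t) k(s, t)`: the regular part is `∂_s ∂_t log k`.
  -- Writing `∂_t log k` as `∂_t k / k` avoids choosing a branch of the logarithm.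
  refine ⟨dfst fun w => dsnd k w / k w, analyticAt_dfst hk1, ?_⟩
  have hs1 : ∀ᶠ w in 𝓝 ((0, 0) : ℂ × ℂ), AnalyticAt ℂ ψ w.1 :=
    (continuous_fst.tendsto ((0, 0) : ℂ × ℂ)).eventually hψ.eventually_analyticAt
  have hs2 : ∀ᶠ w in 𝓝 ((0, 0) : ℂ × ℂ), AnalyticAt ℂ ψ w.2 :=
    (continuous_snd.tendsto ((0, 0) : ℂ × ℂ)).eventually hψ.eventually_analyticAt
  filter_upwards [hkψ.eventually_nhds, hk.eventually_analyticAt, hk1.eventually_analyticAt,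
    (hk.continuousAt.eventually_ne hk0).eventually_nhds, hs1, hs2] with w e1 e2 e3 e4 e5 e6 hne
  obtain ⟨s, t⟩ := w
  have hne : s - t ≠ 0 := sub_ne_zero.2 hne
  have hkne : k (s, t) ≠ 0 := e4.self_of_nhds
  have hψst : ψ s - ψ t = (s - t) * k (s, t) := e1.self_of_nhds
  refine ⟨fun h => mul_ne_zero hne hkne (by rw [← hψst, h, sub_self]), ?_⟩
  have hfst : ∀ {P : ℂ × ℂ → Prop}, (∀ᶠ w in 𝓝 (s, t), P w) → ∀ᶠ s' in 𝓝 s, P (s', t) :=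
    fun h => (Continuous.tendsto (by fun_prop : Continuous fun s' : ℂ => (s', t)) s).eventually h
  -- derivative in `t` at nearby points
  have d1 : ∀ᶠ s' in 𝓝 s, -deriv ψ t = -k (s', t) + (s' - t) * dsnd k (s', t) := by
    filter_upwards [hfst e1.eventually_nhds, hfst e2.eventually_analyticAt] with s' f1 f2
    have a1 : HasDerivAt (fun t' => ψ s' - ψ t') (-deriv ψ t) t := by
      exact ((hasDerivAt_const t (ψ s')).sub e6.differentiableAt.hasDerivAt).congr_deriv
        (zero_sub _)
    have a2 : HasDerivAt (fun t' => (s' - t') * k (s', t'))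
        (-k (s', t) + (s' - t) * dsnd k (s', t)) t := by
      refine (((hasDerivAt_const t s').sub (hasDerivAt_id t)).mul (hasDerivAt_snd f2)).congr_deriv ?_
      simp
    refine a1.unique (a2.congr_of_eventuallyEq ?_)
    filter_upwards [eventually_slice f1] with t' ht'
    exact ht'
  -- logarithmic derivative
  have d2 : ∀ᶠ s' in 𝓝 s, s' - t ≠ 0 → dsnd k (s', t) / k (s', t) =
      -deriv ψ t / (ψ s' - ψ t) + 1 / (s' - t) := by
    filter_upwards [d1, hfst e1, hfst e4] with s' f1 f2 f3 f4
    rw [f1, f2]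
    field_simp
    ring
  have d2' : (fun s' => dsnd k (s', t) / k (s', t)) =ᶠ[𝓝 s]
      fun s' => -deriv ψ t / (ψ s' - ψ t) + 1 / (s' - t) := by
    have : ∀ᶠ s' in 𝓝 s, s' - t ≠ 0 :=
      (continuousAt_id.sub continuousAt_const).eventually_ne hne
    filter_upwards [d2, this] with s' f1 f2 using f1 f2
  have a3 := hasDerivAt_fst e3
  have hψne : ψ s - ψ t ≠ 0 := by rw [hψst]; exact mul_ne_zero hne hkne
  have a4 : HasDerivAt (fun s' => -deriv ψ t / (ψ s' - ψ t) + 1 / (s' - t))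
      (deriv ψ t * deriv ψ s / (ψ s - ψ t) ^ 2 - 1 / (s - t) ^ 2) s := by
    have b1 := (hasDerivAt_const s (-deriv ψ t)).div
      (e5.differentiableAt.hasDerivAt.sub_const (ψ t)) hψne
    have b2 := (hasDerivAt_const s (1 : ℂ)).div ((hasDerivAt_id s).sub_const t) hne
    refine (b1.add b2).congr_deriv ?_
    simp only [id]
    ring
  have := a3.unique (a4.congr_of_eventuallyEq d2')
  simp only at this ⊢
  rw [this]
  ring

section Charts

variable {X : Type u} [TopologicalSpace X] [ChartedSpace ℂ X] [IsManifold 𝓘(ℂ) ω X]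

/-! ### Changes of coordinates -/

theorem analyticAt_transition {e e' : OpenPartialHomeomorph X ℂ}
    (he : e ∈ IsManifold.maximalAtlas 𝓘(ℂ) ω X) (he' : e' ∈ IsManifold.maximalAtlas 𝓘(ℂ) ω X)
    {t : ℂ} (ht : t ∈ e.target) (ht' : e.symm t ∈ e'.source) :
    AnalyticAt ℂ (fun s => e' (e.symm s)) t := by
  have h := (contDiffGroupoid ω 𝓘(ℂ)).compatible_of_mem_maximalAtlas he he'
  rw [contDiffGroupoid, mem_groupoid_of_pregroupoid] at h
  have h1 : ContDiffOn ℂ ω (fun s => e' (e.symm s)) (e.symm ≫ₕ e').source := by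
    simpa [contDiffPregroupoid, Function.comp_def] using h.1
  have h2 : t ∈ (e.symm ≫ₕ e').source := by simp [ht, ht']
  exact (h1.contDiffAt ((e.symm ≫ₕ e').open_source.mem_nhds h2)).analyticAt

theorem eventually_transition {e e' : OpenPartialHomeomorph X ℂ} {t : ℂ} (ht : t ∈ e.target)
    (ht' : e.symm t ∈ e'.source) : ∀ᶠ s in 𝓝 t, s ∈ e.target ∧ e.symm s ∈ e'.source :=
  (e.open_target.eventually_mem ht).and
    ((e.continuousAt_symm ht).eventually (e'.open_source.eventually_mem ht'))

theorem jac_change {e e' : OpenPartialHomeomorph X ℂ}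
    (he : e ∈ IsManifold.maximalAtlas 𝓘(ℂ) ω X) (he' : e' ∈ IsManifold.maximalAtlas 𝓘(ℂ) ω X)
    {t : ℂ} (ht : t ∈ e.target) (ht' : e.symm t ∈ e'.source) :
    jac e t = jac e' (e' (e.symm t)) * deriv (fun s => e' (e.symm s)) t := by
  have hinv : e'.symm (e' (e.symm t)) = e.symm t := e'.left_inv ht'
  unfold jac
  rw [hinv]
  set c := chartAt ℂ (e.symm t) with hc
  have hcm : c ∈ IsManifold.maximalAtlas 𝓘(ℂ) ω X := IsManifold.chart_mem_maximalAtlas _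
  have h1 : AnalyticAt ℂ (fun s => e' (e.symm s)) t := analyticAt_transition he he' ht ht'
  have h2 : AnalyticAt ℂ (fun s => c (e'.symm s)) (e' (e.symm t)) :=
    analyticAt_transition he' hcm (e'.map_source ht') (by rw [hinv]; exact mem_chart_source ℂ _)
  have h3 := h2.differentiableAt.hasDerivAt.comp t h1.differentiableAt.hasDerivAt
  have h4 : HasDerivAt (fun s => c (e.symm s))
      (deriv (fun s => c (e'.symm s)) (e' (e.symm t)) * deriv (fun s => e' (e.symm s)) t) t := by
    refine h3.congr_of_eventuallyEq ?_
    filter_upwards [eventually_transition ht ht'] with s hs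
    simp only [Function.comp]
    rw [e'.left_inv hs.2]
  exact h4.deriv

theorem pull_change {e e' : OpenPartialHomeomorph X ℂ}
    (he : e ∈ IsManifold.maximalAtlas 𝓘(ℂ) ω X) (he' : e' ∈ IsManifold.maximalAtlas 𝓘(ℂ) ω X)
    {t : ℂ} (ht : t ∈ e.target) (ht' : e.symm t ∈ e'.source) (η : X → ℂ) :
    pull e η t = pull e' η (e' (e.symm t)) * deriv (fun s => e' (e.symm s)) t := by
  rw [pull, pull, jac_change he he' ht ht', e'.left_inv ht', mul_assoc]

theorem pull₂_change {e₁ e₁' e₂ e₂' : OpenPartialHomeomorph X ℂ}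
    (h₁ : e₁ ∈ IsManifold.maximalAtlas 𝓘(ℂ) ω X) (h₁' : e₁' ∈ IsManifold.maximalAtlas 𝓘(ℂ) ω X)
    (h₂ : e₂ ∈ IsManifold.maximalAtlas 𝓘(ℂ) ω X) (h₂' : e₂' ∈ IsManifold.maximalAtlas 𝓘(ℂ) ω X)
    {s t : ℂ} (hs : s ∈ e₁.target ∧ e₁.symm s ∈ e₁'.source)
    (ht : t ∈ e₂.target ∧ e₂.symm t ∈ e₂'.source) (B : X → X → ℂ) :
    pull₂ e₁ e₂ B s t = pull₂ e₁' e₂' B (e₁' (e₁.symm s)) (e₂' (e₂.symm t)) *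
      (deriv (fun s => e₁' (e₁.symm s)) s * deriv (fun s => e₂' (e₂.symm s)) t) := by
  rw [pull₂, pull₂, jac_change h₁ h₁' hs.1 hs.2, jac_change h₂ h₂' ht.1 ht.2, e₁'.left_inv hs.2,
    e₂'.left_inv ht.2]
  ring

theorem jac_chartAt (p : X) : jac (chartAt ℂ p) (chartAt ℂ p p) = 1 := by
  have hp : (chartAt ℂ p).symm (chartAt ℂ p p) = p := (chartAt ℂ p).left_inv (mem_chart_source ℂ p)
  unfold jac
  rw [hp]
  have : (fun s => chartAt ℂ p ((chartAt ℂ p).symm s)) =ᶠ[𝓝 (chartAt ℂ p p)] id := by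
    filter_upwards [(chartAt ℂ p).open_target.mem_nhds (mem_chart_target ℂ p)] with s hs
    exact (chartAt ℂ p).right_inv hs
  rw [this.deriv_eq, deriv_id]

theorem deriv_transition_ne_zero {e e' : OpenPartialHomeomorph X ℂ}
    (he : e ∈ IsManifold.maximalAtlas 𝓘(ℂ) ω X) (he' : e' ∈ IsManifold.maximalAtlas 𝓘(ℂ) ω X)
    {t : ℂ} (ht : t ∈ e.target) (ht' : e.symm t ∈ e'.source) :
    deriv (fun s => e' (e.symm s)) t ≠ 0 := by
  have hinv : e'.symm (e' (e.symm t)) = e.symm t := e'.left_inv ht'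
  have h1 : AnalyticAt ℂ (fun s => e' (e.symm s)) t := analyticAt_transition he he' ht ht'
  have h2 : AnalyticAt ℂ (fun s => e (e'.symm s)) (e' (e.symm t)) :=
    analyticAt_transition he' he (e'.map_source ht') (by rw [hinv]; exact e.map_target ht)
  have h3 := h2.differentiableAt.hasDerivAt.comp t h1.differentiableAt.hasDerivAt
  have h4 : HasDerivAt (fun s : ℂ => s)
      (deriv (fun s => e (e'.symm s)) (e' (e.symm t)) * deriv (fun s => e' (e.symm s)) t) t := by
    refine h3.congr_of_eventuallyEq ?_
    filter_upwards [eventually_transition ht ht'] with s hs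
    simp only [Function.comp]
    rw [e'.left_inv hs.2, e.right_inv hs.1]
  intro h0
  rw [h0, mul_zero] at h4
  exact one_ne_zero ((hasDerivAt_id t).unique h4)

theorem meromorphicAt_pull_change {e e' : OpenPartialHomeomorph X ℂ}
    (he : e ∈ IsManifold.maximalAtlas 𝓘(ℂ) ω X) (he' : e' ∈ IsManifold.maximalAtlas 𝓘(ℂ) ω X)
    {t : ℂ} (ht : t ∈ e.target) (ht' : e.symm t ∈ e'.source) {η : X → ℂ}
    (h : MeromorphicAt (pull e' η) (e' (e.symm t))) : MeromorphicAt (pull e η) t := by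
  have h1 := analyticAt_transition he he' ht ht'
  refine (MeromorphicAt.fun_mul (f := fun s => pull e' η (e' (e.symm s)))
    (MeromorphicAt.comp_analyticAt (g := fun s => e' (e.symm s)) h h1)
    h1.deriv.meromorphicAt).congr ?_
  filter_upwards [(eventually_transition ht ht').filter_mono nhdsWithin_le_nhds] with s hs
  exact (pull_change he he' hs.1 hs.2 η).symm

/-- Coordinate changes map punctured neighbourhoods to punctured neighbourhoods. -/
theorem tendsto_transition_punctured {e e' : OpenPartialHomeomorph X ℂ}
    (he : e ∈ IsManifold.maximalAtlas 𝓘(ℂ) ω X) (he' : e' ∈ IsManifold.maximalAtlas 𝓘(ℂ) ω X)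
    {t : ℂ} (ht : t ∈ e.target) (ht' : e.symm t ∈ e'.source) :
    Tendsto (fun s => e' (e.symm s)) (𝓝[≠] t) (𝓝[≠] (e' (e.symm t))) := by
  refine tendsto_nhdsWithin_iff.2 ⟨?_, ?_⟩
  · exact (analyticAt_transition he he' ht ht').continuousAt.tendsto.mono_left nhdsWithin_le_nhds
  · filter_upwards [(eventually_transition ht ht').filter_mono nhdsWithin_le_nhds,
      self_mem_nhdsWithin] with s hs hne h
    refine hne ?_
    have h' := e'.injOn hs.2 ht' h
    rw [← e.right_inv hs.1, ← e.right_inv ht, h']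
    rfl

end Charts

/-! ### The bidifferential in arbitrary coordinates -/

namespace SpectralCurve

variable {X : Type u} [TopologicalSpace X] [ChartedSpace ℂ X] [IsManifold 𝓘(ℂ) ω X]
variable (C : SpectralCurve X)

theorem analyticAt_pull₂_B {e e' : OpenPartialHomeomorph X ℂ}
    (he : e ∈ IsManifold.maximalAtlas 𝓘(ℂ) ω X) (he' : e' ∈ IsManifold.maximalAtlas 𝓘(ℂ) ω X)
    {p q : X} (hp : p ∈ e.source) (hq : q ∈ e'.source) (hpq : p ≠ q) :
    AnalyticAt ℂ (fun w : ℂ × ℂ => pull₂ e e' C.B w.1 w.2) (e p, e' q) := by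
  have hp1 := e.map_source hp
  have hq1 := e'.map_source hq
  have hp2 : e.symm (e p) ∈ (chartAt ℂ p).source := by
    rw [e.left_inv hp]; exact mem_chart_source ℂ p
  have hq2 : e'.symm (e' q) ∈ (chartAt ℂ q).source := by
    rw [e'.left_inv hq]; exact mem_chart_source ℂ q
  have hpm : chartAt ℂ p ∈ IsManifold.maximalAtlas 𝓘(ℂ) ω X := IsManifold.chart_mem_maximalAtlas _
  have hqm : chartAt ℂ q ∈ IsManifold.maximalAtlas 𝓘(ℂ) ω X := IsManifold.chart_mem_maximalAtlas _
  have a1 := analyticAt_transition he hpm hp1 hp2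
  have a2 := analyticAt_transition he' hqm hq1 hq2
  have b1 : AnalyticAt ℂ (fun w : ℂ × ℂ => chartAt ℂ p (e.symm w.1)) (e p, e' q) :=
    a1.fun_comp (f := Prod.fst) (x := (e p, e' q)) analyticAt_fst
  have b2 : AnalyticAt ℂ (fun w : ℂ × ℂ => chartAt ℂ q (e'.symm w.2)) (e p, e' q) :=
    a2.fun_comp (f := Prod.snd) (x := (e p, e' q)) analyticAt_snd
  have c1 : AnalyticAt ℂ (fun w : ℂ × ℂ => deriv (fun s => chartAt ℂ p (e.symm s)) w.1)
      (e p, e' q) := a1.deriv.fun_comp (f := Prod.fst) (x := (e p, e' q)) analyticAt_fst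
  have c2 : AnalyticAt ℂ (fun w : ℂ × ℂ => deriv (fun s => chartAt ℂ q (e'.symm s)) w.2)
      (e p, e' q) := a2.deriv.fun_comp (f := Prod.snd) (x := (e p, e' q)) analyticAt_snd
  have hB := C.B_holomorphic p q hpq
  have hB' : AnalyticAt ℂ (fun w : ℂ × ℂ => pull₂ (chartAt ℂ p) (chartAt ℂ q) C.B w.1 w.2)
      (chartAt ℂ p (e.symm (e p)), chartAt ℂ q (e'.symm (e' q))) := by
    rw [e.left_inv hp, e'.left_inv hq]; exact hB
  have d := hB'.fun_comp (f := fun w : ℂ × ℂ =>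
    (chartAt ℂ p (e.symm w.1), chartAt ℂ q (e'.symm w.2))) (x := (e p, e' q)) (b1.prod b2)
  refine (d.mul (c1.mul c2)).congr ?_
  have h1 : ∀ᶠ w : ℂ × ℂ in 𝓝 (e p, e' q), w.1 ∈ e.target ∧ e.symm w.1 ∈ (chartAt ℂ p).source :=
    (continuous_fst.tendsto _).eventually (eventually_transition hp1 hp2)
  have h2 : ∀ᶠ w : ℂ × ℂ in 𝓝 (e p, e' q), w.2 ∈ e'.target ∧ e'.symm w.2 ∈ (chartAt ℂ q).source :=
    (continuous_snd.tendsto _).eventually (eventually_transition hq1 hq2)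
  filter_upwards [h1, h2] with w hw1 hw2
  exact (pull₂_change he hpm he' hqm hw1 hw2 C.B).symm

/-- The normalisation of the double pole does not depend on the coordinate: the defining property
concerns the preferred chart, and `exists_analytic_schwarzian` says that a transition map changes `1
/ (s - t) ^ 2` only by an analytic function. -/
theorem exists_analytic_pull₂_B_diag {e : OpenPartialHomeomorph X ℂ}
    (he : e ∈ IsManifold.maximalAtlas 𝓘(ℂ) ω X) {a : X} (ha : a ∈ e.source) (h0 : e a = 0) :
    ∃ h : ℂ × ℂ → ℂ, AnalyticAt ℂ h (0, 0) ∧ ∀ᶠ w in 𝓝 ((0, 0) : ℂ × ℂ), w.1 ≠ w.2 →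
      pull₂ e e C.B w.1 w.2 = 1 / (w.1 - w.2) ^ 2 + h w := by
  obtain ⟨h₀, hh₀, hB⟩ := C.B_diagonal a
  have hc : chartAt ℂ a ∈ IsManifold.maximalAtlas 𝓘(ℂ) ω X := IsManifold.chart_mem_maximalAtlas _
  have ht : (0 : ℂ) ∈ e.target := h0 ▸ e.map_source ha
  have hinv : e.symm 0 = a := by rw [← h0]; exact e.left_inv ha
  have ht' : e.symm 0 ∈ (chartAt ℂ a).source := by rw [hinv]; exact mem_chart_source ℂ a
  have a1 := analyticAt_transition he hc ht ht'
  obtain ⟨k, hk, hkψ⟩ := exists_analytic_schwarzian a1 (deriv_transition_ne_zero he hc ht ht')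
  set ψ : ℂ → ℂ := fun s => chartAt ℂ a (e.symm s) with hψ
  have hψ0 : ψ 0 = chartAt ℂ a a := by rw [hψ]; simp only [hinv]
  have b1 : AnalyticAt ℂ (fun w : ℂ × ℂ => ψ w.1) (0, 0) :=
    a1.fun_comp (f := Prod.fst) (x := ((0 : ℂ), (0 : ℂ))) analyticAt_fst
  have b2 : AnalyticAt ℂ (fun w : ℂ × ℂ => ψ w.2) (0, 0) :=
    a1.fun_comp (f := Prod.snd) (x := ((0 : ℂ), (0 : ℂ))) analyticAt_snd
  have c1 : AnalyticAt ℂ (fun w : ℂ × ℂ => deriv ψ w.1) (0, 0) :=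
    a1.deriv.fun_comp (f := Prod.fst) (x := ((0 : ℂ), (0 : ℂ))) analyticAt_fst
  have c2 : AnalyticAt ℂ (fun w : ℂ × ℂ => deriv ψ w.2) (0, 0) :=
    a1.deriv.fun_comp (f := Prod.snd) (x := ((0 : ℂ), (0 : ℂ))) analyticAt_snd
  have hh₀' : AnalyticAt ℂ h₀ ((fun w : ℂ × ℂ => (ψ w.1, ψ w.2)) (0, 0)) := by
    simpa [hψ0] using hh₀
  have d := hh₀'.fun_comp (f := fun w : ℂ × ℂ => (ψ w.1, ψ w.2)) (b1.prod b2)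
  refine ⟨fun w => k w + h₀ (ψ w.1, ψ w.2) * (deriv ψ w.1 * deriv ψ w.2),
    hk.add (d.mul (c1.mul c2)), ?_⟩
  have h1 : ∀ᶠ w : ℂ × ℂ in 𝓝 (0, 0), w.1 ∈ e.target ∧ e.symm w.1 ∈ (chartAt ℂ a).source :=
    (continuous_fst.tendsto _).eventually (eventually_transition ht ht')
  have h2 : ∀ᶠ w : ℂ × ℂ in 𝓝 (0, 0), w.2 ∈ e.target ∧ e.symm w.2 ∈ (chartAt ℂ a).source :=
    (continuous_snd.tendsto _).eventually (eventually_transition ht ht')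
  have h3 : ∀ᶠ w : ℂ × ℂ in 𝓝 (0, 0), ψ w.1 ≠ ψ w.2 →
      pull₂ (chartAt ℂ a) (chartAt ℂ a) C.B (ψ w.1) (ψ w.2) =
        1 / (ψ w.1 - ψ w.2) ^ 2 + h₀ (ψ w.1, ψ w.2) := by
    have : Tendsto (fun w : ℂ × ℂ => (ψ w.1, ψ w.2)) (𝓝 (0, 0))
        (𝓝 (chartAt ℂ a a, chartAt ℂ a a)) := by
      have := (b1.prod b2).continuousAt.tendsto
      simpa [hψ0] using this
    exact this.eventually hB
  filter_upwards [h1, h2, h3, hkψ] with w hw1 hw2 hw3 hw4 hne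
  obtain ⟨hne', hw4⟩ := hw4 hne
  rw [pull₂_change he hc he hc hw1 hw2 C.B, hw3 hne', ← add_assoc, ← hw4]
  ring

end SpectralCurve

/-! ### Primitives along segments -/

theorem segIntegral_eq_sub {f G : ℂ → ℂ} {U : Set ℂ} (hU : Convex ℝ U)
    (hf : ContinuousOn f U) (hG : ∀ z ∈ U, HasDerivAt G (f z) z) {s t : ℂ} (hs : s ∈ U) (ht : t ∈ U) :
    segIntegral f s t = G t - G s := by
  have hmem : ∀ r ∈ Set.Icc (0 : ℝ) 1, s + r • (t - s) ∈ U := fun r hr =>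
    hU.add_smul_sub_mem hs ht hr
  have hc : ContinuousOn (fun r : ℝ => s + r • (t - s)) (Set.Icc 0 1) := by fun_prop
  have := intervalIntegral.integral_unitInterval_deriv_eq_sub (f := G) (f' := f) (z₀ := s)
    (z₁ := t - s) (hf.comp hc hmem) (fun r hr => hG _ (hmem r hr))
  rw [add_sub_cancel] at this
  rw [← this, segIntegral, smul_eq_mul]
  rfl

theorem exists_primitive {f : ℂ → ℂ} (hf : AnalyticAt ℂ f 0) :
    ∃ G : ℂ → ℂ, AnalyticAt ℂ G 0 ∧ G 0 = 0 ∧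
      (∀ n, PowerSeries.coeff (n + 1) (taylor G) = PowerSeries.coeff n (taylor f) / (n + 1)) ∧
      (∀ᶠ t in 𝓝 0, segIntegral f 0 t = G t) ∧
      ∀ᶠ t in 𝓝 0, segIntegral f (-t) t = G t - G (-t) := by
  obtain ⟨ε, hε, hd⟩ := Metric.eventually_nhds_iff_ball.1 hf.eventually_analyticAt
  have hdiff : DifferentiableOn ℂ f (Metric.ball 0 ε) := fun z hz =>
    (hd z hz).differentiableAt.differentiableWithinAt
  obtain ⟨G₀, hG₀⟩ := hdiff.isExactOn_ball
  set G : ℂ → ℂ := fun z => G₀ z - G₀ 0 with hGdef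
  have hG : ∀ z ∈ Metric.ball (0 : ℂ) ε, HasDerivAt G (f z) z := fun z hz =>
    (hG₀ z hz).sub_const _
  have hball : ∀ᶠ t in 𝓝 (0 : ℂ), t ∈ Metric.ball (0 : ℂ) ε := Metric.ball_mem_nhds 0 hε
  have hneg : ∀ {t : ℂ}, t ∈ Metric.ball (0 : ℂ) ε → -t ∈ Metric.ball (0 : ℂ) ε := by
    intro t ht; simpa using ht
  have hGa : AnalyticAt ℂ G 0 := by
    have : DifferentiableOn ℂ G (Metric.ball 0 ε) := fun z hz =>
      (hG z hz).differentiableAt.differentiableWithinAt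
    exact this.analyticAt (Metric.ball_mem_nhds 0 hε)
  refine ⟨G, hGa, by simp [hGdef], fun n => ?_, ?_, ?_⟩
  · rw [coeff_taylor, coeff_taylor, iteratedDeriv_succ']
    have : deriv G =ᶠ[𝓝 0] f := by
      filter_upwards [hball] with z hz using (hG z hz).deriv
    rw [this.iteratedDeriv_eq n, Nat.factorial_succ]
    push_cast
    rw [div_div, mul_comm]
  · filter_upwards [hball] with t ht
    rw [segIntegral_eq_sub (convex_ball 0 ε) hdiff.continuousOn hG (Metric.mem_ball_self hε) ht]
    simp [hGdef]
  · filter_upwards [hball] with t ht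
    exact segIntegral_eq_sub (convex_ball 0 ε) hdiff.continuousOn hG (hneg ht) ht

/-- The segment from `-t` to `t` meets `0` only at parameter `1/2`, a null set. Hence the value that
the function `dy` happens to take at a ramification point does not matter. -/
theorem segIntegral_congr {f g : ℂ → ℂ} (h : f =ᶠ[𝓝[≠] 0] g) :
    ∀ᶠ t in 𝓝[≠] (0 : ℂ), segIntegral f (-t) t = segIntegral g (-t) t := by
  obtain ⟨ε, hε, h⟩ := Metric.eventually_nhds_iff.1 (eventually_nhdsWithin_iff.1 h)
  have hball : ∀ᶠ t in 𝓝[≠] (0 : ℂ), t ∈ Metric.ball (0 : ℂ) ε :=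
    nhdsWithin_le_nhds (Metric.ball_mem_nhds 0 hε)
  filter_upwards [hball, self_mem_nhdsWithin] with t ht ht0
  have ht0 : t ≠ 0 := ht0
  unfold segIntegral
  congr 1
  refine intervalIntegral.integral_congr_ae ?_
  have h12 : ∀ᵐ r : ℝ, r ≠ 1 / 2 := by
    simp [MeasureTheory.ae_iff]
  filter_upwards [h12] with r hr hr'
  rw [Set.uIoc_of_le zero_le_one] at hr'
  have e : -t + (r : ℂ) * (t - -t) = ((2 * r - 1 : ℝ) : ℂ) * t := by push_cast; ring
  rw [e]
  refine h ?_ ?_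
  · rw [dist_zero_right, norm_mul, Complex.norm_real]
    have h1 : ‖2 * r - 1‖ ≤ 1 := by
      rw [Real.norm_eq_abs, abs_le]; constructor <;> linarith [hr'.1, hr'.2]
    have h2 : ‖t‖ < ε := by simpa using ht
    nlinarith [norm_nonneg t]
  · refine mul_ne_zero ?_ ht0
    rw [Ne, Complex.ofReal_eq_zero]
    intro h0
    exact hr (by linarith)

/-- Division of an analytic function vanishing at `0` by the coordinate. -/
theorem exists_analytic_div {f : ℂ → ℂ} (hf : AnalyticAt ℂ f 0) (h0 : f 0 = 0) :
    ∃ g : ℂ → ℂ, AnalyticAt ℂ g 0 ∧ g 0 = deriv f 0 ∧ ∀ t, f t = t * g t := by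
  obtain ⟨p, hp⟩ := hf
  refine ⟨dslope f 0, ⟨_, hp.has_fpower_series_dslope_fslope⟩, dslope_same f 0, fun t => ?_⟩
  have := sub_smul_dslope f 0 t
  simp only [sub_zero, smul_eq_mul, h0] at this
  exact this.symm

/-! ### The Taylor coefficients of the double pole -/

/-- Comparing coefficients in `(s - t) (s - t)⁻¹ = 1` gives a recursion in `n`. -/
theorem coeff_taylor_inv_sub {s : ℂ} (hs : s ≠ 0) (n : ℕ) :
    PowerSeries.coeff n (taylor fun t => (s - t)⁻¹) = (s ^ (n + 1))⁻¹ := by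
  have ha : AnalyticAt ℂ (fun t : ℂ => s - t) 0 := analyticAt_const.sub analyticAt_id
  have hi : AnalyticAt ℂ (fun t : ℂ => (s - t)⁻¹) 0 := ha.fun_inv (by simpa using hs)
  have hid : AnalyticAt ℂ (fun t : ℂ => t) 0 := analyticAt_id
  have h1 : (fun _ => (1 : ℂ)) =ᶠ[𝓝 0] (fun t : ℂ => s - t) * fun t => (s - t)⁻¹ := by
    filter_upwards [ha.continuousAt.eventually_ne (by simpa using hs)] with t ht
    rw [Pi.mul_apply, mul_inv_cancel₀ ht]
  have hX : taylor (fun t : ℂ => t) = PowerSeries.X := by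
    have := taylor_pow 1
    simpa using this
  have hone : taylor (fun _ => (1 : ℂ)) = 1 := by
    have := taylor_pow 0
    simpa using this
  have hsub : taylor (fun t : ℂ => s - t) = PowerSeries.C s - PowerSeries.X := by
    have e : (fun t : ℂ => s - t) = (fun t => s * 1) + fun t => (-1) * t := by
      funext t; simp [sub_eq_add_neg]
    have h1 : AnalyticAt ℂ (fun _ : ℂ => s * 1) 0 := analyticAt_const
    have h2 : AnalyticAt ℂ (fun t : ℂ => (-1) * t) 0 := analyticAt_const.mul hid
    rw [e, taylor_add h1 h2,
      taylor_const_mul s (fun _ => 1), taylor_const_mul (-1) (fun t => t), hX, hone]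
    simp [sub_eq_add_neg]
  have key := taylor_congr h1
  rw [taylor_mul ha hi, hone, hsub] at key
  induction n with
  | zero =>
    have := congrArg (PowerSeries.coeff 0) key
    rw [sub_mul, map_sub, PowerSeries.coeff_C_mul, PowerSeries.coeff_zero_X_mul, sub_zero,
      PowerSeries.coeff_one, if_pos rfl] at this
    rw [zero_add, pow_one]
    exact (eq_inv_of_mul_eq_one_right this.symm)
  | succ n ih =>
    have := congrArg (PowerSeries.coeff (n + 1)) key
    rw [sub_mul, map_sub, PowerSeries.coeff_C_mul, PowerSeries.coeff_succ_X_mul,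
      PowerSeries.coeff_one, if_neg (Nat.succ_ne_zero n), ih] at this
    rw [pow_succ, mul_inv, ← sub_eq_zero.1 this.symm]
    field_simp

theorem coeff_taylor_inv_sub_sq {s : ℂ} (hs : s ≠ 0) (n : ℕ) :
    PowerSeries.coeff n (taylor fun t => 1 / (s - t) ^ 2) = (n + 1) / s ^ (n + 2) := by
  have ha : AnalyticAt ℂ (fun t : ℂ => s - t) 0 := analyticAt_const.sub analyticAt_id
  have hi : AnalyticAt ℂ (fun t : ℂ => (s - t)⁻¹) 0 := ha.fun_inv (by simpa using hs)
  have e : (fun t => 1 / (s - t) ^ 2) = (fun t : ℂ => (s - t)⁻¹) * fun t : ℂ => (s - t)⁻¹ := by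
    funext t
    rw [Pi.mul_apply, one_div, pow_two, mul_inv]
  rw [e, taylor_mul hi hi, PowerSeries.coeff_mul]
  have : ∀ p ∈ Finset.HasAntidiagonal.antidiagonal n,
      PowerSeries.coeff p.1 (taylor fun t => (s - t)⁻¹) *
      PowerSeries.coeff p.2 (taylor fun t => (s - t)⁻¹) = (s ^ (n + 2))⁻¹ := by
    intro p hp
    rw [Finset.HasAntidiagonal.mem_antidiagonal] at hp
    rw [coeff_taylor_inv_sub hs, coeff_taylor_inv_sub hs, ← mul_inv, ← pow_add]
    congr 2
    omega
  rw [Finset.sum_congr rfl this, Finset.sum_const, Finset.Nat.card_antidiagonal, nsmul_eq_mul,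
    div_eq_mul_inv]
  push_cast
  ring

theorem analyticAt_inv_sub_sq {s : ℂ} (hs : s ≠ 0) :
    AnalyticAt ℂ (fun t : ℂ => 1 / (s - t) ^ 2) 0 :=
  analyticAt_const.div ((analyticAt_const.sub analyticAt_id).pow 2) (by simpa using hs)

namespace SpectralCurve

variable {X : Type u} [TopologicalSpace X] [T2Space X] [ChartedSpace ℂ X] [IsManifold 𝓘(ℂ) ω X]
variable {C : SpectralCurve X} (Z : C.LocalCoordinates)

theorem zero_mem_target {a : X} (ha : a ∈ C.ram) : (0 : ℂ) ∈ (Z.ζ a).target := by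
  rw [← Z.center a ha]; exact (Z.ζ a).map_source (Z.mem_source a ha)

theorem symm_zero {a : X} (ha : a ∈ C.ram) : (Z.ζ a).symm 0 = a := by
  rw [← Z.center a ha]; exact (Z.ζ a).left_inv (Z.mem_source a ha)

theorem eventually_symm_ne {a b : X} (ha : a ∈ C.ram) :
    ∀ᶠ t in 𝓝[≠] (0 : ℂ), (Z.ζ a).symm t ≠ b := by
  by_cases h : b = a
  · subst h
    filter_upwards [nhdsWithin_le_nhds ((Z.ζ b).open_target.mem_nhds (zero_mem_target Z ha)),
      self_mem_nhdsWithin] with t ht hne heq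
    refine hne ?_
    rw [← (Z.ζ b).right_inv ht, heq, Z.center b ha]
    rfl
  · have hc := (Z.ζ a).continuousAt_symm (zero_mem_target Z ha)
    refine nhdsWithin_le_nhds (hc.eventually_ne ?_)
    rw [symm_zero Z ha]
    exact fun h' => h h'.symm

theorem eventually_notMem_ram {a : X} (ha : a ∈ C.ram) :
    ∀ᶠ t in 𝓝[≠] (0 : ℂ), (Z.ζ a).symm t ∉ C.ram := by
  have : ∀ᶠ t in 𝓝[≠] (0 : ℂ), ∀ b ∈ C.ram, (Z.ζ a).symm t ≠ b :=
    (Filter.eventually_all_finset C.ram).2 fun b _ => eventually_symm_ne Z ha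
  filter_upwards [this] with t ht h using ht _ h rfl

/-! ### The forms `ξ` -/

/-- The Taylor coefficients of `ω_{0,2}(z, ·)` at a zero `a` of `dx`. -/
def bcoef (a : X) (k : ℕ) (z : X) : ℂ := PowerSeries.coeff k (taylor (pull (Z.ζ a) (C.B z)))

open Classical in
/-- The forms `ξ^{(a,i)} / (2i+1)!!`. -/
def xiNorm (a : X) (i : ℕ) (z : X) : ℂ :=
  if z ∈ C.ram then 0 else bcoef Z a (2 * i) z / (2 * i + 1)

theorem pull_bcoef (e : OpenPartialHomeomorph X ℂ) (a : X) (k : ℕ) (s : ℂ) :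
    pull e (bcoef Z a k) s =
      PowerSeries.coeff k (taylor fun t => pull₂ e (Z.ζ a) C.B s t) := by
  have : (fun t => pull₂ e (Z.ζ a) C.B s t) =
      fun t => jac e s * pull (Z.ζ a) (C.B (e.symm s)) t := by
    funext t
    rw [pull₂, pull]; ring
  rw [this, taylor_const_mul, PowerSeries.coeff_C_mul, pull, bcoef, mul_comm]

theorem analyticAt_pull_B {a z : X} (ha : a ∈ C.ram) (hz : z ≠ a) :
    AnalyticAt ℂ (pull (Z.ζ a) (C.B z)) 0 := by
  have h := C.analyticAt_pull₂_B (e := chartAt ℂ z) (IsManifold.chart_mem_maximalAtlas _)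
    (Z.holomorphic a ha) (mem_chart_source ℂ z) (Z.mem_source a ha) hz
  rw [Z.center a ha] at h
  have h2 := h.fun_comp (f := fun t : ℂ => (chartAt ℂ z z, t)) (x := 0)
    (analyticAt_const.prod analyticAt_id)
  refine h2.congr (Eventually.of_forall fun t => ?_)
  simp only [pull₂, pull, jac_chartAt, mul_one, (chartAt ℂ z).left_inv (mem_chart_source ℂ z)]

/-- The residue against `t ^ (-2i-2)` selects the coefficient of `t ^ (2i+1)` in the primitive,
which is the coefficient of `t ^ (2i)` in `ω_{0,2}(z, ·)` divided by `2i + 1`. -/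
theorem xi_eq {a : X} (ha : a ∈ C.ram) (i : ℕ) :
    xi Z a i = ((2 * i + 1)‼ : ℂ) • xiNorm Z a i := by
  funext z
  simp only [xi, xiNorm, Pi.smul_apply, smul_eq_mul]
  split_ifs with hz
  · simp
  have hza : z ≠ a := fun h => hz (h ▸ ha)
  obtain ⟨G, hG, -, hG1, hG2, -⟩ := exists_primitive (analyticAt_pull_B Z ha hza)
  have hc : AnalyticAt ℂ (fun t => ((2 * i + 1)‼ : ℂ) * G t) 0 := analyticAt_const.mul hG
  rw [residue_eq_coeff (N := 2 * i + 1) hc, taylor_const_mul, PowerSeries.coeff_C_mul, hG1, bcoef]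
  · push_cast; ring
  · filter_upwards [nhdsWithin_le_nhds hG2] with t ht
    rw [ht, mul_comm]

/-- The power series of the coefficients `φ_{(a,k),(b,j)} / (2j+1)`. -/
def phiSeries (a b : X) (j : ℕ) : PowerSeries ℂ :=
  PowerSeries.mk fun k => phi Z a k b j / (2 * j + 1)

theorem pull_xiNorm_eventuallyEq {a : X} (ha : a ∈ C.ram) (b : X) (j : ℕ) :
    pull (Z.ζ a) (xiNorm Z b j) =ᶠ[𝓝[≠] 0] fun s =>
      PowerSeries.coeff (2 * j) (taylor fun t => pull₂ (Z.ζ a) (Z.ζ b) C.B s t) / (2 * j + 1) := by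
  filter_upwards [eventually_notMem_ram Z ha] with s hs
  rw [← pull_bcoef, pull, pull, xiNorm, if_neg hs]
  ring

theorem phi_eq_coeff_of_ne {a b : X} (ha : a ∈ C.ram) (hb : b ∈ C.ram) (hab : a ≠ b) (k j : ℕ) :
    phi Z a k b j = PowerSeries.coeff (2 * k)
      (taylor fun s => PowerSeries.coeff (2 * j) (taylor fun t => pull₂ (Z.ζ a) (Z.ζ b) C.B s t)) := by
  have h := C.analyticAt_pull₂_B (Z.holomorphic a ha) (Z.holomorphic b hb) (Z.mem_source a ha)
    (Z.mem_source b hb) hab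
  rw [Z.center a ha, Z.center b hb] at h
  have hX := analyticAt_coeff_taylor h (2 * j)
  have hev : ∀ᶠ s in 𝓝 (0 : ℂ), AnalyticAt ℂ (fun t => pull₂ (Z.ζ a) (Z.ζ b) C.B s t) 0 := by
    have : ∀ᶠ s in 𝓝 (0 : ℂ),
        AnalyticAt ℂ (fun w : ℂ × ℂ => pull₂ (Z.ζ a) (Z.ζ b) C.B w.1 w.2) (s, 0) :=
      (Continuous.tendsto (by fun_prop : Continuous fun s : ℂ => (s, (0 : ℂ))) 0).eventually
        h.eventually_analyticAt
    filter_upwards [this] with s hs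
    exact hs.fun_comp (f := fun t : ℂ => (s, t)) (analyticAt_const.prod analyticAt_id)
  unfold phi
  simp only [if_neg hab, sub_zero]
  have e2 : ((2 : ℤ) * (k : ℤ)) = ((2 * k : ℕ) : ℤ) := by push_cast; ring
  have e3 : ((2 : ℤ) * (j : ℤ)) = ((2 * j : ℕ) : ℤ) := by push_cast; ring
  rw [e2, e3]
  refine laurentCoeff_eq_coeff hX ?_ _
  filter_upwards [nhdsWithin_le_nhds hev] with s hs
  exact laurentCoeff_eq_coeff hs EventuallyEq.rfl _

theorem evenExp_xiNorm_ne {a b : X} (ha : a ∈ C.ram) (hb : b ∈ C.ram) (hab : a ≠ b) (j T : ℕ) :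
    EvenExp (pull (Z.ζ a) (xiNorm Z b j)) 0 T (phiSeries Z a b j) := by
  have h := C.analyticAt_pull₂_B (Z.holomorphic a ha) (Z.holomorphic b hb) (Z.mem_source a ha)
    (Z.mem_source b hb) hab
  rw [Z.center a ha, Z.center b hb] at h
  have hX := analyticAt_coeff_taylor h (2 * j)
  refine ⟨_, hX.div_const (c := (2 * j + 1 : ℂ)), ?_, fun k _ => ?_, fun k hk => by omega⟩
  · filter_upwards [pull_xiNorm_eventuallyEq Z ha b j] with s hs
    rw [hs]; simp
  · rw [phiSeries, PowerSeries.coeff_mk, phi_eq_coeff_of_ne Z ha hb hab]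
    have := taylor_const_mul (2 * j + 1 : ℂ)⁻¹ (fun s => PowerSeries.coeff (2 * j)
      (taylor fun t => pull₂ (Z.ζ a) (Z.ζ b) C.B s t))
    simp only [div_eq_inv_mul]
    rw [this, PowerSeries.coeff_C_mul]

/-- The regular part of `ω_{0,2}` near a zero of `dx`. -/
theorem exists_regular_part {a : X} (ha : a ∈ C.ram) :
    ∃ h : ℂ × ℂ → ℂ, AnalyticAt ℂ h (0, 0) ∧
      (∀ᶠ w in 𝓝 ((0, 0) : ℂ × ℂ), w.1 ≠ w.2 →
        pull₂ (Z.ζ a) (Z.ζ a) C.B w.1 w.2 = 1 / (w.1 - w.2) ^ 2 + h w) ∧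
      ∀ k j : ℕ, phi Z a k a j = PowerSeries.coeff (2 * k)
        (taylor fun s => PowerSeries.coeff (2 * j) (taylor fun t => h (s, t))) := by
  obtain ⟨h, hh, hB⟩ := C.exists_analytic_pull₂_B_diag (Z.holomorphic a ha) (Z.mem_source a ha)
    (Z.center a ha)
  refine ⟨h, hh, hB, fun k j => ?_⟩
  unfold phi
  simp only [if_pos]
  have e2 : ((2 : ℤ) * (k : ℤ)) = ((2 * k : ℕ) : ℤ) := by push_cast; ring
  have e3 : ((2 : ℤ) * (j : ℤ)) = ((2 * j : ℕ) : ℤ) := by push_cast; ring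
  rw [e2, e3]
  refine laurentCoeff_eq_coeff (analyticAt_coeff_taylor hh (2 * j)) ?_ _
  have hs : ∀ {P : ℂ × ℂ → Prop}, (∀ᶠ w in 𝓝 ((0, 0) : ℂ × ℂ), P w) →
      ∀ᶠ s in 𝓝 (0 : ℂ), P (s, 0) := fun h =>
    (Continuous.tendsto (by fun_prop : Continuous fun s : ℂ => (s, (0 : ℂ))) 0).eventually h
  filter_upwards [nhdsWithin_le_nhds (hs hB.eventually_nhds),
    nhdsWithin_le_nhds (hs hh.eventually_analyticAt), self_mem_nhdsWithin] with s h1 h2 h3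
  have h3 : s ≠ 0 := h3
  refine laurentCoeff_eq_coeff
    (h2.fun_comp (f := fun t : ℂ => (s, t)) (analyticAt_const.prod analyticAt_id)) ?_ _
  have h4 : ∀ᶠ t in 𝓝 (0 : ℂ), s ≠ t := (continuousAt_id.eventually_ne h3.symm).mono
    fun t ht => ht.symm
  filter_upwards [nhdsWithin_le_nhds (eventually_slice h1), nhdsWithin_le_nhds h4] with t ht1 ht2
  rw [ht1 ht2]
  simp

/-- The coefficient of `t ^ (2j)` in `1 / (s - t) ^ 2` is `(2j+1) / s ^ (2j+2)`. Division by `2j +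
1` leaves the pure pole `s ^ (-2j-2)`, the summand `1` here; the regular part of `ω_{0,2}` supplies
the rest. -/
theorem evenExp_xiNorm_self {a : X} (ha : a ∈ C.ram) (j T : ℕ) :
    EvenExp (pull (Z.ζ a) (xiNorm Z a j)) (j + 1) T
      (1 + PowerSeries.X ^ (j + 1) * phiSeries Z a a j) := by
  obtain ⟨h, hh, hB, hphi⟩ := exists_regular_part Z ha
  have hX := analyticAt_coeff_taylor hh (2 * j)
  set χ : ℂ → ℂ := fun s => PowerSeries.coeff (2 * j) (taylor fun t => h (s, t)) with hχ
  have hχ' : AnalyticAt ℂ (fun s => (2 * j + 1 : ℂ)⁻¹ * χ s) 0 := analyticAt_const.mul hX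
  have hpow : AnalyticAt ℂ (fun s : ℂ => s ^ (2 * (j + 1))) 0 := analyticAt_id.pow _
  have hone : AnalyticAt ℂ (fun s : ℂ => s ^ 0) 0 := analyticAt_id.pow _
  have hT : taylor ((fun s : ℂ => s ^ 0) + (fun s : ℂ => s ^ (2 * (j + 1))) *
      fun s => (2 * j + 1 : ℂ)⁻¹ * χ s) =
      1 + PowerSeries.X ^ (2 * (j + 1)) * (PowerSeries.C (2 * j + 1 : ℂ)⁻¹ * taylor χ) := by
    rw [taylor_add hone (hpow.mul hχ'), taylor_mul hpow hχ', taylor_pow, taylor_pow,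
      taylor_const_mul, pow_zero]
  refine ⟨_, hone.add (hpow.mul hχ'), ?_, fun k _ => ?_, fun k hk => ?_⟩
  · have hs : ∀ {P : ℂ × ℂ → Prop}, (∀ᶠ w in 𝓝 ((0, 0) : ℂ × ℂ), P w) →
        ∀ᶠ s in 𝓝 (0 : ℂ), P (s, 0) := fun h =>
      (Continuous.tendsto (by fun_prop : Continuous fun s : ℂ => (s, (0 : ℂ))) 0).eventually h
    filter_upwards [pull_xiNorm_eventuallyEq Z ha a j, nhdsWithin_le_nhds (hs hB.eventually_nhds),
      nhdsWithin_le_nhds (hs hh.eventually_analyticAt), self_mem_nhdsWithin] with s h0 h1 h2 h3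
    have h3 : s ≠ 0 := h3
    have h4 : ∀ᶠ t in 𝓝 (0 : ℂ), s ≠ t := (continuousAt_id.eventually_ne h3.symm).mono
      fun t ht => ht.symm
    have h5 : (fun t => pull₂ (Z.ζ a) (Z.ζ a) C.B s t) =ᶠ[𝓝 0]
        (fun t => 1 / (s - t) ^ 2) + fun t => h (s, t) := by
      filter_upwards [eventually_slice h1, h4] with t ht1 ht2
      rw [Pi.add_apply, ht1 ht2]
    rw [h0, taylor_congr h5, taylor_add (analyticAt_inv_sub_sq h3)
      (h2.fun_comp (f := fun t : ℂ => (s, t)) (analyticAt_const.prod analyticAt_id)), map_add,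
      coeff_taylor_inv_sub_sq h3]
    have h6 : (2 * (j : ℂ) + 1) ≠ 0 := by exact_mod_cast Nat.succ_ne_zero (2 * j)
    simp only [Pi.add_apply, Pi.mul_apply, pow_zero, hχ]
    rw [show 2 * (j + 1) = 2 * j + 2 by ring]
    push_cast
    field_simp
  · rw [hT, map_add, map_add, PowerSeries.coeff_X_pow_mul', PowerSeries.coeff_X_pow_mul',
      PowerSeries.coeff_one, PowerSeries.coeff_one]
    congr 1
    · simp
    · by_cases hk : j + 1 ≤ k
      · rw [if_pos (by omega), if_pos hk, PowerSeries.coeff_C_mul, phiSeries, PowerSeries.coeff_mk,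
          hphi, ← Nat.mul_sub, div_eq_inv_mul]
      · rw [if_neg (by omega), if_neg hk]
  · rw [hT, map_add, PowerSeries.coeff_X_pow_mul', PowerSeries.coeff_one, if_neg (by omega),
      if_neg (by omega), add_zero]

open Classical in
/-- The even part of the expansion of `ξ^{(b,j)} / (2j+1)!!` at `a`. -/
theorem evenExp_xiNorm {a b : X} (ha : a ∈ C.ram) (hb : b ∈ C.ram) (j T : ℕ) :
    EvenExp (pull (Z.ζ a) (xiNorm Z b j)) (j + 1) T
      ((if a = b then 1 else 0) + PowerSeries.X ^ (j + 1) * phiSeries Z a b j) := by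
  split_ifs with h
  · subst h; exact evenExp_xiNorm_self Z ha j T
  · rw [zero_add]
    have := (evenExp_xiNorm_ne Z ha hb h j T).shift (j + 1)
    rw [zero_add] at this
    exact this.mono (by omega)

/-- By symmetry of `ω_{0,2}`, its even Taylor coefficients at `a` in one variable are, up to `2k +
1`, the forms `ξ̂^{(a,k)}` in the other. This is how a factor `ω_{0,2}` in the recursion produces a
form `ξ` in a passive argument. -/
theorem evenExp_B {a q : X} (ha : a ∈ C.ram) (hq : q ∉ C.ram) (T : ℕ) :
    EvenExp (pull (Z.ζ a) fun z => C.B z q) 0 T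
      (PowerSeries.mk fun k => (2 * k + 1) * xiNorm Z a k q) := by
  have hqa : q ≠ a := fun h => hq (h ▸ ha)
  have e : (fun z => C.B z q) = C.B q := funext fun z => C.B_symm z q
  rw [e]
  refine ⟨_, analyticAt_pull_B Z ha hqa, ?_, fun k _ => ?_, fun k hk => by omega⟩
  · exact Eventually.of_forall fun t => by simp
  · have h6 : (2 * (k : ℂ) + 1) ≠ 0 := by exact_mod_cast Nat.succ_ne_zero (2 * k)
    rw [PowerSeries.coeff_mk, xiNorm, if_neg hq, bcoef]
    field_simp

/-- On the antidiagonal the double pole is `1 / (2t) ^ 2`; besides `t ^ (-2)` only the constant term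
is needed. This is the bracket for `ω_{1,1}`. -/
theorem hasEven_B_neg {a : X} (ha : a ∈ C.ram) :
    HasEven (fun t => pull₂ (Z.ζ a) (Z.ζ a) C.B t (-t)) 1
      (PowerSeries.C (1 / 4) + PowerSeries.X * PowerSeries.C (phi Z a 0 a 0)) := by
  obtain ⟨h, hh, hB, hphi⟩ := exists_regular_part Z ha
  have hp : AnalyticAt ℂ (fun t : ℂ => h (t, -t)) 0 := by
    have h0 : AnalyticAt ℂ h ((fun t : ℂ => (t, -t)) 0) := by simpa using hh
    exact h0.fun_comp (f := fun t : ℂ => (t, -t)) (analyticAt_id.prod analyticAt_id.neg)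
  have hpow : AnalyticAt ℂ (fun s : ℂ => s ^ 2) 0 := analyticAt_id.pow _
  have hone : AnalyticAt ℂ (fun s : ℂ => (1 / 4 : ℂ) * s ^ 0) 0 :=
    analyticAt_const.mul (analyticAt_id.pow _)
  have hT : taylor ((fun s : ℂ => (1 / 4 : ℂ) * s ^ 0) + (fun s : ℂ => s ^ 2) *
      fun t => h (t, -t)) =
      PowerSeries.C (1 / 4) + PowerSeries.X ^ 2 * taylor fun t => h (t, -t) := by
    rw [taylor_add hone (hpow.mul hp), taylor_mul hpow hp, taylor_const_mul (1 / 4) fun t => t ^ 0,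
      taylor_pow, taylor_pow, pow_zero, mul_one]
  refine ⟨_, hone.add (hpow.mul hp), ?_, fun k hk => ?_⟩
  · have ht : Tendsto (fun t : ℂ => (t, -t)) (𝓝 0) (𝓝 (0, 0)) := by
      have := (by fun_prop : Continuous fun t : ℂ => (t, -t)).tendsto 0
      simpa using this
    filter_upwards [nhdsWithin_le_nhds (ht.eventually hB), self_mem_nhdsWithin] with t h1 h2
    have h2 : t ≠ 0 := h2
    have h3 : t ≠ -t := fun h => h2 (self_eq_neg.1 h)
    rw [h1 h3, Pi.add_apply, Pi.mul_apply]
    have : t - -t = 2 * t := by ring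
    simp only [this]
    field_simp
    ring
  · rw [hT]
    interval_cases k
    · simp
    · rw [map_add, map_add, PowerSeries.coeff_X_pow_mul', if_pos (by norm_num),
        show 1 = 0 + 1 from rfl, PowerSeries.coeff_succ_X_mul, hphi]
      simp only [Nat.mul_zero]
      simp [coeff_zero_taylor, PowerSeries.coeff_C]

end SpectralCurve

namespace SpectralCurve

variable {X : Type u} [TopologicalSpace X] [T2Space X] [ChartedSpace ℂ X] [IsManifold 𝓘(ℂ) ω X]
variable {C : SpectralCurve X} (Z : C.LocalCoordinates)

/-! ### The recursion kernel -/

theorem exists_analytic_dy (hreg : C.IsRegular) {a : X} (ha : a ∈ C.ram) :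
    ∃ Y : ℂ → ℂ, AnalyticAt ℂ Y 0 ∧ Y 0 ≠ 0 ∧ pull (Z.ζ a) C.dy =ᶠ[𝓝[≠] 0] Y := by
  have h0 := hreg a ha
  have hc : chartAt ℂ a ∈ IsManifold.maximalAtlas 𝓘(ℂ) ω X := IsManifold.chart_mem_maximalAtlas _
  have ht := zero_mem_target Z ha
  have hinv := symm_zero Z ha
  have ht' : (Z.ζ a).symm 0 ∈ (chartAt ℂ a).source := by rw [hinv]; exact mem_chart_source ℂ a
  obtain ⟨g, hg, hg0, hgd⟩ := (meromorphicOrderAt_eq_int_iff (n := 0) (C.dy_meromorphic a)).1 h0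
  have a1 := analyticAt_transition (Z.holomorphic a ha) hc ht ht'
  have hg' : AnalyticAt ℂ g ((fun s => chartAt ℂ a ((Z.ζ a).symm s)) 0) := by
    simpa only [hinv] using hg
  refine ⟨fun t => g (chartAt ℂ a ((Z.ζ a).symm t)) *
    deriv (fun s => chartAt ℂ a ((Z.ζ a).symm s)) t, (AnalyticAt.fun_comp (g := g)
      (f := fun s => chartAt ℂ a ((Z.ζ a).symm s)) hg' a1).mul a1.deriv,
    mul_ne_zero (by simpa only [hinv] using hg0)
      (deriv_transition_ne_zero (Z.holomorphic a ha) hc ht ht'), ?_⟩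
  have h1 := tendsto_transition_punctured (Z.holomorphic a ha) hc ht ht'
  rw [hinv] at h1
  filter_upwards [h1.eventually hgd, nhdsWithin_le_nhds (eventually_transition ht ht')] with t h2 h3
  rw [pull_change (Z.holomorphic a ha) hc h3.1 h3.2, h2]
  simp

/-- The difference `y - y ∘ σ_a` is odd with derivative `2 y'(0)`, nonzero by regularity, so it is
`t g(t)` with `g` even and `g(0) ≠ 0`. As `dx = 2t dt`, the quotient is `-1 / (g(t) t ^ 2)`. -/
theorem exists_theta_function (hreg : C.IsRegular) {a : X} (ha : a ∈ C.ram) :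
    ∃ Θ : ℂ → ℂ, AnalyticAt ℂ Θ 0 ∧
      (∀ᶠ t in 𝓝[≠] (0 : ℂ), -2 / (deltaY Z a t * pull (Z.ζ a) C.dx t) = Θ t / t ^ 2) ∧
      (∀ m, PowerSeries.coeff (2 * m) (taylor Θ) = theta Z a m) ∧
      ∀ m, PowerSeries.coeff (2 * m + 1) (taylor Θ) = 0 := by
  obtain ⟨Y, hY, hY0, hYe⟩ := exists_analytic_dy Z hreg ha
  obtain ⟨G, hG, hG0, hG1, -, hG3⟩ := exists_primitive hY
  have hneg : AnalyticAt ℂ (fun t => G (-t)) 0 := by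
    have h0 : AnalyticAt ℂ G (-0) := by simpa using hG
    exact h0.fun_comp analyticAt_id.neg
  obtain ⟨g, hg, hg0, hgd⟩ := exists_analytic_div (hG.sub hneg) (by simp)
  have hd : deriv (G - fun t => G (-t)) 0 = 2 * Y 0 := by
    have h1 := hG1 0
    rw [coeff_zero_taylor, coeff_taylor] at h1
    simp only [zero_add, iteratedDeriv_one, Nat.factorial_one, Nat.cast_one, div_one,
      CharP.cast_eq_zero] at h1
    rw [deriv_sub hG.differentiableAt hneg.differentiableAt, deriv_comp_neg, neg_zero, h1]
    ring
  have hg0' : g 0 ≠ 0 := by rw [hg0, hd]; exact mul_ne_zero two_ne_zero hY0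
  have hΘ : AnalyticAt ℂ (fun t => -(g t)⁻¹) 0 := (hg.fun_inv hg0').neg
  have hmain : ∀ᶠ t in 𝓝[≠] (0 : ℂ),
      -2 / (deltaY Z a t * pull (Z.ζ a) C.dx t) = -(g t)⁻¹ / t ^ 2 := by
    filter_upwards [segIntegral_congr hYe, nhdsWithin_le_nhds hG3, Z.dx_eq a ha,
      self_mem_nhdsWithin, nhdsWithin_le_nhds (hg.continuousAt.eventually_ne hg0')]
      with t h1 h2 h3 h4 h5
    have h4 : t ≠ 0 := h4
    have := hgd t
    simp only [Pi.sub_apply] at this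
    rw [deltaY, h1, h2, h3, this]
    field_simp
  have heven : ∀ᶠ t in 𝓝 (0 : ℂ), -(g (-t))⁻¹ = -(g t)⁻¹ := by
    refine Eventually.of_forall fun t => ?_
    by_cases h : t = 0
    · simp [h]
    · have h1 := hgd t
      have h2 := hgd (-t)
      simp only [Pi.sub_apply, neg_neg] at h1 h2
      have : t * g (-t) = t * g t := by linear_combination h1 + h2
      rw [mul_left_cancel₀ h this]
  refine ⟨_, hΘ, hmain, fun m => ?_, fun m => ?_⟩
  · symm
    refine residue_eq_coeff hΘ ?_
    filter_upwards [hmain, self_mem_nhdsWithin] with t h1 h2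
    have h2 : t ≠ 0 := h2
    rw [h1, div_mul_eq_mul_div, div_eq_div_iff (pow_ne_zero _ h2) (pow_ne_zero _ h2), mul_assoc]
    congr 1
    rw [← zpow_natCast, ← zpow_natCast, ← zpow_add₀ h2]
    congr 1
    push_cast
    ring
  · have h1 := coeff_taylor_comp_neg (fun t => -(g t)⁻¹) (2 * m + 1)
    rw [taylor_congr heven, pow_succ, Even.neg_one_pow (even_two_mul m)] at h1
    have h2 : (2 : ℂ) * PowerSeries.coeff (2 * m + 1) (taylor fun t => -(g t)⁻¹) = 0 := by
      linear_combination h1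
    exact (mul_eq_zero.1 h2).resolve_left two_ne_zero

/-- The power series of the coefficients `θ_{(a,m)}`. -/
def thetaSeries (a : X) : PowerSeries ℂ := PowerSeries.mk (theta Z a)

theorem coeff_mul_of_odd {f g : PowerSeries ℂ} (hf : ∀ m, PowerSeries.coeff (2 * m + 1) f = 0)
    (k : ℕ) : PowerSeries.coeff (2 * k) (f * g) =
      ∑ p ∈ Finset.HasAntidiagonal.antidiagonal k,
        PowerSeries.coeff (2 * p.1) f * PowerSeries.coeff (2 * p.2) g := by
  rw [PowerSeries.coeff_mul, sum_antidiagonal_two_mul, Finset.sum_eq_zero (s := Finset.filter _ _),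
    add_zero]
  rintro ⟨a, b⟩ hp
  simp only [Finset.mem_filter, Finset.HasAntidiagonal.mem_antidiagonal,
    Nat.not_even_iff_odd] at hp
  obtain ⟨c, hc⟩ := hp.2
  dsimp only
  rw [hc, hf, zero_mul]

/-- The residue of the recursion kernel against a function with known even part. -/
theorem residue_kernel_mul (hreg : C.IsRegular) {a p : X} (ha : a ∈ C.ram) (hp : p ∉ C.ram)
    {F : ℂ → ℂ} {M : ℕ} {E : PowerSeries ℂ} (hF : HasEven F M E) :
    residue (fun t => kernel Z a p t * F t) =
      -∑ i ∈ Finset.range (M + 1), xiNorm Z a i p *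
        (1 / 2 * PowerSeries.coeff (M - i) (thetaSeries Z a * E)) := by
  obtain ⟨Θ, hΘ, hΘe, hΘ0, hΘ1⟩ := exists_theta_function Z hreg ha
  obtain ⟨g, hg, hge, hgE⟩ := hF
  have hpa : p ≠ a := fun h => hp (h ▸ ha)
  obtain ⟨G, hG, hG0, hG1, -, hG3⟩ := exists_primitive (analyticAt_pull_B Z ha hpa)
  have hneg : AnalyticAt ℂ (fun t => G (-t)) 0 := by
    have h0 : AnalyticAt ℂ G (-0) := by simpa using hG
    exact h0.fun_comp analyticAt_id.neg
  have hneg' : AnalyticAt ℂ (fun t => (-1) * G (-t)) 0 := analyticAt_const.mul hneg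
  -- `S` is the integral from `-t` to `t` in the numerator of the kernel. It is odd, and its
  -- coefficient of `t ^ (2i+1)` is twice `xiNorm Z a i p`.
  set S : ℂ → ℂ := G + fun t => (-1) * G (-t) with hS
  have hSa : AnalyticAt ℂ S 0 := hG.add hneg'
  have hSc : ∀ n, PowerSeries.coeff n (taylor S) =
      (1 - (-1) ^ n) * PowerSeries.coeff n (taylor G) := by
    intro n
    rw [hS, taylor_add hG hneg', taylor_const_mul (-1) (fun t => G (-t)), map_add,
      PowerSeries.coeff_C_mul, coeff_taylor_comp_neg]
    ring
  -- The factor `-1/4` combines the `1/2` of the kernel with the `-1/2` in `1 / (Δy dx) = -Θ / (2 t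
  -- ^ 2)`.
  have hres : residue (fun t => kernel Z a p t * F t) =
      PowerSeries.coeff (2 * M + 1) (taylor fun t => (-1 / 4 : ℂ) * (S * (Θ * g)) t) := by
    refine residue_eq_coeff (analyticAt_const.mul (hSa.mul (hΘ.mul hg))) ?_
    filter_upwards [hge, hΘe, nhdsWithin_le_nhds hG3, self_mem_nhdsWithin] with t h1 h2 h3 h4
    have h4 : t ≠ 0 := h4
    have h5 : (deltaY Z a t * pull (Z.ζ a) C.dx t)⁻¹ = (-1 / 2 : ℂ) * (Θ t / t ^ 2) := by
      rw [← h2]; ring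
    rw [kernel, div_eq_mul_inv, h5, h3, h1]
    simp only [hS, Pi.mul_apply, Pi.add_apply]
    rw [show 2 * M + 1 + 1 = 2 * M + 2 by ring, pow_add]
    field_simp
    ring
  rw [hres, taylor_const_mul (-1 / 4) (S * (Θ * g)), PowerSeries.coeff_C_mul,
    taylor_mul hSa (hΘ.mul hg), taylor_mul hΘ hg]
  -- Since `S` is odd, only even coefficients of `Θ g` are paired with it, and since `Θ` is even
  -- these involve only the even coefficients of `g` of index at most `2M`: exactly what `HasEven`
  -- controls.
  have hodd : PowerSeries.coeff (2 * M + 1) (taylor S * (taylor Θ * taylor g)) =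
      ∑ i ∈ Finset.range (M + 1), PowerSeries.coeff (2 * i + 1) (taylor S) *
        PowerSeries.coeff (2 * (M - i)) (taylor Θ * taylor g) := by
    rw [PowerSeries.coeff_mul]
    symm
    refine Finset.sum_of_injOn (fun i => (2 * i + 1, 2 * (M - i))) ?_ ?_ ?_ ?_
    · intro i _ j _ h
      simp only [Prod.mk.injEq] at h
      omega
    · intro i hi
      simp only [Finset.coe_range, Set.mem_Iio] at hi
      simp only [Finset.mem_coe, Finset.HasAntidiagonal.mem_antidiagonal]
      omega
    · rintro ⟨x, y⟩ h1 h2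
      rw [Finset.HasAntidiagonal.mem_antidiagonal] at h1
      dsimp only at h1
      have hx : Even x := by
        by_contra hx
        obtain ⟨c, hc⟩ := Nat.not_even_iff_odd.1 hx
        refine h2 ⟨c, ?_, ?_⟩
        · simp only [Finset.coe_range, Set.mem_Iio]; omega
        · simp only [Prod.mk.injEq]; omega
      dsimp only
      rw [hSc, hx.neg_one_pow, sub_self, zero_mul, zero_mul]
    · intros; rfl
  rw [hodd, Finset.mul_sum, ← Finset.sum_neg_distrib]
  refine Finset.sum_congr rfl fun i hi => ?_
  have hi' : i ≤ M := Nat.lt_succ_iff.1 (Finset.mem_range.1 hi)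
  have e1 : PowerSeries.coeff (2 * i + 1) (taylor S) = 2 * xiNorm Z a i p := by
    rw [hSc, hG1, xiNorm, if_neg hp, bcoef, pow_succ, Even.neg_one_pow (even_two_mul i)]
    push_cast
    ring
  have e2 : PowerSeries.coeff (2 * (M - i)) (taylor Θ * taylor g) =
      PowerSeries.coeff (M - i) (thetaSeries Z a * E) := by
    rw [coeff_mul_of_odd hΘ1, PowerSeries.coeff_mul]
    refine Finset.sum_congr rfl fun x hx => ?_
    rw [Finset.HasAntidiagonal.mem_antidiagonal] at hx
    rw [hΘ0, hgE _ (by omega), thetaSeries, PowerSeries.coeff_mk]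
  rw [e1, e2]
  ring

/-! ### The forms `ξ` belong to `H⁰(X, K(*𝔞))` -/

theorem xiNorm_mem_forms {a : X} (ha : a ∈ C.ram) (i : ℕ) : xiNorm Z a i ∈ C.forms := by
  refine ⟨fun p hp => ?_, fun b hb => ⟨?_, by simp [xiNorm, hb]⟩⟩
  · have hpa : p ≠ a := fun h => hp (h ▸ ha)
    have h := C.analyticAt_pull₂_B (e := chartAt ℂ p) (IsManifold.chart_mem_maximalAtlas _)
      (Z.holomorphic a ha) (mem_chart_source ℂ p) (Z.mem_source a ha) hpa
    rw [Z.center a ha] at h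
    have hX := (analyticAt_coeff_taylor h (2 * i)).div_const (c := (2 * i + 1 : ℂ))
    refine hX.congr ?_
    have hcont := (chartAt ℂ p).continuousAt_symm (mem_chart_target ℂ p)
    have hev : ∀ᶠ s in 𝓝 (chartAt ℂ p p), ∀ b ∈ C.ram, (chartAt ℂ p).symm s ≠ b := by
      refine (Filter.eventually_all_finset C.ram).2 fun b hb => hcont.eventually_ne ?_
      rw [(chartAt ℂ p).left_inv (mem_chart_source ℂ p)]
      rintro rfl
      exact hp hb
    filter_upwards [hev] with s hs
    have hs' : (chartAt ℂ p).symm s ∉ C.ram := fun h => hs _ h rfl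
    simp only [← pull_bcoef]
    rw [pull, pull, xiNorm, if_neg hs']
    ring
  · have hc : chartAt ℂ b ∈ IsManifold.maximalAtlas 𝓘(ℂ) ω X := IsManifold.chart_mem_maximalAtlas _
    have hinv : (chartAt ℂ b).symm (chartAt ℂ b b) = b :=
      (chartAt ℂ b).left_inv (mem_chart_source ℂ b)
    refine meromorphicAt_pull_change hc (Z.holomorphic b hb) (mem_chart_target ℂ b)
      (by rw [hinv]; exact Z.mem_source b hb) ?_
    rw [hinv, Z.center b hb]
    obtain ⟨g, hg, hge, -⟩ := evenExp_xiNorm Z hb ha i 0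
    refine MeromorphicAt.congr (f := fun t => g t / t ^ (2 * (i + 1))) ?_
      (hge.mono fun t ht => ht.symm)
    exact hg.meromorphicAt.fun_div ((MeromorphicAt.id 0).fun_pow _)

end SpectralCurve

/-! ### Cauchy estimates -/

theorem norm_coeff_taylor_le {f : ℂ → ℂ} {R M : ℝ} (hR : 0 < R)
    (hf : ∀ z, ‖z‖ ≤ R → AnalyticAt ℂ f z) (hM : ∀ z, ‖z‖ ≤ R → ‖f z‖ ≤ M) (n : ℕ) :
    ‖PowerSeries.coeff n (taylor f)‖ ≤ M / R ^ n := by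
  have hd : DiffContOnCl ℂ f (Metric.ball 0 R) := by
    apply DifferentiableOn.diffContOnCl
    intro z hz
    have hz' := Metric.closure_ball_subset_closedBall hz
    exact (hf z (by simpa using hz')).differentiableAt.differentiableWithinAt
  have h := Complex.norm_iteratedDeriv_le_of_forall_mem_sphere_norm_le n hR hd
    fun z hz => hM z (by simpa using (Metric.mem_sphere.1 hz).le)
  have hn : (0 : ℝ) < n ! := by exact_mod_cast n.factorial_pos
  rw [coeff_taylor, norm_div, Complex.norm_natCast, div_le_iff₀ hn]
  calc _ ≤ _ := h
    _ = _ := by ring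

theorem exists_norm_coeff_taylor_le {f : ℂ → ℂ} (hf : AnalyticAt ℂ f 0) :
    ∃ M R : ℝ, 0 < R ∧ ∀ n, ‖PowerSeries.coeff n (taylor f)‖ ≤ M / R ^ n := by
  have h1 : ∀ᶠ z in 𝓝 (0 : ℂ), ‖f z‖ < ‖f 0‖ + 1 :=
    hf.continuousAt.norm.eventually_lt continuousAt_const (by simp)
  obtain ⟨ε, hε, h⟩ := Metric.eventually_nhds_iff.1 (hf.eventually_analyticAt.and h1)
  have h' : ∀ z : ℂ, ‖z‖ ≤ ε / 2 → AnalyticAt ℂ f z ∧ ‖f z‖ < ‖f 0‖ + 1 := fun z hz =>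
    h (by rw [dist_zero_right]; linarith)
  exact ⟨‖f 0‖ + 1, ε / 2, half_pos hε, fun n => norm_coeff_taylor_le (half_pos hε)
    (fun z hz => (h' z hz).1) (fun z hz => (h' z hz).2.le) n⟩

theorem exists_norm_coeff_coeff_taylor_le {h : ℂ × ℂ → ℂ} (hh : AnalyticAt ℂ h (0, 0)) :
    ∃ M R : ℝ, 0 < R ∧ ∀ i j, ‖PowerSeries.coeff i
      (taylor fun s => PowerSeries.coeff j (taylor fun t => h (s, t)))‖ ≤ M / R ^ (i + j) := by
  have h1 : ∀ᶠ z in 𝓝 ((0, 0) : ℂ × ℂ), ‖h z‖ < ‖h (0, 0)‖ + 1 :=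
    hh.continuousAt.norm.eventually_lt continuousAt_const (by simp)
  obtain ⟨ε, hε, h2⟩ := Metric.eventually_nhds_iff.1 (hh.eventually_analyticAt.and h1)
  have h' : ∀ s t : ℂ, ‖s‖ ≤ ε / 2 → ‖t‖ ≤ ε / 2 →
      AnalyticAt ℂ h (s, t) ∧ ‖h (s, t)‖ < ‖h (0, 0)‖ + 1 := fun s t hs ht =>
    h2 (by
      rw [Prod.dist_eq, dist_zero_right, dist_zero_right]
      exact max_lt (by linarith) (by linarith))
  refine ⟨‖h (0, 0)‖ + 1, ε / 2, half_pos hε, fun i j => ?_⟩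
  rw [add_comm i j, pow_add, ← div_div]
  refine norm_coeff_taylor_le (half_pos hε) (fun s hs => ?_) (fun s hs => ?_) i
  · exact analyticAt_coeff_taylor (h' s 0 hs (by simpa using (half_pos hε).le)).1 j
  · refine norm_coeff_taylor_le (half_pos hε) (fun t ht => ?_) (fun t ht => (h' s t hs ht).2.le) j
    exact (h' s t hs ht).1.fun_comp (f := fun t : ℂ => (s, t)) (analyticAt_const.prod analyticAt_id)

/-- A single small number `c` serves both as radius and as inverse of the constant. Phrasing this as
a property that holds eventually for `c → 0+` lets finitely many families of coefficients share the
same `c`. -/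
theorem eventually_le_inv_div_pow {ι : Type*} {f : ι → ℝ} {deg : ι → ℕ}
    (h : ∃ M R : ℝ, 0 < R ∧ ∀ i, f i ≤ M / R ^ deg i) :
    ∀ᶠ c in 𝓝[>] (0 : ℝ), ∀ i, f i ≤ c⁻¹ / c ^ deg i := by
  obtain ⟨M, R, hR, h⟩ := h
  have hM : (0 : ℝ) < (|M| + 1)⁻¹ := by positivity
  filter_upwards [Ioo_mem_nhdsGT hR, Ioo_mem_nhdsGT hM] with c hc hc' i
  have hc0 := hc.1
  have h1 : M ≤ c⁻¹ := by
    have : (|M| + 1) ≤ c⁻¹ := by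
      rw [le_inv_comm₀ (by positivity) hc0]; exact hc'.2.le
    linarith [le_abs_self M]
  calc f i ≤ M / R ^ deg i := h i
    _ ≤ c⁻¹ / R ^ deg i := by gcongr
    _ ≤ c⁻¹ / c ^ deg i := by
      have := hc.2.le
      gcongr

/-! ### Regular spectral curves are bounded -/

namespace SpectralCurve

variable {X : Type u} [TopologicalSpace X] [T2Space X] [ChartedSpace ℂ X] [IsManifold 𝓘(ℂ) ω X]
variable {C : SpectralCurve X} (Z : C.LocalCoordinates)

theorem exists_phi_eq_coeff {a b : X} (ha : a ∈ C.ram) (hb : b ∈ C.ram) :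
    ∃ h : ℂ × ℂ → ℂ, AnalyticAt ℂ h (0, 0) ∧
      ∀ k j : ℕ, phi Z a k b j = PowerSeries.coeff (2 * k)
        (taylor fun s => PowerSeries.coeff (2 * j) (taylor fun t => h (s, t))) := by
  by_cases hab : a = b
  · subst hab
    obtain ⟨h, h1, -, h2⟩ := exists_regular_part Z ha
    exact ⟨h, h1, h2⟩
  · have h := C.analyticAt_pull₂_B (Z.holomorphic a ha) (Z.holomorphic b hb) (Z.mem_source a ha)
      (Z.mem_source b hb) hab
    rw [Z.center a ha, Z.center b hb] at h
    exact ⟨_, h, phi_eq_coeff_of_ne Z ha hb hab⟩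

theorem exists_isBoundedCurveWith (hreg : C.IsRegular) :
    ∃ Mθ Mφ ρ : ℝ, IsBoundedCurveWith Z Mθ Mφ ρ := by
  have hθ : ∀ a ∈ C.ram, ∃ M R : ℝ, 0 < R ∧ ∀ i : ℕ, ‖theta Z a i‖ ≤ M / R ^ (i + 1) := by
    intro a ha
    obtain ⟨Θ, hΘ, -, h1, -⟩ := exists_theta_function Z hreg ha
    obtain ⟨M, R, hR, h⟩ := exists_norm_coeff_taylor_le hΘ
    -- Only the Taylor indices `2i` occur, so the radius `R` becomes `R ^ 2`; the factor `R ^ 2` in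
    -- the constant accounts for the exponent `i + 1` in place of `i`.
    refine ⟨M * R ^ 2, R ^ 2, by positivity, fun i => ?_⟩
    rw [← h1]
    refine (h _).trans_eq ?_
    rw [← pow_mul, mul_add, pow_add]
    field_simp
  have hφ : ∀ a ∈ C.ram, ∀ b ∈ C.ram, ∃ M R : ℝ, 0 < R ∧ ∀ p : ℕ × ℕ,
      ‖phi Z a p.1 b p.2‖ ≤ M / R ^ (p.1 + p.2) := by
    intro a ha b hb
    obtain ⟨h, h1, h2⟩ := exists_phi_eq_coeff Z ha hb
    obtain ⟨M, R, hR, h⟩ := exists_norm_coeff_coeff_taylor_le h1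
    refine ⟨M, R ^ 2, by positivity, fun p => ?_⟩
    rw [h2]
    refine (h _ _).trans_eq ?_
    rw [← pow_mul, mul_add]
  have h1 := (Filter.eventually_all_finset C.ram).2 fun a ha => eventually_le_inv_div_pow (hθ a ha)
  have h2 := (Filter.eventually_all_finset C.ram).2 fun a ha =>
    (Filter.eventually_all_finset C.ram).2 fun b hb => eventually_le_inv_div_pow (hφ a ha b hb)
  obtain ⟨c, ⟨h3, h4⟩, hc⟩ := ((h1.and h2).and self_mem_nhdsWithin).exists
  have hc : 0 < c := hc
  exact ⟨c⁻¹, c⁻¹, c, inv_pos.2 hc, (inv_pos.2 hc).le, hc, h3, fun a ha b hb i j =>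
    h4 a ha b hb (i, j)⟩

end SpectralCurve

/-! ### The recursion for the expansion coefficients -/

/-- The expansion coefficients of a spectral curve at its ramification points: `theta a` is the
series of the `θ_{(a,m)}`, and `phi a b j` is the even part at `a` of the regular part of
`ξ^{(b,j)} / (2j+1)!!`. -/
structure LocalData (ι : Type*) where
  theta : ι → PowerSeries ℂ
  phi : ι → ι → ℕ → PowerSeries ℂ

section Splitting

variable {β : Type*}

/-- The restriction of a tuple to a set of indices. -/
def restrict {m : ℕ} (J : Finset (Fin m)) (κ : Fin m → β) : Fin J.card → β :=
  fun i => κ (J.orderEmbOfFin rfl i)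

theorem prod_restrict_mul {M : Type*} [CommMonoid M] {m : ℕ} (J : Finset (Fin m)) (f : Fin m → M) :
    (∏ i, restrict J f i) * ∏ i, restrict Jᶜ f i = ∏ i, f i := by
  rw [← (finSumEquivOfFinset (s := J) rfl rfl).prod_comp, Fintype.prod_sum_type]
  simp [restrict]

theorem sum_restrict_add {M : Type*} [AddCommMonoid M] {m : ℕ} (J : Finset (Fin m))
    (f : Fin m → M) : ∑ i, restrict J f i + ∑ i, restrict Jᶜ f i = ∑ i, f i := by
  rw [← (finSumEquivOfFinset (s := J) rfl rfl).sum_comp, Fintype.sum_sum_type]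
  simp [restrict]

theorem sum_piFinset_restrict {R : Type*} [CommSemiring R] [DecidableEq β] {m : ℕ}
    (J : Finset (Fin m)) (s : Finset β) (f : (Fin J.card → β) → R) (g : (Fin Jᶜ.card → β) → R) :
    ∑ κ ∈ Fintype.piFinset fun _ : Fin m => s, f (restrict J κ) * g (restrict Jᶜ κ) =
      (∑ κ ∈ Fintype.piFinset fun _ => s, f κ) * ∑ κ ∈ Fintype.piFinset fun _ => s, g κ := by
  rw [Finset.sum_mul_sum, ← Finset.sum_product']
  set e := finSumEquivOfFinset (s := J) rfl rfl
  refine Finset.sum_bij' (fun κ _ => (restrict J κ, restrict Jᶜ κ))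
    (fun κ _ => fun i => Sum.elim κ.1 κ.2 (e.symm i)) ?_ ?_ ?_ ?_ ?_
  · intro κ hκ
    simp only [Fintype.mem_piFinset, Finset.mem_product] at hκ ⊢
    exact ⟨fun i => hκ _, fun i => hκ _⟩
  · rintro ⟨κ, κ'⟩ hκ
    simp only [Fintype.mem_piFinset, Finset.mem_product] at hκ ⊢
    intro i
    rcases e.symm i with j | j
    · exact hκ.1 j
    · exact hκ.2 j
  · intro κ _
    funext i
    obtain ⟨j, rfl⟩ := e.surjective i
    rw [e.symm_apply_apply]
    rcases j with j | j <;> simp [e, restrict]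
  · rintro ⟨κ, κ'⟩ _
    refine Prod.ext ?_ ?_
    · funext i
      have : J.orderEmbOfFin rfl i = e (Sum.inl i) := by simp [e]
      simp only [restrict, this, e.symm_apply_apply, Sum.elim_inl]
    · funext i
      have : Jᶜ.orderEmbOfFin rfl i = e (Sum.inr i) := by simp [e]
      simp only [restrict, this, e.symm_apply_apply, Sum.elim_inr]
  · intros; rfl

end Splitting

namespace LocalData

variable {ι : Type*} [Fintype ι] [DecidableEq ι] (L : LocalData ι) (N : ℕ)

/-- The even part at `a` of `ξ^{(b,l)} / (2l+1)!!`, where `λ = (b,l)`, shifted by `X ^ N`. -/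
def branch (a : ι) (lam : ι × ℕ) : PowerSeries ℂ :=
  (if a = lam.1 then PowerSeries.X ^ (N - 1 - lam.2) else 0) +
    PowerSeries.X ^ N * L.phi a lam.1 lam.2

variable (ι) in
/-- The indices of the forms that occur up to a given order. -/
def indices : Finset (ι × ℕ) := Finset.univ ×ˢ Finset.range (N + 1)

/-- The coefficient of `ξ^λ(z₁) ξ^{κ₁}(z₂) ⋯` in `ω_{g,1+m}(z₁, …)` in terms of the forms
`ξ^{(a,i)} / (2i+1)!!`. -/
def coef (g m : ℕ) (lam : ι × ℕ) (κ : Fin m → ι × ℕ) : ℂ :=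
  if 2 ≤ 2 * g + m ∧ lam.2 ≤ 2 * N then
    1 / 2 * PowerSeries.coeff (2 * N - lam.2) (L.theta lam.1 *
      ((if h : 0 < g then
        if m = 0 ∧ g = 1 then PowerSeries.C (1 / 4) * PowerSeries.X ^ (2 * N - 1) +
          PowerSeries.C (PowerSeries.coeff 0 (L.phi lam.1 lam.1 0)) * PowerSeries.X ^ (2 * N)
        else ∑ μ ∈ indices ι N, ∑ μ' ∈ indices ι N,
          PowerSeries.C (coef (g - 1) (m + 1) μ (Fin.cons μ' κ)) *
            (L.branch N lam.1 μ * L.branch N lam.1 μ')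
      else 0) +
      ∑ g₁ : Fin (g + 1), ∑ J : Finset (Fin m),
        if h : (0 < (g₁ : ℕ) + J.card) ∧ (0 < (g - (g₁ : ℕ)) + Jᶜ.card) then
          (if h' : (g₁ : ℕ) = 0 ∧ J.card = 1 then
            if (restrict J κ ⟨0, by omega⟩).1 = lam.1 then
              PowerSeries.C (2 * (restrict J κ ⟨0, by omega⟩).2 + 1 : ℂ) *
                PowerSeries.X ^ (N + (restrict J κ ⟨0, by omega⟩).2)
            else 0
          else ∑ μ ∈ indices ι N,
            PowerSeries.C (coef g₁ J.card μ (restrict J κ)) * L.branch N lam.1 μ) *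
          (if h' : g - (g₁ : ℕ) = 0 ∧ Jᶜ.card = 1 then
            if (restrict Jᶜ κ ⟨0, by omega⟩).1 = lam.1 then
              PowerSeries.C (2 * (restrict Jᶜ κ ⟨0, by omega⟩).2 + 1 : ℂ) *
                PowerSeries.X ^ (N + (restrict Jᶜ κ ⟨0, by omega⟩).2)
            else 0
          else ∑ μ ∈ indices ι N,
            PowerSeries.C (coef (g - g₁) Jᶜ.card μ (restrict Jᶜ κ)) * L.branch N lam.1 μ)
        else 0))
  else 0
termination_by 2 * g + m
decreasing_by
  · omega
  · have _h1 := g₁.2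
    have h2 := Finset.card_add_card_compl J
    rw [Fintype.card_fin] at h2
    omega
  · have _h1 := g₁.2
    have h2 := Finset.card_add_card_compl J
    rw [Fintype.card_fin] at h2
    omega

/-- The even part at `a` of the coefficient of `ξ^{κ₁}(z₂) ⋯` in `ω_{g,1+m}(z, z₂, …)`, shifted by
`X ^ N`. -/
def ser (a : ι) (g m : ℕ) (κ : Fin m → ι × ℕ) : PowerSeries ℂ :=
  if h : g = 0 ∧ m = 1 then
    if (κ ⟨0, by omega⟩).1 = a then
      PowerSeries.C (2 * (κ ⟨0, by omega⟩).2 + 1 : ℂ) * PowerSeries.X ^ (N + (κ ⟨0, by omega⟩).2)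
    else 0
  else ∑ μ ∈ indices ι N, PowerSeries.C (L.coef N g m μ κ) * L.branch N a μ

/-- The contribution of `ω_{g-1,n+1}` to the recursion. -/
def genusSer (a : ι) (g m : ℕ) (κ : Fin m → ι × ℕ) : PowerSeries ℂ :=
  if 0 < g then
    if m = 0 ∧ g = 1 then PowerSeries.C (1 / 4) * PowerSeries.X ^ (2 * N - 1) +
      PowerSeries.C (PowerSeries.coeff 0 (L.phi a a 0)) * PowerSeries.X ^ (2 * N)
    else ∑ μ ∈ indices ι N, ∑ μ' ∈ indices ι N,
      PowerSeries.C (L.coef N (g - 1) (m + 1) μ (Fin.cons μ' κ)) *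
        (L.branch N a μ * L.branch N a μ')
  else 0

/-- The contribution of a splitting to the recursion. -/
def splitSer (a : ι) (g m : ℕ) (κ : Fin m → ι × ℕ) (g₁ : ℕ) (J : Finset (Fin m)) :
    PowerSeries ℂ :=
  if (0 < g₁ + J.card) ∧ (0 < (g - g₁) + Jᶜ.card) then
    L.ser N a g₁ J.card (restrict J κ) * L.ser N a (g - g₁) Jᶜ.card (restrict Jᶜ κ) else 0

theorem coef_eq {g m : ℕ} (hgm : 2 ≤ 2 * g + m) (lam : ι × ℕ) (hlam : lam.2 ≤ 2 * N)
    (κ : Fin m → ι × ℕ) : L.coef N g m lam κ = 1 / 2 * PowerSeries.coeff (2 * N - lam.2)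
      (L.theta lam.1 * (L.genusSer N lam.1 g m κ +
        ∑ g₁ : Fin (g + 1), ∑ J : Finset (Fin m), L.splitSer N lam.1 g m κ g₁ J)) := by
  rw [coef, if_pos ⟨hgm, hlam⟩]
  rfl

theorem coef_eq_zero_of_unstable {g m : ℕ} (hgm : ¬ 2 ≤ 2 * g + m) (lam : ι × ℕ)
    (κ : Fin m → ι × ℕ) : L.coef N g m lam κ = 0 := by
  rw [coef, if_neg fun h => hgm h.1]

theorem X_pow_dvd_branch (a : ι) (lam : ι × ℕ) :
    PowerSeries.X ^ (N - 1 - lam.2) ∣ L.branch N a lam := by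
  refine dvd_add ?_ ((pow_dvd_pow _ (by omega)).mul_right _)
  split_ifs
  · exact dvd_rfl
  · exact dvd_zero _

theorem X_pow_dvd_ser {a : ι} {g m : ℕ} {κ : Fin m → ι × ℕ}
    (h : ∀ lam, L.coef N g m lam κ ≠ 0 → lam.2 + ∑ i, (κ i).2 + 2 ≤ 3 * g + m) :
    PowerSeries.X ^ (N + 1 + ∑ i, (κ i).2 - (3 * g + m)) ∣ L.ser N a g m κ := by
  unfold ser
  split_ifs with h1 h2
  · obtain ⟨rfl, rfl⟩ := h1
    refine Dvd.dvd.mul_left (pow_dvd_pow _ ?_) _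
    simp
  · exact dvd_zero _
  · refine Finset.dvd_sum fun μ _ => ?_
    by_cases h0 : L.coef N g m μ κ = 0
    · rw [h0, map_zero, zero_mul]; exact dvd_zero _
    · refine Dvd.dvd.mul_left ((pow_dvd_pow _ ?_).trans (L.X_pow_dvd_branch N a μ)) _
      have := h _ h0
      omega

theorem splitting_card {m : ℕ} (J : Finset (Fin m)) : J.card + Jᶜ.card = m := by
  rw [Finset.card_add_card_compl, Fintype.card_fin]

/-- `ω_{g,n}` involves only forms of total order at most `3g-3+n`. -/
theorem coef_support : ∀ (k g m : ℕ), 2 * g + m = k → ∀ (lam : ι × ℕ)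
    (κ : Fin m → ι × ℕ),
    L.coef N g m lam κ ≠ 0 → lam.2 + ∑ i, (κ i).2 + 2 ≤ 3 * g + m := by
  intro k
  induction k using Nat.strong_induction_on with
  | _ k ih =>
  intro g m hk lam κ hne
  by_cases hst : 2 ≤ 2 * g + m
  swap
  · exact absurd (L.coef_eq_zero_of_unstable N hst lam κ) hne
  by_cases hlam : lam.2 ≤ 2 * N
  swap
  · rw [coef, if_neg fun h => hlam h.2] at hne
    exact absurd rfl hne
  by_contra hcon
  apply hne
  rw [L.coef_eq N hst lam hlam]
  -- In excessive degree the order of the bracket in `X` exceeds the index `2N - λ` that is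
  -- extracted. A form of degree `l` has order at least `N - 1 - l`, a factor `ω_{0,2}` has order `N
  -- + κ`, and the induction hypothesis bounds the `l` that occur.
  have key : PowerSeries.X ^ (2 * N + 2 + ∑ i, (κ i).2 - (3 * g + m)) ∣
      L.theta lam.1 * (L.genusSer N lam.1 g m κ +
        ∑ g₁ : Fin (g + 1), ∑ J : Finset (Fin m), L.splitSer N lam.1 g m κ g₁ J) := by
    refine Dvd.dvd.mul_left (dvd_add ?_ (Finset.dvd_sum fun g₁ _ => Finset.dvd_sum fun J _ => ?_)) _
    · unfold genusSer
      split_ifs with h1 h2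
      · obtain ⟨rfl, rfl⟩ := h2
        refine dvd_add (Dvd.dvd.mul_left (pow_dvd_pow _ ?_) _)
          (Dvd.dvd.mul_left (pow_dvd_pow _ ?_) _) <;> simp
      · refine Finset.dvd_sum fun μ _ => Finset.dvd_sum fun μ' _ => ?_
        by_cases h0 : L.coef N (g - 1) (m + 1) μ (Fin.cons μ' κ) = 0
        · rw [h0, map_zero, zero_mul]; exact dvd_zero _
        · have h3 := ih (2 * (g - 1) + (m + 1)) (by omega) _ _ rfl _ _ h0
          rw [Fin.sum_univ_succ] at h3
          simp only [Fin.cons_zero, Fin.cons_succ] at h3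
          refine Dvd.dvd.mul_left ((pow_dvd_pow _ (n := (N - 1 - μ.2) + (N - 1 - μ'.2)) ?_).trans ?_) _
          · omega
          · rw [pow_add]
            exact mul_dvd_mul (L.X_pow_dvd_branch N _ μ) (L.X_pow_dvd_branch N _ μ')
      · exact dvd_zero _
    · unfold splitSer
      split_ifs with h1
      · have hg := g₁.2
        have hJ := splitting_card J
        have hs := sum_restrict_add J fun i => (κ i).2
        have d1 := L.X_pow_dvd_ser N (a := lam.1) (g := g₁) (κ := restrict J κ)
          fun lam h => ih _ (by omega) _ _ rfl _ _ h
        have d2 := L.X_pow_dvd_ser N (a := lam.1) (g := g - g₁) (κ := restrict Jᶜ κ)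
          fun lam h => ih _ (by omega) _ _ rfl _ _ h
        refine dvd_trans (pow_dvd_pow _ ?_) (by
          have := mul_dvd_mul d1 d2
          rwa [← pow_add] at this)
        have e1 : ∑ i, (restrict J κ i).2 = ∑ i, restrict J (fun i => (κ i).2) i := rfl
        have e2 : ∑ i, (restrict Jᶜ κ i).2 = ∑ i, restrict Jᶜ (fun i => (κ i).2) i := rfl
        rw [e1, e2]
        omega
      · exact dvd_zero _
  rw [PowerSeries.X_pow_dvd_iff.1 key _ (by omega), mul_zero]

end LocalData

theorem EvenExp.zero (M T : ℕ) : EvenExp (fun _ => 0) M T 0 := by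
  simpa using EvenExp.sum (∅ : Finset ℕ) (f := fun _ _ => 0) (E := fun _ => 0) (M := M) (T := T)
    (by simp)

theorem HasEven.shift {F : ℂ → ℂ} {M : ℕ} {E : PowerSeries ℂ} (h : HasEven F M E) (K : ℕ) :
    HasEven F (M + K) (PowerSeries.X ^ K * E) := by
  obtain ⟨g, h1, h2, h3⟩ := h
  have hX : AnalyticAt ℂ (fun t : ℂ => t ^ (2 * K)) 0 := analyticAt_id.pow _
  refine ⟨(fun t : ℂ => t ^ (2 * K)) * g, hX.mul h1, ?_, fun k hk => ?_⟩
  · filter_upwards [h2, self_mem_nhdsWithin] with t ht h0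
    have h0 : t ≠ 0 := h0
    rw [ht, Pi.mul_apply, mul_add, pow_add]
    field_simp
  · rw [taylor_mul hX h1, taylor_pow, PowerSeries.coeff_X_pow_mul', PowerSeries.coeff_X_pow_mul']
    by_cases hK : K ≤ k
    · rw [if_pos (by omega), if_pos hK, ← h3 (k - K) (by omega)]
      congr 2
      omega
    · rw [if_neg (by omega), if_neg hK]

theorem sum_piFinset_cons {β M : Type*} [AddCommMonoid M] [DecidableEq β] {m : ℕ}
    (s : Finset β) (f : (Fin (m + 1) → β) → M) :
    ∑ κ ∈ Fintype.piFinset fun _ => s, f κ =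
      ∑ μ ∈ s, ∑ κ ∈ Fintype.piFinset fun _ => s, f (Fin.cons μ κ) := by
  rw [← Finset.sum_product']
  refine Finset.sum_bij' (fun κ _ => (κ 0, Fin.tail κ)) (fun κ _ => Fin.cons κ.1 κ.2) ?_ ?_ ?_ ?_ ?_
  · intro κ hκ
    simp only [Fintype.mem_piFinset, Finset.mem_product] at hκ ⊢
    exact ⟨hκ 0, fun i => hκ _⟩
  · rintro ⟨μ, κ⟩ hκ
    simp only [Fintype.mem_piFinset, Finset.mem_product] at hκ ⊢
    intro i
    refine Fin.cases ?_ (fun j => ?_) i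
    · exact hκ.1
    · exact hκ.2 j
  · intro κ _; simp
  · rintro ⟨μ, κ⟩ _; simp
  · intro κ _; simp

/-! ### The expansion of the correlators in the forms `ξ` -/

namespace SpectralCurve

variable {X : Type u} [TopologicalSpace X] [T2Space X] [ChartedSpace ℂ X] [IsManifold 𝓘(ℂ) ω X]
variable {C : SpectralCurve X} (Z : C.LocalCoordinates)

/-- The expansion coefficients of a spectral curve. -/
def localData : LocalData C.ram where
  theta a := thetaSeries Z a
  phi a b j := phiSeries Z a b j

/-- The form `ξ^{(a,i)} / (2i+1)!!` with index `μ = (a,i)`. -/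
def xiIdx (μ : C.ram × ℕ) : X → ℂ := xiNorm Z μ.1 μ.2

theorem xiIdx_of_mem (μ : C.ram × ℕ) {p : X} (hp : p ∈ C.ram) : xiIdx Z μ p = 0 := by
  rw [xiIdx, xiNorm, if_pos hp]

open Classical in
-- All forms are put over the common denominator `t ^ (2N)`, so that the products in the recursion
-- all live over `t ^ (4N)`. `EvenExp.mul_neg` then requires the coefficients up to index `2N`.
theorem evenExp_branch (N : ℕ) (a : C.ram) {μ : C.ram × ℕ} (hμ : μ.2 + 1 ≤ N) :
    EvenExp (pull (Z.ζ a) (xiIdx Z μ)) N (2 * N) ((localData Z).branch N a μ) := by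
  have h := (evenExp_xiNorm Z a.2 μ.1.2 μ.2 (μ.2 + 1 + N)).shift (N - 1 - μ.2)
  have e1 : μ.2 + 1 + (N - 1 - μ.2) = N := by omega
  have e2 : μ.2 + 1 + N + (N - 1 - μ.2) = 2 * N := by omega
  rw [e2, e1] at h
  refine (congrArg (EvenExp _ N (2 * N)) ?_).mpr h
  unfold LocalData.branch
  rw [mul_add, ← mul_assoc, ← pow_add, show N - 1 - μ.2 + (μ.2 + 1) = N by omega]
  congr 1
  by_cases hab : a = μ.1
  · rw [if_pos hab, if_pos (by rw [hab]), mul_one]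
  · rw [if_neg hab, if_neg (fun h => hab (Subtype.ext h)), mul_zero]

/-- The forms `∏ ξ^{κ_i}(q_i)`. -/
def xiProd {m : ℕ} (κ : Fin m → C.ram × ℕ) (q : Fin m → X) : ℂ := ∏ i, xiIdx Z (κ i) (q i)

open Classical in
/-- The expansion of `ω_{g,1+m}` in the forms `ξ`. -/
def HasExpansion (N g m : ℕ) : Prop :=
  ∀ (p : X) (q : Fin m → X), correlatorAux Z g m p q =
    ∑ κ ∈ Fintype.piFinset fun _ => LocalData.indices C.ram N,
      ∑ μ ∈ LocalData.indices C.ram N,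
        ((localData Z).coef N g m μ κ * xiProd Z κ q) * xiIdx Z μ p

theorem correlatorAux_zero_one (p : X) (q : Fin 1 → X) :
    correlatorAux Z 0 1 p q = C.B p (q 0) := by
  rw [correlatorAux]
  simp

open Classical in
theorem evenExp_correlatorAux {N g m : ℕ} (hgm : 0 < 2 * g + m) (hN : 3 * g + m ≤ N)
    (hexp : 2 ≤ 2 * g + m → HasExpansion Z N g m) (a : C.ram) (q : Fin m → X)
    (hq : ∀ i, q i ∉ C.ram) :
    EvenExp (pull (Z.ζ a) fun z => correlatorAux Z g m z q) N (2 * N)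
      (∑ κ ∈ Fintype.piFinset fun _ => LocalData.indices C.ram N,
        PowerSeries.C (xiProd Z κ q) * (localData Z).ser N a g m κ) := by
  by_cases h01 : g = 0 ∧ m = 1
  · obtain ⟨rfl, rfl⟩ := h01
    have h := (evenExp_B Z a.2 (hq 0) N).shift N
    rw [zero_add, ← two_mul] at h
    simp only [correlatorAux_zero_one]
    refine h.of_coeff_eq fun k hk => ?_
    have e : ∀ κ : Fin 1 → C.ram × ℕ, (localData Z).ser N a 0 1 κ = if (κ 0).1 = a then
        PowerSeries.C (2 * (κ 0).2 + 1 : ℂ) * PowerSeries.X ^ (N + (κ 0).2) else 0 := by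
      intro κ
      rw [LocalData.ser, dif_pos ⟨rfl, rfl⟩]
      rfl
    simp only [e, xiProd, Finset.univ_unique, Fin.default_eq_zero, Fin.isValue,
      Finset.prod_singleton]
    rw [sum_piFinset_cons, PowerSeries.coeff_X_pow_mul']
    simp only [Fin.isValue, Fin.cons_zero, Finset.sum_const, map_sum]
    have hc : (Fintype.piFinset fun _ : Fin 0 => LocalData.indices C.ram N).card = 1 := by simp
    rw [hc]
    simp only [one_smul]
    rw [LocalData.indices, Finset.sum_product, Finset.sum_eq_single a]
    rotate_left
    · intro b _ hb
      simp [hb]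
    · simp
    simp only [if_true, PowerSeries.coeff_C_mul, PowerSeries.coeff_X_pow]
    split_ifs with hNk
    · rw [Finset.sum_eq_single (k - N)]
      · rw [if_pos (by omega), PowerSeries.coeff_mk, xiIdx]
        ring
      · intro j _ hj
        rw [if_neg (by omega)]; ring
      · intro hk'
        simp only [Finset.mem_range] at hk'
        omega
    · rw [Finset.sum_eq_zero]
      intro j _
      rw [if_neg (by omega)]; ring
  · have hst : 2 ≤ 2 * g + m := by omega
    have e : (pull (Z.ζ a) fun z => correlatorAux Z g m z q) = fun t =>
        ∑ κ ∈ Fintype.piFinset fun _ => LocalData.indices C.ram N,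
        ∑ μ ∈ LocalData.indices C.ram N,
          ((localData Z).coef N g m μ κ * xiProd Z κ q) * pull (Z.ζ a) (xiIdx Z μ) t := by
      funext t
      simp only [pull, hexp hst _ _, Finset.sum_mul]
      exact Finset.sum_congr rfl fun κ _ => Finset.sum_congr rfl fun μ _ => by ring
    rw [e]
    refine EvenExp.sum _ fun κ _ => ?_
    have e' : PowerSeries.C (xiProd Z κ q) * (localData Z).ser N a g m κ =
        ∑ μ ∈ LocalData.indices C.ram N,
          PowerSeries.C ((localData Z).coef N g m μ κ * xiProd Z κ q) *
            (localData Z).branch N a μ := by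
      rw [LocalData.ser, dif_neg h01, Finset.mul_sum]
      exact Finset.sum_congr rfl fun μ _ => by rw [map_mul]; ring
    rw [e']
    refine EvenExp.sum _ fun μ _ => ?_
    by_cases h0 : (localData Z).coef N g m μ κ = 0
    · simp only [h0, zero_mul, map_zero]
      exact EvenExp.zero _ _
    -- The degree bound guarantees that the poles of the forms that occur fit below `t ^ (2N)`.
    · have := (localData Z).coef_support N _ g m rfl μ κ h0
      exact (evenExp_branch Z N a (by omega)).const_mul _

open Classical in
theorem hasEven_genus {N g m : ℕ} (hg : 0 < g) (hN : 3 * g + m ≤ N)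
    (hexp : 2 ≤ 2 * (g - 1) + (m + 1) → HasExpansion Z N (g - 1) (m + 1)) (a : C.ram)
    (q : Fin m → X) :
    HasEven (fun t => pull₂ (Z.ζ a) (Z.ζ a)
        (fun z z' => correlatorAux Z (g - 1) (m + 1) z (Fin.cons z' q)) t (-t)) (2 * N)
      (∑ κ ∈ Fintype.piFinset fun _ => LocalData.indices C.ram N,
        PowerSeries.C (xiProd Z κ q) * (localData Z).genusSer N a g m κ) := by
  by_cases h1 : m = 0 ∧ g = 1
  · obtain ⟨rfl, rfl⟩ := h1
    have h := (hasEven_B_neg Z a.2).shift (2 * N - 1)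
    rw [show 1 + (2 * N - 1) = 2 * N by omega] at h
    have e0 : ∀ z z', correlatorAux Z (1 - 1) (0 + 1) z (Fin.cons z' q) = C.B z z' :=
      fun z z' => correlatorAux_zero_one Z z _
    simp only [e0]
    refine (congrArg (HasEven _ (2 * N)) ?_).mpr h
    simp only [LocalData.genusSer, zero_lt_one, if_true, and_self]
    rw [Fintype.piFinset_of_isEmpty, Finset.univ_unique, Finset.sum_singleton]
    have e : PowerSeries.coeff 0 ((localData Z).phi a a 0) = phi Z a 0 a 0 := by
      have : PowerSeries.coeff 0 (phiSeries Z a a 0) = phi Z a 0 a 0 := by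
        simp [phiSeries]
      exact this
    have e2 : (PowerSeries.X : PowerSeries ℂ) ^ (2 * N) =
        PowerSeries.X ^ (2 * N - 1) * PowerSeries.X := by
      rw [← pow_succ]; congr 1; omega
    rw [e, xiProd, Finset.univ_eq_empty, Finset.prod_empty, e2, map_one]
    ring
  · have hst : 2 ≤ 2 * (g - 1) + (m + 1) := by omega
    have e : (fun t => pull₂ (Z.ζ a) (Z.ζ a)
        (fun z z' => correlatorAux Z (g - 1) (m + 1) z (Fin.cons z' q)) t (-t)) = fun t =>
        ∑ κ ∈ Fintype.piFinset fun _ => LocalData.indices C.ram N,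
        ∑ μ ∈ LocalData.indices C.ram N, ∑ μ' ∈ LocalData.indices C.ram N,
          ((localData Z).coef N (g - 1) (m + 1) μ (Fin.cons μ' κ) * xiProd Z κ q) *
            (pull (Z.ζ a) (xiIdx Z μ) t * pull (Z.ζ a) (xiIdx Z μ') (-t)) := by
      funext t
      simp only [pull₂, pull, hexp hst _ _, Finset.sum_mul]
      rw [sum_piFinset_cons, Finset.sum_comm]
      refine Finset.sum_congr rfl fun κ _ => ?_
      rw [Finset.sum_comm]
      refine Finset.sum_congr rfl fun μ _ => Finset.sum_congr rfl fun μ' _ => ?_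
      rw [xiProd, xiProd, Fin.prod_univ_succ]
      simp only [Fin.cons_zero, Fin.cons_succ]
      ring
    rw [e]
    refine HasEven.sum _ fun κ _ => ?_
    have e' : PowerSeries.C (xiProd Z κ q) * (localData Z).genusSer N a g m κ =
        ∑ μ ∈ LocalData.indices C.ram N, ∑ μ' ∈ LocalData.indices C.ram N,
          PowerSeries.C ((localData Z).coef N (g - 1) (m + 1) μ (Fin.cons μ' κ) * xiProd Z κ q) *
            ((localData Z).branch N a μ * (localData Z).branch N a μ') := by
      rw [LocalData.genusSer, if_pos hg, if_neg h1, Finset.mul_sum]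
      refine Finset.sum_congr rfl fun μ _ => ?_
      rw [Finset.mul_sum]
      exact Finset.sum_congr rfl fun μ' _ => by rw [map_mul]; ring
    rw [e']
    refine HasEven.sum _ fun μ _ => HasEven.sum _ fun μ' _ => ?_
    by_cases h0 : (localData Z).coef N (g - 1) (m + 1) μ (Fin.cons μ' κ) = 0
    · simp only [h0, zero_mul, map_zero]
      exact HasEven.zero _
    · have h3 := (localData Z).coef_support N _ _ _ rfl μ _ h0
      rw [Fin.sum_univ_succ] at h3
      simp only [Fin.cons_zero] at h3
      have := (evenExp_branch Z N a (μ := μ) (by omega)).mul_neg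
        (evenExp_branch Z N a (μ := μ') (by omega)) (by omega)
      rw [← two_mul] at this
      exact this.const_mul _

open Classical in
theorem hasEven_split {N g m : ℕ} (hN : 3 * g + m ≤ N)
    (hexp : ∀ g' m', 2 * g' + m' < 2 * g + m → 3 * g' + m' ≤ N → 2 ≤ 2 * g' + m' →
      HasExpansion Z N g' m') (a : C.ram)
    (q : Fin m → X) (hq : ∀ i, q i ∉ C.ram) (g₁ : Fin (g + 1)) (J : Finset (Fin m)) :
    HasEven (fun t => if (0 < (g₁ : ℕ) + J.card) ∧ (0 < (g - (g₁ : ℕ)) + Jᶜ.card) then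
        pull (Z.ζ a)
          (fun z => correlatorAux Z g₁ J.card z (fun i => q (J.orderEmbOfFin rfl i))) t *
        -pull (Z.ζ a)
          (fun z => correlatorAux Z (g - g₁) Jᶜ.card z (fun i => q (Jᶜ.orderEmbOfFin rfl i))) (-t)
      else 0) (2 * N)
      (-∑ κ ∈ Fintype.piFinset fun _ => LocalData.indices C.ram N,
        PowerSeries.C (xiProd Z κ q) * (localData Z).splitSer N a g m κ g₁ J) := by
  have hg := g₁.2
  have hJ := LocalData.splitting_card J
  unfold LocalData.splitSer
  by_cases h : (0 < (g₁ : ℕ) + J.card) ∧ (0 < (g - (g₁ : ℕ)) + Jᶜ.card)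
  swap
  · simp only [if_neg h, mul_zero, Finset.sum_const_zero, neg_zero]
    exact HasEven.zero _
  simp only [if_pos h]
  have h1 := evenExp_correlatorAux Z (N := N) (g := g₁) (m := J.card) (by omega) (by omega)
    (fun h' => hexp _ _ (by omega) (by omega) h') a (restrict J q) fun i => hq _
  have h2 := evenExp_correlatorAux Z (N := N) (g := g - g₁) (m := Jᶜ.card) (by omega) (by omega)
    (fun h' => hexp _ _ (by omega) (by omega) h') a (restrict Jᶜ q) fun i => hq _
  have h3 := (h1.mul_neg h2 (by omega)).const_mul (-1)
  rw [← two_mul] at h3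
  refine (congrArg (HasEven _ (2 * N)) ?_).mpr (h3.congr (Eventually.of_forall fun t => ?_))
  rotate_left
  · beta_reduce
    rw [mul_neg, ← neg_one_mul]
    rfl
  · rw [← sum_piFinset_restrict J (LocalData.indices C.ram N)
      (fun κ => PowerSeries.C (xiProd Z κ (restrict J q)) * (localData Z).ser N a g₁ J.card κ)
      (fun κ => PowerSeries.C (xiProd Z κ (restrict Jᶜ q)) *
        (localData Z).ser N a (g - g₁) Jᶜ.card κ), map_neg, map_one, neg_one_mul]
    congr 1
    refine Finset.sum_congr rfl fun κ _ => ?_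
    have : xiProd Z κ q = xiProd Z (restrict J κ) (restrict J q) *
        xiProd Z (restrict Jᶜ κ) (restrict Jᶜ q) :=
      (prod_restrict_mul J fun i => xiIdx Z (κ i) (q i)).symm
    rw [this, map_mul]
    ring

/-- By strong induction on `2g + m` the bracket is an explicit combination of products of forms `ξ`,
to which `residue_kernel_mul` applies. The sign from the pull-back along `σ_a` cancels the sign of
the kernel. A fixed `N` serves all `(g, m)` below it, so the coefficients at different stages are
compatible. -/
theorem hasExpansion (hreg : C.IsRegular) (N : ℕ) : ∀ (k g m : ℕ), 2 * g + m = k →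
    2 ≤ 2 * g + m → 3 * g + m ≤ N → HasExpansion Z N g m := by
  classical
  intro k
  induction k using Nat.strong_induction_on with
  | _ k ih =>
  intro g m hk hst hN p q
  rw [correlatorAux, if_neg (by omega), dif_neg (by omega)]
  by_cases hram : p ∈ C.ram ∨ ∃ i, q i ∈ C.ram
  · rw [if_pos hram]
    symm
    refine Finset.sum_eq_zero fun κ _ => Finset.sum_eq_zero fun μ _ => ?_
    rcases hram with hp | ⟨i, hi⟩
    · rw [xiIdx_of_mem Z μ hp, mul_zero]
    · have : xiProd Z κ q = 0 := Finset.prod_eq_zero (Finset.mem_univ i) (xiIdx_of_mem Z _ hi)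
      rw [this, mul_zero, zero_mul]
  rw [if_neg hram]
  rw [not_or, not_exists] at hram
  obtain ⟨hp, hq⟩ := hram
  have hexp : ∀ g' m', 2 * g' + m' < 2 * g + m → 3 * g' + m' ≤ N → 2 ≤ 2 * g' + m' →
      HasExpansion Z N g' m' := fun g' m' h1 h2 h3 => ih _ (by omega) _ _ rfl h3 h2
  set E : C.ram → (Fin m → C.ram × ℕ) → PowerSeries ℂ := fun a κ =>
    (localData Z).genusSer N a g m κ +
      ∑ g₁ : Fin (g + 1), ∑ J : Finset (Fin m), (localData Z).splitSer N a g m κ g₁ J with hE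
  have key : ∀ a : C.ram, residue (fun t => kernel Z a p t *
      ((if h : 0 < g then
        -pull₂ (Z.ζ a) (Z.ζ a)
          (fun z z' => correlatorAux Z (g - 1) (m + 1) z (Fin.cons z' q)) t (-t)
      else 0) +
    ∑ g₁ : Fin (g + 1), ∑ J : Finset (Fin m),
      if h : (0 < (g₁ : ℕ) + J.card) ∧ (0 < (g - (g₁ : ℕ)) + Jᶜ.card) then
        pull (Z.ζ a)
          (fun z => correlatorAux Z g₁ J.card z (fun i => q (J.orderEmbOfFin rfl i))) t *
        -pull (Z.ζ a)
          (fun z => correlatorAux Z (g - g₁) Jᶜ.card z (fun i => q (Jᶜ.orderEmbOfFin rfl i))) (-t)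
      else 0)) = ∑ i ∈ Finset.range (N + 1),
        ∑ κ ∈ Fintype.piFinset fun _ => LocalData.indices C.ram N,
          ((localData Z).coef N g m (a, i) κ * xiProd Z κ q) * xiIdx Z (a, i) p := by
    intro a
    have hF : HasEven (fun t => (if h : 0 < g then
        -pull₂ (Z.ζ a) (Z.ζ a)
          (fun z z' => correlatorAux Z (g - 1) (m + 1) z (Fin.cons z' q)) t (-t)
      else 0) +
    ∑ g₁ : Fin (g + 1), ∑ J : Finset (Fin m),
      if h : (0 < (g₁ : ℕ) + J.card) ∧ (0 < (g - (g₁ : ℕ)) + Jᶜ.card) then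
        pull (Z.ζ a)
          (fun z => correlatorAux Z g₁ J.card z (fun i => q (J.orderEmbOfFin rfl i))) t *
        -pull (Z.ζ a)
          (fun z => correlatorAux Z (g - g₁) Jᶜ.card z (fun i => q (Jᶜ.orderEmbOfFin rfl i))) (-t)
      else 0) (2 * N) (-∑ κ ∈ Fintype.piFinset fun _ => LocalData.indices C.ram N,
        PowerSeries.C (xiProd Z κ q) * E a κ) := by
      have hsum : (-∑ κ ∈ Fintype.piFinset fun _ => LocalData.indices C.ram N,
          PowerSeries.C (xiProd Z κ q) * E a κ) =
          (-∑ κ ∈ Fintype.piFinset fun _ => LocalData.indices C.ram N,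
            PowerSeries.C (xiProd Z κ q) * (localData Z).genusSer N a g m κ) +
          ∑ g₁ : Fin (g + 1), ∑ J : Finset (Fin m),
            (-∑ κ ∈ Fintype.piFinset fun _ => LocalData.indices C.ram N,
              PowerSeries.C (xiProd Z κ q) * (localData Z).splitSer N a g m κ g₁ J) := by
        simp only [hE, mul_add, Finset.sum_add_distrib, Finset.mul_sum, neg_add,
          Finset.sum_neg_distrib]
        congr 2
        rw [Finset.sum_comm]
        exact Finset.sum_congr rfl fun g₁ _ => Finset.sum_comm
      rw [hsum]
      refine HasEven.add ?_ (HasEven.sum _ fun g₁ _ => HasEven.sum _ fun J _ => ?_)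
      · by_cases hg : 0 < g
        · simp only [dif_pos hg]
          have h := (hasEven_genus Z hg hN
            (fun h => hexp (g - 1) (m + 1) (by omega) (by omega) h) a q).const_mul (-1)
          rw [map_neg, map_one, neg_one_mul] at h
          refine h.congr (Eventually.of_forall fun t => ?_)
          ring
        · simp only [dif_neg hg, LocalData.genusSer, if_neg hg, mul_zero, Finset.sum_const_zero,
            neg_zero]
          exact HasEven.zero _
      · simp only [dite_eq_ite]
        exact hasEven_split Z hN hexp a q hq g₁ J
    rw [residue_kernel_mul Z hreg a.2 hp hF, ← Finset.sum_neg_distrib]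
    -- The residue produces indices `i ≤ 2N`; those above `N` have zero coefficient by the degree
    -- bound.
    have hsub : Finset.range (N + 1) ⊆ Finset.range (2 * N + 1) := by
      intro i hi
      rw [Finset.mem_range] at hi ⊢
      omega
    rw [Finset.sum_subset hsub]
    · refine Finset.sum_congr rfl fun i hi => ?_
      rw [Finset.mem_range] at hi
      rw [mul_neg, map_neg, mul_neg, mul_neg, neg_neg, Finset.mul_sum, map_sum, Finset.mul_sum,
        Finset.mul_sum]
      refine Finset.sum_congr rfl fun κ _ => ?_
      rw [(localData Z).coef_eq N hst (a, i) (by dsimp only; omega), show ∀ c : ℂ, ∀ f e : PowerSeries ℂ, f * (PowerSeries.C c * e) =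
        PowerSeries.C c * (f * e) from fun _ _ _ => mul_left_comm _ _ _, PowerSeries.coeff_C_mul]
      simp only [hE, xiIdx, localData]
      ring
    · intro i _ hi
      rw [Finset.mem_range] at hi
      refine Finset.sum_eq_zero fun κ _ => ?_
      by_cases h0 : (localData Z).coef N g m (a, i) κ = 0
      · rw [h0, zero_mul, zero_mul]
      · have := (localData Z).coef_support N _ g m rfl _ κ h0
        dsimp only at this
        omega
  rw [← Finset.sum_coe_sort C.ram, Finset.sum_congr rfl fun a _ => key a, Finset.sum_comm (s := Fintype.piFinset _)]
  rw [LocalData.indices, Finset.sum_product]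

end SpectralCurve

/-! ### From bounds on the coefficients to bounds on the periods -/

/-- The number of index tuples of total order at most `D`. -/
theorem card_indices_le {ι : Type*} [Fintype ι] [DecidableEq ι] (N n : ℕ) : ∀ D : ℕ,
    ∑ κ ∈ Fintype.piFinset fun _ : Fin n => LocalData.indices ι N,
      (if ∑ i, (κ i).2 ≤ D then 1 else 0) ≤ Fintype.card ι ^ n * (D + n).choose n := by
  induction n with
  | zero => intro D; simp
  | succ n ih =>
    intro D
    rw [sum_piFinset_cons, LocalData.indices, Finset.sum_product]
    simp only [Fin.sum_univ_succ, Fin.cons_zero, Fin.cons_succ]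
    have h1 : ∀ j, ∑ κ ∈ Fintype.piFinset fun _ : Fin n => LocalData.indices ι N,
        (if j + ∑ i, (κ i).2 ≤ D then 1 else 0) ≤
        if j ∈ Finset.range (D + 1) then Fintype.card ι ^ n * (D - j + n).choose n else 0 := by
      intro j
      split_ifs with hj
      · rw [Finset.mem_range] at hj
        refine le_trans (le_of_eq ?_) (ih (D - j))
        refine Finset.sum_congr rfl fun κ _ => ?_
        congr 1
        rw [eq_iff_iff]
        omega
      · rw [Finset.mem_range] at hj
        refine (Finset.sum_eq_zero fun κ _ => ?_).le
        rw [if_neg (by omega)]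
    refine (Finset.sum_le_sum fun a _ => Finset.sum_le_sum fun j _ => h1 j).trans ?_
    rw [Finset.sum_const, Finset.card_univ, smul_eq_mul, pow_succ', mul_assoc]
    refine Nat.mul_le_mul_left _ ?_
    rw [← Finset.sum_filter]
    refine (Finset.sum_le_sum_of_subset
      (fun j hj => (Finset.mem_filter.1 hj).2 : _ ⊆ Finset.range (D + 1))).trans ?_
    rw [← Finset.mul_sum]
    refine Nat.mul_le_mul_left _ (le_of_eq ?_)
    rw [show D + (n + 1) = D + n + 1 by ring, ← Nat.sum_range_add_choose D n,
      ← Finset.sum_range_reflect]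
    refine Finset.sum_congr rfl fun j hj => ?_
    rw [Finset.mem_range] at hj
    rw [show D - (D + 1 - 1 - j) = j by omega]

namespace SpectralCurve

variable {X : Type u} [TopologicalSpace X] [T2Space X] [ChartedSpace ℂ X] [IsManifold 𝓘(ℂ) ω X]
variable {C : SpectralCurve X} (Z : C.LocalCoordinates)

/-- `ξ^{(a,i)} / (2i+1)!!` as an element of `H⁰(X, K(*𝔞))`. -/
def xiForm (μ : C.ram × ℕ) : C.forms := ⟨xiIdx Z μ, xiNorm_mem_forms Z μ.1.2 μ.2⟩

open Classical in
theorem correlator_eq (hreg : C.IsRegular) {g m : ℕ} (hgm : 2 ≤ 2 * g + m) :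
    correlator Z g (m + 1) = fun z =>
      ∑ κ ∈ Fintype.piFinset fun _ : Fin (m + 1) => LocalData.indices C.ram (3 * g + m),
        (localData Z).coef (3 * g + m) g m (κ 0) (Fin.tail κ) *
          ∏ i, (xiForm Z (κ i) : X → ℂ) (z i) := by
  funext z
  rw [correlator, hasExpansion Z hreg (3 * g + m) _ g m rfl hgm le_rfl, sum_piFinset_cons,
    Finset.sum_comm]
  refine Finset.sum_congr rfl fun μ _ => Finset.sum_congr rfl fun κ _ => ?_
  rw [Fin.prod_univ_succ]
  simp only [Fin.cons_zero, Fin.cons_succ, Fin.tail_cons, xiForm, xiProd, Fin.tail]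
  ring

theorem correlator_mem_tensorPower (hreg : C.IsRegular) {g m : ℕ} (hgm : 2 ≤ 2 * g + m) :
    correlator Z g (m + 1) ∈ C.tensorPower (m + 1) := by
  classical
  rw [correlator_eq Z hreg hgm]
  have : (fun z : Fin (m + 1) → X =>
      ∑ κ ∈ Fintype.piFinset fun _ : Fin (m + 1) => LocalData.indices C.ram (3 * g + m),
        (localData Z).coef (3 * g + m) g m (κ 0) (Fin.tail κ) *
          ∏ i, (xiForm Z (κ i) : X → ℂ) (z i)) =
      ∑ κ ∈ Fintype.piFinset fun _ : Fin (m + 1) => LocalData.indices C.ram (3 * g + m),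
        (localData Z).coef (3 * g + m) g m (κ 0) (Fin.tail κ) •
          fun z : Fin (m + 1) → X => ∏ i, (xiForm Z (κ i) : X → ℂ) (z i) := by
    funext z
    rw [Finset.sum_apply]
    rfl
  rw [this]
  exact Submodule.sum_mem _ fun κ _ => Submodule.smul_mem _ _
    (Submodule.subset_span ⟨fun i => xiForm Z (κ i), rfl⟩)

/-- The double factorial is exactly the normalisation of `ξ̂`. Any `V ≤ v` is admitted, and this
freedom is what is optimised at the end. -/
theorem norm_apply_xiForm_le {I : Module.Dual ℂ C.forms} {N v V : ℝ}
    (hI : IsBoundedWith Z I N v) (hV : 0 < V) (hVv : V ≤ v) (μ : C.ram × ℕ) :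
    ‖I (xiForm Z μ)‖ ≤ N / V ^ μ.2 := by
  obtain ⟨hN, hv, h⟩ := hI
  have hd : (0 : ℝ) < ((2 * μ.2 + 1)‼ : ℕ) := by
    exact_mod_cast Nat.doubleFactorial_pos _
  have h1 := h μ.1 μ.1.2 μ.2 (((2 * μ.2 + 1)‼ : ℂ) • xiForm Z μ) (by
    rw [xi_eq Z μ.1.2]; rfl)
  rw [map_smul, norm_smul, Complex.norm_natCast] at h1
  have h2 : ‖I (xiForm Z μ)‖ ≤ N / v ^ μ.2 := by
    refine le_of_mul_le_mul_left (h1.trans_eq ?_) hd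
    ring
  refine h2.trans ?_
  gcongr

/-- The powers of `V` in the coefficients cancel against those from the linear forms, so every
nonzero term has the same bound. What remains is the number of index tuples of degree at most `3g +
m - 2`. -/
theorem norm_period_correlator_le (hreg : C.IsRegular) {g m : ℕ} (hgm : 2 ≤ 2 * g + m)
    {I : Fin (m + 1) → Module.Dual ℂ C.forms} {N v : Fin (m + 1) → ℝ} {V A : ℝ} (hA : 0 ≤ A)
    (hI : ∀ i, IsBoundedWith Z (I i) (N i) (v i)) (hV : 0 < V) (hVv : ∀ i, V ≤ v i)
    (hcoef : ∀ (lam : C.ram × ℕ) (κ : Fin m → C.ram × ℕ),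
      ‖(letI := Classical.decEq X; (localData Z).coef (3 * g + m) g m lam κ)‖ ≤
        A * V ^ (lam.2 + ∑ i, (κ i).2)) :
    ‖C.period (m + 1) I (correlator Z g (m + 1))‖ ≤
      A * (∏ i, (C.ram.card : ℝ) * N i) * ((3 * g + 2 * m - 1).choose (m + 1) : ℝ) := by
  classical
  have hN : ∀ i, 0 < N i := fun i => (hI i).1
  have hP : 0 ≤ ∏ i, N i := Finset.prod_nonneg fun i _ => (hN i).le
  rw [correlator_eq Z hreg hgm]
  have hp := C.period_sum_prod
    (Fintype.piFinset fun _ : Fin (m + 1) => LocalData.indices C.ram (3 * g + m)) (m + 1) I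
    (fun κ => (localData Z).coef (3 * g + m) g m (κ 0) (Fin.tail κ)) fun κ i => xiForm Z (κ i)
  rw [hp]
  refine (norm_sum_le _ _).trans ?_
  have hterm : ∀ κ : Fin (m + 1) → C.ram × ℕ,
      ‖(localData Z).coef (3 * g + m) g m (κ 0) (Fin.tail κ) * ∏ i, I i (xiForm Z (κ i))‖ ≤
      (A * ∏ i, N i) * ((if ∑ i, (κ i).2 ≤ 3 * g + m - 2 then 1 else 0 : ℕ) : ℝ) := by
    intro κ
    by_cases h0 : (localData Z).coef (3 * g + m) g m (κ 0) (Fin.tail κ) = 0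
    · rw [h0, zero_mul, norm_zero]
      positivity
    · have hs := (localData Z).coef_support _ _ g m rfl _ _ h0
      have hs' : ∑ i, (κ i).2 = (κ 0).2 + ∑ i, (Fin.tail κ i).2 := Fin.sum_univ_succ _
      rw [if_pos (by omega), Nat.cast_one, mul_one, norm_mul, norm_prod]
      have h1 : ∏ i, ‖I i (xiForm Z (κ i))‖ ≤ ∏ i, (N i / V ^ (κ i).2) :=
        Finset.prod_le_prod (fun i _ => norm_nonneg _)
          fun i _ => norm_apply_xiForm_le Z (hI i) hV (hVv i) (κ i)
      have h2 : ‖(localData Z).coef (3 * g + m) g m (κ 0) (Fin.tail κ)‖ ≤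
          A * V ^ (∑ i, (κ i).2) := by
        have := hcoef (κ 0) (Fin.tail κ)
        rw [hs']
        convert this using 2
      calc _ ≤ (A * V ^ (∑ i, (κ i).2)) * ∏ i, (N i / V ^ (κ i).2) :=
            mul_le_mul h2 h1 (Finset.prod_nonneg fun i _ => norm_nonneg _) (by positivity)
        _ = A * ∏ i, N i := by
            rw [Finset.prod_div_distrib, Finset.prod_pow_eq_pow_sum]
            have : V ^ (∑ i, (κ i).2) ≠ 0 := (pow_pos hV _).ne'
            field_simp
  refine (Finset.sum_le_sum fun κ _ => hterm κ).trans ?_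
  rw [← Finset.mul_sum, ← Nat.cast_sum]
  have hcard := card_indices_le (ι := C.ram) (3 * g + m) (m + 1) (3 * g + m - 2)
  rw [show 3 * g + m - 2 + (m + 1) = 3 * g + 2 * m - 1 by omega, Fintype.card_coe] at hcard
  have hcard' := (Nat.cast_le (α := ℝ)).2 hcard
  rw [Nat.cast_mul, Nat.cast_pow] at hcard'
  rw [Finset.prod_mul_distrib, Finset.prod_const, Finset.card_univ, Fintype.card_fin]
  calc _ ≤ (A * ∏ i, N i) * ((C.ram.card : ℝ) ^ (m + 1) *
        ((3 * g + 2 * m - 1).choose (m + 1) : ℝ)) := by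
        exact mul_le_mul_of_nonneg_left hcard' (by positivity)
    _ = _ := by ring

end SpectralCurve

/-! ### Elementary sums -/

theorem sum_pow_le_of_le {ν : ℝ} (h0 : 0 ≤ ν) (h1 : ν < 1) (i n : ℕ) :
    ∑ s ∈ Finset.range n, (if i ≤ s then ν ^ s else 0) ≤ ν ^ i / (1 - ν) := by
  rw [← Finset.sum_filter]
  have : (Finset.range n).filter (fun s => i ≤ s) = Finset.Ico i n := by
    ext s
    simp only [Finset.mem_filter, Finset.mem_range, Finset.mem_Ico]
    tauto
  rw [this]
  exact geom_sum_Ico_le_of_lt_one h0 h1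

theorem sum_succ_mul_pow_le {ν : ℝ} (h0 : 0 ≤ ν) (h1 : ν < 1) (n : ℕ) :
    ∑ z ∈ Finset.range n, ((z : ℝ) + 1) * ν ^ z ≤ 1 / (1 - ν) ^ 2 := by
  have h : ∀ n : ℕ, (1 - ν) ^ 2 * ∑ z ∈ Finset.range n, ((z : ℝ) + 1) * ν ^ z =
      1 - ((n : ℝ) * (1 - ν) + 1) * ν ^ n := by
    intro n
    induction n with
    | zero => simp
    | succ n ih => rw [Finset.sum_range_succ, mul_add, ih]; push_cast; ring
  have h2 : (0 : ℝ) < 1 - ν := by linarith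
  rw [le_div_iff₀ (by positivity), mul_comm, h n]
  have : 0 ≤ ((n : ℝ) * (1 - ν) + 1) * ν ^ n := by positivity
  linarith

/-! ### Weighted partial sums of power series -/

/-- The sum of the `ρ ^ k |F_k|` with `k ≤ n`. -/
def wt (ρ : ℝ) (n : ℕ) (F : PowerSeries ℂ) : ℝ :=
  ∑ k ∈ Finset.range (n + 1), ρ ^ k * ‖PowerSeries.coeff k F‖

section Wt

variable {ρ : ℝ} (hρ : 0 < ρ) (n : ℕ)

include hρ in
theorem wt_nonneg (F : PowerSeries ℂ) : 0 ≤ wt ρ n F :=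
  Finset.sum_nonneg fun k _ => mul_nonneg (pow_pos hρ k).le (norm_nonneg _)

include hρ in
theorem wt_add_le (F G : PowerSeries ℂ) : wt ρ n (F + G) ≤ wt ρ n F + wt ρ n G := by
  unfold wt
  rw [← Finset.sum_add_distrib]
  refine Finset.sum_le_sum fun k _ => ?_
  rw [← mul_add, map_add]
  exact mul_le_mul_of_nonneg_left (norm_add_le _ _) (pow_pos hρ k).le

theorem wt_zero : wt ρ n 0 = 0 := by simp [wt]

include hρ in
theorem wt_sum_le {ι : Type*} (s : Finset ι) (F : ι → PowerSeries ℂ) :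
    wt ρ n (∑ i ∈ s, F i) ≤ ∑ i ∈ s, wt ρ n (F i) := by
  classical
  induction s using Finset.induction_on with
  | empty => simp [wt_zero]
  | insert a s ha ih =>
    rw [Finset.sum_insert ha, Finset.sum_insert ha]
    exact (wt_add_le hρ n _ _).trans (by linarith)

theorem wt_C_mul (c : ℂ) (F : PowerSeries ℂ) : wt ρ n (PowerSeries.C c * F) = ‖c‖ * wt ρ n F := by
  unfold wt
  rw [Finset.mul_sum]
  refine Finset.sum_congr rfl fun k _ => ?_
  rw [PowerSeries.coeff_C_mul, norm_mul]
  ring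

theorem wt_X_pow_mul (j : ℕ) (F : PowerSeries ℂ) :
    wt ρ n (PowerSeries.X ^ j * F) = if j ≤ n then ρ ^ j * wt ρ (n - j) F else 0 := by
  unfold wt
  split_ifs with h
  · obtain ⟨k, rfl⟩ := Nat.exists_eq_add_of_le h
    rw [show j + k + 1 = j + (k + 1) by ring, Finset.sum_range_add, Finset.sum_eq_zero, zero_add,
      Finset.mul_sum, Nat.add_sub_cancel_left]
    · refine Finset.sum_congr rfl fun i _ => ?_
      rw [PowerSeries.coeff_X_pow_mul', if_pos (by omega), Nat.add_sub_cancel_left, pow_add]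
      ring
    · intro i hi
      rw [Finset.mem_range] at hi
      rw [PowerSeries.coeff_X_pow_mul', if_neg (by omega), norm_zero, mul_zero]
  · refine Finset.sum_eq_zero fun i hi => ?_
    rw [Finset.mem_range] at hi
    rw [PowerSeries.coeff_X_pow_mul', if_neg (by omega), norm_zero, mul_zero]

theorem wt_X_pow_le (j : ℕ) :
    wt ρ n (PowerSeries.X ^ j) ≤ if j ≤ n then ρ ^ j else 0 := by
  have := wt_X_pow_mul (ρ := ρ) n j 1
  rw [mul_one] at this
  rw [this]
  have h1 : ∀ n, wt ρ n 1 = 1 := by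
    intro n
    rw [wt, Finset.sum_range_succ', Finset.sum_eq_zero]
    · simp
    · intro k _
      rw [PowerSeries.coeff_one, if_neg (by omega), norm_zero, mul_zero]
  rw [h1, mul_one]

include hρ in
theorem wt_le_of_coeff_le {F : PowerSeries ℂ} {c : ℝ}
    (h : ∀ k, ‖PowerSeries.coeff k F‖ ≤ c / ρ ^ k) : wt ρ n F ≤ ((n : ℝ) + 1) * c := by
  have : ∀ k ∈ Finset.range (n + 1), ρ ^ k * ‖PowerSeries.coeff k F‖ ≤ c := by
    intro k _
    have := (le_div_iff₀ (pow_pos hρ k)).1 (h k)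
    linarith
  refine (Finset.sum_le_sum this).trans ?_
  simp

include hρ in
-- The weight `ρ ^ k` is the one for which the geometric bound on `θ` factors out of the
-- convolution.
theorem norm_coeff_mul_le {θ F : PowerSeries ℂ} {M : ℝ}
    (h : ∀ k, ‖PowerSeries.coeff k θ‖ ≤ M / ρ ^ (k + 1)) :
    ‖PowerSeries.coeff n (θ * F)‖ ≤ M / ρ / ρ ^ n * wt ρ n F := by
  rw [PowerSeries.coeff_mul, wt, Finset.mul_sum, Finset.Nat.sum_antidiagonal_eq_sum_range_succ_mk,
    ← Finset.sum_range_reflect]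
  refine (norm_sum_le _ _).trans (Finset.sum_le_sum fun k hk => ?_)
  rw [Finset.mem_range] at hk
  have e : n - (n + 1 - 1 - k) = k := by omega
  obtain ⟨j, rfl⟩ : ∃ j, n = k + j := ⟨n - k, by omega⟩
  dsimp only
  rw [norm_mul, e, show k + j + 1 - 1 - k = j by omega]
  calc _ ≤ M / ρ ^ (j + 1) * ‖PowerSeries.coeff k F‖ :=
        mul_le_mul_of_nonneg_right (h j) (norm_nonneg _)
    _ = _ := by
      have := (pow_pos hρ k).ne'
      have := (pow_pos hρ j).ne'
      rw [pow_add, pow_succ]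
      field_simp
      ring

end Wt

/-! ### Weighted bounds for products of two forms `ξ` -/

namespace LocalData

variable {ι : Type*} [Fintype ι] [DecidableEq ι] (L : LocalData ι) (N : ℕ)

/-- The bounds on the expansion coefficients of a bounded spectral curve. -/
structure Bounds (Mθ Mφ ρ : ℝ) : Prop where
  Mθ_pos : 0 < Mθ
  Mφ_nonneg : 0 ≤ Mφ
  ρ_pos : 0 < ρ
  theta_le : ∀ a k, ‖PowerSeries.coeff k (L.theta a)‖ ≤ Mθ / ρ ^ (k + 1)
  phi_le : ∀ a b j k, ‖PowerSeries.coeff k (L.phi a b j)‖ ≤ Mφ / ρ ^ j / (2 * j + 1) / ρ ^ k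

variable {L} {Mθ Mφ ρ : ℝ} (hL : L.Bounds Mθ Mφ ρ)

include hL in
theorem Bounds.wt_phi_le (n : ℕ) (a b : ι) (j : ℕ) :
    wt ρ n (L.phi a b j) ≤ ((n : ℝ) + 1) * (Mφ / ρ ^ j / (2 * j + 1)) :=
  wt_le_of_coeff_le hL.ρ_pos n (hL.phi_le a b j)

/-- The contribution of a pair of forms `ξ` to the recursion. -/
def pairBound (Mφ ρ : ℝ) (i : ℕ) (a : ι) (μ μ' : ι × ℕ) : ℝ :=
  (if a = μ.1 ∧ a = μ'.1 then if i ≤ μ.2 + μ'.2 + 2 then (ρ ^ (μ.2 + μ'.2 + 2))⁻¹ else 0 else 0) +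
  (if a = μ.1 then if i ≤ μ.2 + 1 then ((μ.2 + 1 - i : ℕ) + 1 : ℝ) / ρ ^ (μ.2 + 1) else 0 else 0) *
    (Mφ / ρ ^ μ'.2 / (2 * μ'.2 + 1)) +
  (if a = μ'.1 then if i ≤ μ'.2 + 1 then ((μ'.2 + 1 - i : ℕ) + 1 : ℝ) / ρ ^ (μ'.2 + 1) else 0
    else 0) * (Mφ / ρ ^ μ.2 / (2 * μ.2 + 1)) +
  if i = 0 then (Mφ / ρ ^ μ.2 / (2 * μ.2 + 1)) * (Mφ / ρ ^ μ'.2 / (2 * μ'.2 + 1)) else 0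

include hL in
-- Each factor is a pole plus a regular part, which gives four products. Pole times pole is one
-- monomial; in the mixed products the weighted sum counts the surviving coefficients of `φ`; the
-- product of regular parts starts at `X ^ (2N)` and is visible only for `i = 0`.
theorem Bounds.wt_branch_mul_branch_le {i : ℕ} (hi : i ≤ 2 * N) (a : ι) {μ μ' : ι × ℕ}
    (hμ : μ.2 + 2 ≤ N) (hμ' : μ'.2 + 2 ≤ N) :
    wt ρ (2 * N - i) (L.branch N a μ * L.branch N a μ') ≤
      ρ ^ (2 * N) * pairBound Mφ ρ i a μ μ' := by
  have hρ := hL.ρ_pos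
  have hc : ∀ j : ℕ, 0 ≤ Mφ / ρ ^ j / (2 * (j : ℝ) + 1) := fun j => by
    have := hL.Mφ_nonneg
    positivity
  have e : L.branch N a μ * L.branch N a μ' =
      (if a = μ.1 ∧ a = μ'.1 then PowerSeries.X ^ ((N - 1 - μ.2) + (N - 1 - μ'.2)) else 0) +
      (if a = μ.1 then PowerSeries.X ^ ((N - 1 - μ.2) + N) * L.phi a μ'.1 μ'.2 else 0) +
      (if a = μ'.1 then PowerSeries.X ^ ((N - 1 - μ'.2) + N) * L.phi a μ.1 μ.2 else 0) +
      PowerSeries.X ^ (2 * N) * (L.phi a μ.1 μ.2 * L.phi a μ'.1 μ'.2) := by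
    rw [branch, branch, two_mul N]
    simp only [pow_add]
    by_cases h1 : a = μ.1
    · by_cases h2 : a = μ'.1
      · simp only [if_pos h1, if_pos h2, if_pos (And.intro h1 h2)]; ring
      · simp only [if_pos h1, if_neg h2, if_neg fun h : a = μ.1 ∧ a = μ'.1 => h2 h.2]; ring
    · by_cases h2 : a = μ'.1
      · simp only [if_neg h1, if_pos h2, if_neg fun h : a = μ.1 ∧ a = μ'.1 => h1 h.1]; ring
      · simp only [if_neg h1, if_neg h2, if_neg fun h : a = μ.1 ∧ a = μ'.1 => h1 h.1]; ring
  have hcross : ∀ ν ν' : ι × ℕ, ν.2 + 2 ≤ N → wt ρ (2 * N - i)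
      (if a = ν.1 then PowerSeries.X ^ ((N - 1 - ν.2) + N) * L.phi a ν'.1 ν'.2 else 0) ≤
      ρ ^ (2 * N) * ((if a = ν.1 then if i ≤ ν.2 + 1 then
        ((ν.2 + 1 - i : ℕ) + 1 : ℝ) / ρ ^ (ν.2 + 1) else 0 else 0) *
        (Mφ / ρ ^ ν'.2 / (2 * ν'.2 + 1))) := by
    intro ν ν' hν
    by_cases h1 : a = ν.1
    swap
    · simp [if_neg h1, wt_zero]
    rw [if_pos h1, if_pos h1, wt_X_pow_mul]
    by_cases h2 : i ≤ ν.2 + 1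
    · rw [if_pos (by omega), if_pos h2, show 2 * N - i - (N - 1 - ν.2 + N) = ν.2 + 1 - i by omega]
      have h3 : ρ ^ (N - 1 - ν.2 + N) = ρ ^ (2 * N) / ρ ^ (ν.2 + 1) := by
        rw [eq_div_iff (pow_pos hρ _).ne', ← pow_add]; congr 1; omega
      rw [h3]
      calc _ ≤ ρ ^ (2 * N) / ρ ^ (ν.2 + 1) * ((((ν.2 + 1 - i : ℕ) : ℝ) + 1) *
            (Mφ / ρ ^ ν'.2 / (2 * ν'.2 + 1))) :=
            mul_le_mul_of_nonneg_left (hL.wt_phi_le _ _ _ _) (by positivity)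
        _ = _ := by ring
    · rw [if_neg (by omega), if_neg h2]
      simp
  rw [e]
  refine (wt_add_le hρ _ _ _).trans ?_
  refine (add_le_add ((wt_add_le hρ _ _ _).trans
    (add_le_add (wt_add_le hρ _ _ _) le_rfl)) le_rfl).trans ?_
  rw [pairBound, mul_add, mul_add, mul_add]
  refine add_le_add (add_le_add (add_le_add ?_ (hcross μ μ' hμ)) (hcross μ' μ hμ')) ?_
  · by_cases h1 : a = μ.1 ∧ a = μ'.1
    swap
    · simp only [if_neg h1, wt_zero, mul_zero, le_refl]
    rw [if_pos h1, if_pos h1]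
    refine (wt_X_pow_le _ _).trans ?_
    by_cases h2 : i ≤ μ.2 + μ'.2 + 2
    · rw [if_pos (by omega), if_pos h2, ← div_eq_mul_inv, le_div_iff₀ (pow_pos hρ _), ← pow_add]
      refine le_of_eq ?_
      congr 1
      omega
    · rw [if_neg (by omega), if_neg h2, mul_zero]
  · rw [wt_X_pow_mul]
    by_cases h1 : i = 0
    · rw [if_pos (by omega), if_pos h1, show 2 * N - i - 2 * N = 0 by omega]
      refine mul_le_mul_of_nonneg_left ?_ (by positivity)
      rw [wt, zero_add, Finset.sum_range_one, pow_zero, one_mul, PowerSeries.coeff_zero_eq_constantCoeff, map_mul,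
        norm_mul, ← PowerSeries.coeff_zero_eq_constantCoeff]
      have h2 := hL.phi_le a μ.1 μ.2 0
      have h3 := hL.phi_le a μ'.1 μ'.2 0
      rw [pow_zero, div_one] at h2 h3
      exact mul_le_mul h2 h3 (norm_nonneg _) (hc _)
    · rw [if_neg (by omega), if_neg h1, mul_zero]

end LocalData

/-- Group the pairs by `s = l + l'`. Counting only the pairs allowed by the degree bound, at most
`cnt` for each `s`, is what later brings in `min` and the linear factor in the genus term. -/
theorem sum_range_mul_range_le {n : ℕ} {F : ℕ → ℕ → ℝ} {G : ℕ → ℝ} (R : ℕ → ℕ → Prop)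
    [∀ l l', Decidable (R l l')] (cnt : ℝ)
    (hR : ∀ s, (((Finset.HasAntidiagonal.antidiagonal s).filter fun p => R p.1 p.2).card : ℝ) ≤ cnt)
    (hG : ∀ s, 0 ≤ G s)
    (hF : ∀ l l', F l l' = if R l l' then G (l + l') else 0) :
    ∑ l ∈ Finset.range n, ∑ l' ∈ Finset.range n, F l l' ≤
      cnt * ∑ s ∈ Finset.range (2 * n), G s := by
  rw [← Finset.sum_product', Finset.mul_sum, ← Finset.sum_fiberwise_of_maps_to
    (t := Finset.range (2 * n)) (g := fun p : ℕ × ℕ => p.1 + p.2)]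
  · refine Finset.sum_le_sum fun s _ => ?_
    calc _ ≤ ∑ p ∈ (Finset.HasAntidiagonal.antidiagonal s).filter fun p => R p.1 p.2, G s := by
          rw [Finset.sum_filter]
          simp only [hF]
          rw [← Finset.sum_filter, ← Finset.sum_filter, Finset.filter_filter]
          refine le_trans (le_of_eq (Finset.sum_congr rfl fun p hp => ?_))
            (Finset.sum_le_sum_of_subset_of_nonneg
              (s := ((Finset.range n ×ˢ Finset.range n).filter fun p =>
                p.1 + p.2 = s ∧ R p.1 p.2)) ?_ fun _ _ _ => hG _)
          · rw [(Finset.mem_filter.1 hp).2.1]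
          · intro p hp
            rw [Finset.mem_filter] at hp ⊢
            exact ⟨Finset.HasAntidiagonal.mem_antidiagonal.2 hp.2.1, hp.2.2⟩
      _ = (((Finset.HasAntidiagonal.antidiagonal s).filter fun p => R p.1 p.2).card : ℝ) * G s := by
          rw [Finset.sum_const, nsmul_eq_mul]
      _ ≤ cnt * G s := mul_le_mul_of_nonneg_right (hR s) (hG s)
  · intro p hp
    simp only [Finset.mem_product, Finset.mem_range] at hp ⊢
    omega

namespace LocalData

variable {ι : Type*} [Fintype ι] [DecidableEq ι] {L : LocalData ι} (N : ℕ)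
variable {Mθ Mφ ρ : ℝ} (hL : L.Bounds Mθ Mφ ρ)

theorem sum_indices_eq_le (a : ι) {F : ℕ → ℝ} :
    ∑ μ ∈ indices ι N, (if a = μ.1 then F μ.2 else 0) = ∑ l ∈ Finset.range (N + 1), F l := by
  rw [indices, Finset.sum_product, Finset.sum_eq_single a]
  · simp
  · intro b _ hb
    simp [hb.symm]
  · simp

include hL in
theorem Bounds.sum_phi_le {v K : ℝ}
    (hK : ∀ n, ∑ l ∈ Finset.range n, (v / ρ) ^ l / (2 * l + 1) ≤ K) :
    ∑ μ ∈ indices ι N, v ^ μ.2 * (Mφ / ρ ^ μ.2 / (2 * μ.2 + 1)) ≤ Fintype.card ι * Mφ * K := by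
  rw [indices, Finset.sum_product]
  have h1 : ∀ a : ι, ∑ l ∈ Finset.range (N + 1), v ^ l * (Mφ / ρ ^ l / (2 * l + 1)) ≤ Mφ * K := by
    intro _
    refine le_trans (le_of_eq ?_) (mul_le_mul_of_nonneg_left (hK (N + 1)) hL.Mφ_nonneg)
    rw [Finset.mul_sum]
    refine Finset.sum_congr rfl fun l _ => ?_
    rw [div_pow]
    ring
  refine (Finset.sum_le_sum fun a _ => h1 a).trans ?_
  rw [Finset.sum_const, Finset.card_univ, nsmul_eq_mul, mul_assoc]

/-- In the variable `z = l + 1 - i` this is a partial sum of `∑ (z + 1) ν ^ z = (1 - ν)⁻²`. -/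
theorem sum_cross_le (hρ : 0 < ρ) {v : ℝ} (hv : 0 < v) (hνlt : v / ρ < 1) (i n : ℕ) :
    ∑ l ∈ Finset.range n, v ^ l *
      (if i ≤ l + 1 then ((l + 1 - i : ℕ) + 1 : ℝ) / ρ ^ (l + 1) else 0) ≤
      (v / ρ) ^ i / v / (1 - v / ρ) ^ 2 := by
  set ν := v / ρ with hν
  have hν0 : 0 < ν := div_pos hv hρ
  have h1 : ∀ l, v ^ l * (if i ≤ l + 1 then ((l + 1 - i : ℕ) + 1 : ℝ) / ρ ^ (l + 1) else 0) =
      ν ^ i / v * (if i ≤ l + 1 then ((l + 1 - i : ℕ) + 1 : ℝ) * ν ^ (l + 1 - i) else 0) := by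
    intro l
    split_ifs with h
    · have e : ν ^ i * ν ^ (l + 1 - i) = ν ^ (l + 1) := by rw [← pow_add]; congr 1; omega
      have e2 : v ^ l / ρ ^ (l + 1) = ν ^ (l + 1) / v := by
        rw [hν, div_pow, pow_succ v]
        field_simp
      calc _ = (((l + 1 - i : ℕ) : ℝ) + 1) * (v ^ l / ρ ^ (l + 1)) := by ring
        _ = (((l + 1 - i : ℕ) : ℝ) + 1) * (ν ^ i * ν ^ (l + 1 - i) / v) := by rw [e2, e]
        _ = _ := by ring
    · simp
  simp only [h1]
  rw [← Finset.mul_sum, div_eq_mul_inv (ν ^ i / v)]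
  refine mul_le_mul_of_nonneg_left ?_ (by positivity)
  rw [← one_div]
  refine le_trans ?_ (sum_succ_mul_pow_le hν0.le hνlt (n + 1))
  rw [← Finset.sum_filter]
  have hinj : Set.InjOn (fun l => l + 1 - i)
      ((Finset.range n).filter (fun l => i ≤ l + 1) : Set ℕ) := by
    intro x hx y hy h
    simp only [Finset.coe_filter, Finset.mem_range, Set.mem_ofPred_eq] at hx hy
    dsimp only at h
    omega
  rw [← Finset.sum_image (f := fun z : ℕ => ((z : ℝ) + 1) * ν ^ z) hinj]
  refine Finset.sum_le_sum_of_subset_of_nonneg ?_ fun z _ _ => by positivity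
  intro z hz
  simp only [Finset.mem_image, Finset.mem_filter, Finset.mem_range] at hz ⊢
  omega

/-- The bound on the sum over all pairs of forms `ξ`. -/
def pairSum (r f K ν cnt : ℝ) : ℝ :=
  cnt / (1 - ν) + 2 * (r * f * K * ν / (1 - ν) ^ 2) + (r * f * K * ν) ^ 2

include hL in
-- The pole–pole term depends only on `l + l'`, and there the restriction `R` enters through `cnt`.
-- The other terms are products of a function of `μ` and one of `μ'`; for them `R` is dropped by
-- positivity and the double sum factors.
theorem Bounds.sum_pairBound_le {v K : ℝ} (hv : 0 < v) (hνlt : v / ρ < 1)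
    (hK : ∀ n, ∑ l ∈ Finset.range n, (v / ρ) ^ l / (2 * l + 1) ≤ K)
    (R : ℕ → ℕ → Prop) [∀ l l', Decidable (R l l')] (cnt : ℝ)
    (hR : ∀ s, (((Finset.HasAntidiagonal.antidiagonal s).filter fun p => R p.1 p.2).card : ℝ) ≤ cnt)
    (i : ℕ) (a : ι) :
    ∑ μ ∈ indices ι N, ∑ μ' ∈ indices ι N,
      (if R μ.2 μ'.2 then v ^ (μ.2 + μ'.2) * pairBound Mφ ρ i a μ μ' else 0) ≤
    (v / ρ) ^ i / v ^ 2 * pairSum (Fintype.card ι) (ρ * Mφ) K (v / ρ) cnt := by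
  have hρ := hL.ρ_pos
  have hMφ := hL.Mφ_nonneg
  have hcnt : 0 ≤ cnt := le_trans (by positivity) (hR 0)
  have hK0 : 0 ≤ K := by simpa using hK 0
  have hν0 : 0 < v / ρ := div_pos hv hρ
  have hν1 : 0 < 1 - v / ρ := by linarith
  set Xf : ι × ℕ → ℝ := fun μ => v ^ μ.2 * (if a = μ.1 then
    if i ≤ μ.2 + 1 then ((μ.2 + 1 - i : ℕ) + 1 : ℝ) / ρ ^ (μ.2 + 1) else 0 else 0) with hX
  set Yf : ι × ℕ → ℝ := fun μ => v ^ μ.2 * (Mφ / ρ ^ μ.2 / (2 * μ.2 + 1)) with hY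
  have hX0 : ∀ μ, 0 ≤ Xf μ := by
    intro μ
    simp only [hX]
    split_ifs <;> positivity
  have hY0 : ∀ μ, 0 ≤ Yf μ := by
    intro μ
    simp only [hY]
    positivity
  have hXs : ∑ μ ∈ indices ι N, Xf μ ≤ (v / ρ) ^ i / v / (1 - v / ρ) ^ 2 := by
    have e : ∀ μ : ι × ℕ, Xf μ = if a = μ.1 then (fun l => v ^ l *
        (if i ≤ l + 1 then ((l + 1 - i : ℕ) + 1 : ℝ) / ρ ^ (l + 1) else 0)) μ.2 else 0 := by
      intro μ
      simp only [hX]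
      split_ifs <;> simp
    refine (Finset.sum_congr rfl fun μ _ => e μ).trans_le ((sum_indices_eq_le N a (F := fun l =>
      v ^ l * (if i ≤ l + 1 then ((l + 1 - i : ℕ) + 1 : ℝ) / ρ ^ (l + 1) else 0))).trans_le ?_)
    exact sum_cross_le hρ hv hνlt i (N + 1)
  have hYs : ∑ μ ∈ indices ι N, Yf μ ≤ Fintype.card ι * Mφ * K := hL.sum_phi_le N hK
  have hterm : ∀ μ μ' : ι × ℕ,
      (if R μ.2 μ'.2 then v ^ (μ.2 + μ'.2) * pairBound Mφ ρ i a μ μ' else 0) ≤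
      (if a = μ.1 then if a = μ'.1 then (if R μ.2 μ'.2 then
        (if i ≤ μ.2 + μ'.2 + 2 then v ^ (μ.2 + μ'.2) * (ρ ^ (μ.2 + μ'.2 + 2))⁻¹ else 0) else 0)
        else 0 else 0) +
      Xf μ * Yf μ' + Yf μ * Xf μ' + (if i = 0 then Yf μ * Yf μ' else 0) := by
    intro μ μ'
    have h1 := mul_nonneg (hX0 μ) (hY0 μ')
    have h2 := mul_nonneg (hY0 μ) (hX0 μ')
    have h3 := mul_nonneg (hY0 μ) (hY0 μ')
    by_cases hRR : R μ.2 μ'.2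
    · refine le_of_eq ?_
      have e1 : v ^ (μ.2 + μ'.2) * (if a = μ.1 ∧ a = μ'.1 then
          if i ≤ μ.2 + μ'.2 + 2 then (ρ ^ (μ.2 + μ'.2 + 2))⁻¹ else 0 else 0) =
          if a = μ.1 then if a = μ'.1 then if i ≤ μ.2 + μ'.2 + 2 then
            v ^ (μ.2 + μ'.2) * (ρ ^ (μ.2 + μ'.2 + 2))⁻¹ else 0 else 0 else 0 := by
        rw [ite_and, mul_ite, mul_ite, mul_ite, mul_zero]
      have e2 : v ^ (μ.2 + μ'.2) * (if i = 0 then (Mφ / ρ ^ μ.2 / (2 * μ.2 + 1)) *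
          (Mφ / ρ ^ μ'.2 / (2 * μ'.2 + 1)) else 0) = if i = 0 then Yf μ * Yf μ' else 0 := by
        rw [mul_ite, mul_zero, pow_add]
        congr 1
        simp only [hY]
        ring
      simp only [if_pos hRR]
      rw [pairBound, mul_add, mul_add, mul_add, e1, e2, pow_add]
      simp only [hX, hY]
      ring
    · rw [if_neg hRR]
      simp only [if_neg hRR, ite_self, zero_add]
      have h4 : 0 ≤ (if i = 0 then Yf μ * Yf μ' else 0) := by split_ifs <;> linarith
      linarith
  refine (Finset.sum_le_sum fun μ _ => Finset.sum_le_sum fun μ' _ => hterm μ μ').trans ?_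
  simp only [Finset.sum_add_distrib]
  have s1 : ∑ μ ∈ indices ι N, ∑ μ' ∈ indices ι N, (if a = μ.1 then if a = μ'.1 then
      (if R μ.2 μ'.2 then (if i ≤ μ.2 + μ'.2 + 2 then
        v ^ (μ.2 + μ'.2) * (ρ ^ (μ.2 + μ'.2 + 2))⁻¹ else 0) else 0) else 0 else 0) ≤
      (v / ρ) ^ i / v ^ 2 * (cnt / (1 - v / ρ)) := by
    have e : ∀ μ : ι × ℕ, (∑ μ' ∈ indices ι N, (if a = μ.1 then if a = μ'.1 then
      (if R μ.2 μ'.2 then (if i ≤ μ.2 + μ'.2 + 2 then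
        v ^ (μ.2 + μ'.2) * (ρ ^ (μ.2 + μ'.2 + 2))⁻¹ else 0) else 0) else 0 else 0)) =
        if a = μ.1 then (fun l => ∑ l' ∈ Finset.range (N + 1), (if R l l' then
          (if i ≤ l + l' + 2 then v ^ (l + l') * (ρ ^ (l + l' + 2))⁻¹ else 0) else 0)) μ.2
        else 0 := by
      intro μ
      by_cases h : a = μ.1
      · simp only [if_pos h]
        exact sum_indices_eq_le N a (F := fun l' => (if R μ.2 l' then (if i ≤ μ.2 + l' + 2 then
          v ^ (μ.2 + l') * (ρ ^ (μ.2 + l' + 2))⁻¹ else 0) else 0))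
      · simp only [if_neg h, Finset.sum_const_zero]
    refine (Finset.sum_congr rfl fun μ _ => e μ).trans_le ((sum_indices_eq_le N a (F := fun l =>
      ∑ l' ∈ Finset.range (N + 1), (if R l l' then
        (if i ≤ l + l' + 2 then v ^ (l + l') * (ρ ^ (l + l' + 2))⁻¹ else 0) else 0))).trans_le ?_)
    refine (sum_range_mul_range_le R cnt hR
      (G := fun s => if i ≤ s + 2 then v ^ s * (ρ ^ (s + 2))⁻¹ else 0)
      (fun s => by split_ifs <;> positivity) (fun _ _ => rfl)).trans ?_
    have e2 : ∀ s : ℕ, (if i ≤ s + 2 then v ^ s * (ρ ^ (s + 2))⁻¹ else 0) =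
        (v ^ 2)⁻¹ * (if i ≤ s + 2 then (v / ρ) ^ (s + 2) else 0) := by
      intro s
      split_ifs
      · rw [div_pow, pow_add v]
        field_simp
      · simp
    simp only [e2]
    rw [← Finset.mul_sum]
    have h3 : ∑ s ∈ Finset.range (2 * (N + 1)), (if i ≤ s + 2 then (v / ρ) ^ (s + 2) else 0) ≤
        (v / ρ) ^ i / (1 - v / ρ) := by
      refine le_trans ?_ (sum_pow_le_of_le hν0.le hνlt i (2 + 2 * (N + 1)))
      rw [Finset.sum_range_add]
      have h4 : 0 ≤ ∑ s ∈ Finset.range 2, (if i ≤ s then (v / ρ) ^ s else 0) :=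
        Finset.sum_nonneg fun s _ => by split_ifs <;> positivity
      have h5 : ∀ s, (if i ≤ s + 2 then (v / ρ) ^ (s + 2) else 0) =
          (if i ≤ 2 + s then (v / ρ) ^ (2 + s) else 0) := fun s => by rw [add_comm s 2]
      simp only [h5]
      linarith
    calc _ ≤ cnt * ((v ^ 2)⁻¹ * ((v / ρ) ^ i / (1 - v / ρ))) := by gcongr
      _ = _ := by ring
  have s2 : ∑ μ ∈ indices ι N, ∑ μ' ∈ indices ι N, Xf μ * Yf μ' ≤
      (v / ρ) ^ i / v ^ 2 * (Fintype.card ι * (ρ * Mφ) * K * (v / ρ) / (1 - v / ρ) ^ 2) := by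
    rw [← Finset.sum_mul_sum]
    calc _ ≤ ((v / ρ) ^ i / v / (1 - v / ρ) ^ 2) * (Fintype.card ι * Mφ * K) :=
          mul_le_mul hXs hYs (Finset.sum_nonneg fun μ _ => hY0 μ) (by positivity)
      _ = _ := by field_simp
  have s3 : ∑ μ ∈ indices ι N, ∑ μ' ∈ indices ι N, Yf μ * Xf μ' ≤
      (v / ρ) ^ i / v ^ 2 * (Fintype.card ι * (ρ * Mφ) * K * (v / ρ) / (1 - v / ρ) ^ 2) := by
    rw [Finset.sum_comm]
    refine le_trans (le_of_eq ?_) s2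
    exact Finset.sum_congr rfl fun μ _ => Finset.sum_congr rfl fun μ' _ => mul_comm _ _
  have s4 : ∑ μ ∈ indices ι N, ∑ μ' ∈ indices ι N, (if i = 0 then Yf μ * Yf μ' else 0) ≤
      (v / ρ) ^ i / v ^ 2 * (Fintype.card ι * (ρ * Mφ) * K * (v / ρ)) ^ 2 := by
    by_cases h : i = 0
    · simp only [if_pos h]
      rw [← Finset.sum_mul_sum, h]
      have hYn : 0 ≤ ∑ μ ∈ indices ι N, Yf μ := Finset.sum_nonneg fun μ _ => hY0 μ
      calc _ ≤ (Fintype.card ι * Mφ * K) * (Fintype.card ι * Mφ * K) :=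
            mul_le_mul hYs hYs hYn (by positivity)
        _ = _ := by field_simp
    · simp only [if_neg h, Finset.sum_const_zero]
      positivity
  rw [pairSum]
  linarith

end LocalData

namespace LocalData

variable {ι : Type*} [Fintype ι] [DecidableEq ι] {L : LocalData ι} (N : ℕ)
variable {Mθ Mφ ρ : ℝ} (hL : L.Bounds Mθ Mφ ρ)

include hL in
theorem Bounds.wt_pair_le {v K : ℝ} (hv : 0 < v) (hνlt : v / ρ < 1)
    (hK : ∀ n, ∑ l ∈ Finset.range n, (v / ρ) ^ l / (2 * l + 1) ≤ K)
    (R : ℕ → ℕ → Prop) [∀ l l', Decidable (R l l')] {cnt H : ℝ} (hH : 0 ≤ H)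
    (hR : ∀ s, (((Finset.HasAntidiagonal.antidiagonal s).filter fun p => R p.1 p.2).card : ℝ) ≤ cnt)
    {h : ι × ℕ → ι × ℕ → ℂ}
    (hh : ∀ μ μ', h μ μ' ≠ 0 → R μ.2 μ'.2 ∧ μ.2 + 2 ≤ N ∧ μ'.2 + 2 ≤ N)
    (hb : ∀ μ μ', ‖h μ μ'‖ ≤ H * v ^ (μ.2 + μ'.2))
    {i : ℕ} (hi : i ≤ 2 * N) (a : ι) :
    wt ρ (2 * N - i) (∑ μ ∈ indices ι N, ∑ μ' ∈ indices ι N,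
      PowerSeries.C (h μ μ') * (L.branch N a μ * L.branch N a μ')) ≤
    ρ ^ (2 * N) * (v / ρ) ^ i * (H / v ^ 2 *
      pairSum (Fintype.card ι) (ρ * Mφ) K (v / ρ) cnt) := by
  have hρ := hL.ρ_pos
  have h1 : ∀ μ μ', wt ρ (2 * N - i) (PowerSeries.C (h μ μ') * (L.branch N a μ * L.branch N a μ')) ≤
      ρ ^ (2 * N) * H * (if R μ.2 μ'.2 then v ^ (μ.2 + μ'.2) * pairBound Mφ ρ i a μ μ' else 0) := by
    intro μ μ'
    rw [wt_C_mul]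
    by_cases h0 : h μ μ' = 0
    · rw [h0, norm_zero, zero_mul]
      have : 0 ≤ pairBound Mφ ρ i a μ μ' := by
        have := hL.Mφ_nonneg
        unfold pairBound
        have e1 : ∀ (P : Prop) [Decidable P] (x : ℝ), 0 ≤ x → 0 ≤ if P then x else 0 := by
          intro P _ x hx
          split_ifs
          · exact hx
          · exact le_rfl
        refine add_nonneg (add_nonneg (add_nonneg ?_ (mul_nonneg ?_ (by positivity)))
          (mul_nonneg ?_ (by positivity))) (e1 _ _ (by positivity)) <;>
        exact e1 _ _ (e1 _ _ (by positivity))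
      refine mul_nonneg (by positivity) ?_
      split_ifs
      · positivity
      · exact le_rfl
    · obtain ⟨h2, h3, h4⟩ := hh μ μ' h0
      rw [if_pos h2]
      calc _ ≤ (H * v ^ (μ.2 + μ'.2)) * (ρ ^ (2 * N) * pairBound Mφ ρ i a μ μ') :=
            mul_le_mul (hb μ μ') (hL.wt_branch_mul_branch_le N hi a h3 h4) (wt_nonneg hρ _ _)
              (by positivity)
        _ = _ := by ring
  refine (wt_sum_le hρ _ _ _).trans ((Finset.sum_le_sum fun μ _ => (wt_sum_le hρ _ _ _).trans
    (Finset.sum_le_sum fun μ' _ => h1 μ μ')).trans ?_)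
  simp only [← Finset.mul_sum]
  refine (mul_le_mul_of_nonneg_left (hL.sum_pairBound_le N hv hνlt hK R cnt hR i a)
    (by positivity)).trans_eq ?_
  ring

include hL in
-- The factor `ω_{0,2}` is the single monomial `(2j+1) X ^ (N+j)`. Against poles it leaves a
-- geometric tail; against regular parts it is seen only for `i = j = 0`, so that the `φ` term
-- carries no factor `2j + 1`.
theorem Bounds.wt_dual_le {v K : ℝ} (hv : 0 < v) (hνlt : v / ρ < 1)
    (hK : ∀ n, ∑ l ∈ Finset.range n, (v / ρ) ^ l / (2 * l + 1) ≤ K)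
    {H : ℝ} (hH : 0 ≤ H) {h : ι × ℕ → ℂ}
    (hh : ∀ μ, h μ ≠ 0 → μ.2 + 2 ≤ N) (hb : ∀ μ, ‖h μ‖ ≤ H * v ^ μ.2)
    {i : ℕ} (hi : i ≤ 2 * N) (a : ι) (c : ι × ℕ) :
    wt ρ (2 * N - i) ((if c.1 = a then
        PowerSeries.C (2 * c.2 + 1 : ℂ) * PowerSeries.X ^ (N + c.2) else 0) *
      ∑ μ ∈ indices ι N, PowerSeries.C (h μ) * L.branch N a μ) ≤
    ρ ^ (2 * N) * (v / ρ) ^ i * (H * v ^ c.2 / v * ((2 * c.2 + 1) / (1 - v / ρ) +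
      Fintype.card ι * (ρ * Mφ) * K * (v / ρ))) := by
  have hρ := hL.ρ_pos
  have hMφ := hL.Mφ_nonneg
  have hK0 : 0 ≤ K := by simpa using hK 0
  have hν0 : 0 < v / ρ := div_pos hv hρ
  have hν1 : 0 < 1 - v / ρ := by linarith
  set j := c.2 with hj
  by_cases hc : c.1 = a
  swap
  · rw [if_neg hc, zero_mul, wt_zero]
    positivity
  rw [if_pos hc, mul_assoc, wt_C_mul, Finset.mul_sum]
  have e0 : ‖(2 * (j : ℂ) + 1)‖ = 2 * j + 1 := by
    have : (2 * (j : ℂ) + 1) = ((2 * j + 1 : ℕ) : ℂ) := by push_cast; ring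
    rw [this, Complex.norm_natCast]; push_cast; ring
  rw [e0]
  have h1 : ∀ μ, wt ρ (2 * N - i) (PowerSeries.X ^ (N + j) *
      (PowerSeries.C (h μ) * L.branch N a μ)) ≤ ρ ^ (2 * N) * H *
      ((if a = μ.1 then (fun l => v ^ l * (if i + j ≤ l + 1 then ρ ^ j / ρ ^ (l + 1) else 0)) μ.2
        else 0) +
        (if j = 0 ∧ i = 0 then v ^ μ.2 * (Mφ / ρ ^ μ.2 / (2 * μ.2 + 1)) else 0)) := by
    intro μ
    rw [mul_left_comm, wt_C_mul]
    have e1 : ∀ (P : Prop) [Decidable P] (x : ℝ), 0 ≤ x → 0 ≤ if P then x else 0 := by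
      intro P _ x hx
      split_ifs
      · exact hx
      · exact le_rfl
    by_cases h0 : h μ = 0
    · rw [h0, norm_zero, zero_mul]
      refine mul_nonneg (by positivity) (add_nonneg (e1 _ _ ?_) (e1 _ _ (by positivity)))
      exact mul_nonneg (by positivity) (e1 _ _ (by positivity))
    have h3 := hh μ h0
    have e : PowerSeries.X ^ (N + j) * L.branch N a μ =
        (if a = μ.1 then PowerSeries.X ^ (N + j + (N - 1 - μ.2)) else 0) +
        PowerSeries.X ^ (2 * N + j) * L.phi a μ.1 μ.2 := by
      rw [branch, mul_add, mul_ite, mul_zero, ← pow_add, ← mul_assoc, ← pow_add,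
        show N + j + N = 2 * N + j by ring]
    have h4 : wt ρ (2 * N - i) (if a = μ.1 then PowerSeries.X ^ (N + j + (N - 1 - μ.2)) else 0) ≤
        ρ ^ (2 * N) * (if a = μ.1 then if i + j ≤ μ.2 + 1 then ρ ^ j / ρ ^ (μ.2 + 1) else 0
          else 0) := by
      by_cases h5 : a = μ.1
      swap
      · simp only [if_neg h5, wt_zero, mul_zero, le_refl]
      rw [if_pos h5, if_pos h5]
      refine (wt_X_pow_le _ _).trans ?_
      by_cases h6 : i + j ≤ μ.2 + 1
      · rw [if_pos (by omega), if_pos h6, ← mul_div_assoc, le_div_iff₀ (pow_pos hρ _), ← pow_add,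
          ← pow_add]
        refine le_of_eq ?_
        congr 1
        omega
      · rw [if_neg (by omega), if_neg h6, mul_zero]
    have h5 : wt ρ (2 * N - i) (PowerSeries.X ^ (2 * N + j) * L.phi a μ.1 μ.2) ≤
        ρ ^ (2 * N) * (if j = 0 ∧ i = 0 then Mφ / ρ ^ μ.2 / (2 * μ.2 + 1) else 0) := by
      rw [wt_X_pow_mul]
      by_cases h6 : j = 0 ∧ i = 0
      · rw [if_pos (by omega), if_pos h6, h6.1, h6.2]
        refine mul_le_mul_of_nonneg_left ?_ (by positivity)
        have := hL.wt_phi_le (2 * N - 0 - (2 * N + 0)) a μ.1 μ.2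
        simpa using this
      · rw [if_neg (by omega), if_neg h6, mul_zero]
    rw [e]
    calc _ ≤ (H * v ^ μ.2) * (ρ ^ (2 * N) * (if a = μ.1 then
          if i + j ≤ μ.2 + 1 then ρ ^ j / ρ ^ (μ.2 + 1) else 0 else 0) +
          ρ ^ (2 * N) * (if j = 0 ∧ i = 0 then Mφ / ρ ^ μ.2 / (2 * μ.2 + 1) else 0)) :=
          mul_le_mul (hb μ) ((wt_add_le hρ _ _ _).trans (add_le_add h4 h5)) (wt_nonneg hρ _ _)
            (by positivity)
      _ = _ := by
        rw [← mul_add, show H * v ^ μ.2 * (ρ ^ (2 * N) * ((if a = μ.1 then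
          if i + j ≤ μ.2 + 1 then ρ ^ j / ρ ^ (μ.2 + 1) else 0 else 0) +
          (if j = 0 ∧ i = 0 then Mφ / ρ ^ μ.2 / (2 * μ.2 + 1) else 0))) = ρ ^ (2 * N) * H *
          (v ^ μ.2 * (if a = μ.1 then
          if i + j ≤ μ.2 + 1 then ρ ^ j / ρ ^ (μ.2 + 1) else 0 else 0) +
          v ^ μ.2 * (if j = 0 ∧ i = 0 then Mφ / ρ ^ μ.2 / (2 * μ.2 + 1) else 0)) by ring]
        rw [mul_ite (a = μ.1), mul_zero, mul_ite (j = 0 ∧ i = 0), mul_zero]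
  have s1 : ∑ μ ∈ indices ι N, (if a = μ.1 then
      (fun l => v ^ l * (if i + j ≤ l + 1 then ρ ^ j / ρ ^ (l + 1) else 0)) μ.2 else 0) ≤
      (v / ρ) ^ i * v ^ j / v / (1 - v / ρ) := by
    refine (sum_indices_eq_le N a (F := fun l =>
      v ^ l * (if i + j ≤ l + 1 then ρ ^ j / ρ ^ (l + 1) else 0))).trans_le ?_
    have e2 : ∀ l : ℕ, v ^ l * (if i + j ≤ l + 1 then ρ ^ j / ρ ^ (l + 1) else 0) =
        ρ ^ j / v * (if i + j ≤ l + 1 then (v / ρ) ^ (l + 1) else 0) := by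
      intro l
      split_ifs
      · rw [div_pow, pow_succ v]
        field_simp
      · simp
    simp only [e2]
    rw [← Finset.mul_sum]
    have h3 : ∑ l ∈ Finset.range (N + 1), (if i + j ≤ l + 1 then (v / ρ) ^ (l + 1) else 0) ≤
        (v / ρ) ^ (i + j) / (1 - v / ρ) := by
      refine le_trans ?_ (sum_pow_le_of_le hν0.le hνlt (i + j) (N + 1 + 1))
      rw [Finset.sum_range_succ' _ (N + 1)]
      have : (0 : ℝ) ≤ if i + j ≤ 0 then (v / ρ) ^ 0 else 0 := by split_ifs <;> simp
      linarith
    calc _ ≤ ρ ^ j / v * ((v / ρ) ^ (i + j) / (1 - v / ρ)) := by gcongr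
      _ = _ := by
        rw [pow_add, div_pow v ρ j]
        field_simp
  have s2 : (2 * (j : ℝ) + 1) * ∑ μ ∈ indices ι N, (if j = 0 ∧ i = 0 then
      v ^ μ.2 * (Mφ / ρ ^ μ.2 / (2 * μ.2 + 1)) else 0) ≤
      (v / ρ) ^ i * v ^ j / v * (Fintype.card ι * (ρ * Mφ) * K * (v / ρ)) := by
    by_cases h6 : j = 0 ∧ i = 0
    · simp only [if_pos h6]
      rw [h6.1, h6.2]
      have := hL.sum_phi_le N hK
      calc _ = ∑ μ ∈ indices ι N, v ^ μ.2 * (Mφ / ρ ^ μ.2 / (2 * μ.2 + 1)) := by simp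
        _ ≤ _ := this
        _ = _ := by field_simp
    · simp only [if_neg h6, Finset.sum_const_zero, mul_zero]
      positivity
  have s3 : wt ρ (2 * N - i) (∑ μ ∈ indices ι N, PowerSeries.X ^ (N + j) *
      (PowerSeries.C (h μ) * L.branch N a μ)) ≤ ρ ^ (2 * N) * H *
      (∑ μ ∈ indices ι N, (if a = μ.1 then
      (fun l => v ^ l * (if i + j ≤ l + 1 then ρ ^ j / ρ ^ (l + 1) else 0)) μ.2 else 0) +
      ∑ μ ∈ indices ι N, (if j = 0 ∧ i = 0 then
      v ^ μ.2 * (Mφ / ρ ^ μ.2 / (2 * μ.2 + 1)) else 0)) := by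
    rw [← Finset.sum_add_distrib, Finset.mul_sum]
    exact (wt_sum_le hρ _ _ _).trans (Finset.sum_le_sum fun μ _ => h1 μ)
  have hj0 : (0 : ℝ) ≤ 2 * j + 1 := by positivity
  have hH' : 0 ≤ ρ ^ (2 * N) * H := by positivity
  calc _ ≤ (2 * (j : ℝ) + 1) * (ρ ^ (2 * N) * H *
      (∑ μ ∈ indices ι N, (if a = μ.1 then
      (fun l => v ^ l * (if i + j ≤ l + 1 then ρ ^ j / ρ ^ (l + 1) else 0)) μ.2 else 0) +
      ∑ μ ∈ indices ι N, (if j = 0 ∧ i = 0 then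
      v ^ μ.2 * (Mφ / ρ ^ μ.2 / (2 * μ.2 + 1)) else 0))) := mul_le_mul_of_nonneg_left s3 hj0
    _ = ρ ^ (2 * N) * H * ((2 * (j : ℝ) + 1) *
      (∑ μ ∈ indices ι N, (if a = μ.1 then
      (fun l => v ^ l * (if i + j ≤ l + 1 then ρ ^ j / ρ ^ (l + 1) else 0)) μ.2 else 0)) +
      (2 * (j : ℝ) + 1) * ∑ μ ∈ indices ι N, (if j = 0 ∧ i = 0 then
      v ^ μ.2 * (Mφ / ρ ^ μ.2 / (2 * μ.2 + 1)) else 0)) := by ring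
    _ ≤ ρ ^ (2 * N) * H * ((2 * (j : ℝ) + 1) * ((v / ρ) ^ i * v ^ j / v / (1 - v / ρ)) +
      (v / ρ) ^ i * v ^ j / v * (Fintype.card ι * (ρ * Mφ) * K * (v / ρ))) :=
      mul_le_mul_of_nonneg_left (add_le_add (mul_le_mul_of_nonneg_left s1 hj0) s2) hH'
    _ = _ := by ring

end LocalData

theorem card_filter_antidiagonal_le {R : ℕ → ℕ → Prop} [∀ l l', Decidable (R l l')] {c : ℕ}
    (h : ∀ l l', R l l' → l < c) (s : ℕ) :
    ((Finset.HasAntidiagonal.antidiagonal s).filter fun p => R p.1 p.2).card ≤ c := by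
  rw [← Finset.card_range c]
  refine Finset.card_le_card_of_injOn Prod.fst (fun p hp => ?_) (fun p hp q hq hpq => ?_)
  · simp only [Finset.coe_filter, Set.mem_ofPred_eq] at hp
    simpa using h _ _ hp.2
  · simp only [Finset.coe_filter, Set.mem_ofPred_eq, Finset.HasAntidiagonal.mem_antidiagonal] at hp hq
    refine Prod.ext hpq ?_
    omega

theorem card_filter_antidiagonal_le' {R : ℕ → ℕ → Prop} [∀ l l', Decidable (R l l')] {c : ℕ}
    (h : ∀ l l', R l l' → l' < c) (s : ℕ) :
    ((Finset.HasAntidiagonal.antidiagonal s).filter fun p => R p.1 p.2).card ≤ c := by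
  rw [← Finset.card_range c]
  refine Finset.card_le_card_of_injOn Prod.snd (fun p hp => ?_) (fun p hp q hq hpq => ?_)
  · simp only [Finset.coe_filter, Set.mem_ofPred_eq] at hp
    simpa using h _ _ hp.2
  · simp only [Finset.coe_filter, Set.mem_ofPred_eq, Finset.HasAntidiagonal.mem_antidiagonal] at hp hq
    refine Prod.ext ?_ hpq
    omega

theorem sum_finset_card_eq_one {M : Type*} [AddCommMonoid M] {m : ℕ} (δ : Fin m → M) :
    ∑ J : Finset (Fin m), (if J.card = 1 then ∑ k ∈ J, δ k else 0) = ∑ k, δ k := by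
  rw [← Finset.sum_filter]
  have : (Finset.univ.filter fun J : Finset (Fin m) => J.card = 1) =
      Finset.univ.map ⟨singleton, Finset.singleton_injective⟩ := by
    ext J
    simp only [Finset.mem_filter, Finset.mem_univ, true_and, Finset.mem_map,
      Function.Embedding.coeFn_mk, Finset.card_eq_one]
    exact exists_congr fun a => eq_comm
  rw [this, Finset.sum_map]
  simp

theorem sum_finset_card {M : Type*} [AddCommMonoid M] {m : ℕ} (F : ℕ → M) :
    ∑ J : Finset (Fin m), F J.card = ∑ k ∈ Finset.range (m + 1), m.choose k • F k := by
  have := Finset.sum_powerset_apply_card F (x := (Finset.univ : Finset (Fin m)))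
  simpa using this

/-! ### The recursion as an inequality between numbers -/

namespace LocalData

variable {ι : Type*} [Fintype ι] [DecidableEq ι] {L : LocalData ι} (N : ℕ)
variable {Mθ Mφ ρ : ℝ} (hL : L.Bounds Mθ Mφ ρ)

/-- The coefficients of the correlators satisfy the bound `|coef| ≤ A v ^ d`. -/
def CoefBound (L : LocalData ι) (N : ℕ) (v : ℝ) (A : ℕ → ℕ → ℝ) (g m : ℕ) : Prop :=
  ∀ (μ : ι × ℕ) (κ : Fin m → ι × ℕ),
    ‖L.coef N g m μ κ‖ ≤ A g m * v ^ (μ.2 + ∑ i, (κ i).2)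

variable {v K : ℝ} (hv : 0 < v) (hνlt : v / ρ < 1)
  (hK : ∀ n, ∑ l ∈ Finset.range n, (v / ρ) ^ l / (2 * l + 1) ≤ K) {A : ℕ → ℕ → ℝ}
  (hA : ∀ g m, 0 ≤ A g m)

include hL hv hνlt hK hA in
theorem Bounds.wt_genusSer_le {g m : ℕ} (hg : 0 < g) (h10 : ¬ (m = 0 ∧ g = 1))
    (hN : 3 * g + m ≤ N) (hb : CoefBound L N v A (g - 1) (m + 1)) {i : ℕ} (hi : i ≤ 2 * N) (a : ι)
    (κ : Fin m → ι × ℕ) :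
    wt ρ (2 * N - i) (L.genusSer N a g m κ) ≤ ρ ^ (2 * N) * (v / ρ) ^ i * v ^ (∑ k, (κ k).2) *
      if ∑ k, (κ k).2 + 4 ≤ 3 * g + m then A (g - 1) (m + 1) / v ^ 2 *
        pairSum (Fintype.card ι) (ρ * Mφ) K (v / ρ) ((3 * g + m - 3 - ∑ k, (κ k).2 : ℕ) : ℝ)
      else 0 := by
  have hρ := hL.ρ_pos
  rw [genusSer, if_pos hg, if_neg h10]
  set e := ∑ k, (κ k).2 with he
  have hsupp : ∀ μ μ' : ι × ℕ, L.coef N (g - 1) (m + 1) μ (Fin.cons μ' κ) ≠ 0 →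
      μ.2 + μ'.2 + e + 4 ≤ 3 * g + m := by
    intro μ μ' h0
    have h := L.coef_support N _ _ _ rfl μ _ h0
    rw [Fin.sum_univ_succ] at h
    simp only [Fin.cons_zero, Fin.cons_succ, ← he] at h
    omega
  split_ifs with hcond
  -- Whatever the sum `l + l'`, the index `l` takes at most `3g + m - 3 - e` values.
  · have := hL.wt_pair_le N hv hνlt hK (R := fun l l' => l + l' + e + 4 ≤ 3 * g + m)
      (cnt := ((3 * g + m - 3 - e : ℕ) : ℝ)) (H := A (g - 1) (m + 1) * v ^ e)
      (mul_nonneg (hA _ _) (by positivity))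
      (fun s => by
        exact_mod_cast card_filter_antidiagonal_le
          (R := fun l l' => l + l' + e + 4 ≤ 3 * g + m) (fun l l' h => by omega) s)
      (h := fun μ μ' => L.coef N (g - 1) (m + 1) μ (Fin.cons μ' κ))
      (fun μ μ' h0 => by
        have := hsupp μ μ' h0
        exact ⟨by omega, by omega, by omega⟩)
      (fun μ μ' => by
        have := hb μ (Fin.cons μ' κ)
        rw [Fin.sum_univ_succ] at this
        simp only [Fin.cons_zero, Fin.cons_succ, ← he] at this
        refine this.trans_eq ?_
        rw [pow_add, pow_add, pow_add]
        ring) hi a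
    refine this.trans_eq ?_
    ring
  · rw [mul_zero]
    refine le_of_eq ?_
    rw [Finset.sum_eq_zero, wt_zero]
    intro μ _
    refine Finset.sum_eq_zero fun μ' _ => ?_
    by_cases h0 : L.coef N (g - 1) (m + 1) μ (Fin.cons μ' κ) = 0
    · rw [h0, map_zero, zero_mul]
    · have := hsupp μ μ' h0
      omega

include hL hv hνlt hK hA in
-- The degree bound limits each of the two indices separately; for a given sum the number of pairs
-- is at most the shorter of the two ranges, hence the `min`.
theorem Bounds.wt_ser_mul_ser_le {g g' m m' : ℕ} (h01 : ¬ (g = 0 ∧ m = 1))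
    (h01' : ¬ (g' = 0 ∧ m' = 1)) (hN : 3 * g + m ≤ N) (hN' : 3 * g' + m' ≤ N)
    (hb : CoefBound L N v A g m) (hb' : CoefBound L N v A g' m') {i : ℕ} (hi : i ≤ 2 * N) (a : ι)
    (κ : Fin m → ι × ℕ) (κ' : Fin m' → ι × ℕ) :
    wt ρ (2 * N - i) (L.ser N a g m κ * L.ser N a g' m' κ') ≤ ρ ^ (2 * N) * (v / ρ) ^ i *
      v ^ (∑ k, (κ k).2 + ∑ k, (κ' k).2) *
      if ∑ k, (κ k).2 + ∑ k, (κ' k).2 + 4 ≤ 3 * g + m + (3 * g' + m') then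
        A g m * A g' m' / v ^ 2 * pairSum (Fintype.card ι) (ρ * Mφ) K (v / ρ)
          ((min (3 * g + m) (3 * g' + m') - 1 : ℕ) : ℝ)
      else 0 := by
  have hρ := hL.ρ_pos
  rw [ser, dif_neg h01, ser, dif_neg h01', Finset.sum_mul_sum]
  set e := ∑ k, (κ k).2 with he
  set e' := ∑ k, (κ' k).2 with he'
  have hrw : ∀ μ μ' : ι × ℕ, PowerSeries.C (L.coef N g m μ κ) * L.branch N a μ *
      (PowerSeries.C (L.coef N g' m' μ' κ') * L.branch N a μ') =
      PowerSeries.C (L.coef N g m μ κ * L.coef N g' m' μ' κ') *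
        (L.branch N a μ * L.branch N a μ') := by
    intro μ μ'
    rw [map_mul]
    ring
  simp only [hrw]
  have hsupp : ∀ μ μ' : ι × ℕ, L.coef N g m μ κ * L.coef N g' m' μ' κ' ≠ 0 →
      μ.2 + e + 2 ≤ 3 * g + m ∧ μ'.2 + e' + 2 ≤ 3 * g' + m' := by
    intro μ μ' h0
    rw [mul_ne_zero_iff] at h0
    exact ⟨L.coef_support N _ _ _ rfl μ _ h0.1, L.coef_support N _ _ _ rfl μ' _ h0.2⟩
  split_ifs with hcond
  · have := hL.wt_pair_le N hv hνlt hK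
      (R := fun l l' => l + e + 2 ≤ 3 * g + m ∧ l' + e' + 2 ≤ 3 * g' + m')
      (cnt := ((min (3 * g + m) (3 * g' + m') - 1 : ℕ) : ℝ))
      (H := A g m * A g' m' * v ^ (e + e'))
      (mul_nonneg (mul_nonneg (hA _ _) (hA _ _)) (by positivity))
      (fun s => by
        have h1 := card_filter_antidiagonal_le (c := 3 * g + m - 1)
          (R := fun l l' => l + e + 2 ≤ 3 * g + m ∧ l' + e' + 2 ≤ 3 * g' + m')
          (fun l l' h => by omega) s
        have h2 := card_filter_antidiagonal_le' (c := 3 * g' + m' - 1)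
          (R := fun l l' => l + e + 2 ≤ 3 * g + m ∧ l' + e' + 2 ≤ 3 * g' + m')
          (fun l l' h => by omega) s
        have h3 : ((Finset.HasAntidiagonal.antidiagonal s).filter fun p =>
            p.1 + e + 2 ≤ 3 * g + m ∧ p.2 + e' + 2 ≤ 3 * g' + m').card ≤
            min (3 * g + m) (3 * g' + m') - 1 := by omega
        exact_mod_cast h3)
      (h := fun μ μ' => L.coef N g m μ κ * L.coef N g' m' μ' κ')
      (fun μ μ' h0 => by
        have := hsupp μ μ' h0
        exact ⟨this, by omega, by omega⟩)
      (fun μ μ' => by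
        rw [norm_mul]
        refine (mul_le_mul (hb μ κ) (hb' μ' κ') (norm_nonneg _)
          (mul_nonneg (hA _ _) (by positivity))).trans_eq ?_
        rw [← he, ← he', pow_add, pow_add, pow_add, pow_add]
        ring) hi a
    refine this.trans_eq ?_
    ring
  · rw [mul_zero]
    refine le_of_eq ?_
    rw [Finset.sum_eq_zero, wt_zero]
    intro μ _
    refine Finset.sum_eq_zero fun μ' _ => ?_
    by_cases h0 : L.coef N g m μ κ * L.coef N g' m' μ' κ' = 0
    · rw [h0, map_zero, zero_mul]
    · have := hsupp μ μ' h0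
      omega

/-- The bound on the contribution of `ω_{0,2}` in the arguments `z₁, z_k`. -/
def dualBound (r f K ν : ℝ) (g m : ℕ) (κ : Fin m → ι × ℕ) (k : Fin m) : ℝ :=
  if ∑ i, (κ i).2 + 2 = 3 * g + m ∧ (κ k).2 = 0 then 0
  else (2 * (κ k).2 + 1) / (1 - ν) + r * f * K * ν

include hL hv hνlt hK in
theorem Bounds.dualBound_nonneg {g m : ℕ} (κ : Fin m → ι × ℕ) (k : Fin m) :
    0 ≤ dualBound (Fintype.card ι) (ρ * Mφ) K (v / ρ) g m κ k := by
  have hρ := hL.ρ_pos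
  have hMφ := hL.Mφ_nonneg
  have hK0 : 0 ≤ K := by simpa using hK 0
  have hν0 : 0 < v / ρ := div_pos hv hρ
  have hν1 : 0 < 1 - v / ρ := by linarith
  unfold dualBound
  split_ifs <;> positivity

include hL hv hνlt hK hA in
theorem Bounds.wt_dual_ser_le {g m : ℕ} (h3 : 3 ≤ 3 * g + m) (hN : 3 * g + m ≤ N)
    (hb : CoefBound L N v A g (m - 1)) {i : ℕ} (hi : i ≤ 2 * N) (a : ι)
    (κ : Fin m → ι × ℕ) {J : Finset (Fin m)} (hJ : J.card = 1) :
    wt ρ (2 * N - i) (L.ser N a 0 J.card (restrict J κ) * L.ser N a g Jᶜ.card (restrict Jᶜ κ)) ≤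
      ρ ^ (2 * N) * (v / ρ) ^ i * v ^ (∑ k, (κ k).2) * (A g (m - 1) / v *
      ∑ k ∈ J, dualBound (Fintype.card ι) (ρ * Mφ) K (v / ρ) g m κ k) := by
  have hρ := hL.ρ_pos
  have hc := splitting_card J
  have hJc : Jᶜ.card = m - 1 := by omega
  have hs := sum_restrict_add J fun i => (κ i).2
  set e' := ∑ k, (restrict Jᶜ κ k).2 with he'
  set k₀ := J.orderEmbOfFin rfl ⟨0, by omega⟩ with hk₀
  have hmem : k₀ ∈ J := Finset.orderEmbOfFin_mem _ _ _
  have hsJ : ∑ i, restrict J (fun i => (κ i).2) i = (κ k₀).2 := by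
    rw [Fintype.sum_eq_single (⟨0, by omega⟩ : Fin J.card)]
    · rfl
    · intro x hx
      exact absurd (Fin.ext (by have := x.2; simp only; omega)) hx
  have he : ∑ k, (κ k).2 = (κ k₀).2 + e' := by
    rw [← hs, hsJ]; rfl
  have e1 : L.ser N a 0 J.card (restrict J κ) = if (κ k₀).1 = a then
      PowerSeries.C (2 * (κ k₀).2 + 1 : ℂ) * PowerSeries.X ^ (N + (κ k₀).2) else 0 := by
    rw [ser, dif_pos ⟨rfl, hJ⟩]
    rfl
  have hb' : CoefBound L N v A g Jᶜ.card := by rw [hJc]; exact hb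
  have hsupp : ∀ μ : ι × ℕ, L.coef N g Jᶜ.card μ (restrict Jᶜ κ) ≠ 0 →
      μ.2 + e' + 2 ≤ 3 * g + (m - 1) := by
    intro μ h0
    rw [← hJc]
    exact L.coef_support N _ _ _ rfl μ _ h0
  have hsingle : dualBound (Fintype.card ι) (ρ * Mφ) K (v / ρ) g m κ k₀ ≤
      ∑ k ∈ J, dualBound (Fintype.card ι) (ρ * Mφ) K (v / ρ) g m κ k :=
    Finset.single_le_sum (fun k _ => hL.dualBound_nonneg hv hνlt hK κ k) hmem
  have hA1 : 0 ≤ A g (m - 1) / v := div_nonneg (hA _ _) hv.le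
  refine le_trans ?_ (mul_le_mul_of_nonneg_left (mul_le_mul_of_nonneg_left hsingle hA1)
    (by positivity))
  rw [e1, ser, dif_neg (by omega)]
  -- If the passive indices already have top degree, removing an index `0` leaves a tuple of too
  -- large degree for one argument less, and the contribution vanishes. This exception keeps the
  -- later count at top degree below `3D`.
  by_cases hz : ∑ i, (κ i).2 + 2 = 3 * g + m ∧ (κ k₀).2 = 0
  · rw [dualBound, if_pos hz, mul_zero, mul_zero, Finset.sum_eq_zero (s := indices ι N), mul_zero,
      wt_zero]
    intro μ _
    by_cases h0 : L.coef N g Jᶜ.card μ (restrict Jᶜ κ) = 0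
    · rw [h0, map_zero, zero_mul]
    · have := hsupp μ h0
      omega
  · rw [dualBound, if_neg hz]
    have := hL.wt_dual_le N hv hνlt hK (H := A g (m - 1) * v ^ e')
      (mul_nonneg (hA _ _) (by positivity))
      (h := fun μ => L.coef N g Jᶜ.card μ (restrict Jᶜ κ))
      (fun μ h0 => by have := hsupp μ h0; omega)
      (fun μ => by
        refine (hb' μ _).trans_eq ?_
        rw [← he', hJc, pow_add]
        ring) hi a (κ k₀)
    refine this.trans_eq ?_
    rw [he, pow_add]
    ring

include hL hv hνlt hK hA in
/-- One step of the recursion for the bounds on the coefficients. -/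
theorem Bounds.norm_coef_le {g m : ℕ} (hst : 2 ≤ 2 * g + m) (h3 : 3 ≤ 3 * g + m)
    (h10 : ¬ (m = 0 ∧ g = 1)) (hN : 3 * g + m ≤ N)
    (hb : ∀ g' m', 2 * g' + m' < 2 * g + m → 2 ≤ 2 * g' + m' → 3 * g' + m' ≤ N →
      CoefBound L N v A g' m') (lam : ι × ℕ) (κ : Fin m → ι × ℕ)
    (hlam : lam.2 + ∑ k, (κ k).2 + 2 ≤ 3 * g + m) :
    ‖L.coef N g m lam κ‖ ≤ v ^ (lam.2 + ∑ k, (κ k).2) * (1 / 2 * (Mθ / ρ) *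
      (2 * (A g (m - 1) / v *
        ∑ k, dualBound (Fintype.card ι) (ρ * Mφ) K (v / ρ) g m κ k) +
      if ∑ k, (κ k).2 + 4 ≤ 3 * g + m then
        (if 0 < g then A (g - 1) (m + 1) / v ^ 2 *
          pairSum (Fintype.card ι) (ρ * Mφ) K (v / ρ) ((3 * g + m - 3 - ∑ k, (κ k).2 : ℕ) : ℝ)
        else 0) +
        ∑ g₁ ∈ Finset.range (g + 1), ∑ m₁ ∈ Finset.range (m + 1),
          (if 2 ≤ 2 * g₁ + m₁ ∧ 2 ≤ 2 * (g - g₁) + (m - m₁) then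
            (m.choose m₁ : ℝ) * (A g₁ m₁ * A (g - g₁) (m - m₁) / v ^ 2 *
              pairSum (Fintype.card ι) (ρ * Mφ) K (v / ρ)
              ((min (3 * g₁ + m₁) (3 * (g - g₁) + (m - m₁)) - 1 : ℕ) : ℝ))
          else 0)
      else 0)) := by
  have hρ := hL.ρ_pos
  have hi : lam.2 ≤ 2 * N := by omega
  set e := ∑ k, (κ k).2 with he
  set i := lam.2 with hi'
  set a := lam.1
  set r : ℝ := ((Fintype.card ι : ℕ) : ℝ) with hr
  set f := ρ * Mφ
  set ν := v / ρ with hν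
  have hν0 : 0 < ν := div_pos hv hρ
  set W := ρ ^ (2 * N) * ν ^ i * v ^ e with hW
  have hW0 : 0 ≤ W := by positivity
  set P : ℕ → ℕ → ℝ := fun g₁ m₁ => if 2 ≤ 2 * g₁ + m₁ ∧ 2 ≤ 2 * (g - g₁) + (m - m₁) then
    A g₁ m₁ * A (g - g₁) (m - m₁) / v ^ 2 * pairSum r f K ν
      ((min (3 * g₁ + m₁) (3 * (g - g₁) + (m - m₁)) - 1 : ℕ) : ℝ) else 0 with hP
  set P' : ℕ → ℕ → ℝ := fun g₁ m₁ => if e + 4 ≤ 3 * g + m then P g₁ m₁ else 0 with hP'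
  set δ : Fin m → ℝ := fun k => A g (m - 1) / v * dualBound r f K ν g m κ k with hδ
  have hδ0 : ∀ k, 0 ≤ δ k := fun k =>
    mul_nonneg (div_nonneg (hA _ _) hv.le) (hL.dualBound_nonneg hv hνlt hK κ k)
  have hK0 : 0 ≤ K := by simpa using hK 0
  have hν1 : 0 < 1 - ν := by linarith
  have hf0 : 0 ≤ f := mul_nonneg hρ.le hL.Mφ_nonneg
  have hP0 : ∀ g₁ m₁, 0 ≤ P' g₁ m₁ := by
    intro g₁ m₁
    simp only [hP', hP]
    split_ifs
    · refine mul_nonneg (div_nonneg (mul_nonneg (hA _ _) (hA _ _)) (by positivity)) ?_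
      unfold pairSum
      positivity
    · exact le_rfl
    · exact le_rfl
  have hsplit : ∀ (g₁ : Fin (g + 1)) (J : Finset (Fin m)),
      wt ρ (2 * N - i) (L.splitSer N a g m κ g₁ J) ≤ W * (
        (if (g₁ : ℕ) = 0 then if J.card = 1 then ∑ k ∈ J, δ k else 0 else 0) +
        (if (g₁ : ℕ) = g then if Jᶜ.card = 1 then ∑ k ∈ Jᶜ, δ k else 0 else 0) +
        P' g₁ J.card) := by
    intro g₁ J
    have hg := g₁.2
    have hc := splitting_card J
    have n1 : (0 : ℝ) ≤ if (g₁ : ℕ) = 0 then if J.card = 1 then ∑ k ∈ J, δ k else 0 else 0 := by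
      split_ifs
      · exact Finset.sum_nonneg fun k _ => hδ0 k
      · exact le_rfl
      · exact le_rfl
    have n2 : (0 : ℝ) ≤ if (g₁ : ℕ) = g then if Jᶜ.card = 1 then ∑ k ∈ Jᶜ, δ k else 0 else 0 := by
      split_ifs
      · exact Finset.sum_nonneg fun k _ => hδ0 k
      · exact le_rfl
      · exact le_rfl
    have n3 := hP0 g₁ J.card
    unfold splitSer
    by_cases hpos : 0 < (g₁ : ℕ) + J.card ∧ 0 < g - (g₁ : ℕ) + Jᶜ.card
    swap
    · rw [if_neg hpos, wt_zero]
      exact mul_nonneg hW0 (by linarith)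
    rw [if_pos hpos]
    -- A splitting with a factor `ω_{0,2}` on the left has a mirror image with it on the right;
    -- together they give the factor `2` in front of the sum over `k`.
    by_cases hl : (g₁ : ℕ) = 0 ∧ J.card = 1
    · rw [hl.1, Nat.sub_zero]
      have h := hL.wt_dual_ser_le N hv hνlt hK hA h3 hN (hb g (m - 1) (by omega) (by omega)
        (by omega)) hi a κ hl.2
      refine h.trans ?_
      rw [Finset.mul_sum]
      refine mul_le_mul_of_nonneg_left ?_ hW0
      rw [if_pos rfl, if_pos hl.2]
      rw [hl.1] at n2 n3
      simp only [hδ] at n2 ⊢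
      linarith
    by_cases hr : (g₁ : ℕ) = g ∧ Jᶜ.card = 1
    · rw [hr.1, Nat.sub_self, mul_comm (L.ser N a g J.card (restrict J κ))]
      have h := hL.wt_dual_ser_le N hv hνlt hK hA h3 hN (hb g (m - 1) (by omega) (by omega)
        (by omega)) hi a κ hr.2
      rw [compl_compl] at h
      refine h.trans ?_
      rw [Finset.mul_sum]
      refine mul_le_mul_of_nonneg_left ?_ hW0
      rw [if_pos rfl, if_pos hr.2]
      rw [hr.1] at n1 n3
      simp only [hδ] at n1 ⊢
      linarith
    · have hJc : Jᶜ.card = m - J.card := by omega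
      have h := hL.wt_ser_mul_ser_le N hv hνlt hK hA (g := g₁) (g' := g - g₁) (m := J.card)
        (m' := Jᶜ.card) hl (by omega) (by omega) (by omega)
        (hb _ _ (by omega) (by omega) (by omega)) (hb _ _ (by omega) (by omega) (by omega)) hi a
        (restrict J κ) (restrict Jᶜ κ)
      refine h.trans ?_
      have hs : ∑ k, (restrict J κ k).2 + ∑ k, (restrict Jᶜ κ k).2 = e :=
        sum_restrict_add J fun i => (κ i).2
      rw [hs]
      refine mul_le_mul_of_nonneg_left ?_ hW0
      refine le_trans (le_of_eq ?_) (le_add_of_nonneg_left (add_nonneg n1 n2))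
      simp only [hP', hP]
      rw [if_pos (show 2 ≤ 2 * (g₁ : ℕ) + J.card ∧ 2 ≤ 2 * (g - (g₁ : ℕ)) + (m - J.card) by omega),
        hJc, show 3 * (g₁ : ℕ) + J.card + (3 * (g - (g₁ : ℕ)) + (m - J.card)) = 3 * g + m by omega]
  have hgen : wt ρ (2 * N - i) (L.genusSer N a g m κ) ≤ W *
      (if e + 4 ≤ 3 * g + m then if 0 < g then A (g - 1) (m + 1) / v ^ 2 *
          pairSum r f K ν ((3 * g + m - 3 - e : ℕ) : ℝ) else 0 else 0) := by
    by_cases hg : 0 < g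
    · refine (hL.wt_genusSer_le N hv hνlt hK hA hg h10 hN
        (hb _ _ (by omega) (by omega) (by omega)) hi a κ).trans_eq ?_
      simp only [if_pos hg]
      rfl
    · simp only [genusSer, if_neg hg, wt_zero, ite_self, mul_zero, le_refl]
  have hsum : ∑ g₁ : Fin (g + 1), ∑ J : Finset (Fin m), W * (
        (if (g₁ : ℕ) = 0 then if J.card = 1 then ∑ k ∈ J, δ k else 0 else 0) +
        (if (g₁ : ℕ) = g then if Jᶜ.card = 1 then ∑ k ∈ Jᶜ, δ k else 0 else 0) +
        P' g₁ J.card) = W * (2 * ∑ k, δ k +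
        ∑ g₁ ∈ Finset.range (g + 1), ∑ m₁ ∈ Finset.range (m + 1),
          (m.choose m₁ : ℝ) * P' g₁ m₁) := by
    simp only [← Finset.mul_sum, Finset.sum_add_distrib]
    congr 1
    have s1 : ∑ g₁ : Fin (g + 1), ∑ J : Finset (Fin m),
        (if (g₁ : ℕ) = 0 then if J.card = 1 then ∑ k ∈ J, δ k else 0 else 0) = ∑ k, δ k := by
      rw [Fintype.sum_eq_single (0 : Fin (g + 1))]
      · simp only [Fin.val_zero, if_true]
        exact sum_finset_card_eq_one δ
      · intro x hx
        refine Finset.sum_eq_zero fun J _ => if_neg fun h => hx (Fin.ext h)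
    have s2 : ∑ g₁ : Fin (g + 1), ∑ J : Finset (Fin m),
        (if (g₁ : ℕ) = g then if Jᶜ.card = 1 then ∑ k ∈ Jᶜ, δ k else 0 else 0) = ∑ k, δ k := by
      rw [Fintype.sum_eq_single (Fin.last g)]
      · simp only [Fin.val_last, if_true]
        rw [← sum_finset_card_eq_one δ]
        exact Equiv.sum_comp (Function.Involutive.toPerm _ (compl_involutive (α := Finset (Fin m))))
          fun J : Finset (Fin m) => if J.card = 1 then ∑ k ∈ J, δ k else 0
      · intro x hx
        refine Finset.sum_eq_zero fun J _ => if_neg fun h => hx (Fin.ext h)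
    have s3 : ∑ g₁ : Fin (g + 1), ∑ J : Finset (Fin m), P' g₁ J.card =
        ∑ g₁ ∈ Finset.range (g + 1), ∑ m₁ ∈ Finset.range (m + 1),
          (m.choose m₁ : ℝ) * P' g₁ m₁ := by
      rw [Finset.sum_range fun g₁ => ∑ m₁ ∈ Finset.range (m + 1), (m.choose m₁ : ℝ) * P' g₁ m₁]
      refine Finset.sum_congr rfl fun g₁ _ => ?_
      rw [sum_finset_card]
      simp only [nsmul_eq_mul]
    rw [s1, s2, s3]
    ring
  have hwt : wt ρ (2 * N - i) (L.genusSer N a g m κ +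
      ∑ g₁ : Fin (g + 1), ∑ J : Finset (Fin m), L.splitSer N a g m κ g₁ J) ≤
      W * (2 * ∑ k, δ k + ((if e + 4 ≤ 3 * g + m then if 0 < g then A (g - 1) (m + 1) / v ^ 2 *
          pairSum r f K ν ((3 * g + m - 3 - e : ℕ) : ℝ) else 0 else 0) +
        ∑ g₁ ∈ Finset.range (g + 1), ∑ m₁ ∈ Finset.range (m + 1),
          (m.choose m₁ : ℝ) * P' g₁ m₁)) := by
    refine (wt_add_le hρ _ _ _).trans ?_
    have h2 : wt ρ (2 * N - i) (∑ g₁ : Fin (g + 1), ∑ J : Finset (Fin m),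
        L.splitSer N a g m κ g₁ J) ≤ _ :=
      ((wt_sum_le hρ _ _ _).trans (Finset.sum_le_sum fun g₁ _ => (wt_sum_le hρ _ _ _).trans
        (Finset.sum_le_sum fun J _ => hsplit g₁ J))).trans hsum.le
    refine (add_le_add hgen h2).trans_eq ?_
    ring
  rw [L.coef_eq N hst lam hi, norm_mul]
  have hn : ‖(1 / 2 : ℂ)‖ = 1 / 2 := by norm_num
  rw [hn]
  have hco := norm_coeff_mul_le hρ (2 * N - i) (F := L.genusSer N a g m κ +
      ∑ g₁ : Fin (g + 1), ∑ J : Finset (Fin m), L.splitSer N a g m κ g₁ J) (hL.theta_le a)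
  have hM : 0 ≤ Mθ / ρ / ρ ^ (2 * N - i) := by
    have := hL.Mθ_pos
    positivity
  refine (mul_le_mul_of_nonneg_left (hco.trans (mul_le_mul_of_nonneg_left hwt hM))
    (by norm_num : (0 : ℝ) ≤ 1 / 2)).trans_eq ?_
  -- Here the auxiliary order `N` and all stray powers of `ρ` disappear.
  have hpow : W / ρ ^ (2 * N - i) = v ^ (i + e) := by
    rw [hW, hν, div_pow, pow_add, div_eq_iff (by positivity)]
    have : ρ ^ (2 * N) = ρ ^ (2 * N - i) * ρ ^ i := by rw [← pow_add]; congr 1; omega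
    rw [this]
    field_simp
  have hPP : (if e + 4 ≤ 3 * g + m then if 0 < g then A (g - 1) (m + 1) / v ^ 2 *
          pairSum r f K ν ((3 * g + m - 3 - e : ℕ) : ℝ) else 0 else 0) +
        ∑ g₁ ∈ Finset.range (g + 1), ∑ m₁ ∈ Finset.range (m + 1),
          (m.choose m₁ : ℝ) * P' g₁ m₁ = if e + 4 ≤ 3 * g + m then
        (if 0 < g then A (g - 1) (m + 1) / v ^ 2 *
          pairSum r f K ν ((3 * g + m - 3 - e : ℕ) : ℝ) else 0) +
        ∑ g₁ ∈ Finset.range (g + 1), ∑ m₁ ∈ Finset.range (m + 1),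
          (if 2 ≤ 2 * g₁ + m₁ ∧ 2 ≤ 2 * (g - g₁) + (m - m₁) then
            (m.choose m₁ : ℝ) * (A g₁ m₁ * A (g - g₁) (m - m₁) / v ^ 2 * pairSum r f K ν
              ((min (3 * g₁ + m₁) (3 * (g - g₁) + (m - m₁)) - 1 : ℕ) : ℝ))
          else 0) else 0 := by
    by_cases hc : e + 4 ≤ 3 * g + m
    · simp only [hP', hP, if_pos hc, mul_ite, mul_zero]
    · simp only [hP', if_neg hc, mul_zero, Finset.sum_const_zero, add_zero]
  rw [hPP, ← hpow, ← Finset.mul_sum]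
  ring

end LocalData

/-! ### A convolution estimate -/

/-- The weights of the convolution estimate for the products of correlators. -/
def splitWeight (a c : ℕ) : ℝ :=
  6 * ((a + c + 3) * (a + c + 4) * (a + c + 8) * (min a c + 1 : ℕ)) /
    ((a + 1) * (a + 2) * (a + 6) * ((c + 1) * (c + 2) * (c + 6)))

theorem splitWeight_comm (a c : ℕ) : splitWeight a c = splitWeight c a := by
  unfold splitWeight
  rw [min_comm]
  congr 1 <;> ring

/-- An integer upper bound for `10000 * ∑ splitWeight k (n - k)`, the sum being over `k < j`. -/
def splitWeightSum (n : ℕ) : ℕ → ℕ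
  | 0 => 0
  | k + 1 => splitWeightSum n k + (60000 * ((n + 3) * (n + 4) * (n + 8) * (min k (n - k) + 1)) /
      ((k + 1) * (k + 2) * (k + 6) * ((n - k + 1) * (n - k + 2) * (n - k + 6))) + 1)

theorem sum_splitWeight_le_splitWeightSum (n j : ℕ) (hj : j ≤ n + 1) :
    10000 * ∑ k ∈ Finset.range j, splitWeight k (n - k) ≤ splitWeightSum n j := by
  induction j with
  | zero => simp [splitWeightSum]
  | succ j ih =>
    have h := ih (by omega)
    rw [Finset.sum_range_succ, splitWeightSum]
    push_cast only [Nat.cast_add]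
    rw [mul_add]
    refine add_le_add h ?_
    obtain ⟨c, hc⟩ : ∃ c, n - j = c := ⟨_, rfl⟩
    rw [hc]
    have hn : n = j + c := by omega
    -- The `+ 1` in `splitWeightSum` rounds every scaled summand up to an integer.
    have h1 := (Nat.lt_succ_floor ((60000 * ((n + 3) * (n + 4) * (n + 8) * (min j c + 1)) : ℕ) /
      ((j + 1) * (j + 2) * (j + 6) * ((c + 1) * (c + 2) * (c + 6)) : ℕ) : ℝ)).le
    rw [Nat.floor_div_eq_div] at h1
    refine le_trans (le_of_eq ?_) (h1.trans_eq (by push_cast; rfl))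
    rw [hn]
    unfold splitWeight
    push_cast
    ring

theorem splitWeightSum_le {n : ℕ} (hn : n < 300) : splitWeightSum n (n + 1) ≤ 70000 := by
  -- A finite computation with integers settles the range in which the asymptotic estimate is too
  -- weak.
  have : ∀ n < 300, splitWeightSum n (n + 1) ≤ 70000 := by decide +kernel
  exact this n hn

/-- Partial fractions telescope, and the full sum is `¼ (1/2 + 1/3 + 1/4 + 1/5) = 77/240`. -/
theorem sum_inv_mul_le (n : ℕ) :
    ∑ a ∈ Finset.range n, 1 / (((a : ℝ) + 2) * (a + 6)) ≤ 77 / 240 := by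
  have : ∑ a ∈ Finset.range n, 1 / (((a : ℝ) + 2) * (a + 6)) = 77 / 240 -
      1 / 4 * (1 / ((n : ℝ) + 2) + 1 / (n + 3) + 1 / (n + 4) + 1 / (n + 5)) := by
    induction n with
    | zero => norm_num
    | succ n ih =>
      rw [Finset.sum_range_succ, ih]
      push_cast
      field_simp
      ring
  rw [this]
  have : 0 ≤ 1 / 4 * (1 / ((n : ℝ) + 2) + 1 / (n + 3) + 1 / (n + 4) + 1 / (n + 5)) := by
    positivity
  linarith

/-- Beyond the computed start every summand is at most `1/60`, so a line of slope `1/60` dominates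
the harmonic growth. -/
theorem sum_inv_le {n : ℕ} (hn : 54 ≤ n) :
    ∑ a ∈ Finset.range n, 1 / ((a : ℝ) + 6) ≤ 3 / 2 + n / 60 := by
  induction n, hn using Nat.le_induction with
  | base => norm_num [Finset.sum_range_succ]
  | succ n hn ih =>
    rw [Finset.sum_range_succ]
    have hn' : (54 : ℝ) ≤ n := by exact_mod_cast hn
    have : 1 / ((n : ℝ) + 6) ≤ 1 / 60 := one_div_le_one_div_of_le (by norm_num) (by linarith)
    push_cast
    linarith

theorem splitWeight_le {a c : ℕ} (h : a ≤ c) (hn : 300 ≤ a + c) :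
    splitWeight a c ≤ 6.25 * (1 / (((a : ℝ) + 2) * (a + 6)) +
      14 / (a + c + 1 : ℕ) * (1 / ((a : ℝ) + 6))) := by
  have h' : (a : ℝ) ≤ c := by exact_mod_cast h
  have hn' : (300 : ℝ) ≤ a + c := by exact_mod_cast hn
  have ha : (0 : ℝ) ≤ a := a.cast_nonneg
  unfold splitWeight
  rw [min_eq_left h]
  push_cast
  set x : ℝ := (a : ℝ)
  set y : ℝ := (c : ℝ)
  set s : ℝ := x + y + 1 with hs
  have hs0 : 301 ≤ s := by linarith
  have e1 : 6 * ((x + y + 3) * (x + y + 4) * (x + y + 8)) ≤ 6.25 * s ^ 3 := by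
    have h2 : 301 * s ≤ s ^ 2 := by nlinarith
    have h3 : 301 * s ^ 2 ≤ s ^ 3 := by nlinarith [sq_nonneg s]
    have : x + y = s - 1 := by rw [hs]; ring
    rw [this]
    nlinarith
  -- This bounds `(s / (s - x)) ^ 3` by `1 + 14 x / s` for `0 ≤ x ≤ s/2`: at `x = s/2` both sides
  -- equal `8`, which fixes the constant `14`.
  have e2 : s ^ 3 * s ≤ (y + 1) ^ 3 * (s + 14 * x) := by
    have hy : y + 1 = s - x := by rw [hs]; ring
    have hx : x ≤ s / 2 := by linarith
    rw [hy]
    have key : 0 ≤ (s - x) ^ 3 * (s + 14 * x) - s ^ 3 * s := by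
      have e : (s - x) ^ 3 * (s + 14 * x) - s ^ 3 * s =
        x * (s - 2 * x) * (11 * s ^ 2 - 17 * s * x + 7 * x ^ 2) := by ring
      rw [e]
      have : 0 ≤ 11 * s ^ 2 - 17 * s * x + 7 * x ^ 2 := by
        nlinarith [sq_nonneg (22 * s - 17 * x), sq_nonneg x]
      have : 0 ≤ s - 2 * x := by linarith
      positivity
    linarith
  rw [div_le_iff₀ (by positivity)]
  have e3 : (6.25 * (1 / ((x + 2) * (x + 6)) + 14 / s * (1 / (x + 6)))) *
      ((x + 1) * (x + 2) * (x + 6) * ((y + 1) * (y + 2) * (y + 6))) =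
      6.25 * (s + 14 * (x + 2)) / s * ((x + 1) * ((y + 1) * (y + 2) * (y + 6))) := by
    field_simp
  rw [e3]
  have e4 : (y + 1) ^ 3 ≤ (y + 1) * (y + 2) * (y + 6) := by
    have : 0 ≤ y := by linarith
    nlinarith [sq_nonneg y]
  calc 6 * ((x + y + 3) * (x + y + 4) * (x + y + 8) * (x + 1))
      = 6 * ((x + y + 3) * (x + y + 4) * (x + y + 8)) * (x + 1) := by ring
    _ ≤ 6.25 * s ^ 3 * (x + 1) := by gcongr
    _ = 6.25 * (s ^ 3 * s) / s * (x + 1) := by field_simp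
    _ ≤ 6.25 * ((y + 1) ^ 3 * (s + 14 * x)) / s * (x + 1) := by gcongr
    _ ≤ 6.25 * (((y + 1) * (y + 2) * (y + 6)) * (s + 14 * (x + 2))) / s * (x + 1) := by
        gcongr
        linarith
    _ = _ := by ring

/-- Without the weights `6 / (D + 6)` the summand would decay only like `1/a` away from the ends and
the sum would grow like `log n`; with them it decays like `1/a²`. For large `n` the symmetry folds
the sum onto `a ≤ n/2`, and the bound is `2 · 6.25 · (77/240 + 0.19) < 7`. -/
theorem sum_splitWeight_le (n : ℕ) :
    ∑ p ∈ Finset.HasAntidiagonal.antidiagonal n, splitWeight p.1 p.2 ≤ 7 := by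
  rw [Finset.Nat.sum_antidiagonal_eq_sum_range_succ]
  rcases lt_or_ge n 300 with hn | hn
  · have h1 := sum_splitWeight_le_splitWeightSum n (n + 1) le_rfl
    have h2 : (splitWeightSum n (n + 1) : ℝ) ≤ 70000 := by exact_mod_cast splitWeightSum_le hn
    rw [Nat.succ_eq_add_one]
    linarith
  set T : ℕ → ℝ := fun a => 6.25 * (1 / (((a : ℝ) + 2) * (a + 6)) +
      14 / (n + 1 : ℕ) * (1 / ((a : ℝ) + 6))) with hT
  have hT0 : ∀ a, 0 ≤ T a := fun a => by simp only [hT]; positivity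
  have key : ∀ k ∈ Finset.range (n + 1), splitWeight k (n - k) ≤
      (if k ≤ n / 2 then T k else 0) + (if n - k ≤ n / 2 then T (n - k) else 0) := by
    intro k hk
    have hk' := Finset.mem_range.1 hk
    rcases le_total k (n - k) with h | h
    · have h1 := splitWeight_le h (by omega)
      rw [show k + (n - k) = n by omega] at h1
      rw [if_pos (by omega)]
      refine h1.trans (le_add_of_nonneg_right ?_)
      split_ifs
      exacts [hT0 _, le_rfl]
    · have h1 := splitWeight_le h (by omega)
      rw [show (n - k) + k = n by omega, splitWeight_comm] at h1
      rw [if_pos (show n - k ≤ n / 2 by omega)]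
      refine h1.trans (le_add_of_nonneg_left ?_)
      split_ifs
      exacts [hT0 _, le_rfl]
  refine (Finset.sum_le_sum key).trans ?_
  rw [Finset.sum_add_distrib]
  have hr := Finset.sum_range_reflect (fun k => if k ≤ n / 2 then T k else 0) (n + 1)
  simp only [Nat.add_sub_cancel] at hr
  rw [hr]
  have hs : ∑ k ∈ Finset.range (n + 1), (if k ≤ n / 2 then T k else 0) =
      ∑ k ∈ Finset.range (n / 2 + 1), T k := by
    rw [← Finset.sum_filter]
    refine Finset.sum_congr ?_ fun _ _ => rfl
    ext k
    simp only [Finset.mem_filter, Finset.mem_range]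
    omega
  rw [hs]
  have hle : ∑ k ∈ Finset.range (n / 2 + 1), T k ≤ 6.25 * (77 / 240 + 14 / (n + 1 : ℕ) *
      (3 / 2 + (n / 2 + 1 : ℕ) / 60)) := by
    simp only [hT]
    rw [← Finset.mul_sum, Finset.sum_add_distrib, ← Finset.mul_sum]
    gcongr
    · exact sum_inv_mul_le _
    · exact sum_inv_le (by omega)
  have hn' : (300 : ℝ) ≤ n := by exact_mod_cast hn
  have hd : ((n / 2 + 1 : ℕ) : ℝ) ≤ n / 2 + 1 := by
    push_cast
    have := Nat.cast_div_le (α := ℝ) (m := n) (n := 2)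
    push_cast at this
    linarith
  have : 14 / ((n + 1 : ℕ) : ℝ) * (3 / 2 + (n / 2 + 1 : ℕ) / 60) ≤ 0.19 := by
    rw [div_mul_eq_mul_div, div_le_iff₀ (by positivity)]
    push_cast at hd ⊢
    linarith
  linarith

/-! ### The weights attached to the genus -/

/-- The weight of the genus in the bounds: `w₀ = 1`, `w₁ = 7/2`, `w_g = w_{g-1} / (g - 3/2)`. -/
def genusWeight : ℕ → ℝ
  | 0 => 1
  | 1 => 7 / 2
  | g + 2 => genusWeight (g + 1) / (g + 1 / 2)

theorem genusWeight_pos : ∀ g, 0 < genusWeight g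
  | 0 => by norm_num [genusWeight]
  | 1 => by norm_num [genusWeight]
  | g + 2 => by
    have := genusWeight_pos (g + 1)
    rw [genusWeight]
    positivity

theorem choose_three_mul_succ (a b : ℕ) :
    ((3 * (a + (b + 1))).choose (3 * a) : ℝ) * ((3 * b + 3) * (3 * b + 2) * (3 * b + 1)) =
      ((3 * (a + b)).choose (3 * a) : ℝ) *
        ((3 * (a + b) + 3) * (3 * (a + b) + 2) * (3 * (a + b) + 1)) := by
  have key : ∀ c : ℕ, ((3 * a + (c + 1)).choose (3 * a) : ℝ) * (c + 1) =
      ((3 * a + c).choose (3 * a) : ℝ) * (3 * a + c + 1) := by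
    intro c
    have h := Nat.choose_mul_succ_eq (3 * a + c) (3 * a)
    rw [show 3 * a + c + 1 - 3 * a = c + 1 by omega] at h
    rw [← add_assoc]
    exact_mod_cast h.symm
  have h0 := key (3 * b)
  have h1 := key (3 * b + 1)
  have h2 := key (3 * b + 2)
  push_cast at h0 h1 h2
  rw [show 3 * (a + (b + 1)) = 3 * a + (3 * b + 2 + 1) by ring, show 3 * (a + b) = 3 * a + 3 * b by
    ring]
  rw [show (3 * b + 1 + 1 : ℕ) = 3 * b + 2 by ring] at h1
  linear_combination (3 * (b : ℝ) + 1) * (3 * b + 2) * h2 +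
    (3 * (b : ℝ) + 1) * (3 * a + (3 * b + 2) + 1) * h1 +
    (3 * a + (3 * (b : ℝ) + 2) + 1) * (3 * a + (3 * b + 1) + 1) * h0

/-- In the step from `b` to `b + 1` the binomial coefficient gains a ratio of cubic polynomials,
which outweighs the ratio `(a + b - 1/2) / (b - 1/2)` lost in the weights. -/
theorem genusWeight_mul_succ_le {a b : ℕ} (ha : 1 ≤ a) (hb : 1 ≤ b)
    (h : genusWeight a * genusWeight b ≤
      9 / 100 * ((3 * (a + b)).choose (3 * a) : ℝ) * genusWeight (a + b)) :
    genusWeight a * genusWeight (b + 1) ≤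
      9 / 100 * ((3 * (a + (b + 1))).choose (3 * a) : ℝ) * genusWeight (a + (b + 1)) := by
  obtain ⟨c, rfl⟩ : ∃ c, b = c + 1 := ⟨b - 1, by omega⟩
  have hw : genusWeight (a + (c + 1 + 1)) = genusWeight (a + (c + 1)) / (a + c + 1 / 2) := by
    rw [show a + (c + 1 + 1) = (a + c) + 2 by ring, genusWeight]
    push_cast
    rfl
  have hw' : genusWeight (c + 1 + 1) = genusWeight (c + 1) / (c + 1 / 2) := rfl
  rw [hw, hw']
  have hC := choose_three_mul_succ a (c + 1)
  set C' := ((3 * (a + (c + 1 + 1))).choose (3 * a) : ℝ)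
  set C := ((3 * (a + (c + 1))).choose (3 * a) : ℝ)
  have hC0 : 0 ≤ C := Nat.cast_nonneg _
  have ha' : (1 : ℝ) ≤ a := by exact_mod_cast ha
  have hc : (0 : ℝ) ≤ c := c.cast_nonneg
  have hA := genusWeight_pos (a + (c + 1))
  push_cast at hC
  have hratio : C * (a + c + 1 / 2) ≤ C' * (c + 1 / 2) := by
    have hpos : (0 : ℝ) < (3 * (c + 1) + 3) * (3 * (c + 1) + 2) * (3 * (c + 1) + 1) := by positivity
    refine le_of_mul_le_mul_right ?_ hpos
    have : C' * (c + 1 / 2) * ((3 * (c + 1) + 3) * (3 * (c + 1) + 2) * (3 * (c + 1) + 1)) =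
        C * (((3 * (a + (c + 1)) + 3) * (3 * (a + (c + 1)) + 2) * (3 * (a + (c + 1)) + 1)) *
          (c + 1 / 2)) := by
      linear_combination ((c : ℝ) + 1 / 2) * hC
    rw [this, mul_assoc]
    refine mul_le_mul_of_nonneg_left ?_ hC0
    rw [← sub_nonneg]
    obtain ⟨d, hd⟩ : ∃ d : ℝ, (a : ℝ) = 1 + d := ⟨a - 1, by ring⟩
    have hd0 : 0 ≤ d := by linarith
    rw [hd]
    ring_nf
    positivity
  calc genusWeight a * (genusWeight (c + 1) / (c + 1 / 2))
      = (genusWeight a * genusWeight (c + 1)) / (c + 1 / 2) := by ring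
    _ ≤ (9 / 100 * C * genusWeight (a + (c + 1))) / (c + 1 / 2) := by gcongr
    _ = 9 / 100 * genusWeight (a + (c + 1)) * (C * (a + c + 1 / 2)) /
        ((c + 1 / 2) * (a + c + 1 / 2)) := by field_simp
    _ ≤ 9 / 100 * genusWeight (a + (c + 1)) * (C' * (c + 1 / 2)) /
        ((c + 1 / 2) * (a + c + 1 / 2)) := by gcongr
    _ = _ := by field_simp

/-- The constant comes from `a = b = 1`, where the inequality is `49/4 ≤ 9/100 · 20 · 7`. Induction
in one variable, symmetry and induction in the other cover all cases. -/
theorem genusWeight_mul_le {a b : ℕ} (ha : 1 ≤ a) (hb : 1 ≤ b) :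
    genusWeight a * genusWeight b ≤
      9 / 100 * ((3 * (a + b)).choose (3 * a) : ℝ) * genusWeight (a + b) := by
  induction b, hb using Nat.le_induction with
  | succ b hb ih => exact genusWeight_mul_succ_le ha hb ih
  | base =>
    have h1 : ∀ a, 1 ≤ a → genusWeight 1 * genusWeight a ≤
      9 / 100 * ((3 * (1 + a)).choose (3 * 1) : ℝ) * genusWeight (1 + a) := by
      intro a ha
      induction a, ha using Nat.le_induction with
      | base =>
        have : genusWeight (1 + 1) = 7 := by norm_num [genusWeight]
        have hc : (3 * (1 + 1)).choose (3 * 1) = 20 := by decide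
        rw [this, hc]
        norm_num [genusWeight]
      | succ b hb ih => exact genusWeight_mul_succ_le le_rfl hb ih
    have h := h1 a ha
    rw [mul_comm, add_comm a 1]
    have hc : (3 * (1 + a)).choose (3 * 1) = (3 * (1 + a)).choose (3 * a) :=
      Nat.choose_symm_of_eq_add (by ring)
    rwa [hc] at h

/-! ### Binomial coefficients -/

theorem choose_mul_le_mul_choose {m n : ℕ} (h : m ≤ n) {j : ℕ} (hj : 1 ≤ j) :
    m.choose j * n ≤ m * n.choose j := by
  obtain ⟨i, rfl⟩ : ∃ i, j = i + 1 := ⟨j - 1, by omega⟩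
  rcases m with _ | m
  · simp
  rcases n with _ | n
  · simp
  have h1 := Nat.add_one_mul_choose_eq m i
  have h2 := Nat.add_one_mul_choose_eq n i
  have h3 : m.choose i ≤ n.choose i := Nat.choose_le_choose i (by omega)
  refine Nat.le_of_mul_le_mul_right (c := i + 1) ?_ (by omega)
  calc (m + 1).choose (i + 1) * (n + 1) * (i + 1) =
      (n + 1) * ((m + 1).choose (i + 1) * (i + 1)) := by ring
    _ = (n + 1) * (m + 1) * m.choose i := by rw [← h1]; ring
    _ ≤ (n + 1) * (m + 1) * n.choose i := Nat.mul_le_mul_left _ h3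
    _ = (m + 1) * ((n + 1).choose (i + 1) * (i + 1)) := by rw [← h2]; ring
    _ = _ := by ring

theorem choose_add_two_le {D j : ℕ} (h2 : 2 ≤ j) (hj : j ≤ D) :
    (D + 2).choose j ≤ 3 * D * D.choose (j - 1) := by
  obtain ⟨i, rfl⟩ : ∃ i, j = i + 2 := ⟨j - 2, by omega⟩
  obtain ⟨c, rfl⟩ : ∃ c, D = i + 2 + c := ⟨D - (i + 2), by omega⟩
  rw [show i + 2 - 1 = i + 1 by omega]
  set D := i + 2 + c with hD
  have h1 := Nat.add_one_mul_choose_eq (D + 1) (i + 1)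
  have h3 := Nat.choose_mul_succ_eq D (i + 1)
  rw [show D + 1 - (i + 1) = c + 2 by omega] at h3
  refine Nat.le_of_mul_le_mul_right (c := (i + 2) * (c + 2)) ?_ (by positivity)
  calc (D + 2).choose (i + 2) * ((i + 2) * (c + 2))
      = ((D + 1 + 1).choose (i + 1 + 1) * (i + 1 + 1)) * (c + 2) := by ring
    _ = (D + 2) * ((D + 1).choose (i + 1) * (c + 2)) := by rw [← h1]; ring
    _ = D.choose (i + 1) * ((D + 2) * (D + 1)) := by rw [← h3]; ring
    _ ≤ D.choose (i + 1) * (3 * D * ((i + 2) * (c + 2))) := by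
        refine Nat.mul_le_mul_left _ ?_
        have hic : 2 * D ≤ (i + 2) * (c + 2) := by rw [hD]; nlinarith
        nlinarith [Nat.mul_le_mul_left (3 * D) hic]
    _ = _ := by ring

/-- This handles the extreme splittings `g₁ = 0` and `g₁ = g`, where the genus weights give no gain.
As `m ≤ D - 1`, passing from `C(m, j)` to `C(D-1, j)` gains `m / (D-1)`. Pascal's rule, used three
times, exhibits the two extreme binomials as part of `C(D+2, j)`, and the middle terms are large
enough to leave them at most the fraction `(D-1)/D`. -/
theorem choose_add_choose_le {g m D j : ℕ} (hg : 1 ≤ g) (hD : D + 2 = 3 * g + m) (h2 : 2 ≤ j)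
    (hj : j ≤ D) :
    (m.choose j + m.choose (D + 2 - j)) * D ≤ m * (D + 2).choose j := by
  obtain ⟨E, rfl⟩ : ∃ E, D = E + 1 := ⟨D - 1, by omega⟩
  have hE : 0 < E := by omega
  have hm : m ≤ E := by omega
  have a1 := choose_mul_le_mul_choose hm (show 1 ≤ j by omega)
  have a2 := choose_mul_le_mul_choose hm (show 1 ≤ E + 1 + 2 - j by omega)
  have hb := choose_add_two_le h2 hj
  obtain ⟨i, rfl⟩ : ∃ i, j = i + 2 := ⟨j - 2, by omega⟩
  rw [show i + 2 - 1 = i + 1 by omega] at hb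
  have hv : (E + 1 + 2).choose (i + 2) = E.choose (i + 2) + 3 * (E + 1).choose (i + 1) +
      E.choose (E + 1 + 2 - (i + 2)) := by
    rw [show E + 1 + 2 = E + 1 + 1 + 1 from rfl, show i + 2 = i + 1 + 1 from rfl,
      Nat.choose_succ_succ' (E + 1 + 1), Nat.choose_succ_succ' (E + 1) (i + 1),
      Nat.choose_succ_succ' E (i + 1), Nat.choose_succ_succ' (E + 1) i]
    rcases i with _ | i
    · rw [Nat.choose_eq_zero_of_lt (show E < E + 1 + 1 + 1 - (0 + 1 + 1) by omega)]
      simp only [Nat.choose_succ_succ', Nat.choose_zero_right]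
      ring
    · rw [Nat.choose_symm_of_eq_add (n := E) (a := E + 1 + 1 + 1 - (i + 1 + 1 + 1)) (b := i)
        (by omega)]
      simp only [Nat.choose_succ_succ']
      ring
  refine Nat.le_of_mul_le_mul_right (c := E) ?_ hE
  have hmul : E.choose (i + 2) + E.choose (E + 1 + 2 - (i + 2)) + 3 * (E + 1).choose (i + 1) =
    (E + 1 + 2).choose (i + 2) := by rw [hv]; ring
  have hmain : (E.choose (i + 2) + E.choose (E + 1 + 2 - (i + 2))) * (E + 1) ≤
      E * (E + 1 + 2).choose (i + 2) := by nlinarith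
  calc (m.choose (i + 2) + m.choose (E + 1 + 2 - (i + 2))) * (E + 1) * E
      = (m.choose (i + 2) * E + m.choose (E + 1 + 2 - (i + 2)) * E) * (E + 1) := by ring
    _ ≤ (m * E.choose (i + 2) + m * E.choose (E + 1 + 2 - (i + 2))) * (E + 1) := by gcongr
    _ = m * ((E.choose (i + 2) + E.choose (E + 1 + 2 - (i + 2))) * (E + 1)) := by ring
    _ ≤ m * (E * (E + 1 + 2).choose (i + 2)) := by gcongr
    _ = _ := by ring

/-- A subsum of Vandermonde's identity for `3g + m`, over the indices divisible by `3`. -/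
theorem sum_choose_mul_choose_le (g m j : ℕ) :
    ∑ g₁ ∈ Finset.range (g + 1), ∑ m₁ ∈ Finset.range (m + 1),
      (if j = 3 * g₁ + m₁ then (3 * g).choose (3 * g₁) * m.choose m₁ else 0) ≤
      (3 * g + m).choose j := by
  rw [Nat.add_choose_eq, ← Finset.sum_product', ← Finset.sum_filter]
  have hinj : Set.InjOn (fun p : ℕ × ℕ => (3 * p.1, p.2))
      ((Finset.range (g + 1) ×ˢ Finset.range (m + 1)).filter fun p => j = 3 * p.1 + p.2) := by
    rintro ⟨a, b⟩ - ⟨c, d⟩ - h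
    simp only [Prod.mk.injEq] at h ⊢
    omega
  rw [← Finset.sum_image (f := fun q : ℕ × ℕ => (3 * g).choose q.1 * m.choose q.2) hinj]
  refine Finset.sum_le_sum_of_subset ?_
  intro q hq
  obtain ⟨p, hp, rfl⟩ := Finset.mem_image.1 hq
  simp only [Finset.mem_filter] at hp
  simp [hp.2]

/-- The decaying weight `6 / (D + 6)` in the bounds. -/
def decayWeight (D : ℕ) : ℝ := 6 / (D + 6)

theorem decayWeight_pos (D : ℕ) : 0 < decayWeight D := by
  unfold decayWeight; positivity

/-- The factor gained in the sum over the splittings. -/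
def splitFactor (g m D : ℕ) : ℝ := if g = 0 then 1 else m / D + 9 / 100

theorem splitFactor_nonneg (g m D : ℕ) : 0 ≤ splitFactor g m D := by
  unfold splitFactor; split_ifs <;> positivity

/-- `splitWeight` is designed for this identity: it is what a product of two majorants costs, with
its multiplicities, relative to the majorant of degree `a + c + 2`. -/
theorem decayWeight_mul_factorial (a c : ℕ) :
    decayWeight a * decayWeight c * (a ! * c !) * (min a c + 1 : ℕ) *
      ((a + c + 4).choose (a + 2) : ℝ) =
      decayWeight (a + c + 2) * (a + c + 2)! * splitWeight a c := by
  have h := Nat.add_choose_mul_factorial_mul_factorial (a + 2) (c + 2)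
  rw [show a + 2 + (c + 2) = a + c + 4 by ring,
    Nat.choose_symm_of_eq_add (show a + c + 4 = (c + 2) + (a + 2) by ring)] at h
  have h' : ((a + c + 4).choose (a + 2) : ℝ) * ((a + 2) * (a + 1) * a !) *
      ((c + 2) * (c + 1) * c !) = (a + c + 4) * (a + c + 3) * (a + c + 2)! := by
    have e : ∀ k : ℕ, ((k + 2)! : ℝ) = (k + 2) * (k + 1) * k ! := by
      intro k
      rw [Nat.factorial_succ, Nat.factorial_succ]
      push_cast
      ring
    have := congrArg (Nat.cast (R := ℝ)) h
    push_cast at this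
    rw [e a, e c, show a + c + 4 = (a + c + 2) + 2 by ring, e (a + c + 2)] at this
    push_cast at this
    rw [show a + c + 4 = (a + c + 2) + 2 by ring]
    linear_combination this
  unfold decayWeight splitWeight
  push_cast
  rw [div_mul_div_comm, div_mul_eq_mul_div, div_mul_eq_mul_div, div_mul_eq_mul_div,
    div_mul_eq_mul_div, div_mul_div_comm, div_eq_div_iff (by positivity) (by positivity)]
  linear_combination 36 * (min (a : ℝ) c + 1) * (a + 6) * (c + 6) * (a + c + 2 + 6) * h'

theorem sum_sum_ite_and_le {x : ℝ} (hx : 0 ≤ x) (s t : Finset ℕ) (i j : ℕ) :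
    ∑ a ∈ s, ∑ b ∈ t, (if a = i ∧ b = j then x else 0) ≤ x := by
  have : ∀ a ∈ s, ∑ b ∈ t, (if a = i ∧ b = j then x else 0) ≤ if a = i then x else 0 := by
    intro a _
    by_cases ha : a = i
    · simp only [ha, true_and, if_true, Finset.sum_ite_eq']
      split_ifs
      exacts [le_rfl, hx]
    · simp [ha]
  refine (Finset.sum_le_sum this).trans ?_
  rw [Finset.sum_ite_eq']
  split_ifs
  exacts [le_rfl, hx]

/-- The end terms `g₁ = 0, g` contribute `m / D` through `choose_add_choose_le`; the interior ones
contribute `9/100` through `genusWeight_mul_le` and Vandermonde. In genus `0` there is a single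
term. -/
theorem sum_choose_mul_genusWeight_le {g m a c : ℕ} (h : 3 * g + m = a + c + 4) :
    ∑ g₁ ∈ Finset.range (g + 1), ∑ m₁ ∈ Finset.range (m + 1),
      (if a + 2 = 3 * g₁ + m₁ then
        (m.choose m₁ : ℝ) * (genusWeight g₁ * genusWeight (g - g₁)) else 0) ≤
      genusWeight g * splitFactor g m (a + c + 2) * ((a + c + 4).choose (a + 2) : ℝ) := by
  rcases Nat.eq_zero_or_pos g with rfl | hg
  · have hm : m = a + c + 4 := by omega
    subst hm
    simp only [splitFactor, if_true, mul_one]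
    have hw : genusWeight 0 = 1 := rfl
    simp [hw, Finset.sum_ite_eq]
    split_ifs
    · exact le_rfl
    · positivity
  have hw := genusWeight_pos g
  have key : ∀ g₁ ∈ Finset.range (g + 1), ∀ m₁ ∈ Finset.range (m + 1),
      (if a + 2 = 3 * g₁ + m₁ then
        (m.choose m₁ : ℝ) * (genusWeight g₁ * genusWeight (g - g₁)) else 0) ≤
      genusWeight g * ((if g₁ = 0 ∧ m₁ = a + 2 then (m.choose (a + 2) : ℝ) else 0) +
        (if g₁ = g ∧ m₁ = m - (c + 2) then (m.choose (c + 2) : ℝ) else 0) +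
        9 / 100 * ((if a + 2 = 3 * g₁ + m₁ then (3 * g).choose (3 * g₁) * m.choose m₁ else 0 : ℕ)
          : ℝ)) := by
    intro g₁ hg₁ m₁ hm₁
    rw [Finset.mem_range] at hg₁ hm₁
    have p1 : (0 : ℝ) ≤ if g₁ = 0 ∧ m₁ = a + 2 then (m.choose (a + 2) : ℝ) else 0 := by
      split_ifs <;> positivity
    have p2 : (0 : ℝ) ≤ if g₁ = g ∧ m₁ = m - (c + 2) then (m.choose (c + 2) : ℝ) else 0 := by
      split_ifs <;> positivity
    by_cases hcond : a + 2 = 3 * g₁ + m₁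
    swap
    · rw [if_neg hcond]
      positivity
    rw [if_pos hcond, if_pos hcond]
    have p3 : (0 : ℝ) ≤ 9 / 100 * ((3 * g).choose (3 * g₁) * m.choose m₁ : ℕ) := by positivity
    by_cases h0 : g₁ = 0
    · subst h0
      have hw0 : genusWeight 0 = 1 := rfl
      rw [if_pos ⟨rfl, by omega⟩, hw0, one_mul, Nat.sub_zero, mul_comm,
        show m₁ = a + 2 by omega]
      refine mul_le_mul_of_nonneg_left ?_ hw.le
      rw [show m₁ = a + 2 by omega] at p2 p3
      linarith
    by_cases h1 : g₁ = g
    · subst h1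
      have hw0 : genusWeight 0 = 1 := rfl
      rw [if_pos (⟨rfl, by omega⟩ : g₁ = g₁ ∧ m₁ = m - (c + 2)), Nat.sub_self, hw0, mul_one,
        mul_comm, ← Nat.choose_symm_of_eq_add (show m = m₁ + (c + 2) by omega)]
      refine mul_le_mul_of_nonneg_left ?_ hw.le
      linarith
    · have hle := genusWeight_mul_le (a := g₁) (b := g - g₁) (by omega) (by omega)
      rw [show g₁ + (g - g₁) = g by omega] at hle
      have : (m.choose m₁ : ℝ) * (genusWeight g₁ * genusWeight (g - g₁)) ≤
          genusWeight g * (9 / 100 * ((3 * g).choose (3 * g₁) * m.choose m₁ : ℕ)) := by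
        refine (mul_le_mul_of_nonneg_left hle (Nat.cast_nonneg _)).trans_eq ?_
        push_cast
        ring
      refine this.trans (mul_le_mul_of_nonneg_left ?_ hw.le)
      linarith
  refine (Finset.sum_le_sum fun g₁ h₁ => Finset.sum_le_sum fun m₁ h₂ => key g₁ h₁ m₁ h₂).trans ?_
  simp only [← Finset.mul_sum, Finset.sum_add_distrib]
  rw [mul_assoc]
  refine mul_le_mul_of_nonneg_left ?_ hw.le
  have s1 := sum_sum_ite_and_le (Nat.cast_nonneg (α := ℝ) (m.choose (a + 2)))
    (Finset.range (g + 1)) (Finset.range (m + 1)) 0 (a + 2)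
  have s2 := sum_sum_ite_and_le (Nat.cast_nonneg (α := ℝ) (m.choose (c + 2)))
    (Finset.range (g + 1)) (Finset.range (m + 1)) g (m - (c + 2))
  have s3 := sum_choose_mul_choose_le g m (a + 2)
  have s3' : ∑ g₁ ∈ Finset.range (g + 1), ∑ m₁ ∈ Finset.range (m + 1),
      ((if a + 2 = 3 * g₁ + m₁ then (3 * g).choose (3 * g₁) * m.choose m₁ else 0 : ℕ) : ℝ) ≤
      ((a + c + 4).choose (a + 2) : ℝ) := by
    rw [h] at s3
    exact_mod_cast s3
  have s4 := choose_add_choose_le (m := m) (D := a + c + 2) (j := a + 2) hg (by omega) (by omega)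
    (by omega)
  rw [show a + c + 2 + 2 - (a + 2) = c + 2 by omega, show a + c + 2 + 2 = a + c + 4 by ring] at s4
  have s4' : ((m.choose (a + 2) : ℝ) + m.choose (c + 2)) ≤
      m / (a + c + 2 : ℕ) * ((a + c + 4).choose (a + 2) : ℝ) := by
    rw [div_mul_eq_mul_div, le_div_iff₀ (by positivity)]
    exact_mod_cast s4
  unfold splitFactor
  rw [if_neg hg.ne', add_mul]
  linarith

/-- The sum over the splittings of the genus and of the arguments. -/
theorem sum_splittings_le {g m n : ℕ} (h : 3 * g + m = n + 4) :
    ∑ g₁ ∈ Finset.range (g + 1), ∑ m₁ ∈ Finset.range (m + 1),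
      (if 2 ≤ 2 * g₁ + m₁ ∧ 2 ≤ 2 * (g - g₁) + (m - m₁) then
        (m.choose m₁ : ℝ) * (genusWeight g₁ * genusWeight (g - g₁) *
          (decayWeight (3 * g₁ + m₁ - 2) * decayWeight (3 * (g - g₁) + (m - m₁) - 2) *
          ((3 * g₁ + m₁ - 2)! * (3 * (g - g₁) + (m - m₁) - 2)!) *
          (min (3 * g₁ + m₁) (3 * (g - g₁) + (m - m₁)) - 1 : ℕ))) else 0) ≤
      7 * (genusWeight g * splitFactor g m (n + 2) * (decayWeight (n + 2) * (n + 2)!)) := by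
  set F : ℕ → ℕ → ℝ := fun a c =>
    decayWeight a * decayWeight c * (a ! * c !) * (min a c + 1 : ℕ) with hF
  have hF0 : ∀ a c, 0 ≤ F a c := fun a c => by
    have := decayWeight_pos a
    have := decayWeight_pos c
    simp only [hF]
    positivity
  have hX0 : ∀ g₁ m₁, 0 ≤ (m.choose m₁ : ℝ) * (genusWeight g₁ * genusWeight (g - g₁)) :=
    fun g₁ m₁ => by
      have := genusWeight_pos g₁
      have := genusWeight_pos (g - g₁)
      positivity
  have hw := genusWeight_pos g
  have hf := splitFactor_nonneg g m (n + 2)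
  have key : ∀ g₁ ∈ Finset.range (g + 1), ∀ m₁ ∈ Finset.range (m + 1),
      (if 2 ≤ 2 * g₁ + m₁ ∧ 2 ≤ 2 * (g - g₁) + (m - m₁) then
        (m.choose m₁ : ℝ) * (genusWeight g₁ * genusWeight (g - g₁) *
          (decayWeight (3 * g₁ + m₁ - 2) * decayWeight (3 * (g - g₁) + (m - m₁) - 2) *
          ((3 * g₁ + m₁ - 2)! * (3 * (g - g₁) + (m - m₁) - 2)!) *
          (min (3 * g₁ + m₁) (3 * (g - g₁) + (m - m₁)) - 1 : ℕ))) else 0) ≤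
      ∑ p ∈ Finset.HasAntidiagonal.antidiagonal n, (if p.1 + 2 = 3 * g₁ + m₁ then
        (m.choose m₁ : ℝ) * (genusWeight g₁ * genusWeight (g - g₁)) else 0) * F p.1 p.2 := by
    intro g₁ hg₁ m₁ hm₁
    rw [Finset.mem_range] at hg₁ hm₁
    have hnn : ∀ p ∈ Finset.HasAntidiagonal.antidiagonal n, 0 ≤ (if p.1 + 2 = 3 * g₁ + m₁ then
        (m.choose m₁ : ℝ) * (genusWeight g₁ * genusWeight (g - g₁)) else 0) * F p.1 p.2 := by
      intro p _
      refine mul_nonneg ?_ (hF0 _ _)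
      split_ifs
      exacts [hX0 _ _, le_rfl]
    split_ifs with hst
    swap
    · exact Finset.sum_nonneg hnn
    -- Splittings are sorted by the degrees of the two factors, which add up to `D - 2 = n`.
    have hp : (3 * g₁ + m₁ - 2, 3 * (g - g₁) + (m - m₁) - 2) ∈
        Finset.HasAntidiagonal.antidiagonal n := by
      rw [Finset.HasAntidiagonal.mem_antidiagonal]
      omega
    refine le_trans (le_of_eq ?_) (Finset.single_le_sum hnn hp)
    rw [if_pos (by omega)]
    simp only [hF]
    rw [show min (3 * g₁ + m₁) (3 * (g - g₁) + (m - m₁)) - 1 =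
      min (3 * g₁ + m₁ - 2) (3 * (g - g₁) + (m - m₁) - 2) + 1 by omega]
    ring
  refine (Finset.sum_le_sum fun g₁ h₁ => Finset.sum_le_sum fun m₁ h₂ => key g₁ h₁ m₁ h₂).trans ?_
  have hcomm : ∑ g₁ ∈ Finset.range (g + 1), ∑ m₁ ∈ Finset.range (m + 1),
      ∑ p ∈ Finset.HasAntidiagonal.antidiagonal n, (if p.1 + 2 = 3 * g₁ + m₁ then
        (m.choose m₁ : ℝ) * (genusWeight g₁ * genusWeight (g - g₁)) else 0) * F p.1 p.2 =
      ∑ p ∈ Finset.HasAntidiagonal.antidiagonal n, (∑ g₁ ∈ Finset.range (g + 1),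
        ∑ m₁ ∈ Finset.range (m + 1), if p.1 + 2 = 3 * g₁ + m₁ then
        (m.choose m₁ : ℝ) * (genusWeight g₁ * genusWeight (g - g₁)) else 0) * F p.1 p.2 := by
    simp only [Finset.sum_mul]
    rw [Finset.sum_comm]
    conv_rhs => rw [Finset.sum_comm]
    rw [Finset.sum_comm]
    refine Finset.sum_congr rfl fun g₁ _ => ?_
    rw [Finset.sum_comm]
  rw [hcomm]
  have hbd : ∀ p ∈ Finset.HasAntidiagonal.antidiagonal n, (∑ g₁ ∈ Finset.range (g + 1),
        ∑ m₁ ∈ Finset.range (m + 1), if p.1 + 2 = 3 * g₁ + m₁ then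
        (m.choose m₁ : ℝ) * (genusWeight g₁ * genusWeight (g - g₁)) else 0) * F p.1 p.2 ≤
      genusWeight g * splitFactor g m (n + 2) * (decayWeight (n + 2) * (n + 2)!) *
        splitWeight p.1 p.2 := by
    intro p hp
    rw [Finset.HasAntidiagonal.mem_antidiagonal] at hp
    refine (mul_le_mul_of_nonneg_right (sum_choose_mul_genusWeight_le (a := p.1) (c := p.2)
      (by omega)) (hF0 _ _)).trans_eq ?_
    have := decayWeight_mul_factorial p.1 p.2
    rw [hp] at this ⊢
    simp only [hF]
    linear_combination genusWeight g * splitFactor g m (n + 2) * this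
  refine (Finset.sum_le_sum hbd).trans ?_
  rw [← Finset.mul_sum, mul_comm]
  have := decayWeight_pos (n + 2)
  exact mul_le_mul_of_nonneg_right (sum_splitWeight_le n) (by positivity)

/-! ### The numerical inequalities behind the supersolution -/

/-- The ratio `w_{g-1} / w_g` of consecutive genus weights. -/
def genusRatio (g : ℕ) : ℝ := if g = 0 then 0 else if g = 1 then 2 / 7 else g - 3 / 2

theorem genusRatio_nonneg (g : ℕ) : 0 ≤ genusRatio g := by
  unfold genusRatio
  split_ifs with h0 h1
  · exact le_rfl
  · norm_num
  · have : (2 : ℝ) ≤ g := by exact_mod_cast (by omega : 2 ≤ g)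
    linarith

theorem genusWeight_pred {g : ℕ} (hg : 0 < g) :
    genusWeight (g - 1) = genusRatio g * genusWeight g := by
  rcases g with _ | _ | g
  · omega
  · norm_num [genusRatio, genusWeight]
  · have h : genusRatio (g + 1 + 1) = (g : ℝ) + 1 / 2 := by
      unfold genusRatio
      rw [if_neg (by omega), if_neg (by omega)]
      push_cast
      ring
    rw [h, genusWeight, Nat.add_sub_cancel]
    field_simp

/-- The factor of the term with a correlator of smaller genus. -/
def genusFactor (g D : ℕ) : ℝ := genusRatio g * (((D : ℝ) + 6) / (D + 4)) / (D * (D - 1))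

/-- The factor of the terms with a correlator with one argument less. -/
def argFactor (D : ℕ) : ℝ := ((D : ℝ) + 6) / (D + 5) / D

/-- The ratio of the growth rates of the bounds in the number of arguments. -/
def argRate (ν : ℝ) : ℝ := 1 / 4 + ν / 22

/-- Eliminating `y` leaves `1 + 4f + f (f - 2) z`, affine in `z`: the worst case is `z = 0` for `f ≤
2` and `z = 1` for `f ≥ 2`. This is the origin of the maximum in `Q`. -/
theorem add_mul_add_sq_mul_le_max {f x y z : ℝ} (hf : 0 ≤ f) (hx : x ≤ 1) (hz0 : 0 ≤ z)
    (hz : z ≤ 1)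
    (hyz : y + 2 * z ≤ 4) : x + f * y + f ^ 2 * z ≤ max ((1 + f) ^ 2) (1 + 4 * f) := by
  have h1 : x + f * y + f ^ 2 * z ≤ 1 + 4 * f + f * (f - 2) * z := by
    have := mul_le_mul_of_nonneg_left (show y ≤ 4 - 2 * z by linarith) hf
    nlinarith
  rcases le_total f 2 with h | h
  · refine h1.trans (le_max_of_le_right ?_)
    nlinarith [mul_nonneg (mul_nonneg hf (sub_nonneg.2 h)) hz0]
  · refine h1.trans (le_max_of_le_left ?_)
    nlinarith [mul_nonneg (mul_nonneg hf (sub_nonneg.2 h)) (sub_nonneg.2 hz)]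

section

variable {ν : ℝ} (h0 : 0 ≤ ν) (h1 : ν ≤ 0.578)
include h0 h1

theorem argRate_le : argRate ν ≤ 0.2763 := by unfold argRate; linarith

theorem argRate_pos : 0 < argRate ν := by unfold argRate; positivity

theorem argRate_sq_le : argRate ν ^ 2 * (1 - ν) ≤ 1 / 16 - 0.0397 * ν := by
  have : 1 / 16 - 0.0397 * ν - argRate ν ^ 2 * (1 - ν) =
    ν * ((1 / 16 - 1 / 44 - 0.0397) + (1 / 44 - 1 / 484) * ν + ν ^ 2 / 484) := by
    unfold argRate; ring
  have h2 : (0 : ℝ) ≤ 1 / 16 - 1 / 44 - 0.0397 := by norm_num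
  have h3 : (0 : ℝ) ≤ 1 / 44 - 1 / 484 := by norm_num
  have : 0 ≤ 1 / 16 - 0.0397 * ν - argRate ν ^ 2 * (1 - ν) := by rw [this]; positivity
  linarith

theorem argRate_mul_argFactor_le {D : ℕ} (hD : 1 ≤ D) {B : ℝ} (hB : B ≤ 3 * D) :
    argRate ν * argFactor D * B ≤ 1 := by
  have hD' : (1 : ℝ) ≤ D := by exact_mod_cast hD
  have hc := argRate_le h0 h1
  have hc0 := (argRate_pos h0 h1).le
  have h2 : ((D : ℝ) + 6) / (D + 5) ≤ 7 / 6 := by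
    rw [div_le_div_iff₀ (by positivity) (by norm_num)]; linarith
  have h3 : B / D ≤ 3 := by rw [div_le_iff₀ (by positivity)]; exact hB
  have e : argRate ν * argFactor D * B = argRate ν * (((D : ℝ) + 6) / (D + 5)) * (B / D) := by
    unfold argFactor; field_simp
  rw [e]
  calc _ ≤ argRate ν * (((D : ℝ) + 6) / (D + 5)) * 3 := by gcongr
    _ ≤ 0.2763 * (7 / 6) * 3 := by gcongr
    _ ≤ 1 := by norm_num

/-- Genus `0`. The slope `1/22` of `argRate` is harmless here, since the growth `3.02/22` in `ν` of
the first term is outweighed by the decrease `3.5 · 0.0397` of the second. -/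
theorem main_le_zero {D : ℝ} (hD : 2 ≤ D) :
    argRate ν * ((D + 6) / (D + 5) / D) * (3 * D - 2) + 7 / 2 * (argRate ν ^ 2 * (1 - ν)) ≤ 1 := by
  have hc := argRate_sq_le h0 h1
  have hc0 := (argRate_pos h0 h1).le
  have h2 : ((D : ℝ) + 6) / (D + 5) / D * (3 * D - 2) ≤ 3.02 := by
    rw [div_div, div_mul_eq_mul_div, div_le_iff₀ (by positivity)]
    nlinarith [sq_nonneg (D - 22.5)]
  have h3 := mul_le_mul_of_nonneg_left h2 hc0
  have h4 : argRate ν * 3.02 = 3.02 / 4 + 3.02 / 22 * ν := by unfold argRate; ring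
  rw [h4] at h3
  linarith

/-- The left side is affine in `X` and in `Y` separately, so the four corners of the square suffice.
-/
theorem bilinear_le {X Y : ℝ} (hX0 : 0 ≤ X) (hX1 : X ≤ 1) (hY0 : 0 ≤ Y) (hY1 : Y ≤ 1) :
    argRate ν * (2 * X + Y) + 0.97 * ((1 - X) * (1 - Y)) +
      7 / 2 * (argRate ν ^ 2 * (1 - ν)) * (Y + 0.09) ≤ 1 := by
  have hc := argRate_sq_le h0 h1
  set s := argRate ν ^ 2 * (1 - ν)
  have hs : s ≤ 1 / 16 := by linarith
  have hc' : argRate ν ≤ 0.2763 := argRate_le h0 h1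
  have hcd : argRate ν = 1 / 4 + ν / 22 := rfl
  set c := argRate ν
  have v00 : 0.97 + 7 / 2 * s * 0.09 ≤ 1 := by linarith
  have v10 : 2 * c + 7 / 2 * s * 0.09 ≤ 1 := by linarith
  have v01 : c + 7 / 2 * s * 1.09 ≤ 1 := by linarith
  have v11 : 3 * c + 7 / 2 * s * 1.09 ≤ 1 := by linarith
  have hX2 : 0 ≤ 1 - X := by linarith
  have hY2 : 0 ≤ 1 - Y := by linarith
  nlinarith [mul_le_mul_of_nonneg_left v00 (mul_nonneg hX2 hY2),
    mul_le_mul_of_nonneg_left v10 (mul_nonneg hX0 hY2),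
    mul_le_mul_of_nonneg_left v01 (mul_nonneg hX2 hY0),
    mul_le_mul_of_nonneg_left v11 (mul_nonneg hX0 hY0)]

theorem main_le_one {D e : ℝ} (hD : D = 2 ∧ e = 0 ∨ 3 ≤ D) (he0 : 0 ≤ e) (he : e ≤ D - 2) :
    argRate ν * ((D + 6) / (D + 5) / D) * (2 * e + (D - 1)) +
      2.91 * (2 / 7 * ((D + 6) / (D + 4)) / (D * (D - 1))) * (D - 1 - e) +
      7 / 2 * (argRate ν ^ 2 * (1 - ν)) * ((D - 1) / D + 9 / 100) ≤ 1 := by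
  have hc := argRate_sq_le h0 h1
  have hc' : argRate ν ≤ 0.2763 := argRate_le h0 h1
  have hcd : argRate ν = 1 / 4 + ν / 22 := rfl
  have hc0 := (argRate_pos h0 h1).le
  have hs0 : 0 ≤ argRate ν ^ 2 * (1 - ν) := mul_nonneg (sq_nonneg _) (by linarith)
  rcases hD with ⟨rfl, rfl⟩ | hD
  · norm_num
    linarith
  set s := argRate ν ^ 2 * (1 - ν)
  set c := argRate ν
  have hD1 : 0 < D - 1 := by linarith
  set X := e / (D - 1) with hX
  have hX0 : 0 ≤ X := by positivity
  have hX1 : X ≤ 1 := by rw [hX, div_le_one hD1]; linarith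
  have he' : e = X * (D - 1) := by rw [hX]; field_simp
  have a1 : (D + 6) / (D + 5) / D * (2 * e + (D - 1)) ≤ 2 * X + 1 := by
    rw [div_div, div_mul_eq_mul_div, div_le_iff₀ (by positivity), he']
    have : (D + 6) * (D - 1) ≤ (D + 5) * D := by nlinarith
    nlinarith [mul_le_mul_of_nonneg_left this (show 0 ≤ 2 * X + 1 by linarith)]
  have a2 : 2 / 7 * ((D + 6) / (D + 4)) / (D * (D - 1)) * (D - 1 - e) ≤ 2 / 7 * (3 / 7) * (1 - X) := by
    have : 2 / 7 * ((D + 6) / (D + 4)) / (D * (D - 1)) * (D - 1 - e) =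
      2 / 7 * ((D + 6) / (D + 4) / D) * (1 - X) := by rw [he']; field_simp
    rw [this]
    have h3 : (D + 6) / (D + 4) / D ≤ 3 / 7 := by
      rw [div_div, div_le_div_iff₀ (by positivity) (by norm_num)]
      nlinarith
    have : 0 ≤ 1 - X := by linarith
    gcongr
  have a3 : (D - 1) / D + 9 / 100 ≤ 1.09 := by
    have : (D - 1) / D ≤ 1 := by rw [div_le_one (by linarith)]; linarith
    linarith
  have b1 := mul_le_mul_of_nonneg_left a1 hc0
  have b3 := mul_le_mul_of_nonneg_left a3 (show 0 ≤ 7 / 2 * s by positivity)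
  nlinarith [mul_nonneg hc0 (sub_nonneg.2 hX1)]

/-- With `X = e/(D-1)` and `Y = m/(D-1)` every term is dominated by its counterpart in
`bilinear_le`; the shift `3/2` in the genus ratio yields the factor `1 - Y`, and `2.91 / 3 = 0.97`.
-/
theorem main_le_two {D e m : ℝ} (hD : 4 ≤ D) (hm0 : 0 ≤ m) (hm : m ≤ D - 4) (he0 : 0 ≤ e)
    (he : e ≤ D - 2) :
    argRate ν * ((D + 6) / (D + 5) / D) * (2 * e + m) +
      2.91 * (((D + 2 - m) / 3 - 3 / 2) * ((D + 6) / (D + 4)) / (D * (D - 1))) * (D - 1 - e) +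
      7 / 2 * (argRate ν ^ 2 * (1 - ν)) * (m / D + 9 / 100) ≤ 1 := by
  have hc0 := (argRate_pos h0 h1).le
  have hs0 : 0 ≤ argRate ν ^ 2 * (1 - ν) := mul_nonneg (sq_nonneg _) (by linarith)
  have hD1 : 0 < D - 1 := by linarith
  set X := e / (D - 1) with hX
  have hX0 : 0 ≤ X := by positivity
  have hX1 : X ≤ 1 := by rw [hX, div_le_one hD1]; linarith
  have he' : e = X * (D - 1) := by rw [hX]; field_simp
  set Y := m / (D - 1) with hY
  have hY0 : 0 ≤ Y := by positivity
  have hY1 : Y ≤ 1 := by rw [hY, div_le_one hD1]; linarith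
  have hm' : m = Y * (D - 1) := by rw [hY]; field_simp
  have hb := bilinear_le h0 h1 hX0 hX1 hY0 hY1
  have a1 : (D + 6) / (D + 5) / D * (2 * e + m) ≤ 2 * X + Y := by
    rw [div_div, div_mul_eq_mul_div, div_le_iff₀ (by positivity), he', hm']
    have : (D + 6) * (D - 1) ≤ (D + 5) * D := by nlinarith
    nlinarith [mul_le_mul_of_nonneg_left this (show 0 ≤ 2 * X + Y by linarith)]
  have a2 : ((D + 2 - m) / 3 - 3 / 2) * ((D + 6) / (D + 4)) / (D * (D - 1)) * (D - 1 - e) ≤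
      1 / 3 * ((1 - X) * (1 - Y)) := by
    have e1 : ((D + 2 - m) / 3 - 3 / 2) * ((D + 6) / (D + 4)) / (D * (D - 1)) * (D - 1 - e) =
      1 / 3 * ((D - 5 / 2 - m) * (D + 6) / ((D + 4) * D)) * (1 - X) := by
      rw [he']; field_simp; ring
    have h3 : (D - 5 / 2 - m) * (D + 6) / ((D + 4) * D) ≤ 1 - Y := by
      have : 1 - Y = (D - 1 - m) / (D - 1) := by rw [hY]; field_simp
      rw [this, div_le_div_iff₀ (by positivity) hD1]
      nlinarith [mul_nonneg (sub_nonneg.2 hm) (sub_nonneg.2 hD), mul_nonneg hm0 (sub_nonneg.2 hD)]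
    rw [e1]
    have : 0 ≤ 1 - X := by linarith
    calc _ ≤ 1 / 3 * (1 - Y) * (1 - X) := by gcongr
      _ = _ := by ring
  have a3 : m / D + 9 / 100 ≤ Y + 0.09 := by
    have : m / D ≤ Y := by rw [hY]; gcongr; linarith
    linarith
  have b1 := mul_le_mul_of_nonneg_left a1 hc0
  have b3 := mul_le_mul_of_nonneg_left a3 (show 0 ≤ 7 / 2 * (argRate ν ^ 2 * (1 - ν)) by positivity)
  linarith

/-- This is the part of the recursion free of `φ`, divided by the majorant: the summands come from
`ω_{0,2}`, from the lower genus and from the splittings. Genus `0` has no lower genus term and genus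
`1` has an exceptional weight, whence three cases. -/
theorem main_le {g m D e : ℕ} (hD : D + 2 = 3 * g + m) (he : e + 2 ≤ D) {B : ℝ}
    (hB : B ≤ 2 * e + m) :
    argRate ν * argFactor D * B + 2.91 * genusFactor g D * ((D : ℝ) - 1 - e) +
      7 / 2 * (argRate ν ^ 2 * (1 - ν)) * splitFactor g m D ≤ 1 := by
  have hc0 := (argRate_pos h0 h1).le
  have he' : (e : ℝ) + 2 ≤ D := by exact_mod_cast he
  have he0 : (0 : ℝ) ≤ e := e.cast_nonneg
  have hm0 : (0 : ℝ) ≤ m := m.cast_nonneg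
  have hD' : (D : ℝ) + 2 = 3 * g + m := by exact_mod_cast hD
  have hr : 0 ≤ argFactor D := by unfold argFactor; positivity
  have hB' := mul_le_mul_of_nonneg_left hB (mul_nonneg hc0 hr)
  rcases lt_trichotomy g 1 with hg | rfl | hg
  · obtain rfl : g = 0 := by omega
    have hb2 : (2 : ℝ) * e + m ≤ 3 * D - 2 := by push_cast at hD'; linarith
    have := mul_le_mul_of_nonneg_left hb2 (mul_nonneg hc0 hr)
    have h := main_le_zero h0 h1 (D := D) (by linarith)
    unfold argFactor at *
    simp only [genusFactor, genusRatio, splitFactor, if_true, zero_mul, zero_div, mul_zero, mul_one]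
    linarith
  · have hm : (m : ℝ) = D - 1 := by push_cast at hD'; linarith
    have h := main_le_one h0 h1 (D := D) (e := e) (by
      rcases (by omega : D = 2 ∧ e = 0 ∨ 3 ≤ D) with ⟨h, h'⟩ | h
      · left; rw [h, h']; norm_num
      · right; exact_mod_cast h) he0 (by linarith)
    unfold argFactor at *
    simp only [genusFactor, genusRatio, splitFactor, if_true, if_neg one_ne_zero]
    rw [hm] at hB' ⊢
    linarith
  · have hg' : (g : ℝ) = (D + 2 - m) / 3 := by linarith
    have hg2 : (2 : ℝ) ≤ g := by exact_mod_cast hg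
    have hD4 : (4 : ℝ) ≤ D := by exact_mod_cast (by omega : 4 ≤ D)
    have h := main_le_two h0 h1 (D := D) (e := e) (m := m) hD4 hm0 (by linarith) he0 (by linarith)
    unfold argFactor at *
    simp only [genusFactor, genusRatio, splitFactor, if_neg (show g ≠ 0 by omega),
      if_neg (show g ≠ 1 by omega)]
    rw [hg']
    linarith

omit h0 h1 in
theorem genusFactor_le {g m D : ℕ} (hD : D + 2 = 3 * g + m) (h2 : 2 ≤ D) :
    genusFactor g D ≤ 4 / 21 := by
  have h2' : (2 : ℝ) ≤ D := by exact_mod_cast h2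
  have hr : ((D : ℝ) + 6) / (D + 4) ≤ 4 / 3 := by
    rw [div_le_div_iff₀ (by positivity) (by norm_num)]; linarith
  have hg : genusRatio g / (D * (D - 1)) ≤ 1 / 7 := by
    have hpos : (0 : ℝ) < D * (D - 1) := mul_pos (by linarith) (by linarith)
    rw [div_le_iff₀ hpos]
    unfold genusRatio
    split_ifs with a b
    · positivity
    · nlinarith
    · have hg' : 3 * (g : ℝ) ≤ D + 2 := by exact_mod_cast (by omega : 3 * g ≤ D + 2)
      have : (4 : ℝ) ≤ D := by exact_mod_cast (by omega : 4 ≤ D)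
      nlinarith
  have hg0 := genusRatio_nonneg g
  have e : genusFactor g D = genusRatio g / (D * (D - 1)) * (((D : ℝ) + 6) / (D + 4)) := by
    unfold genusFactor; ring
  rw [e]
  calc _ ≤ 1 / 7 * (((D : ℝ) + 6) / (D + 4)) := by gcongr
    _ ≤ 1 / 7 * (4 / 3) := by gcongr
    _ = 4 / 21 := by norm_num

omit h0 h1 in
theorem splitFactor_le {g m D : ℕ} (hD : D + 2 = 3 * g + m) : splitFactor g m D ≤ 1.09 := by
  unfold splitFactor
  split_ifs with h
  · norm_num
  · have : (m : ℝ) / D ≤ 1 :=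
      div_le_one_of_le₀ (by exact_mod_cast (by omega : m ≤ D)) (Nat.cast_nonneg _)
    linarith

omit h0 h1 in
theorem argFactor_mul_le {g m D : ℕ} (hD : D + 2 = 3 * g + m) (h1 : 1 ≤ D) :
    argFactor D * m ≤ 3.5 := by
  have h1' : (1 : ℝ) ≤ D := by exact_mod_cast h1
  have hm : (m : ℝ) ≤ D + 2 := by exact_mod_cast (by omega : m ≤ D + 2)
  unfold argFactor
  rw [div_div, div_mul_eq_mul_div, div_le_iff₀ (by positivity)]
  nlinarith

/-- The terms that are linear and quadratic in `φ` are controlled. -/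
theorem cross_le {x σ y : ℝ} (hx : x ≤ 4 / 21) (hσ0 : 0 ≤ σ) (hσ : σ ≤ 1.09)
    (hy0 : 0 ≤ y) (hy : y ≤ 3.5) :
    (3 / 2 * ν * (1 - ν) * argRate ν * y + 5.82 * x * (3 / 2 * ν) / (1 - ν) +
      7 * argRate ν ^ 2 * σ * (3 / 2 * ν)) +
    2 * (2.91 * x * (3 / 2 * ν) ^ 2 * (1 - ν) +
      7 / 2 * argRate ν ^ 2 * σ * (3 / 2 * ν) ^ 2 * (1 - ν) ^ 2) ≤ 4 ∧
    2.91 * x * (3 / 2 * ν) ^ 2 * (1 - ν) +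
      7 / 2 * argRate ν ^ 2 * σ * (3 / 2 * ν) ^ 2 * (1 - ν) ^ 2 ≤ 1 := by
  have hc := argRate_le h0 h1
  have hc0 := (argRate_pos h0 h1).le
  have hν1 : 0 < 1 - ν := by linarith
  have k1 : ν * (1 - ν) ≤ 1 / 4 := by nlinarith [sq_nonneg (ν - 1 / 2)]
  have k0 : 0 ≤ ν * (1 - ν) := mul_nonneg h0 hν1.le
  have k2 : ν / (1 - ν) ≤ 1.37 := by rw [div_le_iff₀ hν1]; linarith
  have c2 : argRate ν ^ 2 ≤ 0.0764 := by
    calc argRate ν ^ 2 ≤ 0.2763 ^ 2 := by gcongr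
      _ ≤ 0.0764 := by norm_num
  have t1 : 3 / 2 * ν * (1 - ν) * argRate ν * y ≤ 0.37 := by
    calc 3 / 2 * ν * (1 - ν) * argRate ν * y = 3 / 2 * (ν * (1 - ν)) * argRate ν * y := by ring
      _ ≤ 3 / 2 * (1 / 4) * 0.2763 * 3.5 := by gcongr
      _ ≤ 0.37 := by norm_num
  have t2 : 5.82 * x * (3 / 2 * ν) / (1 - ν) ≤ 2.28 := by
    calc 5.82 * x * (3 / 2 * ν) / (1 - ν) = 5.82 * x * (3 / 2 * (ν / (1 - ν))) := by ring
      _ ≤ 5.82 * (4 / 21) * (3 / 2 * 1.37) := by gcongr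
      _ ≤ 2.28 := by norm_num
  have t3 : 7 * argRate ν ^ 2 * σ * (3 / 2 * ν) ≤ 0.51 := by
    calc 7 * argRate ν ^ 2 * σ * (3 / 2 * ν) ≤ 7 * 0.0764 * 1.09 * (3 / 2 * 0.578) := by gcongr
      _ ≤ 0.51 := by norm_num
  have t4 : 2.91 * x * (3 / 2 * ν) ^ 2 * (1 - ν) ≤ 0.19 := by
    calc 2.91 * x * (3 / 2 * ν) ^ 2 * (1 - ν) = 2.91 * x * (9 / 4 * (ν * (ν * (1 - ν)))) := by ring
      _ ≤ 2.91 * (4 / 21) * (9 / 4 * (0.578 * (1 / 4))) := by gcongr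
      _ ≤ 0.19 := by norm_num
  have t5 : 7 / 2 * argRate ν ^ 2 * σ * (3 / 2 * ν) ^ 2 * (1 - ν) ^ 2 ≤ 0.05 := by
    calc 7 / 2 * argRate ν ^ 2 * σ * (3 / 2 * ν) ^ 2 * (1 - ν) ^ 2 =
        7 / 2 * argRate ν ^ 2 * σ * (9 / 4 * (ν * (1 - ν)) ^ 2) := by ring
      _ ≤ 7 / 2 * 0.0764 * 1.09 * (9 / 4 * (1 / 4) ^ 2) := by gcongr
      _ ≤ 0.05 := by norm_num
  constructor <;> linarith

end

/-! ### The initial cases -/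

namespace LocalData

variable {ι : Type*} [Fintype ι] [DecidableEq ι] {L : LocalData ι} (N : ℕ)
variable {Mθ Mφ ρ : ℝ} (hL : L.Bounds Mθ Mφ ρ)

theorem ser_eq_zero_or_eq_X_pow (a : ι) {m : ℕ} (hm : m = 1) (κ : Fin m → ι × ℕ)
    (hκ : ∀ k, (κ k).2 = 0) : L.ser N a 0 m κ = 0 ∨ L.ser N a 0 m κ = PowerSeries.X ^ N := by
  unfold ser
  rw [dif_pos ⟨rfl, hm⟩]
  split_ifs
  · right
    rw [hκ]
    simp
  · left
    rfl

include hL in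
-- For `ω_{0,3}` the bracket consists of the two products of two factors `ω_{0,2}`, and the degree
-- bound forces all indices to be `0`.
theorem Bounds.norm_coef_zero_two_le (lam : ι × ℕ) (κ : Fin 2 → ι × ℕ) :
    ‖L.coef N 0 2 lam κ‖ ≤ Mθ / ρ := by
  have hρ := hL.ρ_pos
  have hM : 0 ≤ Mθ / ρ := (div_pos hL.Mθ_pos hρ).le
  by_cases h0 : L.coef N 0 2 lam κ = 0
  · rw [h0, norm_zero]; exact hM
  have hs := L.coef_support N _ _ _ rfl lam κ h0
  have hκ : ∀ k, (κ k).2 = 0 := by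
    intro k
    have := Finset.single_le_sum (f := fun k => (κ k).2) (fun _ _ => Nat.zero_le _)
      (Finset.mem_univ k)
    omega
  have hi : lam.2 = 0 := by omega
  rw [L.coef_eq N (by norm_num) lam (by omega), norm_mul, hi, Nat.sub_zero]
  have hJ : ∀ J : Finset (Fin 2), wt ρ (2 * N) (L.splitSer N lam.1 0 2 κ 0 J) ≤
      ρ ^ (2 * N) * if J.card = 1 then ∑ k ∈ J, (1 : ℝ) else 0 := by
    intro J
    have hc := splitting_card J
    have hz : (0 : ℝ) ≤ ρ ^ (2 * N) * if J.card = 1 then ∑ k ∈ J, (1 : ℝ) else 0 := by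
      split_ifs <;> positivity
    unfold splitSer
    split_ifs with h1 h2 h2
    · have e1 : ∀ k, (restrict J κ k).2 = 0 := fun k => hκ _
      have e2 : ∀ k, (restrict Jᶜ κ k).2 = 0 := fun k => hκ _
      rcases ser_eq_zero_or_eq_X_pow (L := L) N lam.1 h2 (restrict J κ) e1 with h | h
      · rw [h, zero_mul, wt_zero, if_pos h2] at *
        simpa using hz
      rcases ser_eq_zero_or_eq_X_pow (L := L) N lam.1 (show Jᶜ.card = 1 by omega)
        (restrict Jᶜ κ) e2 with h' | h'
      · rw [Nat.sub_zero, h', mul_zero, wt_zero]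
        rw [if_pos h2] at hz
        exact hz
      · rw [Nat.sub_zero, h, h', ← pow_add, ← two_mul]
        refine (wt_X_pow_le _ _).trans ?_
        rw [if_pos le_rfl]
        simp [h2]
    · omega
    · rw [wt_zero]
      simpa [h2] using hz
    · rw [wt_zero, mul_zero]
  have hwt : wt ρ (2 * N) (L.genusSer N lam.1 0 2 κ + ∑ g₁ : Fin (0 + 1), ∑ J : Finset (Fin 2),
      L.splitSer N lam.1 0 2 κ g₁ J) ≤ ρ ^ (2 * N) * 2 := by
    have : L.genusSer N lam.1 0 2 κ = 0 := by simp [genusSer]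
    have h1 : ∑ g₁ : Fin (0 + 1), ∑ J : Finset (Fin 2), L.splitSer N lam.1 0 2 κ g₁ J =
      ∑ J : Finset (Fin 2), L.splitSer N lam.1 0 2 κ 0 J := Fin.sum_univ_one _
    rw [this, zero_add, h1]
    refine (wt_sum_le hρ _ _ _).trans ((Finset.sum_le_sum fun J _ => hJ J).trans_eq ?_)
    rw [← Finset.mul_sum, sum_finset_card_eq_one]
    simp
  have := norm_coeff_mul_le hρ (2 * N) (F := L.genusSer N lam.1 0 2 κ + ∑ g₁ : Fin (0 + 1),
      ∑ J : Finset (Fin 2), L.splitSer N lam.1 0 2 κ g₁ J) (hL.theta_le lam.1)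
  have h2 : ‖(1 / 2 : ℂ)‖ = 1 / 2 := by norm_num
  rw [h2]
  calc _ ≤ 1 / 2 * (Mθ / ρ / ρ ^ (2 * N) * (ρ ^ (2 * N) * 2)) := by
        refine mul_le_mul_of_nonneg_left (this.trans ?_) (by norm_num)
        exact mul_le_mul_of_nonneg_left hwt (by positivity)
    _ = _ := by field_simp

theorem coef_one_zero (lam : ι × ℕ) (hlam : lam.2 ≤ 2 * N) (κ : Fin 0 → ι × ℕ) :
    L.coef N 1 0 lam κ = 1 / 2 * PowerSeries.coeff (2 * N - lam.2) (L.theta lam.1 *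
      (PowerSeries.C (1 / 4) * PowerSeries.X ^ (2 * N - 1) +
        PowerSeries.C (PowerSeries.coeff 0 (L.phi lam.1 lam.1 0)) * PowerSeries.X ^ (2 * N))) := by
  rw [L.coef_eq N (by norm_num) lam hlam]
  have hs : ∑ g₁ : Fin (1 + 1), ∑ J : Finset (Fin 0), L.splitSer N lam.1 1 0 κ g₁ J = 0 := by
    refine Finset.sum_eq_zero fun g₁ _ => Finset.sum_eq_zero fun J _ => ?_
    have hc := splitting_card J
    have := g₁.2
    unfold splitSer
    rw [if_neg (by omega)]
  rw [hs, add_zero, genusSer, if_pos one_pos, if_pos ⟨rfl, rfl⟩]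

include hL in
-- For `ω_{1,1}` the degree is at most `1`; the double pole contributes `θ_1 / 4` or `θ_0 / 4`, and
-- the regular part `φ_{00} θ_0` only in degree `0`.
theorem Bounds.norm_coef_one_zero_le (hN : 1 ≤ N) (lam : ι × ℕ) (κ : Fin 0 → ι × ℕ) :
    ‖L.coef N 1 0 lam κ‖ ≤ (if lam.2 = 0 then (1 + 4 * (ρ * Mφ)) / ρ else 1) * (Mθ / (8 * ρ)) := by
  have hρ := hL.ρ_pos
  have hM := hL.Mθ_pos
  have hf := hL.Mφ_nonneg
  by_cases h0 : L.coef N 1 0 lam κ = 0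
  · rw [h0, norm_zero]
    split_ifs <;> positivity
  have hs := L.coef_support N _ _ _ rfl lam κ h0
  simp only [Finset.univ_eq_empty, Finset.sum_empty] at hs
  rw [coef_one_zero N lam (by omega), mul_add, map_add, mul_left_comm, mul_left_comm (L.theta _),
    PowerSeries.coeff_C_mul, PowerSeries.coeff_C_mul, PowerSeries.coeff_mul_X_pow',
    PowerSeries.coeff_mul_X_pow', if_pos (by omega)]
  have t0 := hL.theta_le lam.1 0
  have t1 := hL.theta_le lam.1 1
  rw [zero_add, pow_one] at t0
  have p0 := hL.phi_le lam.1 lam.1 0 0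
  simp only [pow_zero, div_one, CharP.cast_eq_zero, mul_zero, zero_add] at p0
  rcases (by omega : lam.2 = 0 ∨ lam.2 = 1) with h | h
  · rw [h, if_pos rfl, if_pos (by omega), show 2 * N - 0 - (2 * N - 1) = 1 by omega,
      show 2 * N - 0 - 2 * N = 0 by omega]
    rw [norm_mul]
    have hn : ‖(1 / 2 : ℂ)‖ = 1 / 2 := by norm_num
    have hn4 : ‖(1 / 4 : ℂ)‖ = 1 / 4 := by norm_num
    rw [hn]
    calc _ ≤ 1 / 2 * (1 / 4 * (Mθ / ρ ^ (1 + 1)) + Mφ * (Mθ / ρ)) := by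
          refine mul_le_mul_of_nonneg_left ((norm_add_le _ _).trans (add_le_add ?_ ?_))
            (by norm_num)
          · rw [norm_mul, hn4]; gcongr
          · rw [norm_mul]; gcongr
      _ = _ := by field_simp; ring
  · rw [h, if_neg (by omega), if_neg (by omega), show 2 * N - 1 - (2 * N - 1) = 0 by omega]
    rw [mul_zero, add_zero, norm_mul, norm_mul]
    have hn : ‖(1 / 2 : ℂ)‖ = 1 / 2 := by norm_num
    have hn4 : ‖(1 / 4 : ℂ)‖ = 1 / 4 := by norm_num
    rw [hn, hn4]
    calc _ ≤ 1 / 2 * (1 / 4 * (Mθ / ρ)) := by gcongr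
      _ = _ := by field_simp; ring

end LocalData

/-- Bounding the denominators after the first by `3` gives `1 + ν / (3 (1 - ν))`; this is the
constant `K = 3/2` used from here on. -/
theorem sum_pow_div_le {ν : ℝ} (h0 : 0 ≤ ν) (h1 : ν ≤ 0.578) (n : ℕ) :
    ∑ l ∈ Finset.range n, ν ^ l / (2 * l + 1) ≤ 3 / 2 := by
  rcases n with _ | n
  · norm_num
  rw [Finset.sum_range_succ']
  have h2 : ∑ l ∈ Finset.range n, ν ^ (l + 1) / (2 * (l + 1 : ℕ) + 1) ≤
      ν / 3 * ∑ l ∈ Finset.range n, (if 0 ≤ l then ν ^ l else 0) := by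
    rw [Finset.mul_sum]
    refine Finset.sum_le_sum fun l _ => ?_
    rw [if_pos (Nat.zero_le l)]
    calc ν ^ (l + 1) / (2 * (l + 1 : ℕ) + 1) ≤ ν ^ (l + 1) / 3 := by
          gcongr
          push_cast
          have : (0 : ℝ) ≤ l := l.cast_nonneg
          linarith
      _ = _ := by ring
  have h3 := sum_pow_le_of_le h0 (show ν < 1 by linarith) 0 n
  have h4 : ν ^ 0 / (1 - ν) ≤ 1 / 0.422 := by
    rw [pow_zero]
    exact one_div_le_one_div_of_le (by norm_num) (by linarith)
  have h5 : ν / 3 * ∑ l ∈ Finset.range n, (if 0 ≤ l then ν ^ l else 0) ≤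
      0.578 / 3 * (1 / 0.422) := by
    refine mul_le_mul (by linarith) (h3.trans h4) ?_ (by norm_num)
    exact Finset.sum_nonneg fun l _ => by split_ifs <;> positivity
  have h6 := h2.trans h5
  rw [CharP.cast_eq_zero, mul_zero, pow_zero]
  norm_num at h6 ⊢
  linarith

/-! ### The majorant of the coefficients -/

theorem decayWeight_pred_mul {D : ℕ} (hD : 1 ≤ D) :
    decayWeight (D - 1) * (D - 1)! = argFactor D * (decayWeight D * D !) := by
  obtain ⟨n, rfl⟩ : ∃ n, D = n + 1 := ⟨D - 1, by omega⟩
  rw [Nat.add_sub_cancel, Nat.factorial_succ]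
  unfold decayWeight argFactor
  push_cast
  field_simp
  ring

theorem decayWeight_pred_pred_mul {D : ℕ} (hD : 2 ≤ D) :
    decayWeight (D - 2) * (D - 2)! =
      ((D : ℝ) + 6) / (D + 4) / (D * (D - 1)) * (decayWeight D * D !) := by
  obtain ⟨n, rfl⟩ : ∃ n, D = n + 2 := ⟨D - 2, by omega⟩
  rw [Nat.add_sub_cancel, Nat.factorial_succ, Nat.factorial_succ]
  unfold decayWeight
  push_cast
  have : ((n : ℝ) + 2 - 1) = n + 1 := by ring
  rw [this]
  field_simp
  ring

/-- The exponential factor of the majorant. -/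
def growth (T q r α β : ℝ) (g m : ℕ) : ℝ :=
  T / (q ^ 2 * r ^ 3 * β ^ 3) * (q ^ 2 * r ^ 3 * α) ^ g * (q * r * β) ^ (m + 1)

/-- The majorant of the coefficients. -/
def majorant (T q r α β : ℝ) (g m : ℕ) : ℝ :=
  genusWeight g * (decayWeight (3 * g + m - 2) * (3 * g + m - 2)!) * growth T q r α β g m

section

variable {T q r α β c μ v : ℝ} (hT : 0 < T) (hq : 0 < q) (hr : 0 < r) (hα : 0 < α) (hβ : 0 < β)
  (hv : 0 < v)

include hT hq hr hα hβ in
theorem growth_pos (g m : ℕ) : 0 < growth T q r α β g m := by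
  unfold growth; positivity

include hT hq hr hα hβ in
theorem majorant_pos (g m : ℕ) : 0 < majorant T q r α β g m := by
  have := genusWeight_pos g
  have := decayWeight_pos (3 * g + m - 2)
  have := growth_pos hT hq hr hα hβ g m
  unfold majorant
  positivity

variable (hTβ : c * μ * v * β = T) (hTα : 5.82 * v ^ 2 * μ * α = β * T)

include hq hr hβ hv hTβ in
-- The hypothesis on `β` is what makes the quotient explicit. The spare powers `q` and `1/r` reflect
-- that the recursion lowers `2g - 2 + n` by one and `3g - 3 + n` by one.
theorem majorant_arg {g m : ℕ} (hm : 1 ≤ m) (h3 : 3 ≤ 3 * g + m) :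
    T * (majorant T q r α β g (m - 1) / v) * q =
      majorant T q r α β g m * (argFactor (3 * g + m - 2) * (c * μ) / r) := by
  have h := decayWeight_pred_mul (show 1 ≤ 3 * g + m - 2 by omega)
  obtain ⟨k, rfl⟩ : ∃ k, m = k + 1 := ⟨m - 1, by omega⟩
  unfold majorant
  rw [Nat.add_sub_cancel, show 3 * g + k - 2 = 3 * g + (k + 1) - 2 - 1 by omega, h]
  have hg : growth T q r α β g (k + 1) = growth T q r α β g k * (q * r * β) := by
    unfold growth; ring
  rw [hg, ← hTβ]
  field_simp

include hq hr hβ hv hTα in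
-- The hypothesis on `α` is the genus analogue; the degree drops by two, hence `1 / r ^ 2`.
theorem majorant_genus {g m : ℕ} (hg : 0 < g) (h4 : 4 ≤ 3 * g + m) :
    T * (majorant T q r α β (g - 1) (m + 1) / v ^ 2) * q =
      majorant T q r α β g m * (genusFactor g (3 * g + m - 2) * (5.82 * μ) / r ^ 2) := by
  have h := decayWeight_pred_pred_mul (show 2 ≤ 3 * g + m - 2 by omega)
  have hw := genusWeight_pred hg
  obtain ⟨k, rfl⟩ : ∃ k, g = k + 1 := ⟨g - 1, by omega⟩
  rw [Nat.add_sub_cancel] at hw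
  unfold majorant genusFactor
  rw [Nat.add_sub_cancel, show 3 * k + (m + 1) - 2 = 3 * (k + 1) + m - 2 - 2 by omega, h, hw]
  have hg : growth T q r α β (k + 1) m * (5.82 * μ) / r ^ 2 =
      T * (growth T q r α β k (m + 1) / v ^ 2) * q := by
    have e1 : growth T q r α β (k + 1) m =
        T / (q ^ 2 * r ^ 3 * β ^ 3) * (q ^ 2 * r ^ 3 * α) ^ k * (q * r * β) ^ (m + 1) *
          (q ^ 2 * r ^ 3 * α) := by unfold growth; ring
    have e2 : growth T q r α β k (m + 1) =
        T / (q ^ 2 * r ^ 3 * β ^ 3) * (q ^ 2 * r ^ 3 * α) ^ k * (q * r * β) ^ (m + 1) *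
          (q * r * β) := by unfold growth; ring
    rw [e1, e2]
    set Y := T / (q ^ 2 * r ^ 3 * β ^ 3) * (q ^ 2 * r ^ 3 * α) ^ k * (q * r * β) ^ (m + 1)
    rw [div_eq_iff (by positivity)]
    field_simp
    linear_combination Y * hTα
  have hrw : ∀ a b d e : ℝ, a * b * growth T q r α β (k + 1) m *
      (d * e * (5.82 * μ) / r ^ 2) =
      a * b * d * e * (growth T q r α β (k + 1) m * (5.82 * μ) / r ^ 2) := by
    intros; ring
  rw [mul_div_assoc (genusRatio (k + 1)), hrw, hg]
  ring

include hq hr hβ hv hTβ in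
theorem majorant_mul {g m g₁ m₁ : ℕ} (hg : g₁ ≤ g) (hm : m₁ ≤ m) :
    T * (majorant T q r α β g₁ m₁ * majorant T q r α β (g - g₁) (m - m₁) / v ^ 2) * q =
      (genusWeight g₁ * genusWeight (g - g₁) *
          (decayWeight (3 * g₁ + m₁ - 2) * decayWeight (3 * (g - g₁) + (m - m₁) - 2) *
          ((3 * g₁ + m₁ - 2)! * (3 * (g - g₁) + (m - m₁) - 2)!))) *
      (growth T q r α β g m * (c ^ 2 * μ ^ 2) / r ^ 2) := by
  have h : growth T q r α β g₁ m₁ * growth T q r α β (g - g₁) (m - m₁) =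
      growth T q r α β g m * (T / (q ^ 2 * r ^ 3 * β ^ 3) * (q * r * β)) := by
    have e1 : (q ^ 2 * r ^ 3 * α) ^ g = (q ^ 2 * r ^ 3 * α) ^ g₁ * (q ^ 2 * r ^ 3 * α) ^ (g - g₁) := by
      rw [← pow_add]; congr 1; omega
    have e2 : (q * r * β) ^ (m + 1) * (q * r * β) =
        (q * r * β) ^ (m₁ + 1) * (q * r * β) ^ (m - m₁ + 1) := by
      rw [← pow_add, ← pow_succ]; congr 1; omega
    unfold growth
    rw [e1]
    linear_combination -(T / (q ^ 2 * r ^ 3 * β ^ 3)) ^ 2 * (q ^ 2 * r ^ 3 * α) ^ g₁ *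
      (q ^ 2 * r ^ 3 * α) ^ (g - g₁) * e2
  have h2 : T * (T / (q ^ 2 * r ^ 3 * β ^ 3) * (q * r * β) / v ^ 2) * q = c ^ 2 * μ ^ 2 / r ^ 2 := by
    rw [← hTβ]
    field_simp
  unfold majorant
  rw [show ∀ a b d e a' b' d' : ℝ, T * (a * (b * d) * e * (a' * (b' * d') * growth T q r α β
    (g - g₁) (m - m₁)) / v ^ 2) * q = T * (a * a' * (b * b' * (d * d')) * (e *
    growth T q r α β (g - g₁) (m - m₁)) / v ^ 2) * q from fun _ _ _ _ _ _ _ => by ring, h]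
  linear_combination genusWeight g₁ * genusWeight (g - g₁) *
          (decayWeight (3 * g₁ + m₁ - 2) * decayWeight (3 * (g - g₁) + (m - m₁) - 2) *
          ((3 * g₁ + m₁ - 2)! * (3 * (g - g₁) + (m - m₁) - 2)!)) * growth T q r α β g m * h2

end

/-! ### The majorant is a supersolution -/

namespace LocalData

/-- The regular parts couple different ramification points and cost up to `r ^ 2`, exactly the power
that the majorant gains when the degree drops by two. -/
theorem pairSum_le {r f K ν cnt : ℝ} (hr : 1 ≤ r) (hf : 0 ≤ f) (hK : 0 ≤ K) (hν : 0 ≤ ν)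
    (hν1 : ν < 1) (hcnt : 0 ≤ cnt) : pairSum r f K ν cnt ≤ r ^ 2 * pairSum 1 f K ν cnt := by
  have h1 : 0 < 1 - ν := by linarith
  have hr2 : r ≤ r ^ 2 := by nlinarith
  have hr3 : 1 ≤ r ^ 2 := by nlinarith
  have a1 : cnt / (1 - ν) ≤ r ^ 2 * (cnt / (1 - ν)) := le_mul_of_one_le_left (by positivity) hr3
  have a2 : r * f * K * ν / (1 - ν) ^ 2 ≤ r ^ 2 * (1 * f * K * ν / (1 - ν) ^ 2) := by
    have := mul_le_mul_of_nonneg_right hr2 (show 0 ≤ f * K * ν / (1 - ν) ^ 2 by positivity)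
    calc r * f * K * ν / (1 - ν) ^ 2 = r * (f * K * ν / (1 - ν) ^ 2) := by ring
      _ ≤ _ := this
      _ = _ := by ring
  have a3 : (r * f * K * ν) ^ 2 = r ^ 2 * (1 * f * K * ν) ^ 2 := by ring
  unfold pairSum
  rw [a3]
  linarith

theorem pairSum_le_mul {f K ν cnt : ℝ} (hf : 0 ≤ f) (hK : 0 ≤ K) (hν : 0 ≤ ν)
    (hcnt : 1 ≤ cnt) : pairSum 1 f K ν cnt ≤ cnt * pairSum 1 f K ν 1 := by
  have a2 : (0 : ℝ) ≤ 1 * f * K * ν / (1 - ν) ^ 2 := by positivity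
  have a3 : (0 : ℝ) ≤ (1 * f * K * ν) ^ 2 := by positivity
  have b2 := le_mul_of_one_le_left a2 hcnt
  have b3 := le_mul_of_one_le_left a3 hcnt
  have e : cnt * (1 / (1 - ν)) = cnt / (1 - ν) := by ring
  unfold pairSum
  linarith

end LocalData

namespace LocalData

section

variable {T r f ν v α β : ℝ} {q : ℝ} (hT : 0 < T) (hq : 0 < q) (hr : 1 ≤ r) (hf : 0 ≤ f)
  (hα : 0 < α) (hβ : 0 < β) (hv : 0 < v) (h0 : 0 ≤ ν) (h1 : ν ≤ 0.578)
  (hTβ : argRate ν * (1 - ν) * v * β = T) (hTα : 5.82 * v ^ 2 * (1 - ν) * α = β * T)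

include hT hq hr hf hα hβ hv h0 h1 hTβ in
theorem dual_term_le {g m : ℕ} (h3 : 3 ≤ 3 * g + m) {B s : ℝ} (hB : 0 ≤ B)
    (hs : s ≤ B / (1 - ν) + m * (r * f * (3 / 2) * ν)) (hs0 : m = 0 → s = 0) :
    T * (majorant T q r α β g (m - 1) / v * s) * q ≤ majorant T q r α β g m *
      (argRate ν * argFactor (3 * g + m - 2) * B +
        f * (3 / 2 * ν * (1 - ν) * argRate ν * (argFactor (3 * g + m - 2) * m))) := by
  have hμ : 0 < 1 - ν := by linarith
  have hc := argRate_pos h0 h1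
  have hr0 : 0 < r := by linarith
  have hF : 0 ≤ argFactor (3 * g + m - 2) := by unfold argFactor; positivity
  have hA := (majorant_pos hT hq hr0 hα hβ g m).le
  rcases Nat.eq_zero_or_pos m with hm | hm
  · rw [hs0 hm, mul_zero, mul_zero, zero_mul]
    positivity
  have h := majorant_arg (T := T) (α := α) hq hr0 hβ hv hTβ (g := g) hm h3
  rw [show T * (majorant T q r α β g (m - 1) / v * s) * q =
    T * (majorant T q r α β g (m - 1) / v) * q * s by ring, h, mul_assoc]
  refine mul_le_mul_of_nonneg_left ?_ hA
  have hX : 0 ≤ argFactor (3 * g + m - 2) * (argRate ν * (1 - ν)) / r := by positivity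
  refine (mul_le_mul_of_nonneg_left hs hX).trans ?_
  have e : argFactor (3 * g + m - 2) * (argRate ν * (1 - ν)) / r *
      (B / (1 - ν) + m * (r * f * (3 / 2) * ν)) = argRate ν * argFactor (3 * g + m - 2) * (B / r) +
        f * (3 / 2 * ν * (1 - ν) * argRate ν * (argFactor (3 * g + m - 2) * m)) := by
    field_simp
  rw [e]
  have hBr : B / r ≤ B := div_le_self hB hr
  gcongr

include hT hq hr hf hα hβ hv h0 h1 hTα in
theorem genus_term_le {g m : ℕ} (h4 : 4 ≤ 3 * g + m) {cnt : ℝ} (hcnt : 0 ≤ cnt) :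
    1 / 2 * T * (if 0 < g then majorant T q r α β (g - 1) (m + 1) / v ^ 2 *
      pairSum r f (3 / 2) ν cnt else 0) * q ≤ majorant T q r α β g m *
      (2.91 * genusFactor g (3 * g + m - 2) * cnt +
        f * (5.82 * genusFactor g (3 * g + m - 2) * (3 / 2 * ν) / (1 - ν)) +
        f ^ 2 * (2.91 * genusFactor g (3 * g + m - 2) * (3 / 2 * ν) ^ 2 * (1 - ν))) := by
  have hμ : 0 < 1 - ν := by linarith
  have hr0 : 0 < r := by linarith
  have hA := (majorant_pos hT hq hr0 hα hβ g m).le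
  have hx : 0 ≤ genusFactor g (3 * g + m - 2) := by
    have hD : (1 : ℝ) ≤ (3 * g + m - 2 : ℕ) := by exact_mod_cast (by omega : 1 ≤ 3 * g + m - 2)
    have := genusRatio_nonneg g
    have : 0 ≤ ((3 * g + m - 2 : ℕ) : ℝ) - 1 := by linarith
    unfold genusFactor
    positivity
  set x := genusFactor g (3 * g + m - 2) with hxdef
  split_ifs with hg
  swap
  · rw [mul_zero, zero_mul]
    positivity
  have h := majorant_genus (T := T) hq hr0 hβ hv hTα hg h4
  rw [← hxdef] at h
  rw [show 1 / 2 * T * (majorant T q r α β (g - 1) (m + 1) / v ^ 2 * pairSum r f (3 / 2) ν cnt) * q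
    = T * (majorant T q r α β (g - 1) (m + 1) / v ^ 2) * q * (1 / 2 * pairSum r f (3 / 2) ν cnt)
    by ring, h, mul_assoc]
  refine mul_le_mul_of_nonneg_left ?_ hA
  have hp := pairSum_le (K := 3 / 2) hr hf (by norm_num) h0 (by linarith : ν < 1) hcnt
  calc x * (5.82 * (1 - ν)) / r ^ 2 * (1 / 2 * pairSum r f (3 / 2) ν cnt)
      ≤ x * (5.82 * (1 - ν)) / r ^ 2 * (1 / 2 * (r ^ 2 * pairSum 1 f (3 / 2) ν cnt)) := by gcongr
    _ = _ := by
      unfold pairSum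
      field_simp
      ring

include hT hq hr hf hα hβ hv h0 h1 hTβ in
theorem split_term_le {g m : ℕ} (h4 : 4 ≤ 3 * g + m) :
    1 / 2 * T * (∑ g₁ ∈ Finset.range (g + 1), ∑ m₁ ∈ Finset.range (m + 1),
          (if 2 ≤ 2 * g₁ + m₁ ∧ 2 ≤ 2 * (g - g₁) + (m - m₁) then
            (m.choose m₁ : ℝ) * (majorant T q r α β g₁ m₁ * majorant T q r α β (g - g₁) (m - m₁) /
              v ^ 2 * pairSum r f (3 / 2) ν
              ((min (3 * g₁ + m₁) (3 * (g - g₁) + (m - m₁)) - 1 : ℕ) : ℝ))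
          else 0)) * q ≤ majorant T q r α β g m *
      (7 / 2 * (argRate ν ^ 2 * (1 - ν)) * splitFactor g m (3 * g + m - 2) +
        f * (7 * argRate ν ^ 2 * splitFactor g m (3 * g + m - 2) * (3 / 2 * ν)) +
        f ^ 2 * (7 / 2 * argRate ν ^ 2 * splitFactor g m (3 * g + m - 2) * (3 / 2 * ν) ^ 2 *
          (1 - ν) ^ 2)) := by
  have hμ : 0 < 1 - ν := by linarith
  have hr0 : 0 < r := by linarith
  set P := pairSum 1 f (3 / 2) ν 1 with hP
  have hP0 : 0 ≤ P := by simp only [hP, pairSum]; positivity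
  set G := growth T q r α β g m * (argRate ν ^ 2 * (1 - ν) ^ 2) with hG
  have hgr := growth_pos hT hq hr0 hα hβ g m
  have hG0 : 0 ≤ G := by positivity
  rw [show ∀ x : ℝ, 1 / 2 * T * x * q = 1 / 2 * (T * q * x) from fun _ => by ring, Finset.mul_sum]
  simp only [Finset.mul_sum]
  have key : ∀ g₁ ∈ Finset.range (g + 1), ∀ m₁ ∈ Finset.range (m + 1),
      T * q * (if 2 ≤ 2 * g₁ + m₁ ∧ 2 ≤ 2 * (g - g₁) + (m - m₁) then
            (m.choose m₁ : ℝ) * (majorant T q r α β g₁ m₁ * majorant T q r α β (g - g₁) (m - m₁) /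
              v ^ 2 * pairSum r f (3 / 2) ν
              ((min (3 * g₁ + m₁) (3 * (g - g₁) + (m - m₁)) - 1 : ℕ) : ℝ))
          else 0) ≤ G * P * (if 2 ≤ 2 * g₁ + m₁ ∧ 2 ≤ 2 * (g - g₁) + (m - m₁) then
        (m.choose m₁ : ℝ) * (genusWeight g₁ * genusWeight (g - g₁) *
          (decayWeight (3 * g₁ + m₁ - 2) * decayWeight (3 * (g - g₁) + (m - m₁) - 2) *
          ((3 * g₁ + m₁ - 2)! * (3 * (g - g₁) + (m - m₁) - 2)!) *
          (min (3 * g₁ + m₁) (3 * (g - g₁) + (m - m₁)) - 1 : ℕ))) else 0) := by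
    intro g₁ hg₁ m₁ hm₁
    rw [Finset.mem_range] at hg₁ hm₁
    split_ifs with hst
    swap
    · simp
    have h := majorant_mul (T := T) (α := α) hq hr0 hβ hv hTβ (g := g) (m := m) (g₁ := g₁)
      (m₁ := m₁) (by omega) (by omega)
    set cnt : ℕ := min (3 * g₁ + m₁) (3 * (g - g₁) + (m - m₁)) - 1 with hcnt
    have hcnt1 : (1 : ℝ) ≤ cnt := by exact_mod_cast (by omega : 1 ≤ cnt)
    set M := majorant T q r α β g₁ m₁ * majorant T q r α β (g - g₁) (m - m₁) / v ^ 2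
    set W := genusWeight g₁ * genusWeight (g - g₁) *
          (decayWeight (3 * g₁ + m₁ - 2) * decayWeight (3 * (g - g₁) + (m - m₁) - 2) *
          ((3 * g₁ + m₁ - 2)! * (3 * (g - g₁) + (m - m₁) - 2)! : ℝ)) with hW
    have hW0 : 0 ≤ W := by
      have := genusWeight_pos g₁
      have := genusWeight_pos (g - g₁)
      have := decayWeight_pos (3 * g₁ + m₁ - 2)
      have := decayWeight_pos (3 * (g - g₁) + (m - m₁) - 2)
      positivity
    have hp : pairSum r f (3 / 2) ν cnt ≤ r ^ 2 * (cnt * P) :=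
      (pairSum_le (K := 3 / 2) hr hf (by norm_num) h0 (by linarith : ν < 1) (by linarith)).trans
        (mul_le_mul_of_nonneg_left (pairSum_le_mul hf (by norm_num) h0 hcnt1) (by positivity))
    calc T * q * ((m.choose m₁ : ℝ) * (M * pairSum r f (3 / 2) ν cnt))
        = (m.choose m₁ : ℝ) * (T * M * q * pairSum r f (3 / 2) ν cnt) := by ring
      _ = (m.choose m₁ : ℝ) * (W * (G / r ^ 2) * pairSum r f (3 / 2) ν cnt) := by rw [h]
      _ ≤ (m.choose m₁ : ℝ) * (W * (G / r ^ 2) * (r ^ 2 * (cnt * P))) := by gcongr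
      _ = (m.choose m₁ : ℝ) * (W * G * (cnt * P)) := by field_simp
      _ = _ := by rw [hW]; ring
  have hsum : ∑ g₁ ∈ Finset.range (g + 1), ∑ m₁ ∈ Finset.range (m + 1), _ ≤ _ :=
    Finset.sum_le_sum fun g₁ hg₁ => Finset.sum_le_sum fun m₁ hm₁ => key g₁ hg₁ m₁ hm₁
  simp only [← Finset.mul_sum] at hsum ⊢
  obtain ⟨n, hn⟩ : ∃ n, 3 * g + m = n + 4 := ⟨3 * g + m - 4, by omega⟩
  have hsp := mul_le_mul_of_nonneg_left (sum_splittings_le hn) (mul_nonneg hG0 hP0)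
  have hD : 3 * g + m - 2 = n + 2 := by omega
  refine (mul_le_mul_of_nonneg_left (hsum.trans hsp) (by norm_num)).trans_eq ?_
  rw [majorant, hD, hG, hP]
  unfold pairSum
  field_simp

include hT hr hf hα hβ hv h0 h1 hTβ hTα in
/-- The majorant is a supersolution of the recursion. -/
theorem recursion_majorant_le (hq : q = max ((1 + f) ^ 2) (1 + 4 * f)) {g m e : ℕ}
    (h3 : 3 ≤ 3 * g + m) {B s : ℝ} (hB : 0 ≤ B)
    (hB2 : B ≤ 2 * e + m) (hB3 : B ≤ 3 * (3 * g + m - 2 : ℕ))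
    (hs : s ≤ B / (1 - ν) + m * (r * f * (3 / 2) * ν)) (hs0 : m = 0 → s = 0) :
    1 / 2 * T * (2 * (majorant T q r α β g (m - 1) / v * s) +
      if e + 4 ≤ 3 * g + m then
        (if 0 < g then majorant T q r α β (g - 1) (m + 1) / v ^ 2 *
          pairSum r f (3 / 2) ν ((3 * g + m - 3 - e : ℕ) : ℝ) else 0) +
        ∑ g₁ ∈ Finset.range (g + 1), ∑ m₁ ∈ Finset.range (m + 1),
          (if 2 ≤ 2 * g₁ + m₁ ∧ 2 ≤ 2 * (g - g₁) + (m - m₁) then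
            (m.choose m₁ : ℝ) * (majorant T q r α β g₁ m₁ * majorant T q r α β (g - g₁) (m - m₁) /
              v ^ 2 * pairSum r f (3 / 2) ν
              ((min (3 * g₁ + m₁) (3 * (g - g₁) + (m - m₁)) - 1 : ℕ) : ℝ))
          else 0)
      else 0) ≤ majorant T q r α β g m := by
  have hq0 : 0 < q := by rw [hq]; exact lt_max_of_lt_right (by linarith)
  have hr0 : 0 < r := by linarith
  have hμ : 0 < 1 - ν := by linarith
  have hA := (majorant_pos hT hq0 hr0 hα hβ g m).le
  obtain ⟨D, hD⟩ : ∃ D, 3 * g + m - 2 = D := ⟨_, rfl⟩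
  have hD2 : D + 2 = 3 * g + m := by omega
  have t1 := dual_term_le hT hq0 hr hf hα hβ hv h0 h1 hTβ h3 hB hs hs0
  have hy := argFactor_mul_le hD2 (by omega)
  have hy0 : 0 ≤ argFactor D * m := by unfold argFactor; positivity
  rw [hD] at t1 hB3
  refine le_of_mul_le_mul_right ?_ hq0
  -- If the passive degree `e` is within one of the top, only the terms with `ω_{0,2}` survive, and
  -- the count `B ≤ 3D` is used; otherwise all three kinds of terms are present and `B ≤ 2e + m` is
  -- used.
  by_cases hc : e + 4 ≤ 3 * g + m
  · rw [if_pos hc]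
    have t2 := genus_term_le hT hq0 hr hf hα hβ hv h0 h1 hTα (g := g) (m := m) (by omega)
      (Nat.cast_nonneg (3 * g + m - 3 - e))
    have t3 := split_term_le hT hq0 hr hf hα hβ hv h0 h1 hTβ (g := g) (m := m) (by omega)
    rw [hD] at t2 t3
    have hcnt : ((3 * g + m - 3 - e : ℕ) : ℝ) = (D : ℝ) - 1 - e := by
      have : 3 * g + m - 3 - e + 1 + e = D := by omega
      rw [← this]
      push_cast
      ring
    rw [hcnt] at t2 ⊢
    have hx0 : 0 ≤ genusFactor g D := by
      have hD : (1 : ℝ) ≤ D := by exact_mod_cast (by omega : 1 ≤ D)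
      have := genusRatio_nonneg g
      have : 0 ≤ (D : ℝ) - 1 := by linarith
      unfold genusFactor
      positivity
    clear hs hs0
    have hm := main_le h0 h1 hD2 (show e + 2 ≤ D by omega) hB2
    have hcr := cross_le h0 h1 (genusFactor_le hD2 (by omega)) (splitFactor_nonneg g m D)
      (splitFactor_le hD2) hy0 hy
    -- Sort the three contributions by powers of `f`. The recursion is short of one power of `q`
    -- compared with the majorant, and `q` is precisely the bound for the quadratic polynomial in
    -- `f`.
    have hfin := add_mul_add_sq_mul_le_max hf hm (z := 2.91 * genusFactor g D * (3 / 2 * ν) ^ 2 *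
      (1 - ν) + 7 / 2 * argRate ν ^ 2 * splitFactor g m D * (3 / 2 * ν) ^ 2 * (1 - ν) ^ 2) (by
        have := splitFactor_nonneg g m D
        positivity) hcr.2 hcr.1
    rw [← hq] at hfin
    refine le_trans (le_of_eq ?_) ((add_le_add (add_le_add t1 t2) t3).trans
      (le_trans (le_of_eq ?_) (mul_le_mul_of_nonneg_left hfin hA)))
    · ring
    · ring
  · rw [if_neg hc, add_zero]
    have hm := argRate_mul_argFactor_le h0 h1 (show 1 ≤ D by omega) hB3
    have hcr := cross_le h0 h1 (x := 0) (σ := 0) (by norm_num) le_rfl (by norm_num) hy0 hy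
    have hfin := add_mul_add_sq_mul_le_max hf hm (z := 0) le_rfl (by norm_num)
      (y := 3 / 2 * ν * (1 - ν) * argRate ν * (argFactor D * m)) (by
        have := hcr.1
        simpa using this)
    rw [← hq, mul_zero, add_zero] at hfin
    have := mul_le_mul_of_nonneg_left hfin hA
    linarith

end

end LocalData

/-! ### Growth rates, initial values and the bound on all coefficients -/

/-- The growth rate of the majorant in the number of arguments. -/
def argGrowth (Mθ ρ v : ℝ) : ℝ := Mθ / ρ / (argRate (v / ρ) * (1 - v / ρ) * v)

/-- The growth rate of the majorant in the genus. -/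
def genusGrowth (Mθ ρ v : ℝ) : ℝ :=
  argGrowth Mθ ρ v * (Mθ / ρ) / (5.82 * v ^ 2 * (1 - v / ρ))

section

variable {Mθ ρ v : ℝ} (hM : 0 < Mθ) (hρ : 0 < ρ) (hv : 0 < v) (hν : v / ρ ≤ 0.578)
include hM hρ hv hν

theorem argGrowth_pos : 0 < argGrowth Mθ ρ v := by
  have h0 : 0 ≤ v / ρ := by positivity
  have := argRate_pos h0 hν
  have : 0 < 1 - v / ρ := by linarith
  unfold argGrowth
  positivity

theorem genusGrowth_pos : 0 < genusGrowth Mθ ρ v := by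
  have := argGrowth_pos hM hρ hv hν
  have : 0 < 1 - v / ρ := by linarith
  unfold genusGrowth
  positivity

theorem mul_argGrowth : argRate (v / ρ) * (1 - v / ρ) * v * argGrowth Mθ ρ v = Mθ / ρ := by
  have h0 : 0 ≤ v / ρ := by positivity
  have := argRate_pos h0 hν
  have : 0 < 1 - v / ρ := by linarith
  unfold argGrowth
  rw [mul_div_cancel₀]
  positivity

theorem mul_genusGrowth : 5.82 * v ^ 2 * (1 - v / ρ) * genusGrowth Mθ ρ v =
    argGrowth Mθ ρ v * (Mθ / ρ) := by
  have : 0 < 1 - v / ρ := by linarith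
  unfold genusGrowth
  rw [mul_div_cancel₀]
  positivity

end

theorem majorant_zero_two {T q r α β : ℝ} (hq : 0 < q) (hr : 0 < r) (hβ : 0 < β) :
    majorant T q r α β 0 2 = T * q := by
  have : decayWeight 0 = 1 := by norm_num [decayWeight]
  have hw : genusWeight 0 = 1 := rfl
  simp only [majorant, growth, mul_zero, zero_add, Nat.sub_self, this, hw]
  simp
  field_simp

/-- The numerical factors are `7/2 · 6/7 = 3` from the weights and `5.82 / 3 = 1.94`. -/
theorem majorant_one_zero {T q r α β c μ v : ℝ} (hT : 0 < T) (hq : 0 < q) (hr : 0 < r)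
    (hβ : 0 < β) (hv : 0 < v) (hμ : 0 < μ) (hTβ : c * μ * v * β = T)
    (hTα : 5.82 * v ^ 2 * μ * α = β * T) :
    majorant T q r α β 1 0 = T * q * r * c / (1.94 * v) := by
  have hd : decayWeight 1 = 6 / 7 := by norm_num [decayWeight]
  have hw : genusWeight 1 = 7 / 2 := rfl
  have hα : α = β * T / (5.82 * v ^ 2 * μ) := by
    rw [eq_div_iff (by positivity)]; linarith
  have hm : majorant T q r α β 1 0 = 3 * (T * q * r) * α / β ^ 2 := by
    simp only [majorant, growth, hw, show 3 * 1 + 0 - 2 = 1 from rfl, hd, zero_add, pow_one,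
      Nat.factorial_one, Nat.cast_one]
    field_simp
    ring
  rw [hm, hα]
  have : 3 * (T * q * r) * (β * T / (5.82 * v ^ 2 * μ)) / β ^ 2 =
    3 * (T * q * r) * T / (5.82 * v ^ 2 * μ * β) := by field_simp
  rw [this]
  nth_rewrite 2 [← hTβ]
  field_simp
  ring

namespace LocalData

variable {ι : Type*} [Fintype ι] [DecidableEq ι] {L : LocalData ι} (N : ℕ)
variable {Mθ Mφ ρ : ℝ} (hL : L.Bounds Mθ Mφ ρ)

theorem sum_dualBound_le {r f K ν : ℝ} (hrf : 0 ≤ r * f * K * ν) {g m : ℕ}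
    (κ : Fin m → ι × ℕ) :
    ∑ k, dualBound r f K ν g m κ k ≤
      (∑ k, if ∑ i, (κ i).2 + 2 = 3 * g + m ∧ (κ k).2 = 0 then (0 : ℝ) else 2 * (κ k).2 + 1) /
        (1 - ν) + m * (r * f * K * ν) := by
  have hm : (m : ℝ) * (r * f * K * ν) = ∑ _k : Fin m, r * f * K * ν := by simp
  rw [Finset.sum_div, hm, ← Finset.sum_add_distrib]
  refine Finset.sum_le_sum fun k _ => ?_
  unfold dualBound
  split_ifs
  · simpa using hrf
  · exact le_rfl

theorem sum_dualCount_le (g : ℕ) {m : ℕ} (κ : Fin m → ι × ℕ) :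
    (∑ k, if ∑ i, (κ i).2 + 2 = 3 * g + m ∧ (κ k).2 = 0 then (0 : ℝ) else 2 * (κ k).2 + 1) ≤
      2 * (∑ k, (κ k).2 : ℕ) + m := by
  have hm : 2 * ((∑ k, (κ k).2 : ℕ) : ℝ) + m = ∑ k, (2 * ((κ k).2 : ℝ) + 1) := by
    rw [Finset.sum_add_distrib, ← Finset.mul_sum]
    simp
  rw [hm]
  refine Finset.sum_le_sum fun k _ => ?_
  split_ifs
  · positivity
  · exact le_rfl

/-- At top degree the indices `0` are excluded, and `2j + 1 ≤ 3j` for the others; below top degree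
the count `2e + m` is already small enough. -/
theorem sum_dualCount_le' {g m : ℕ} (κ : Fin m → ι × ℕ) (h : ∑ k, (κ k).2 + 2 ≤ 3 * g + m) :
    (∑ k, if ∑ i, (κ i).2 + 2 = 3 * g + m ∧ (κ k).2 = 0 then (0 : ℝ) else 2 * (κ k).2 + 1) ≤
      3 * (3 * g + m - 2 : ℕ) := by
  by_cases he : ∑ i, (κ i).2 + 2 = 3 * g + m
  · have : 3 * g + m - 2 = ∑ i, (κ i).2 := by omega
    rw [this, Nat.cast_sum, Finset.mul_sum]
    refine Finset.sum_le_sum fun k _ => ?_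
    split_ifs with hk
    · positivity
    · have : (1 : ℝ) ≤ (κ k).2 := by
        exact_mod_cast Nat.one_le_iff_ne_zero.2 fun h => hk ⟨he, h⟩
      linarith
  · refine (sum_dualCount_le g κ).trans ?_
    exact_mod_cast (by omega : 2 * (∑ k, (κ k).2) + m ≤ 3 * (3 * g + m - 2))

include hL in
/-- The bound for all expansion coefficients. -/
theorem Bounds.coefBound [Nonempty ι] {v : ℝ} (hv : 0 < v) (hν : v / ρ ≤ 0.578) :
    ∀ k g m : ℕ, 2 * g + m = k → 2 ≤ 2 * g + m → 3 * g + m ≤ N →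
      CoefBound L N v (majorant (Mθ / ρ) (max ((1 + ρ * Mφ) ^ 2) (1 + 4 * (ρ * Mφ)))
        (Fintype.card ι) (genusGrowth Mθ ρ v) (argGrowth Mθ ρ v)) g m := by
  have hρ := hL.ρ_pos
  have hM := hL.Mθ_pos
  have hf : 0 ≤ ρ * Mφ := mul_nonneg hρ.le hL.Mφ_nonneg
  set f := ρ * Mφ with hfdef
  set q := max ((1 + f) ^ 2) (1 + 4 * f) with hq
  have hq1 : 1 + 4 * f ≤ q := le_max_right _ _
  have hq0 : 0 < q := by linarith
  have hr : (1 : ℝ) ≤ (Fintype.card ι : ℝ) := by exact_mod_cast Fintype.card_pos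
  set r : ℝ := ((Fintype.card ι : ℕ) : ℝ)
  have hr0 : 0 < r := by linarith
  have hα := genusGrowth_pos hM hρ hv hν
  have hβ := argGrowth_pos hM hρ hv hν
  have hTβ := mul_argGrowth hM hρ hv hν
  have hTα := mul_genusGrowth hM hρ hv hν
  set α := genusGrowth Mθ ρ v
  set β := argGrowth Mθ ρ v
  have hT : 0 < Mθ / ρ := by positivity
  set T := Mθ / ρ with hTdef
  have h0 : 0 ≤ v / ρ := by positivity
  have hμ : 0 < 1 - v / ρ := by linarith
  have hA := majorant_pos hT hq0 hr0 hα hβ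
  intro k
  induction k using Nat.strong_induction_on with
  | _ k ih =>
  intro g m hk hst hN μ κ
  by_cases hz : L.coef N g m μ κ = 0
  · rw [hz, norm_zero]
    have := hA g m
    positivity
  have hlam := L.coef_support N _ _ _ rfl μ κ hz
  by_cases h02 : g = 0 ∧ m = 2
  · obtain ⟨rfl, rfl⟩ := h02
    rw [majorant_zero_two hq0 hr0 hβ, show μ.2 + ∑ i, (κ i).2 = 0 by omega, pow_zero, mul_one]
    exact (hL.norm_coef_zero_two_le N μ κ).trans (le_mul_of_one_le_right hT.le (by linarith))
  by_cases h10 : g = 1 ∧ m = 0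
  · obtain ⟨rfl, rfl⟩ := h10
    rw [majorant_one_zero hT hq0 hr0 hβ hv hμ hTβ hTα]
    refine (hL.norm_coef_one_zero_le N (by omega) μ κ).trans ?_
    have e8 : Mθ / (8 * ρ) = T / 8 := by rw [hTdef]; field_simp
    -- `ω_{1,1}` fits under the majorant because `1/4` exceeds `1.94 / 8`.
    have hc : 1 / 4 ≤ argRate (v / ρ) := by unfold argRate; linarith
    have hvρ : v ≤ ρ := by
      have : v / ρ ≤ 1 := by linarith
      rwa [div_le_one hρ] at this
    rw [e8]
    simp only [Finset.univ_eq_empty, Finset.sum_empty, add_zero] at hlam ⊢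
    have hqr : (1 + 4 * f) ≤ q * r := hq1.trans (le_mul_of_one_le_right hq0.le hr)
    rcases (by omega : μ.2 = 0 ∨ μ.2 = 1) with h | h
    · rw [h, if_pos rfl, pow_zero, mul_one]
      calc (1 + 4 * f) / ρ * (T / 8) ≤ (q * r) / v * (T / 8) := by gcongr
        _ = T * q * r * (1.94 / 8) / (1.94 * v) := by field_simp
        _ ≤ T * q * r * argRate (v / ρ) / (1.94 * v) := by
          gcongr
          exact le_trans (by norm_num) hc
    · rw [h, if_neg one_ne_zero, pow_one, one_mul]
      have : T * q * r * argRate (v / ρ) / (1.94 * v) * v =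
        T * (q * r) * (argRate (v / ρ) / 1.94) := by field_simp
      rw [this]
      have h2 : 1 / 8 ≤ argRate (v / ρ) / 1.94 := by
        rw [div_le_div_iff₀ (by norm_num) (by norm_num)]; linarith
      calc T / 8 = T * 1 * (1 / 8) := by ring
        _ ≤ T * (q * r) * (argRate (v / ρ) / 1.94) := by
          gcongr
          linarith
  have h3 : 3 ≤ 3 * g + m := by omega
  refine (hL.norm_coef_le N hv (by linarith) (sum_pow_div_le h0 hν) (fun g m => (hA g m).le) hst h3
    (fun h => h10 ⟨h.2, h.1⟩) hN (fun g' m' h1 h2 h4 => ih _ (by omega) _ _ rfl h2 h4) μ κ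
    hlam).trans ?_
  rw [mul_comm]
  refine mul_le_mul_of_nonneg_right ?_ (by positivity)
  refine recursion_majorant_le hT hr hf hα hβ hv h0 hν hTβ hTα hq h3
    (B := ∑ k, if ∑ i, (κ i).2 + 2 = 3 * g + m ∧ (κ k).2 = 0 then (0 : ℝ) else 2 * (κ k).2 + 1)
    ?_ (sum_dualCount_le g κ) (sum_dualCount_le' κ (by omega)) (sum_dualBound_le (by positivity) κ)
    ?_
  · exact Finset.sum_nonneg fun k _ => by split_ifs <;> positivity
  · intro hm
    subst hm
    simp

end LocalData

/-! ### Comparison of the growth rates -/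

/-- From genus `k + 1` to `k + 2` the product grows by `(k+2)/(k+1/2)`, hence polynomially; the cube
is generous and makes the induction immediate. -/
theorem genusWeight_mul_factorial_le (g : ℕ) : genusWeight g * g ! ≤ 4 * ((g : ℝ) + 1) ^ 3 := by
  have h2 : ∀ g, 2 ≤ g → genusWeight g * g ! ≤ 4 * ((g : ℝ) + 1) ^ 3 := by
    intro g hg
    induction g, hg using Nat.le_induction with
    | base => norm_num [genusWeight, Nat.factorial]
    | succ g hg ih =>
      obtain ⟨k, rfl⟩ : ∃ k, g = k + 1 := ⟨g - 1, by omega⟩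
      have hk : (1 : ℝ) ≤ k := by exact_mod_cast (by omega : 1 ≤ k)
      have e : genusWeight (k + 1 + 1) * ((k + 1 + 1)! : ℝ) =
          genusWeight (k + 1) * (k + 1)! * (((k : ℝ) + 2) / (k + 1 / 2)) := by
        rw [genusWeight, Nat.factorial_succ (k + 1)]
        push_cast
        ring
      rw [e]
      calc _ ≤ 4 * (((k + 1 : ℕ) : ℝ) + 1) ^ 3 * (((k : ℝ) + 2) / (k + 1 / 2)) := by gcongr
        _ ≤ _ := by
          rw [mul_div_assoc', div_le_iff₀ (by positivity)]
          push_cast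
          nlinarith [pow_pos (show (0 : ℝ) < k by linarith) 3, sq_nonneg ((k : ℝ) - 1)]
  rcases (by omega : g = 0 ∨ g = 1 ∨ 2 ≤ g) with rfl | rfl | h
  · norm_num [genusWeight]
  · norm_num [genusWeight]
  · exact h2 g h

theorem exists_pow_mul_pow_le (k : ℕ) {x : ℝ} (h0 : 0 ≤ x) (h1 : x < 1) :
    ∃ c : ℝ, 0 < c ∧ ∀ g : ℕ, ((g : ℝ) + 1) ^ k * x ^ g ≤ c := by
  rcases h0.eq_or_lt with rfl | hx
  · refine ⟨1, one_pos, fun g => ?_⟩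
    rcases g with _ | g <;> simp
  have h := (tendsto_pow_const_mul_const_pow_of_abs_lt_one k
    (by rwa [abs_of_nonneg h0] : |x| < 1)).bddAbove_range
  obtain ⟨c, hc⟩ := h
  refine ⟨max c 1 / x, by positivity, fun g => ?_⟩
  have := hc ⟨g + 1, rfl⟩
  rw [le_div_iff₀ hx]
  refine le_trans (le_of_eq ?_) (this.trans (le_max_left _ _))
  push_cast
  ring

/-- Part of the margin `0.995 ^ g` pays for the polynomial in `w_g g!`; the rest, `0.998 ^ g`, is
kept for the estimate with `n` fixed. -/
theorem exists_genusWeight_le : ∃ c : ℝ, 0 < c ∧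
    ∀ g : ℕ, genusWeight g * 0.995 ^ g ≤ c * 0.998 ^ g / (g ! : ℝ) := by
  obtain ⟨c, hc, h⟩ := exists_pow_mul_pow_le 3 (x := 0.995 / 0.998) (by norm_num) (by norm_num)
  refine ⟨4 * c, by positivity, fun g => ?_⟩
  rw [le_div_iff₀ (by positivity)]
  have h1 := genusWeight_mul_factorial_le g
  have e : (0.995 : ℝ) ^ g = (0.995 / 0.998) ^ g * 0.998 ^ g := by
    rw [← mul_pow]; norm_num
  calc genusWeight g * 0.995 ^ g * g ! = genusWeight g * g ! * 0.995 ^ g := by ring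
    _ ≤ 4 * ((g : ℝ) + 1) ^ 3 * 0.995 ^ g := by gcongr
    _ = 4 * (((g : ℝ) + 1) ^ 3 * (0.995 / 0.998) ^ g) * 0.998 ^ g := by rw [e]; ring
    _ ≤ 4 * c * 0.998 ^ g := by gcongr; exact h g

theorem constU_bounds {ρ : ℝ} (hρ : 0 < ρ) :
    0.231 * ρ ≤ constU ρ ∧ constU ρ ≤ 0.2312 * ρ ∧ constU ρ ^ 3 = ρ ^ 3 / 81 := by
  have h3 : ((3 : ℝ) ^ (-(4 / 3) : ℝ)) ^ 3 = 1 / 81 := by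
    rw [← Real.rpow_natCast, ← Real.rpow_mul (by norm_num)]
    norm_num
  have h0 : 0 < (3 : ℝ) ^ (-(4 / 3) : ℝ) := by positivity
  unfold constU
  set U := (3 : ℝ) ^ (-(4 / 3) : ℝ)
  refine ⟨?_, ?_, by rw [mul_pow, h3]; ring⟩
  · refine mul_le_mul_of_nonneg_right ?_ hρ.le
    refine le_of_pow_le_pow_left₀ (n := 3) (by norm_num) h0.le ?_
    rw [h3]; norm_num
  · refine mul_le_mul_of_nonneg_right ?_ hρ.le
    refine le_of_pow_le_pow_left₀ (n := 3) (by norm_num) (by norm_num) ?_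
    rw [h3]; norm_num

theorem constU_pos {ρ : ℝ} (hρ : 0 < ρ) : 0 < constU ρ := by
  have := (constU_bounds hρ).1
  exact lt_of_lt_of_le (by positivity) this

section

variable {Mθ ρ v : ℝ} (hM : 0 < Mθ) (hρ : 0 < ρ) (hv : 0 < v) (hvu : v ≤ 5 / 2 * constU ρ)
include hρ hv hvu

/-- `0.578 = 5/2 · 0.2312`: the admissible range of `ν` in the numerical inequalities is dictated by
`v ≤ 5u/2`. -/
theorem div_le_of_le_constU : v / ρ ≤ 0.578 := by
  rw [div_le_iff₀ hρ]
  linarith [(constU_bounds hρ).2.1]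

include hM

/-- Since `u ≤ 0.2312 ρ`, it suffices that `0.4624 - 0.4 ν ≤ 2 (1/4 + ν/22) (1 - ν)`. This is nearly
an equality at `ν = 0.578` and would fail there without the term `ν/22`. -/
theorem argGrowth_le : argGrowth Mθ ρ v ≤ 2 * Mθ * (1 / (v * (2 * constU ρ - 2 / 5 * v))) := by
  have hν := div_le_of_le_constU hρ hv hvu
  have h0 : 0 ≤ v / ρ := by positivity
  have hc := argRate_pos h0 hν
  have hμ : 0 < 1 - v / ρ := by linarith
  have hu := constU_pos hρ
  have hp : 0 < 2 * constU ρ - 2 / 5 * v := by linarith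
  unfold argGrowth
  rw [div_div, mul_one_div, div_le_div_iff₀ (by positivity) (by positivity)]
  have key : 2 * constU ρ - 2 / 5 * v ≤ 2 * (argRate (v / ρ) * (1 - v / ρ)) * ρ := by
    have h1 := (constU_bounds hρ).2.1
    set ν := v / ρ with hνd
    have hvd : v = ν * ρ := by rw [hνd]; field_simp
    rw [hvd]
    have : 0.4624 - 0.4 * ν ≤ 2 * (argRate ν * (1 - ν)) := by
      unfold argRate
      nlinarith
    have := mul_le_mul_of_nonneg_right this hρ.le
    linarith
  have := mul_le_mul_of_nonneg_left key (mul_pos hM hv).le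
  linarith

theorem genusGrowth_le : genusGrowth Mθ ρ v ≤ 0.995 * (2 * constU ρ / 27) * (2 * Mθ) ^ 2 *
    (1 / (v * (2 * constU ρ - 2 / 5 * v))) ^ 3 := by
  have hν := div_le_of_le_constU hρ hv hvu
  have h0 : 0 ≤ v / ρ := by positivity
  have hc := argRate_pos h0 hν
  have hμ : 0 < 1 - v / ρ := by linarith
  obtain ⟨hu1, hu2, hu3⟩ := constU_bounds hρ
  have hu := constU_pos hρ
  have hp : 0 < 2 * constU ρ - 2 / 5 * v := by linarith
  unfold genusGrowth argGrowth
  set ν := v / ρ with hνd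
  set u := constU ρ
  have hvd : v = ν * ρ := by rw [hνd]; field_simp
  have e1 : Mθ / ρ / (argRate ν * (1 - ν) * v) * (Mθ / ρ) / (5.82 * v ^ 2 * (1 - ν)) =
      Mθ ^ 2 / v ^ 3 * (1 / (5.82 * argRate ν * (1 - ν) ^ 2 * ρ ^ 2)) := by
    field_simp
  have e2 : 0.995 * (2 * u / 27) * (2 * Mθ) ^ 2 * (1 / (v * (2 * u - 2 / 5 * v))) ^ 3 =
      Mθ ^ 2 / v ^ 3 * (0.995 * (8 * u / 27) / (2 * u - 2 / 5 * v) ^ 3) := by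
    field_simp
    ring
  rw [e1, e2]
  refine mul_le_mul_of_nonneg_left ?_ (by positivity)
  rw [div_le_div_iff₀ (by positivity) (by positivity), one_mul]
  -- `1.73` is just below `0.4 / 0.2312`. Factoring out `u` makes it possible to use `u ^ 3 = ρ ^ 3
  -- / 81` exactly.
  have k1 : 2 * u - 2 / 5 * v ≤ u * (2 - 1.73 * ν) := by
    have : 1.73 * (u * ν) ≤ 2 / 5 * (ν * ρ) := by nlinarith
    rw [hvd]
    linarith
  -- At `ν = 0` there is almost no room: `5.82` must be this large for the genus growth rate to stay
  -- below its target with the margin `0.995`, while `bilinear_le` does not allow it to be much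
  -- larger.
  have k2 : (2 - 1.73 * ν) ^ 3 / 81 ≤ 0.231 * 0.995 * (8 / 27) * (5.82 * argRate ν * (1 - ν) ^ 2) := by
    have hd : 0 ≤ 0.578 - ν := by linarith
    unfold argRate
    nlinarith [mul_nonneg h0 hd, mul_nonneg (mul_nonneg h0 hd) hd, mul_nonneg (mul_nonneg h0 h0) hd]
  have hX : 0 ≤ 0.995 * (8 / 27) * (5.82 * argRate ν * (1 - ν) ^ 2) := by positivity
  calc (2 * u - 2 / 5 * v) ^ 3 ≤ (u * (2 - 1.73 * ν)) ^ 3 := by gcongr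
    _ = ρ ^ 3 * ((2 - 1.73 * ν) ^ 3 / 81) := by rw [mul_pow, hu3]; ring
    _ ≤ ρ ^ 3 * (0.231 * 0.995 * (8 / 27) * (5.82 * argRate ν * (1 - ν) ^ 2)) := by gcongr
    _ = (0.231 * ρ) * (0.995 * (8 / 27) * (5.82 * argRate ν * (1 - ν) ^ 2)) * ρ ^ 2 := by ring
    _ ≤ u * (0.995 * (8 / 27) * (5.82 * argRate ν * (1 - ν) ^ 2)) * ρ ^ 2 := by gcongr
    _ = _ := by ring

/-- `β` enters the prefactor of the majorant with exponent `-3`, so a lower bound on it is needed as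
well; a crude one suffices, since it affects only the constant `S`. -/
theorem div_argGrowth_pow_le : Mθ / ρ / argGrowth Mθ ρ v ^ 3 ≤
    4 / v / ((2 * Mθ) ^ 2 * (1 / (v * (2 * constU ρ - 2 / 5 * v))) ^ 3) := by
  have hν := div_le_of_le_constU hρ hv hvu
  have h0 : 0 ≤ v / ρ := by positivity
  have hc := argRate_pos h0 hν
  have hc' := argRate_le h0 hν
  have hμ : 0 < 1 - v / ρ := by linarith
  have hμ' : 1 - v / ρ ≤ 1 := by linarith
  obtain ⟨hu1, hu2, hu3⟩ := constU_bounds hρ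
  have hu := constU_pos hρ
  have hp : constU ρ ≤ 2 * constU ρ - 2 / 5 * v := by linarith
  have hp0 : 0 < 2 * constU ρ - 2 / 5 * v := by linarith
  unfold argGrowth
  set ν := v / ρ with hνd
  set u := constU ρ
  have e1 : Mθ / ρ / (Mθ / ρ / (argRate ν * (1 - ν) * v)) ^ 3 =
      v ^ 2 / Mθ ^ 2 * ((argRate ν * (1 - ν)) ^ 3 * (v * ρ ^ 2)) := by
    field_simp
  have e2 : 4 / v / ((2 * Mθ) ^ 2 * (1 / (v * (2 * u - 2 / 5 * v))) ^ 3) =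
      v ^ 2 / Mθ ^ 2 * (2 * u - 2 / 5 * v) ^ 3 := by
    field_simp
    ring
  rw [e1, e2]
  refine mul_le_mul_of_nonneg_left ?_ (by positivity)
  calc (argRate ν * (1 - ν)) ^ 3 * (v * ρ ^ 2) ≤ (0.2763 * 1) ^ 3 * (5 / 2 * u * ρ ^ 2) := by gcongr
    _ = (0.2763 * 1) ^ 3 * (5 / 2) * u * ρ ^ 2 := by ring
    _ ≤ (0.231) ^ 2 * u * ρ ^ 2 := by gcongr; norm_num
    _ = u * (0.231 * ρ) ^ 2 := by ring
    _ ≤ u * u ^ 2 := by gcongr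
    _ = u ^ 3 := by ring
    _ ≤ _ := by gcongr

end

/-- `v (2u - 2v/5)` increases up to `v = 5u/2`. So the right side is the least value of its
reciprocal over `0 < v ≤ V`, and the two cases of `P` say whether the constraint is active. -/
theorem constP_div_sq {u V : ℝ} (hu : 0 < u) (hV : 0 < V) :
    constP (u / V) / V ^ 2 =
      1 / (min V (5 / 2 * u) * (2 * u - 2 / 5 * min V (5 / 2 * u))) := by
  unfold constP
  split_ifs with h
  · rw [div_lt_iff₀ hV] at h
    rw [min_eq_right (by linarith)]
    field_simp
    ring
  · rw [not_lt, le_div_iff₀ hV] at h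
    rw [min_eq_left (by linarith)]
    have h1 : 0 < 10 * (u / V) - 2 := by
      have : 2 / 5 ≤ u / V := by rw [le_div_iff₀ hV]; exact h
      linarith
    have h2 : 0 < 2 * u - 2 / 5 * V := by linarith
    have e : 10 * (u / V) - 2 = 5 * (2 * u - 2 / 5 * V) / V := by field_simp; ring
    rw [e]
    field_simp

theorem one_div_min_le {u V : ℝ} (hu : 0 < u) (hV : 0 < V) :
    1 / min V (5 / 2 * u) ≤ (1 + 1 / (u / V)) / V := by
  have e : (1 + 1 / (u / V)) / V = 1 / V + 1 / u := by field_simp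
  rw [e]
  rcases min_choice V (5 / 2 * u) with h | h
  · rw [h]
    have : 0 ≤ 1 / u := by positivity
    linarith
  · rw [h]
    have h1 : 1 / (5 / 2 * u) ≤ 1 / u := one_div_le_one_div_of_le hu (by linarith)
    have : 0 ≤ 1 / V := by positivity
    linarith

theorem growth_le {Mθ ρ v q r : ℝ} (hM : 0 < Mθ) (hρ : 0 < ρ) (hv : 0 < v)
    (hvu : v ≤ 5 / 2 * constU ρ) (hq : 0 < q) (hr : 0 < r) {g m : ℕ} (hst : 2 ≤ 2 * g + m) {p : ℝ}
    (hp : p = 1 / (v * (2 * constU ρ - 2 / 5 * v))) :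
    growth (Mθ / ρ) q r (genusGrowth Mθ ρ v) (argGrowth Mθ ρ v) g m ≤
      4 / v * 0.995 ^ g * (2 * constU ρ / 27) ^ g * (2 * Mθ * q) ^ (2 * g + m - 1) *
        (r * p) ^ (3 * g + m - 2) := by
  have hν := div_le_of_le_constU hρ hv hvu
  have hα := genusGrowth_pos hM hρ hv hν
  have hβ := argGrowth_pos hM hρ hv hν
  have h1 := argGrowth_le hM hρ hv hvu
  have h2 := genusGrowth_le hM hρ hv hvu
  have h3 := div_argGrowth_pow_le hM hρ hv hvu
  rw [← hp] at h1 h2 h3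
  have hu := constU_pos hρ
  have hp0 : 0 < p := by
    have : 0 < 2 * constU ρ - 2 / 5 * v := by linarith
    rw [hp]
    positivity
  set α := genusGrowth Mθ ρ v
  set β := argGrowth Mθ ρ v
  have hk1 : (q ^ 2) ^ g * q ^ (m + 1) = q ^ (2 * g + m - 1) * q ^ 2 := by
    rw [← pow_mul, ← pow_add, ← pow_add]; congr 1; omega
  have hk2 : (r ^ 3) ^ g * r ^ (m + 1) = r ^ (3 * g + m - 2) * r ^ 3 := by
    rw [← pow_mul, ← pow_add, ← pow_add]; congr 1; omega
  have hk3 : ((2 * Mθ) ^ 2) ^ g * (2 * Mθ) ^ (m + 1) =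
      (2 * Mθ) ^ (2 * g + m - 1) * (2 * Mθ) ^ 2 := by
    rw [← pow_mul, ← pow_add, ← pow_add]; congr 1; omega
  have hk4 : (p ^ 3) ^ g * p ^ (m + 1) = p ^ (3 * g + m - 2) * p ^ 3 := by
    rw [← pow_mul, ← pow_add, ← pow_add]; congr 1; omega
  have e : growth (Mθ / ρ) q r α β g m =
      (Mθ / ρ / β ^ 3) * α ^ g * β ^ (m + 1) * (q ^ (2 * g + m - 1) * r ^ (3 * g + m - 2)) := by
    unfold growth
    have : (q ^ 2 * r ^ 3 * α) ^ g * (q * r * β) ^ (m + 1) =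
        (q ^ (2 * g + m - 1) * q ^ 2) * (r ^ (3 * g + m - 2) * r ^ 3) * α ^ g * β ^ (m + 1) := by
      rw [← hk1, ← hk2, mul_pow, mul_pow, mul_pow, mul_pow]; ring
    rw [mul_assoc, this]
    field_simp
  rw [e]
  calc _ ≤ (4 / v / ((2 * Mθ) ^ 2 * p ^ 3)) *
        (0.995 * (2 * constU ρ / 27) * (2 * Mθ) ^ 2 * p ^ 3) ^ g * (2 * Mθ * p) ^ (m + 1) *
        (q ^ (2 * g + m - 1) * r ^ (3 * g + m - 2)) := by gcongr
    _ = (4 / v / ((2 * Mθ) ^ 2 * p ^ 3)) * (0.995 ^ g * (2 * constU ρ / 27) ^ g) *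
        (((2 * Mθ) ^ 2) ^ g * (2 * Mθ) ^ (m + 1)) * ((p ^ 3) ^ g * p ^ (m + 1)) *
        (q ^ (2 * g + m - 1) * r ^ (3 * g + m - 2)) := by
      simp only [mul_pow]
      ring
    _ = _ := by
      rw [hk3, hk4, mul_pow (2 * Mθ) q, mul_pow r p]
      field_simp

/-- Two mechanisms create the factorials of the theorem: `D! C(D+n, n) = (D+n)!/n!`, and the genus
weight, which supplies `1/g!`. The constant `c` is chosen before all data of the curve and is
therefore universal. -/
theorem exists_majorant_le : ∃ c : ℝ, 0 < c ∧ ∀ {Mθ Mφ ρ r V : ℝ}, 0 < Mθ → 0 ≤ Mφ → 0 < ρ →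
    0 < r → 0 < V → ∀ {g m : ℕ}, 2 ≤ 2 * g + m →
    majorant (Mθ / ρ) (max ((1 + ρ * Mφ) ^ 2) (1 + 4 * (ρ * Mφ))) r
      (genusGrowth Mθ ρ (min V (5 / 2 * constU ρ))) (argGrowth Mθ ρ (min V (5 / 2 * constU ρ)))
      g m * ((3 * g + 2 * m - 1).choose (m + 1) : ℝ) ≤
    c * (1 + 1 / (constU ρ / V)) / V * 0.998 ^ g * (2 * constU ρ / 27) ^ g *
      constQ Mθ Mφ ρ ^ (2 * g + m - 1) * (r * constP (constU ρ / V) / V ^ 2) ^ (3 * g + m - 2) *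
      ((3 * g + 2 * m - 1)! / (g ! * (m + 1)!)) := by
  obtain ⟨c, hc, hw⟩ := exists_genusWeight_le
  refine ⟨4 * c, by positivity, ?_⟩
  intro Mθ Mφ ρ r V hM hφ hρ hr hV g m hst
  have hu := constU_pos hρ
  set u := constU ρ with hudef
  have hv : 0 < min V (5 / 2 * u) := lt_min hV (by positivity)
  have hvu : min V (5 / 2 * u) ≤ 5 / 2 * u := min_le_right _ _
  have hv1 := one_div_min_le hu hV
  have hP := constP_div_sq hu hV
  set v := min V (5 / 2 * u)
  set q := max ((1 + ρ * Mφ) ^ 2) (1 + 4 * (ρ * Mφ)) with hq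
  have hq0 : 0 < q := lt_max_of_lt_right (by positivity)
  have hQ : constQ Mθ Mφ ρ = 2 * Mθ * q := by rw [constQ, hq, mul_assoc 4]
  rw [hQ, mul_div_assoc r, hP]
  set p := 1 / (v * (2 * u - 2 / 5 * v)) with hp
  have hp0 : 0 < p := by
    have : 0 < 2 * u - 2 / 5 * v := by linarith
    positivity
  have hg := growth_le hM hρ hv hvu hq0 hr hst hp
  have hD : decayWeight (3 * g + m - 2) ≤ 1 := by
    unfold decayWeight
    rw [div_le_one (by positivity)]
    linarith [Nat.cast_nonneg (α := ℝ) (3 * g + m - 2)]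
  have hfac : ((3 * g + m - 2)! : ℝ) * ((3 * g + 2 * m - 1).choose (m + 1) : ℝ) =
      (3 * g + 2 * m - 1)! / (m + 1)! := by
    have := Nat.choose_mul_factorial_mul_factorial (show m + 1 ≤ 3 * g + 2 * m - 1 by omega)
    rw [show 3 * g + 2 * m - 1 - (m + 1) = 3 * g + m - 2 by omega] at this
    rw [eq_div_iff (by positivity)]
    have h' : (((3 * g + 2 * m - 1).choose (m + 1) : ℝ)) * (m + 1)! * (3 * g + m - 2)! =
      (3 * g + 2 * m - 1)! := by exact_mod_cast this
    linarith
  have hwg := genusWeight_pos g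
  have hwl := hw g
  set R := (2 * u / 27) ^ g * (2 * Mθ * q) ^ (2 * g + m - 1) * (r * p) ^ (3 * g + m - 2) with hR
  have hR0 : 0 ≤ R := by positivity
  have hd0 := decayWeight_pos (3 * g + m - 2)
  calc _ = genusWeight g * decayWeight (3 * g + m - 2) *
        growth (Mθ / ρ) q r (genusGrowth Mθ ρ v) (argGrowth Mθ ρ v) g m *
        (((3 * g + m - 2)! : ℝ) * ((3 * g + 2 * m - 1).choose (m + 1) : ℝ)) := by
        unfold majorant; ring
    _ ≤ genusWeight g * 1 * (4 / v * 0.995 ^ g * (2 * u / 27) ^ g *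
        (2 * Mθ * q) ^ (2 * g + m - 1) * (r * p) ^ (3 * g + m - 2)) *
        ((3 * g + 2 * m - 1)! / (m + 1)!) := by
        rw [hfac]
        have : 0 ≤ growth (Mθ / ρ) q r (genusGrowth Mθ ρ v) (argGrowth Mθ ρ v) g m :=
          (growth_pos (by positivity) hq0 hr
            (genusGrowth_pos hM hρ hv (div_le_of_le_constU hρ hv hvu))
            (argGrowth_pos hM hρ hv (div_le_of_le_constU hρ hv hvu)) g m).le
        gcongr
    _ = (genusWeight g * 0.995 ^ g) * (1 / v) * (4 * R * ((3 * g + 2 * m - 1)! / (m + 1)!)) := by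
        rw [hR]; ring
    _ ≤ (c * 0.998 ^ g / g !) * ((1 + 1 / (u / V)) / V) *
        (4 * R * ((3 * g + 2 * m - 1)! / (m + 1)!)) := by gcongr
    _ = _ := by
        rw [hR]
        field_simp

/-! ### The explicit bound on the periods -/

namespace SpectralCurve

variable {X : Type u} [TopologicalSpace X] [T2Space X] [ChartedSpace ℂ X] [IsManifold 𝓘(ℂ) ω X]
variable {C : SpectralCurve X} (Z : C.LocalCoordinates)

theorem bounds_localData {Mθ Mφ ρ : ℝ} (h : IsBoundedCurveWith Z Mθ Mφ ρ) :
    (localData Z).Bounds Mθ Mφ ρ := by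
  obtain ⟨h1, h2, h3, h4, h5⟩ := h
  refine ⟨h1, h2, h3, fun a k => ?_, fun a b j k => ?_⟩
  · change ‖PowerSeries.coeff k (thetaSeries Z a)‖ ≤ _
    rw [thetaSeries, PowerSeries.coeff_mk]
    exact h4 a a.2 k
  · change ‖PowerSeries.coeff k (phiSeries Z a b j)‖ ≤ _
    rw [phiSeries, PowerSeries.coeff_mk, norm_div]
    have e : ‖(2 * (j : ℂ) + 1)‖ = 2 * j + 1 := by
      have : (2 * (j : ℂ) + 1) = ((2 * j + 1 : ℕ) : ℂ) := by push_cast; ring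
      rw [this, Complex.norm_natCast]
      push_cast
      ring
    rw [e, div_right_comm, div_div Mφ, ← pow_add, add_comm j k]
    gcongr
    exact h5 a a.2 b b.2 k j

/-- The explicit bound, improved by a factor that decays exponentially with the genus. -/
theorem exists_norm_period_le : ∃ c : ℝ, 0 < c ∧ ∀ (X : Type u) [TopologicalSpace X] [T2Space X]
    [ChartedSpace ℂ X] [IsManifold 𝓘(ℂ) ω X] (C : SpectralCurve X) (Z : C.LocalCoordinates),
    C.IsRegular → ∀ Mθ Mφ ρ : ℝ, IsBoundedCurveWith Z Mθ Mφ ρ →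
    ∀ n : ℕ, 1 ≤ n → ∀ (I : Fin n → Module.Dual ℂ C.forms) (N v : Fin n → ℝ),
    (∀ i, IsBoundedWith Z (I i) (N i) (v i)) → ∀ g : ℕ, 2 < 2 * g + n →
    ∀ V : ℝ, 0 < V → (∀ i, V ≤ v i) →
    ‖C.period n I (correlator Z g n)‖ ≤ (∏ i, (C.ram.card : ℝ) * N i) *
      (c * (1 + 1 / (constU ρ / V)) / V) * 0.998 ^ g * (2 * constU ρ / 27) ^ g *
      constQ Mθ Mφ ρ ^ (2 * g + n - 2) *
      ((C.ram.card : ℝ) * constP (constU ρ / V) / V ^ 2) ^ (3 * g + n - 3) *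
      ((3 * g + 2 * n - 3)! / (g ! * n !)) := by
  obtain ⟨c, hc, hmaj⟩ := exists_majorant_le
  refine ⟨c, hc, ?_⟩
  intro X _ _ _ _ C Z hreg Mθ Mφ ρ hb n hn I N v hI g hst V hV hVv
  obtain ⟨m, rfl⟩ : ∃ m, n = m + 1 := ⟨n - 1, by omega⟩
  have hL := bounds_localData Z hb
  have hst' : 2 ≤ 2 * g + m := by omega
  have hN : ∀ i, 0 < N i := fun i => (hI i).1
  rw [show 2 * g + (m + 1) - 2 = 2 * g + m - 1 by omega,
    show 3 * g + (m + 1) - 3 = 3 * g + m - 2 by omega,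
    show 3 * g + 2 * (m + 1) - 3 = 3 * g + 2 * m - 1 by omega]
  rcases Finset.eq_empty_or_nonempty C.ram with he | hne
  -- Without ramification points there are no coefficients, `A = 0` is admissible, and both sides
  -- vanish.
  · have h := norm_period_correlator_le Z hreg hst' le_rfl hI hV hVv
      (fun lam => absurd lam.1.2 (by simp [he]))
    rw [zero_mul, zero_mul] at h
    have hp : ∏ i : Fin (m + 1), (C.ram.card : ℝ) * N i = 0 := by
      rw [he, Finset.card_empty, Nat.cast_zero]
      simp
    rw [hp]
    simpa using h
  · have : Nonempty C.ram := hne.coe_sort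
    have hr : (0 : ℝ) < C.ram.card := by exact_mod_cast hne.card_pos
    have hu := constU_pos hL.ρ_pos
    have hv : 0 < min V (5 / 2 * constU ρ) := lt_min hV (by positivity)
    have hν := div_le_of_le_constU hL.ρ_pos hv (min_le_right _ _)
    let _ := Classical.decEq X
    have hcoef := hL.coefBound (3 * g + m) hv hν _ g m rfl hst' le_rfl
    have hA := majorant_pos (T := Mθ / ρ) (q := max ((1 + ρ * Mφ) ^ 2) (1 + 4 * (ρ * Mφ)))
      (r := (Fintype.card C.ram : ℝ)) (div_pos hL.Mθ_pos hL.ρ_pos)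
      (lt_max_of_lt_right (by have := hL.ρ_pos; have := hL.Mφ_nonneg; positivity))
      (by rw [Fintype.card_coe]; exact hr)
      (genusGrowth_pos hL.Mθ_pos hL.ρ_pos hv hν) (argGrowth_pos hL.Mθ_pos hL.ρ_pos hv hν) g m
    have h := norm_period_correlator_le Z hreg hst' hA.le hI hv
      (fun i => (min_le_left _ _).trans (hVv i)) (fun lam κ => by convert hcoef lam κ)
    have hm := hmaj hL.Mθ_pos hL.Mφ_nonneg hL.ρ_pos hr hV hst'
    rw [Fintype.card_coe] at h
    have hP : 0 ≤ ∏ i : Fin (m + 1), (C.ram.card : ℝ) * N i :=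
      Finset.prod_nonneg fun i _ => mul_nonneg hr.le (hN i).le
    refine h.trans ?_
    rw [mul_right_comm, mul_comm]
    refine (mul_le_mul_of_nonneg_left hm hP).trans_eq ?_
    ring

end SpectralCurve

/-! ### The bound for a fixed number of arguments -/

theorem iInf_pos_of_pos {n : ℕ} (hn : 1 ≤ n) {v : Fin n → ℝ} (hv : ∀ i, 0 < v i) :
    0 < ⨅ i, v i := by
  have : Nonempty (Fin n) := ⟨⟨0, hn⟩⟩
  obtain ⟨i, hi⟩ := exists_eq_ciInf_of_finite (f := v)
  rw [← hi]
  exact hv i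

theorem constP_pos {w : ℝ} (hw : 0 < w) : 0 < constP w := by
  unfold constP
  split_ifs with h
  · positivity
  · have : 0 < 10 * w - 2 := by linarith
    positivity

theorem constQ_pos {Mθ Mφ ρ : ℝ} (hM : 0 < Mθ) (hφ : 0 ≤ Mφ) (hρ : 0 < ρ) :
    0 < constQ Mθ Mφ ρ := by
  have : 0 < max ((1 + ρ * Mφ) ^ 2) (1 + 4 * ρ * Mφ) := lt_max_of_lt_right (by positivity)
  unfold constQ
  positivity

theorem choose_mul_two_pow_le (n k : ℕ) (h : k ≤ n) : n.choose k * 2 ^ (n - k) ≤ 3 ^ n := by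
  have h1 := add_pow (1 : ℕ) 2 n
  norm_num at h1
  rw [h1]
  refine le_trans (le_of_eq (mul_comm _ _)) (Finset.single_le_sum (f := fun k => 2 ^ (n - k) *
    n.choose k) (fun _ _ => Nat.zero_le _) (Finset.mem_range.2 (by omega : k < n + 1)))

/-- With `k = 2g + n - 3` the left side is `C(k+n+g, g) (k+n)!/n!`. One term of `(1 + 2) ^ (k+n+g)`
bounds the binomial by `3 ^ (k+n+g) / 2 ^ (k+n)`, which is `(27/4) ^ g` up to a constant depending
on `n`, the true exponential rate of `C(3g, g)`. Removing `n` factors from `(k+n)!` costs a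
polynomial in `g`. -/
theorem factorial_div_le {g n : ℕ} (h : 2 < 2 * g + n) :
    ((3 * g + 2 * n - 3)! / (g ! * n !) : ℝ) ≤
      (27 / 4) ^ g * ((9 / 4) ^ n * (2 * n + 2) ^ n) * ((g : ℝ) + 1) ^ n * (2 * g + n - 3)! := by
  obtain ⟨k, hk⟩ : ∃ k, 2 * g + n = k + 3 := ⟨2 * g + n - 3, by omega⟩
  have e1 : 3 * g + 2 * n - 3 = k + n + g := by omega
  have e2 : 2 * g + n - 3 = k := by omega
  rw [e1, e2]
  have a1 : ((k + n + g)! : ℝ) = (k + n + g).choose g * g ! * (k + n)! := by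
    have := Nat.choose_mul_factorial_mul_factorial (show g ≤ k + n + g by omega)
    rw [Nat.add_sub_cancel] at this
    exact_mod_cast this.symm
  have a2 : ((k + n)! : ℝ) ≤ k ! * (k + n) ^ n := by
    have h1 := Nat.factorial_mul_ascFactorial k n
    have h2 := Nat.ascFactorial_le_pow_add k n
    rw [← h1]
    exact_mod_cast Nat.mul_le_mul_left _ h2
  have a3 : ((k : ℝ) + n) ≤ (2 * n + 2) * (g + 1) := by
    have : (k : ℝ) + 3 = 2 * g + n := by exact_mod_cast hk.symm
    have hn : (0 : ℝ) ≤ n := n.cast_nonneg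
    have hg : (0 : ℝ) ≤ g := g.cast_nonneg
    nlinarith
  have a4 : ((k + n + g).choose g : ℝ) ≤ (27 / 4) ^ g * (9 / 4) ^ n := by
    have h1 := choose_mul_two_pow_le (k + n + g) g (by omega)
    rw [Nat.add_sub_cancel] at h1
    have h2 : ((k + n + g).choose g : ℝ) * 2 ^ (k + n) ≤ 3 ^ (k + n + g) := by exact_mod_cast h1
    have h3 : (3 : ℝ) ^ (k + n + g) * 27 = 27 ^ g * 9 ^ n := by
      have : (27 : ℝ) ^ g * 9 ^ n = 3 ^ (3 * g + 2 * n) := by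
        rw [pow_add, pow_mul, pow_mul]; norm_num
      rw [this, show 3 * g + 2 * n = k + n + g + 3 by omega, pow_add _ _ 3]
      norm_num
    have h4 : (2 : ℝ) ^ (k + n) * 8 = 4 ^ g * 4 ^ n := by
      have : (4 : ℝ) ^ g * 4 ^ n = 2 ^ (2 * g + 2 * n) := by
        rw [pow_add, pow_mul, pow_mul]; norm_num
      rw [this, show 2 * g + 2 * n = k + n + 3 by omega, pow_add _ _ 3]
      norm_num
    rw [div_pow, div_pow, div_mul_div_comm, ← h3, ← h4, le_div_iff₀ (by positivity)]
    have : (0 : ℝ) ≤ 3 ^ (k + n + g) := by positivity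
    linarith
  rw [a1]
  have hn1 : (1 : ℝ) ≤ n ! := by exact_mod_cast Nat.one_le_iff_ne_zero.2 (Nat.factorial_ne_zero n)
  have : ((k + n + g).choose g : ℝ) * g ! * (k + n)! / (g ! * n !) =
      (k + n + g).choose g * (k + n)! / n ! := by field_simp
  rw [this]
  calc _ ≤ ((k + n + g).choose g : ℝ) * (k + n)! := div_le_self (by positivity) hn1
    _ ≤ ((27 / 4) ^ g * (9 / 4) ^ n) * (k ! * ((2 * n + 2) * (g + 1)) ^ n) := by
        gcongr
        exact a2.trans (by gcongr)
    _ = _ := by rw [mul_pow (2 * (n : ℝ) + 2)]; ring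

/-- The rates `4/27` and `27/4` cancel exactly, so the polynomial `(g+1) ^ n` can only be absorbed
by the surplus `0.998 ^ g`. -/
theorem exists_factorial_div_le (n : ℕ) : ∃ c : ℝ, 0 < c ∧ ∀ g : ℕ, 2 < 2 * g + n →
    0.998 ^ g * (4 / 27) ^ g * ((3 * g + 2 * n - 3)! / (g ! * n !) : ℝ) ≤ c * (2 * g + n - 3)! := by
  obtain ⟨c, hc, h⟩ := exists_pow_mul_pow_le n (x := 0.998) (by norm_num) (by norm_num)
  refine ⟨(9 / 4) ^ n * (2 * n + 2) ^ n * c, by positivity, fun g hg => ?_⟩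
  have e : (4 / 27 : ℝ) ^ g * (27 / 4) ^ g = 1 := by rw [← mul_pow]; norm_num
  calc _ ≤ 0.998 ^ g * (4 / 27) ^ g * ((27 / 4) ^ g * ((9 / 4) ^ n * (2 * n + 2) ^ n) *
        ((g : ℝ) + 1) ^ n * (2 * g + n - 3)!) := by gcongr; exact factorial_div_le hg
    _ = ((4 / 27 : ℝ) ^ g * (27 / 4) ^ g) * ((9 / 4) ^ n * (2 * n + 2) ^ n) *
        (((g : ℝ) + 1) ^ n * 0.998 ^ g) * (2 * g + n - 3)! := by ring
    _ ≤ 1 * ((9 / 4) ^ n * (2 * n + 2) ^ n) * c * (2 * g + n - 3)! := by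
        rw [e]; gcongr; exact h g
    _ = _ := by ring

/-- With `a = √(u/2)` and `b = x ^ (3/2)` the powers indexed by `g` are rewritten as powers indexed
by `2g - 2 + n`; the correction depends on `n` alone. -/
theorem pow_comparison {u x a b : ℝ} (hx : 0 < x) (ha : 0 < a) (hb : 0 < b) (hau : a ^ 2 = u / 2)
    (hbx : b ^ 2 = x ^ 3) {g n : ℕ} (h : 2 < 2 * g + n) :
    (2 * u / 27) ^ g * x ^ (3 * g + n - 3) = (4 / 27) ^ g * (a * b) ^ (2 * g + n - 2) *
      (a ^ 2 * b ^ 2 * x ^ n / (a ^ n * b ^ n * x ^ 3)) := by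
  have h1 : (2 * u / 27) ^ g = (4 / 27) ^ g * a ^ (2 * g) := by
    rw [pow_mul, hau, ← mul_pow]; congr 1; ring
  have h2 : x ^ (3 * g + n - 3) * x ^ 3 = b ^ (2 * g) * x ^ n := by
    rw [pow_mul, hbx, ← pow_mul, ← pow_add, ← pow_add]; congr 1; omega
  have h3 : (a * b) ^ (2 * g + n - 2) * (a ^ 2 * b ^ 2) = a ^ (2 * g) * b ^ (2 * g) *
      (a ^ n * b ^ n) := by
    rw [← mul_pow, ← mul_pow, ← mul_pow, ← pow_add, ← pow_add]; congr 1; omega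
  rw [h1, mul_assoc ((4 / 27 : ℝ) ^ g), mul_assoc ((4 / 27 : ℝ) ^ g)]
  congr 1
  rw [mul_div_assoc', eq_div_iff (by positivity)]
  linear_combination a ^ (2 * g) * a ^ n * b ^ n * h2 - x ^ n * h3

namespace SpectralCurve

/-- The bound for a fixed number of arguments, with constants that depend only on the number of
ramification points and on the constants in the boundedness assumptions. -/
theorem exists_norm_period_le_gamma {n : ℕ} (hn : 1 ≤ n) (r : ℕ) {Mθ Mφ ρ : ℝ} {N v : Fin n → ℝ}
    (hM : 0 < Mθ) (hφ : 0 ≤ Mφ) (hρ : 0 < ρ) (hN : ∀ i, 0 < N i) (hv : ∀ i, 0 < v i) :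
    ∃ Sₙ A : ℝ, 0 < Sₙ ∧ 0 < A ∧
      (0 < r → A⁻¹ = constQ Mθ Mφ ρ / (⨅ i, v i) ^ 3 * √(constU ρ / 2) *
        ((r : ℝ) * constP (constU ρ / ⨅ i, v i)) ^ (3 / 2 : ℝ)) ∧
      ∀ (X : Type u) [TopologicalSpace X] [T2Space X] [ChartedSpace ℂ X]
        [IsManifold 𝓘(ℂ) ω X] (C : SpectralCurve X) (Z : C.LocalCoordinates),
        C.IsRegular → C.ram.card = r → IsBoundedCurveWith Z Mθ Mφ ρ →
        ∀ I : Fin n → Module.Dual ℂ C.forms,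
        (∀ i, IsBoundedWith Z (I i) (N i) (v i)) →
        ∀ g : ℕ, 2 < 2 * g + n →
          ‖C.period n I (correlator Z g n)‖ ≤
            Sₙ * Real.Gamma (2 * (g : ℝ) - 2 + n) / A ^ (2 * g + n - 2) := by
  obtain ⟨c, hc, hbd⟩ := exists_norm_period_le.{u}
  obtain ⟨d, hd, hfac⟩ := exists_factorial_div_le n
  have hV := iInf_pos_of_pos hn hv
  have hVv : ∀ i, (⨅ i, v i) ≤ v i := fun i => ciInf_le (Set.finite_range v).bddBelow i
  set V := ⨅ i, v i with hVdef
  have hu := constU_pos hρ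
  have hQ := constQ_pos hM hφ hρ
  have hP := constP_pos (show 0 < constU ρ / V by positivity)
  set u := constU ρ with hudef
  set P := constP (u / V) with hPdef
  set Q := constQ Mθ Mφ ρ with hQdef
  have hΓ : ∀ g : ℕ, 2 < 2 * g + n → Real.Gamma (2 * (g : ℝ) - 2 + n) = (2 * g + n - 3)! := by
    intro g hg
    rw [← Real.Gamma_nat_eq_factorial]
    congr 1
    obtain ⟨k, hk⟩ : ∃ k, 2 * g + n = k + 3 := ⟨2 * g + n - 3, by omega⟩
    have hk' : 2 * (g : ℝ) + n = k + 3 := by exact_mod_cast hk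
    rw [hk, Nat.add_sub_cancel]
    linarith
  -- For `r = 0` the formula for `A⁻¹` would give `0`; all periods vanish and any `A` serves.
  rcases Nat.eq_zero_or_pos r with rfl | hr
  · refine ⟨1, 1, one_pos, one_pos, fun h => absurd h (lt_irrefl _), ?_⟩
    intro X _ _ _ _ C Z hreg hcard hb I hI g hg
    have h := hbd X C Z hreg Mθ Mφ ρ hb n hn I N v hI g hg V hV hVv
    have h0 : ∏ i : Fin n, (C.ram.card : ℝ) * N i = 0 := by
      rw [hcard, Nat.cast_zero]
      simp only [zero_mul, Finset.prod_const, Finset.card_univ, Fintype.card_fin]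
      exact zero_pow (by omega)
    rw [h0] at h
    simp only [zero_mul] at h
    refine h.trans ?_
    rw [hΓ g hg]
    positivity
  have hr' : (0 : ℝ) < r := by exact_mod_cast hr
  set a := √(u / 2) with ha
  have ha0 : 0 < a := Real.sqrt_pos.2 (by positivity)
  have hau : a ^ 2 = u / 2 := Real.sq_sqrt (by positivity)
  set b := (r * P) ^ (3 / 2 : ℝ) / V ^ 3 with hb
  have hb0 : 0 < b := by positivity
  set x := r * P / V ^ 2 with hx
  have hx0 : 0 < x := by positivity
  have hbx : b ^ 2 = x ^ 3 := by
    rw [hb, hx, div_pow, div_pow, ← Real.rpow_natCast _ 2, ← Real.rpow_mul (by positivity)]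
    norm_num
    rw [← pow_mul, ← pow_mul]
  have hA : Q * (a * b) = Q / V ^ 3 * a * (r * P) ^ (3 / 2 : ℝ) := by
    rw [hb]; ring
  have hN0 : 0 < ∏ i, (r : ℝ) * N i := Finset.prod_pos fun i _ => mul_pos hr' (hN i)
  refine ⟨(∏ i, (r : ℝ) * N i) * (c * (1 + 1 / (u / V)) / V) *
    (a ^ 2 * b ^ 2 * x ^ n / (a ^ n * b ^ n * x ^ 3)) * d, (Q * (a * b))⁻¹, by positivity,
    by positivity, fun _ => by rw [inv_inv, hA], ?_⟩
  intro X _ _ _ _ C Z hreg hcard hbc I hI g hg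
  have h := hbd X C Z hreg Mθ Mφ ρ hbc n hn I N v hI g hg V hV hVv
  rw [hcard] at h
  refine h.trans ?_
  have hp := pow_comparison hx0 ha0 hb0 hau hbx hg
  rw [hΓ g hg, inv_pow, div_inv_eq_mul, mul_pow Q]
  set K := (∏ i, (r : ℝ) * N i) * (c * (1 + 1 / (u / V)) / V) with hK
  have hK0 : 0 < K := by positivity
  set E := a ^ 2 * b ^ 2 * x ^ n / (a ^ n * b ^ n * x ^ 3) with hE
  have hE0 : 0 < E := by positivity
  set F : ℝ := (3 * g + 2 * n - 3)! / (g ! * n !) with hF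
  calc K * 0.998 ^ g * (2 * u / 27) ^ g * Q ^ (2 * g + n - 2) * x ^ (3 * g + n - 3) * F
      = K * 0.998 ^ g * ((2 * u / 27) ^ g * x ^ (3 * g + n - 3)) * Q ^ (2 * g + n - 2) * F := by
        ring
    _ = K * E * (0.998 ^ g * (4 / 27) ^ g * F) *
        (Q ^ (2 * g + n - 2) * (a * b) ^ (2 * g + n - 2)) := by rw [hp]; ring
    _ ≤ K * E * (d * (2 * g + n - 3)!) *
        (Q ^ (2 * g + n - 2) * (a * b) ^ (2 * g + n - 2)) := by
        exact mul_le_mul_of_nonneg_right (mul_le_mul_of_nonneg_left (hfac g hg) (by positivity))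
          (by positivity)
    _ = _ := by ring

end SpectralCurve

/-! ### The generating series -/

theorem add_three_le (k : ℕ) : (k : ℝ) + 3 ≤ 3 * 2 ^ k := by
  have : (k : ℝ) + 1 ≤ 2 ^ k := by exact_mod_cast Nat.lt_two_pow_self (n := k)
  linarith [Nat.cast_nonneg (α := ℝ) k]

/-- Writing `3g + 2n - 3 = χ + g + (n-1)` exhibits the quotient as `χ!` times two binomial
coefficients, divided by `n`; each binomial is at most a power of `2`. -/
theorem factorial_div_mul_le {χ g n : ℕ} (hχ : 0 < χ) (h : 2 * g + n = χ + 2) (hn : 1 ≤ n) :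
    ((3 * g + 2 * n - 3)! / (g ! * n !) : ℝ) ≤ 8 * 8 ^ χ * χ ! := by
  obtain ⟨m, rfl⟩ : ∃ m, n = m + 1 := ⟨n - 1, by omega⟩
  rw [show 3 * g + 2 * (m + 1) - 3 = χ + (g + m) by omega]
  have a1 := Nat.add_choose_mul_factorial_mul_factorial χ (g + m)
  have a2 := Nat.add_choose_mul_factorial_mul_factorial g m
  have b1 : (χ + (g + m)).choose (g + m) ≤ 2 ^ (2 * χ + 1) :=
    (Nat.choose_le_two_pow _ _).trans (Nat.pow_le_pow_right (by norm_num) (by omega))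
  have b2 : (g + m).choose m ≤ 2 ^ (χ + 2) :=
    (Nat.choose_le_two_pow _ _).trans (Nat.pow_le_pow_right (by norm_num) (by omega))
  have hm : m ! ≤ (m + 1)! := Nat.factorial_le (by omega)
  have key : (χ + (g + m))! ≤ 8 * 8 ^ χ * χ ! * (g ! * (m + 1)!) := by
    rw [← a1, ← a2]
    calc _ ≤ 2 ^ (2 * χ + 1) * χ ! * (2 ^ (χ + 2) * g ! * (m + 1)!) := by gcongr
      _ = _ := by
        have : (8 : ℕ) * 8 ^ χ = 2 ^ (2 * χ + 1) * 2 ^ (χ + 2) := by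
          rw [← pow_succ', ← pow_add, show 2 * χ + 1 + (χ + 2) = 3 * (χ + 1) by ring, pow_mul]
          norm_num
        rw [this]
        ring
  rw [div_le_iff₀ (by positivity)]
  exact_mod_cast key

namespace SpectralCurve

variable {X : Type u} [TopologicalSpace X] [T2Space X] [ChartedSpace ℂ X] [IsManifold 𝓘(ℂ) ω X]
variable {C : SpectralCurve X} (Z : C.LocalCoordinates)

/-- At most one genus contributes to a given power of `ħ`; bounding all `χ + 3` summands instead
costs only `2 ^ χ`. -/
theorem isGevreyOne_periodSeries (hreg : C.IsRegular) {n : ℕ} (hn : 1 ≤ n)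
    {I : Fin n → Module.Dual ℂ C.forms} (hI : ∀ i, ∃ N v : ℝ, IsBoundedWith Z (I i) N v) :
    IsGevreyOne (periodSeries Z n I) := by
  choose N v hI using hI
  obtain ⟨Mθ, Mφ, ρ, hb⟩ := exists_isBoundedCurveWith Z hreg
  obtain ⟨S, A, hS, hA, -, h⟩ := exists_norm_period_le_gamma.{u} hn C.ram.card hb.1 hb.2.1 hb.2.2.1
    (fun i => (hI i).1) (fun i => (hI i).2.1)
  refine ⟨3 * S, 2 * A⁻¹, by positivity, by positivity, fun χ => ?_⟩
  rw [periodSeries, PowerSeries.coeff_mk]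
  have hterm : ∀ g ∈ Finset.range (χ + 3), ‖(if 0 < χ ∧ 2 * g + n = χ + 2 then
      C.period n I (correlator Z g n) else 0)‖ ≤ S * (A⁻¹) ^ χ * χ ! := by
    intro g _
    split_ifs with hc
    · refine (h X C Z hreg rfl hb I hI g (by omega)).trans ?_
      have e : 2 * (g : ℝ) - 2 + n = (χ - 1 : ℕ) + 1 := by
        have : 2 * (g : ℝ) + n = χ + 2 := by exact_mod_cast hc.2
        rw [Nat.cast_sub hc.1]
        push_cast
        linarith
      rw [e, Real.Gamma_nat_eq_factorial, show 2 * g + n - 2 = χ by omega, inv_pow,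
        div_eq_mul_inv, mul_right_comm]
      have : ((χ - 1)! : ℝ) ≤ χ ! := by exact_mod_cast Nat.factorial_le (by omega)
      gcongr
    · rw [norm_zero]
      positivity
  refine (norm_sum_le _ _).trans ((Finset.sum_le_sum hterm).trans ?_)
  rw [Finset.sum_const, Finset.card_range, nsmul_eq_mul, mul_pow]
  have h3 := add_three_le χ
  push_cast
  calc ((χ : ℝ) + 3) * (S * A⁻¹ ^ χ * χ !) ≤ (3 * 2 ^ χ) * (S * A⁻¹ ^ χ * χ !) := by gcongr
    _ = _ := by ring

/-- Here `n` varies together with `g`, so the explicit bound is used. All exponents in it are at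
most `3(χ + 2)`, so each power is dominated by a fixed base to the power `χ + 2`. -/
theorem exists_norm_period_const_le (hreg : C.IsRegular) {I : Module.Dual ℂ C.forms}
    (hI : ∃ N v : ℝ, IsBoundedWith Z I N v) : ∃ K b : ℝ, 0 < K ∧ 0 < b ∧
      ∀ χ g n : ℕ, 0 < χ → 2 * g + n = χ + 2 → 1 ≤ n →
        ‖C.period n (fun _ => I) (correlator Z g n)‖ ≤ K * b ^ χ * χ ! := by
  obtain ⟨N, v, hI⟩ := hI
  have hN := hI.1
  have hv := hI.2.1
  obtain ⟨Mθ, Mφ, ρ, hb⟩ := exists_isBoundedCurveWith Z hreg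
  obtain ⟨c, hc, h⟩ := exists_norm_period_le.{u}
  have hu := constU_pos hb.2.2.1
  have hQ := constQ_pos hb.1 hb.2.1 hb.2.2.1
  have hP := constP_pos (show 0 < constU ρ / v by positivity)
  obtain ⟨r, hr⟩ : ∃ r : ℝ, (C.ram.card : ℝ) = r := ⟨_, rfl⟩
  have hr0 : 0 ≤ r := hr ▸ Nat.cast_nonneg _
  obtain ⟨K, hK⟩ : ∃ K : ℝ, c * (1 + 1 / (constU ρ / v)) / v = K := ⟨_, rfl⟩
  have hK0 : 0 < K := hK ▸ by positivity
  obtain ⟨x, hx⟩ : ∃ x : ℝ, r * constP (constU ρ / v) / v ^ 2 = x := ⟨_, rfl⟩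
  have hx0 : 0 ≤ x := hx ▸ by positivity
  obtain ⟨z, hz⟩ : ∃ z : ℝ, 2 * constU ρ / 27 = z := ⟨_, rfl⟩
  have hz0 : 0 ≤ z := hz ▸ by positivity
  obtain ⟨Q, hQd⟩ : ∃ Q : ℝ, constQ Mθ Mφ ρ = Q := ⟨_, rfl⟩
  rw [hQd] at hQ
  have hpow : ∀ {y : ℝ} {i χ : ℕ}, 0 ≤ y → i ≤ 3 * (χ + 2) → y ^ i ≤ ((1 + y) ^ 3) ^ (χ + 2) :=
    fun {y i χ} hy hi => (pow_le_pow_left₀ hy (by linarith) i).trans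
      ((pow_le_pow_right₀ (by linarith) hi).trans_eq (pow_mul _ _ _))
  obtain ⟨Y, hY⟩ : ∃ Y : ℝ, (1 + r * N) ^ 3 * (1 + z) ^ 3 * (1 + x) ^ 3 = Y := ⟨_, rfl⟩
  have hY0 : 0 < Y := hY ▸ by positivity
  refine ⟨K * Y ^ 2 * 8, Y * Q * 8, by positivity, by positivity, fun χ g n hχ hg hn => ?_⟩
  have h1 := h X C Z hreg Mθ Mφ ρ hb n hn (fun _ => I) (fun _ => N) (fun _ => v)
    (fun _ => hI) g (by omega) v hv (fun _ => le_rfl)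
  rw [Finset.prod_const, Finset.card_univ, Fintype.card_fin, show 2 * g + n - 2 = χ by omega, hr,
    hK, hx, hz, hQd] at h1
  have p1 : (r * N) ^ n ≤ ((1 + r * N) ^ 3) ^ (χ + 2) := hpow (by positivity) (by omega)
  have p2 : z ^ g ≤ ((1 + z) ^ 3) ^ (χ + 2) := hpow hz0 (by omega)
  have p3 : x ^ (3 * g + n - 3) ≤ ((1 + x) ^ 3) ^ (χ + 2) := hpow hx0 (by omega)
  have p4 : (0.998 : ℝ) ^ g ≤ 1 := pow_le_one₀ (by norm_num) (by norm_num)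
  have p5 := factorial_div_mul_le hχ hg hn
  have hYp : ((1 + r * N) ^ 3) ^ (χ + 2) * ((1 + z) ^ 3) ^ (χ + 2) * ((1 + x) ^ 3) ^ (χ + 2) =
      Y ^ χ * Y ^ 2 := by
    rw [← pow_add, ← hY, mul_pow, mul_pow]
  refine h1.trans ?_
  calc _ ≤ ((1 + r * N) ^ 3) ^ (χ + 2) * K * 1 * ((1 + z) ^ 3) ^ (χ + 2) * Q ^ χ *
        ((1 + x) ^ 3) ^ (χ + 2) * (8 * 8 ^ χ * χ !) := by gcongr
    _ = (((1 + r * N) ^ 3) ^ (χ + 2) * ((1 + z) ^ 3) ^ (χ + 2) * ((1 + x) ^ 3) ^ (χ + 2)) *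
        (K * Q ^ χ * (8 * 8 ^ χ * χ !)) := by ring
    _ = _ := by
        rw [hYp, mul_pow, mul_pow]
        ring

theorem isGevreyOne_totalPeriodSeries (hreg : C.IsRegular) {I : Module.Dual ℂ C.forms}
    (hI : ∃ N v : ℝ, IsBoundedWith Z I N v) : IsGevreyOne (totalPeriodSeries Z I) := by
  obtain ⟨K, b, hK, hb, h⟩ := exists_norm_period_const_le Z hreg hI
  refine ⟨9 * K, 4 * b, by positivity, by positivity, fun χ => ?_⟩
  rw [totalPeriodSeries, PowerSeries.coeff_mk]
  have hterm : ∀ g ∈ Finset.range (χ + 3), ∀ n ∈ Finset.Icc 1 (χ + 2),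
      ‖(if 0 < χ ∧ 2 * g + n = χ + 2 then
      C.period n (fun _ => I) (correlator Z g n) / (n ! : ℂ) else 0)‖ ≤ K * b ^ χ * χ ! := by
    intro g _ n hn
    rw [Finset.mem_Icc] at hn
    split_ifs with hc
    · have hn1 : (1 : ℝ) ≤ n ! := by
        exact_mod_cast Nat.one_le_iff_ne_zero.2 (Nat.factorial_ne_zero n)
      rw [norm_div, Complex.norm_natCast]
      exact (div_le_self (norm_nonneg _) hn1).trans (h χ g n hc.1 hc.2 hn.1)
    · rw [norm_zero]
      positivity
  refine (norm_sum_le _ _).trans ((Finset.sum_le_sum fun g hg => (norm_sum_le _ _).trans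
    (Finset.sum_le_sum (hterm g hg))).trans ?_)
  simp only [Finset.sum_const, Finset.card_range, Nat.card_Icc, nsmul_eq_mul]
  have h3 := add_three_le χ
  have h4 : ((χ + 2 + 1 - 1 : ℕ) : ℝ) ≤ 3 * 2 ^ χ := by
    rw [Nat.add_sub_cancel]
    push_cast
    linarith
  have h5 : ((χ + 3 : ℕ) : ℝ) ≤ 3 * 2 ^ χ := by
    push_cast
    linarith
  have e : (4 : ℝ) ^ χ = 2 ^ χ * 2 ^ χ := by rw [← mul_pow]; norm_num
  calc _ ≤ (3 * 2 ^ χ) * ((3 * 2 ^ χ) * (K * b ^ χ * χ !)) := by gcongr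
    _ = _ := by
      rw [mul_pow, e]
      ring

end SpectralCurve

end TopRec

end

theorem mainTheorem3 :
    -- a universal function `S`, positive on the positive reals
    ∃ S : ℝ → ℝ, (∀ w, 0 < w → 0 < S w) ∧
    -- regular spectral curves are bounded, and the correlators lie in the domain of the periods
    (∀ (X : Type u) [TopologicalSpace X] [T2Space X] [ChartedSpace ℂ X] [IsManifold 𝓘(ℂ) ω X]
      (C : TopRec.SpectralCurve X) (Z : C.LocalCoordinates), C.IsRegular →
      (∃ Mθ Mφ ρ : ℝ, TopRec.SpectralCurve.IsBoundedCurveWith Z Mθ Mφ ρ) ∧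
      (∀ g n : ℕ, 1 ≤ n → 2 < 2 * g + n →
        TopRec.SpectralCurve.correlator Z g n ∈ C.tensorPower n)) ∧
    -- the explicit bound
    (∀ (X : Type u) [TopologicalSpace X] [T2Space X] [ChartedSpace ℂ X] [IsManifold 𝓘(ℂ) ω X]
      (C : TopRec.SpectralCurve X) (Z : C.LocalCoordinates), C.IsRegular →
      ∀ Mθ Mφ ρ : ℝ, TopRec.SpectralCurve.IsBoundedCurveWith Z Mθ Mφ ρ →
      ∀ (n : ℕ), 1 ≤ n → ∀ (I : Fin n → Module.Dual ℂ C.forms) (N v : Fin n → ℝ),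
      (∀ i, TopRec.SpectralCurve.IsBoundedWith Z (I i) (N i) (v i)) →
      ∀ g : ℕ, 2 < 2 * g + n →
        ‖C.period n I (TopRec.SpectralCurve.correlator Z g n)‖ ≤
          (∏ i, (C.ram.card : ℝ) * N i) *
          (S (TopRec.constU ρ / ⨅ i, v i) / ⨅ i, v i) *
          (2 * TopRec.constU ρ / 27) ^ g *
          TopRec.constQ Mθ Mφ ρ ^ (2 * g + n - 2) *
          ((C.ram.card : ℝ) * TopRec.constP (TopRec.constU ρ / ⨅ i, v i) / (⨅ i, v i) ^ 2)
            ^ (3 * g + n - 3) *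
          (((3 * g + 2 * n - 3)! : ℝ) / ((g ! : ℝ) * (n ! : ℝ)))) ∧
    -- the bound for fixed `n`, with constants that depend only on `n`, on the number `r` of
    -- ramification points, and on the constants in the boundedness assumptions
    (∀ (n : ℕ), 1 ≤ n → ∀ (r : ℕ) (Mθ Mφ ρ : ℝ) (N v : Fin n → ℝ),
      0 < Mθ → 0 ≤ Mφ → 0 < ρ → (∀ i, 0 < N i) → (∀ i, 0 < v i) →
      ∃ Sₙ A : ℝ, 0 < Sₙ ∧ 0 < A ∧
        (0 < r → A⁻¹ = TopRec.constQ Mθ Mφ ρ / (⨅ i, v i) ^ 3 * √(TopRec.constU ρ / 2) *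
          ((r : ℝ) * TopRec.constP (TopRec.constU ρ / ⨅ i, v i)) ^ (3 / 2 : ℝ)) ∧
        ∀ (X : Type u) [TopologicalSpace X] [T2Space X] [ChartedSpace ℂ X]
          [IsManifold 𝓘(ℂ) ω X] (C : TopRec.SpectralCurve X) (Z : C.LocalCoordinates),
          C.IsRegular → C.ram.card = r →
          TopRec.SpectralCurve.IsBoundedCurveWith Z Mθ Mφ ρ →
          ∀ I : Fin n → Module.Dual ℂ C.forms,
          (∀ i, TopRec.SpectralCurve.IsBoundedWith Z (I i) (N i) (v i)) →
          ∀ g : ℕ, 2 < 2 * g + n →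
            ‖C.period n I (TopRec.SpectralCurve.correlator Z g n)‖ ≤
              Sₙ * Real.Gamma (2 * (g : ℝ) - 2 + n) / A ^ (2 * g + n - 2)) ∧
    -- the associated generating series are Gevrey-1
    (∀ (X : Type u) [TopologicalSpace X] [T2Space X] [ChartedSpace ℂ X] [IsManifold 𝓘(ℂ) ω X]
      (C : TopRec.SpectralCurve X) (Z : C.LocalCoordinates), C.IsRegular →
      (∀ (n : ℕ), 1 ≤ n → ∀ I : Fin n → Module.Dual ℂ C.forms,
        (∀ i, ∃ N v : ℝ, TopRec.SpectralCurve.IsBoundedWith Z (I i) N v) →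
        TopRec.IsGevreyOne (TopRec.SpectralCurve.periodSeries Z n I)) ∧
      (∀ I : Module.Dual ℂ C.forms,
        (∃ N v : ℝ, TopRec.SpectralCurve.IsBoundedWith Z I N v) →
        TopRec.IsGevreyOne (TopRec.SpectralCurve.totalPeriodSeries Z I))) := by
  obtain ⟨c, hc, hbd⟩ := TopRec.SpectralCurve.exists_norm_period_le.{u}
  -- The prefactor of the majorant is a multiple of `1/v` with `v = min(V, 5u/2)`, and `1/v ≤ 1/V +
  -- 1/u = (1 + 1/w)/V` for `w = u/V`.
  refine ⟨fun w => c * (1 + 1 / w), fun w hw => by positivity, ?_, ?_, ?_, ?_⟩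
  · intro X _ _ _ _ C Z hreg
    refine ⟨TopRec.SpectralCurve.exists_isBoundedCurveWith Z hreg, fun g n hn hst => ?_⟩
    obtain ⟨m, rfl⟩ : ∃ m, n = m + 1 := ⟨n - 1, by omega⟩
    exact TopRec.SpectralCurve.correlator_mem_tensorPower Z hreg (by omega)
  · intro X _ _ _ _ C Z hreg Mθ Mφ ρ hb n hn I N v hI g hst
    have hv : ∀ i, 0 < v i := fun i => (hI i).2.1
    have hN : ∀ i, 0 < N i := fun i => (hI i).1
    have hV := TopRec.iInf_pos_of_pos hn hv
    have h := hbd X C Z hreg Mθ Mφ ρ hb n hn I N v hI g hst _ hV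
      fun i => ciInf_le (Set.finite_range v).bddBelow i
    refine h.trans ?_
    have hu := TopRec.constU_pos hb.2.2.1
    have hQ := TopRec.constQ_pos hb.1 hb.2.1 hb.2.2.1
    have hP := TopRec.constP_pos (div_pos hu hV)
    have hN0 : 0 ≤ ∏ i, (C.ram.card : ℝ) * N i :=
      Finset.prod_nonneg fun i _ => mul_nonneg (Nat.cast_nonneg _) (hN i).le
    have h1 : (0.998 : ℝ) ^ g ≤ 1 := pow_le_one₀ (by norm_num) (by norm_num)
    calc _ ≤ (∏ i, (C.ram.card : ℝ) * N i) *
          (c * (1 + 1 / (TopRec.constU ρ / ⨅ i, v i)) / ⨅ i, v i) * 1 *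
          (2 * TopRec.constU ρ / 27) ^ g * TopRec.constQ Mθ Mφ ρ ^ (2 * g + n - 2) *
          ((C.ram.card : ℝ) * TopRec.constP (TopRec.constU ρ / ⨅ i, v i) / (⨅ i, v i) ^ 2)
            ^ (3 * g + n - 3) *
          (((3 * g + 2 * n - 3)! : ℝ) / ((g ! : ℝ) * (n ! : ℝ))) := by gcongr
      _ = _ := by rw [mul_one]
  · intro n hn r Mθ Mφ ρ N v hM hφ hρ hN hv
    exact TopRec.SpectralCurve.exists_norm_period_le_gamma hn r hM hφ hρ hN hv
  · intro X _ _ _ _ C Z hreg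
    exact ⟨fun n hn I hI => TopRec.SpectralCurve.isGevreyOne_periodSeries Z hreg hn hI,
      fun I hI => TopRec.SpectralCurve.isGevreyOne_totalPeriodSeries Z hreg hI⟩
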